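/- **Conventions.** Let $M^n$ be a connected smooth manifold without boundary (Hausdorff, second countable) of dimension $n\ge 2$. A smooth metric measure space $(M^n,g,e^{-\phi}\,\mathrm{dvol}_g,m)$ consists of a smooth Riemannian metric $g$, a function $\phi\in C^\infty(M)$ and a parameter $m\in[0,\infty)$, with $\phi=0$ if $m=0$; for $m>0$ one writes $v=e^{-\phi/m}$ and $v^m\,\mathrm{dvol}_g$ for the measure, and $1^m\,\mathrm{dvol}$ when $\phi=0$. Assume $m+n>2$. Put $$\mathrm{Ric}_\phi^m=\mathrm{Ric}+\nabla^2\phi-\tfrac1m\,d\phi\otimes d\phi,\qquad R_\phi^m=R+2\Delta\phi-\tfrac{m+1}{m}|\nabla\phi|^2$$ (the terms with $\frac1m$ being absent if $m=0$). The space satisfies the weighted Einstein-type equation with constant $\lambda\in\mathbb R$ if $$\mathrm{Ric}_\phi^m-\frac{R_\phi^m}{2(m+n-1)}\,g=\frac{m+n-2}{2(m+n-1)}\,\lambda\, g .\qquad(\ast)$$ Two smooth metric measure spaces on $M$ with the same $m$ are pointwise conformally equivalent if for some $\sigma\in C^\infty(M)$ $$\hat g=e^{\frac{2}{m+n-2}\sigma}g,\qquad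 e^{-\hat\phi}\,\mathrm{dvol}_{\hat g}=e^{\frac{m+n}{m+n-2}\sigma}e^{-\phi}\,\mathrm{dvol}_g ;$$ two such spaces on possibly different manifolds are conformally equivalent if the pull-back of one of them by a diffeomorphism is pointwise conformally equivalent to the other. **Proposition.** Let $(M^n,g,e^{-\phi}\,\mathrm{dvol}_g,m)$ and $(M^n,\hat g,e^{-\hat\phi}\,\mathrm{dvol}_{\hat g},m)$ be pointwise conformally equivalent and satisfy $(\ast)$ with constants $\lambda$ and $\hat\lambda$ respectively. Write $\hat g=u^{-2}g$ with $u>0$, and suppose that $u$ is nonconstant. 1. If $M$ is compact, then $m=1$ unless $m=0$, and $(M^n,g,e^{-\phi}\,\mathrm{dvol}_g,m)$ is conformally equivalent to $(S^n,g_0,1^m\,\mathrm{dvol}_{g_0})$, where $g_0$ is the round metric of a sphere of some radius $r>0$. 2. If instead $(M^n,g)$ is complete, $\lambda=0$ and $\hat\lambda>0$, then $(M^n,g)$ is isometric to $(\mathbb R^n,dx^2)$, and under this isometry $$u(x)=\frac{c}{2(m+n-1)}\,|x-x_0|^2+\frac{\hat\lambda}{2c}$$ for some $x_0\in\mathbb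 R^n$ and some constant $c>0$. -/

import Mathlib

open scoped Manifold ContDiff Bundle

noncomputable section

/-! ### Local coordinate expressions

For a field `G` of symmetric matrices on (an open subset of) `ℝⁿ`, the coordinate expression of a
Riemannian metric, and a function `f`, the coordinate expression of a function on the manifold. -/

namespace LocalCoord

variable {n : ℕ}

/-- The partial derivative `∂ᵢ f`. -/
def pd (i : Fin n) (f : EuclideanSpace ℝ (Fin n) → ℝ) (y : EuclideanSpace ℝ (Fin n)) : ℝ :=
  fderiv ℝ f y (EuclideanSpace.single i 1)

variable (G : EuclideanSpace ℝ (Fin n) → Matrix (Fin n) (Fin n) ℝ)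

/-- The Christoffel symbols `Γᵏᵢⱼ` of the Levi-Civita connection of `G`. -/
def christoffel (k i j : Fin n) (y : EuclideanSpace ℝ (Fin n)) : ℝ :=
  (1 / 2) * ∑ l, (G y)⁻¹ k l *
    (pd i (fun z => G z j l) y + pd j (fun z => G z i l) y - pd l (fun z => G z i j) y)

/-- The components `Ricᵢⱼ` of the Ricci tensor of `G`
(positive on round spheres). -/
def ricci (i j : Fin n) (y : EuclideanSpace ℝ (Fin n)) : ℝ :=
  ∑ k, pd k (christoffel G k i j) y - ∑ k, pd j (christoffel G k i k) y
    + ∑ k, ∑ l, (christoffel G k k l y * christoffel G l i j y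
      - christoffel G k j l y * christoffel G l i k y)

/-- The trace with respect to `G` of a symmetric two-tensor with components `T`. -/
def trace (T : Fin n → Fin n → EuclideanSpace ℝ (Fin n) → ℝ) (y : EuclideanSpace ℝ (Fin n)) : ℝ :=
  ∑ i, ∑ j, (G y)⁻¹ i j * T i j y

/-- The scalar curvature of `G`. -/
def scalarCurvature (y : EuclideanSpace ℝ (Fin n)) : ℝ := trace G (ricci G) y

/-- The components of the Hessian `∇²f`. -/
def hessian (f : EuclideanSpace ℝ (Fin n) → ℝ) (i j : Fin n) (y : EuclideanSpace ℝ (Fin n)) : ℝ :=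
  pd i (pd j f) y - ∑ k, christoffel G k i j y * pd k f y

/-- The Laplacian `Δf = tr ∇²f`. -/
def laplacian (f : EuclideanSpace ℝ (Fin n) → ℝ) (y : EuclideanSpace ℝ (Fin n)) : ℝ :=
  trace G (hessian G f) y

/-- The squared length `|∇f|²` of the gradient. -/
def gradSq (f : EuclideanSpace ℝ (Fin n) → ℝ) (y : EuclideanSpace ℝ (Fin n)) : ℝ :=
  trace G (fun i j z => pd i f z * pd j f z) y

/-- The components of the Bakry-Émery Ricci tensor `Ric + ∇²φ - (1/m) dφ ⊗ dφ`. -/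
def bakryEmeryRicci (φ : EuclideanSpace ℝ (Fin n) → ℝ) (m : ℝ) (i j : Fin n)
    (y : EuclideanSpace ℝ (Fin n)) : ℝ :=
  ricci G i j y + hessian G φ i j y - 1 / m * (pd i φ y * pd j φ y)

/-- The weighted scalar curvature `R + 2Δφ - ((m+1)/m) |∇φ|²`. -/
def weightedScalarCurvature (φ : EuclideanSpace ℝ (Fin n) → ℝ) (m : ℝ)
    (y : EuclideanSpace ℝ (Fin n)) : ℝ :=
  scalarCurvature G y + 2 * laplacian G φ y - (m + 1) / m * gradSq G φ y

end LocalCoord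

/-- A smooth Riemannian metric on a smooth `n`-manifold (without boundary). -/
abbrev SmoothMetric (n : ℕ) (M : Type*) [TopologicalSpace M]
    [ChartedSpace (EuclideanSpace ℝ (Fin n)) M] [IsManifold (𝓡 n) ∞ M] :=
  Bundle.ContMDiffRiemannianMetric (𝓡 n) ∞ (EuclideanSpace ℝ (Fin n))
    (fun x : M => TangentSpace (𝓡 n) x)

namespace SmoothMetric

variable {n : ℕ} {M : Type*} [TopologicalSpace M]
  [ChartedSpace (EuclideanSpace ℝ (Fin n)) M] [IsManifold (𝓡 n) ∞ M]

/-- The matrix `gᵢⱼ = g(∂ᵢ, ∂ⱼ)` of the metric in the chart `c`,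
as a function of the coordinates `y`. -/
def inChart (g : SmoothMetric n M) (c : OpenPartialHomeomorph M (EuclideanSpace ℝ (Fin n)))
    (y : EuclideanSpace ℝ (Fin n)) : Matrix (Fin n) (Fin n) ℝ :=
  Matrix.of fun i j => g.inner (c.symm y)
    (mfderiv (𝓡 n) (𝓡 n) c.symm y (EuclideanSpace.single i (1 : ℝ)))
    (mfderiv (𝓡 n) (𝓡 n) c.symm y (EuclideanSpace.single j (1 : ℝ)))

/-- The Riemannian distance of `g`: the infimum of the lengths of `C¹` paths. -/
def dist (g : SmoothMetric n M) (x y : M) : ENNReal :=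
  letI : Bundle.RiemannianBundle (fun x : M => TangentSpace (𝓡 n) x) := ⟨g.toRiemannianMetric⟩
  Manifold.riemannianEDist (𝓡 n) x y

/-- `(M, g)` is complete: Cauchy sequences for the Riemannian distance converge. -/
def IsComplete (g : SmoothMetric n M) : Prop :=
  ∀ s : ℕ → M, (∀ ε : ENNReal, 0 < ε → ∃ N, ∀ i ≥ N, ∀ j ≥ N, g.dist (s i) (s j) < ε) →
    ∃ x, Filter.Tendsto (fun i => g.dist (s i) x) Filter.atTop (nhds 0)

end SmoothMetric

/-- A smooth metric measure space `(Mⁿ, g, e^{-φ} dvol, m)` with finite dimensional parameter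
`m ∈ [0, ∞)`. In the case `m = 0` one requires `φ = 0`. -/
structure SmoothMetricMeasureSpace (n : ℕ) (M : Type*) [TopologicalSpace M]
    [ChartedSpace (EuclideanSpace ℝ (Fin n)) M] [IsManifold (𝓡 n) ∞ M] where
  g : SmoothMetric n M
  φ : M → ℝ
  contMDiff_φ : ContMDiff (𝓡 n) 𝓘(ℝ) ∞ φ
  m : ℝ
  m_nonneg : 0 ≤ m
  φ_eq_zero : m = 0 → ∀ x, φ x = 0

namespace SmoothMetricMeasureSpace

variable {n : ℕ} {M : Type*} [TopologicalSpace M]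
  [ChartedSpace (EuclideanSpace ℝ (Fin n)) M] [IsManifold (𝓡 n) ∞ M]
  {N : Type*} [TopologicalSpace N]
  [ChartedSpace (EuclideanSpace ℝ (Fin n)) N] [IsManifold (𝓡 n) ∞ N]

/-- The smooth measure `e^{-φ} dvol`, as a density: its value on an `n`-tuple `b` of tangent vectors
at `x` is `e^{-φ(x)}` times the Riemannian volume of the parallelepiped spanned by `b`. -/
def density (S : SmoothMetricMeasureSpace n M) (x : M) (b : Fin n → TangentSpace (𝓡 n) x) : ℝ :=
  Real.exp (-S.φ x) * √(Matrix.det (Matrix.of fun i j => S.g.inner x (b i) (b j)))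

/-- The equation `Ric_φ^m - R_φ^m / (2(m+n-1)) g = (m+n-2) / (2(m+n-1)) λ g`,
in every smooth chart of `M`. -/
def SatisfiesEinsteinType (S : SmoothMetricMeasureSpace n M) (lam : ℝ) : Prop :=
  ∀ c ∈ IsManifold.maximalAtlas (𝓡 n) ∞ M, ∀ y ∈ c.target, ∀ i j : Fin n,
    LocalCoord.bakryEmeryRicci (S.g.inChart c) (S.φ ∘ c.symm) S.m i j y
      - LocalCoord.weightedScalarCurvature (S.g.inChart c) (S.φ ∘ c.symm) S.m y
          / (2 * (S.m + n - 1)) * S.g.inChart c y i j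
    = (S.m + n - 2) / (2 * (S.m + n - 1)) * lam * S.g.inChart c y i j

/-- `S` and `S'`, on the same manifold, are pointwise conformally equivalent: for some smooth `σ`,
`ĝ = e^{2σ/(m+n-2)} g` and `e^{-φ̂} dvol_ĝ = e^{(m+n)σ/(m+n-2)} e^{-φ} dvol_g`. -/
def PointwiseConformal (S S' : SmoothMetricMeasureSpace n M) : Prop :=
  S'.m = S.m ∧ ∃ σ : M → ℝ, ContMDiff (𝓡 n) 𝓘(ℝ) ∞ σ ∧
    (∀ (x : M) (v w : TangentSpace (𝓡 n) x),
      S'.g.inner x v w = Real.exp (2 / (S.m + n - 2) * σ x) * S.g.inner x v w) ∧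
    ∀ (x : M) (b : Fin n → TangentSpace (𝓡 n) x),
      S'.density x b = Real.exp ((S.m + n) / (S.m + n - 2) * σ x) * S.density x b

/-- `S` on `M` and `S'` on `N` are conformally equivalent: for some diffeomorphism `F : N → M`, the
pull-back `(N, F^*g, F^*(e^{-φ} dvol_g), m)` is pointwise conformally equivalent to `S'`. -/
def ConformallyEquivalent (S : SmoothMetricMeasureSpace n M) (S' : SmoothMetricMeasureSpace n N) :
    Prop :=
  S'.m = S.m ∧ ∃ F : N ≃ₘ^∞⟮𝓡 n, 𝓡 n⟯ M, ∃ σ : N → ℝ, ContMDiff (𝓡 n) 𝓘(ℝ) ∞ σ ∧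
    (∀ (x : N) (v w : TangentSpace (𝓡 n) x),
      S'.g.inner x v w = Real.exp (2 / (S.m + n - 2) * σ x) *
        S.g.inner (F x) (mfderiv (𝓡 n) (𝓡 n) F x v) (mfderiv (𝓡 n) (𝓡 n) F x w)) ∧
    ∀ (x : N) (b : Fin n → TangentSpace (𝓡 n) x),
      S'.density x b = Real.exp ((S.m + n) / (S.m + n - 2) * σ x) *
        S.density (F x) (fun i => mfderiv (𝓡 n) (𝓡 n) F x (b i))

end SmoothMetricMeasureSpace

/-- The unit sphere `Sⁿ` in `ℝⁿ⁺¹`. -/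
abbrev UnitSphere (n : ℕ) : Type := Metric.sphere (0 : EuclideanSpace ℝ (Fin (n + 1))) 1

/-- The differential at `x` of the inclusion `Sⁿ → ℝⁿ⁺¹`. -/
def sphereInclDeriv (n : ℕ) (x : UnitSphere n) :
    TangentSpace (𝓡 n) x →L[ℝ] EuclideanSpace ℝ (Fin (n + 1)) :=
  mvfderiv (𝓡 n) (fun p : UnitSphere n => (p : EuclideanSpace ℝ (Fin (n + 1)))) x

/-- The bilinear form `r² ⟪dι v, dι w⟫` on `TₓSⁿ`, where `ι : Sⁿ → ℝⁿ⁺¹` is the inclusion. -/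
def roundInner (n : ℕ) (r : ℝ) (x : UnitSphere n) :
    TangentSpace (𝓡 n) x →L[ℝ] TangentSpace (𝓡 n) x →L[ℝ] ℝ :=
  letI D : EuclideanSpace ℝ (Fin n) →L[ℝ] EuclideanSpace ℝ (Fin (n + 1)) := sphereInclDeriv n x
  letI B : EuclideanSpace ℝ (Fin (n + 1)) →L[ℝ] EuclideanSpace ℝ (Fin (n + 1)) →L[ℝ] ℝ := innerSL ℝ
  r ^ 2 • B.bilinearComp D D

theorem roundInner_apply (n : ℕ) (r : ℝ) (x : UnitSphere n) (v w : TangentSpace (𝓡 n) x) :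
    roundInner n r x v w = r ^ 2 * inner ℝ (sphereInclDeriv n x v) (sphereInclDeriv n x w) := rfl

theorem sphereInclDeriv_injective (n : ℕ) (x : UnitSphere n) :
    Function.Injective (sphereInclDeriv n x) :=
  haveI := Fact.mk (@finrank_euclideanSpace_fin ℝ _ (n + 1))
  injective_mvfderiv_subtypeVal_sphere x

theorem roundInner_pos (n : ℕ) (r : ℝ) (hr : 0 < r) (x : UnitSphere n) (v : TangentSpace (𝓡 n) x)
    (hv : v ≠ 0) : 0 < roundInner n r x v v := by
  have h : sphereInclDeriv n x v ≠ 0 := by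
    intro h
    exact hv (sphereInclDeriv_injective n x (h.trans (map_zero _).symm))
  have := real_inner_self_pos.2 h
  rw [roundInner_apply]
  positivity

theorem roundInner_isVonNBounded (n : ℕ) (r : ℝ) (hr : 0 < r) (x : UnitSphere n) :
    Bornology.IsVonNBounded ℝ {v : TangentSpace (𝓡 n) x | roundInner n r x v v < 1} := by
  let D : EuclideanSpace ℝ (Fin n) →L[ℝ] EuclideanSpace ℝ (Fin (n + 1)) := sphereInclDeriv n x
  have hinj : Function.Injective D.toLinearMap := sphereInclDeriv_injective n x
  obtain ⟨K, hK, hD⟩ := LinearMap.exists_antilipschitzWith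
    D.toLinearMap (LinearMap.ker_eq_bot.2 hinj)
  change Bornology.IsVonNBounded ℝ {v : EuclideanSpace ℝ (Fin n) | roundInner n r x v v < 1}
  refine (NormedSpace.isVonNBounded_closedBall ℝ (EuclideanSpace ℝ (Fin n)) (K * r⁻¹)).subset ?_
  intro v hv
  have h1 : r ^ 2 * inner ℝ (sphereInclDeriv n x v) (sphereInclDeriv n x v) < 1 := hv
  rw [real_inner_self_eq_norm_sq, ← mul_pow] at h1
  have h2 : r * ‖sphereInclDeriv n x v‖ < 1 := by
    by_contra! h
    nlinarith
  have h3 : ‖sphereInclDeriv n x v‖ ≤ r⁻¹ := by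
    rw [← one_div, le_div_iff₀ hr]
    linarith
  have h4 : ‖v‖ ≤ K * ‖sphereInclDeriv n x v‖ := by
    have h := hD.le_mul_dist v 0
    rw [map_zero, dist_zero_right, dist_zero_right] at h
    exact h
  rw [mem_closedBall_zero_iff]
  exact h4.trans (mul_le_mul_of_nonneg_left h3 K.2)

theorem contDiff_smul_bilinearComp {E F : Type*} [NormedAddCommGroup E] [NormedSpace ℝ E]
    [FiniteDimensional ℝ E] [NormedAddCommGroup F] [NormedSpace ℝ F] (a : ℝ) (B : F →L[ℝ] F →L[ℝ] ℝ) :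
    ContDiff ℝ ∞ (fun D : E →L[ℝ] F => a • B.bilinearComp D D) := by
  refine contDiff_clm_apply_iff.2 fun v => contDiff_clm_apply_iff.2 fun w => ?_
  have hv : ContDiff ℝ ∞ (fun D : E →L[ℝ] F => D v) := contDiff_id.clm_apply contDiff_const
  have hw : ContDiff ℝ ∞ (fun D : E →L[ℝ] F => D w) := contDiff_id.clm_apply contDiff_const
  exact contDiff_const.mul ((contDiff_const.clm_apply hv).clm_apply hw)

theorem contMDiff_roundInner (n : ℕ) (r : ℝ) :
    ContMDiff (𝓡 n) ((𝓡 n).prod 𝓘(ℝ, EuclideanSpace ℝ (Fin n) →L[ℝ]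
      EuclideanSpace ℝ (Fin n) →L[ℝ] ℝ)) ∞
      (fun x => Bundle.TotalSpace.mk' (EuclideanSpace ℝ (Fin n) →L[ℝ]
        EuclideanSpace ℝ (Fin n) →L[ℝ] ℝ)
        (E := fun x : UnitSphere n => TangentSpace (𝓡 n) x →L[ℝ] TangentSpace (𝓡 n) x →L[ℝ] ℝ)
        x (roundInner n r x)) := by
  have := Fact.mk (@finrank_euclideanSpace_fin ℝ _ (n + 1))
  intro x₀
  rw [Bundle.contMDiffAt_section]
  let A : UnitSphere n → EuclideanSpace ℝ (Fin n) →L[ℝ] EuclideanSpace ℝ (Fin (n + 1)) :=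
    inTangentCoordinates (𝓡 n) 𝓘(ℝ, EuclideanSpace ℝ (Fin (n + 1))) id
      (fun p : UnitSphere n => (p : EuclideanSpace ℝ (Fin (n + 1))))
      (mfderiv (𝓡 n) 𝓘(ℝ, EuclideanSpace ℝ (Fin (n + 1)))
        (fun p : UnitSphere n => (p : EuclideanSpace ℝ (Fin (n + 1))))) x₀
  have hA : ContMDiffAt (𝓡 n) 𝓘(ℝ, EuclideanSpace ℝ (Fin n) →L[ℝ]
      EuclideanSpace ℝ (Fin (n + 1))) ∞ A x₀ :=
    ((contMDiff_coe_sphere (E := EuclideanSpace ℝ (Fin (n + 1))) (n := n) (m := ∞)).contMDiffAt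
      (x := x₀)).mfderiv_const (m := ∞) (by simp)
  let B : EuclideanSpace ℝ (Fin (n + 1)) →L[ℝ] EuclideanSpace ℝ (Fin (n + 1)) →L[ℝ] ℝ := innerSL ℝ
  have hB := contDiff_smul_bilinearComp (E := EuclideanSpace ℝ (Fin n)) (r ^ 2) B
  refine (hB.contMDiff.contMDiffAt.comp x₀ hA).congr_of_eventuallyEq ?_
  filter_upwards [(FiberBundle.trivializationAt (EuclideanSpace ℝ (Fin n))
    (TangentSpace (𝓡 n)) x₀).open_baseSet.mem_nhds
      (FiberBundle.mem_baseSet_trivializationAt' x₀)] with x hx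
  ext v w
  simp only [hom_trivializationAt_apply, Function.comp_apply]
  have h1 : A x = (sphereInclDeriv n x).comp
      ((FiberBundle.trivializationAt (EuclideanSpace ℝ (Fin n)) (TangentSpace (𝓡 n)) x₀).symmL ℝ x) := by
    ext v : 1
    simp [A, inTangentCoordinates, ContinuousLinearMap.inCoordinates]
    rfl
  have h2 : x ∈ (FiberBundle.trivializationAt (EuclideanSpace ℝ (Fin n) →L[ℝ] ℝ)
      (fun x : UnitSphere n => TangentSpace (𝓡 n) x →L[ℝ] ℝ) x₀).baseSet := by
    rw [hom_trivializationAt_baseSet]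
    exact ⟨hx, Set.mem_univ _⟩
  simp [ContinuousLinearMap.inCoordinates, Bundle.Trivialization.continuousLinearMapAt_apply, Bundle.Trivialization.coe_linearMapAt_of_mem _ h2, hom_trivializationAt_apply]
  rw [h1]
  rfl

/-- The round metric of a sphere of radius `r`, transported to the unit sphere by scaling:
`r²` times the metric induced by the inclusion `Sⁿ → ℝⁿ⁺¹`. -/
def roundMetric (n : ℕ) (r : ℝ) (hr : 0 < r) : SmoothMetric n (UnitSphere n) where
  inner := roundInner n r
  symm x v w := by
    rw [roundInner_apply, roundInner_apply, real_inner_comm]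
  pos := roundInner_pos n r hr
  isVonNBounded := roundInner_isVonNBounded n r hr
  contMDiff := contMDiff_roundInner n r

/-- The round sphere of radius `r` with its Riemannian volume (`φ = 0`, i.e. `1^m dvol`), as a
smooth metric measure space with dimensional parameter `m`. -/
def roundSphere (n : ℕ) (r : ℝ) (hr : 0 < r) (m : ℝ) (hm : 0 ≤ m) :
    SmoothMetricMeasureSpace n (UnitSphere n) where
  g := roundMetric n r hr
  φ := fun _ => 0
  contMDiff_φ := contMDiff_const
  m := m
  m_nonneg := hm
  φ_eq_zero := fun _ _ => rfl

end

/-! Put w = log u. Comparing densities gives φ̂ = φ + m w, and with this weight the tensor E =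
Ric_φ^m - R_φ^m/(2(m+n-1)) g changes under ĝ = e^{-2w} g as the Schouten tensor does, with n
replaced by m+n: Ê = E + (m+n-2)(∇²w + dw⊗dw - ½|∇w|² g) (`conformal_weightedEinstein`). Since ∇²w +
dw⊗dw = u⁻¹∇²u, the two equations say ∇²u = f g with f = |∇u|²/(2u) + a/u - bu, where a =
λ̂/(2(m+n-1)) and b = λ/(2(m+n-1)). From d|∇u|² = 2f du one gets a constant s with |∇u|² = -2a -
2bu² + 2su and f = s - 2bu (`IsConcircular.exists_first_integral`).

Rigidity comes from one dynamical principle, used instead of warped products and geodesics. If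
L_X(ψg) = -2κψg with κ > 0 and p is a zero of X, then the flow of X contracts ψg by a constant
factor. The maps L⁻ᵏTᵏ, with T the time-one map and L its derivative at p, converge to an isometry
onto a flat space conjugating T to L; spreading it along the flow gives a chart from the whole basin
of attraction of p onto ℝⁿ in which ψg is Euclidean (`IsFlow.exists_basin_chart`).

Complete case, λ = 0: here ∇²u = s g with s > 0, and -∇u contracts g. Completeness makes every orbit
converge to a critical point; the basins are open and disjoint, so there is only one and it is M. In
its chart u has Hessian s times the identity.

Compact case: the extreme values of u are the roots of the quadratic for |∇u|², which forces b > 0,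
and y = u - min u satisfies |∇y|² = 2ky(D - y) and ∇²y = (kD - 2ky) g with k = b (`IsHeight`). Now
∇y contracts y⁻²g where y > 0, and -∇y contracts (D - y)⁻²g where y < D. Because ℝⁿ minus a point is
connected for n ≥ 2, just two basins cover M, each missing one point. In them 1/y and 1/(D - y) are
explicit quadratics, and the transition is an inversion up to an orthogonal map
(`IsHeight.exists_inversion_charts`); so g is round.

It remains to treat the weight. For m > 0, removing the conformal factor turns the equation into the
flat one with constant zero. For v = e^{-φ₀/m} it says that ∇²v is a multiple H of the identity and
(m-1)(2Hv - |∇v|²) = 0. Hence H is constant, and compactness of M gives H > 0; at the minimum of v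
this forces m = 1 (`SatisfiesEinsteinType.exists_weight`). Then v is a quadratic α|x-x₀|² + β, so
rescaling g to unit weight gives dx²/(α|x-x₀|² + β)², again a round metric in stereographic
coordinates, centred at x₀. The identification extends over the missing pole by a Möbius computation
(`exists_sphere_diffeo`). -/

noncomputable section
open scoped Topology
open Filter

namespace LocalCoord

variable {n : ℕ}

/-! ### Calculus of partial derivatives -/

section pd

theorem pd_congr {f g : EuclideanSpace ℝ (Fin n) → ℝ} {y : EuclideanSpace ℝ (Fin n)} (i : Fin n)
    (h : f =ᶠ[𝓝 y] g) : pd i f y = pd i g y := by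
  rw [pd, pd, h.fderiv_eq]

theorem pd_add {f g : EuclideanSpace ℝ (Fin n) → ℝ} {y : EuclideanSpace ℝ (Fin n)} (i : Fin n)
    (hf : DifferentiableAt ℝ f y)
    (hg : DifferentiableAt ℝ g y) : pd i (fun z => f z + g z) y = pd i f y + pd i g y := by
  rw [pd, fderiv_fun_add hf hg]; rfl

theorem pd_sub {f g : EuclideanSpace ℝ (Fin n) → ℝ} {y : EuclideanSpace ℝ (Fin n)} (i : Fin n)
    (hf : DifferentiableAt ℝ f y)
    (hg : DifferentiableAt ℝ g y) : pd i (fun z => f z - g z) y = pd i f y - pd i g y := by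
  rw [pd, fderiv_fun_sub hf hg]; rfl

theorem pd_neg {f : EuclideanSpace ℝ (Fin n) → ℝ} {y : EuclideanSpace ℝ (Fin n)} (i : Fin n) :
    pd i (fun z => -f z) y = -pd i f y := by
  rw [pd, fderiv_fun_neg]; rfl

theorem pd_const (i : Fin n) (a : ℝ) (y : EuclideanSpace ℝ (Fin n)) : pd i (fun _ => a) y = 0 := by
  simp [pd]

theorem pd_mul {f g : EuclideanSpace ℝ (Fin n) → ℝ} {y : EuclideanSpace ℝ (Fin n)} (i : Fin n)
    (hf : DifferentiableAt ℝ f y)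
    (hg : DifferentiableAt ℝ g y) :
    pd i (fun z => f z * g z) y = f y * pd i g y + g y * pd i f y := by
  rw [pd, fderiv_fun_mul hf hg]; rfl

theorem pd_const_mul {f : EuclideanSpace ℝ (Fin n) → ℝ} {y : EuclideanSpace ℝ (Fin n)} (i : Fin n)
    (a : ℝ) (hf : DifferentiableAt ℝ f y) :
    pd i (fun z => a * f z) y = a * pd i f y := by
  rw [pd_mul i (differentiableAt_const a) hf, pd_const]; ring

theorem pd_sum {ι : Type*} (s : Finset ι) {f : ι → EuclideanSpace ℝ (Fin n) → ℝ}
    {y : EuclideanSpace ℝ (Fin n)} (i : Fin n)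
    (hf : ∀ a ∈ s, DifferentiableAt ℝ (f a) y) :
    pd i (fun z => ∑ a ∈ s, f a z) y = ∑ a ∈ s, pd i (f a) y := by
  rw [pd, fderiv_fun_sum hf]; simp [pd]

theorem pd_comp {h : ℝ → ℝ} {h' : ℝ} {f : EuclideanSpace ℝ (Fin n) → ℝ}
    {y : EuclideanSpace ℝ (Fin n)} (i : Fin n) (hh : HasDerivAt h h' (f y))
    (hf : DifferentiableAt ℝ f y) : pd i (fun z => h (f z)) y = h' * pd i f y := by
  have := hh.comp_hasFDerivAt y hf.hasFDerivAt
  rw [pd, HasFDerivAt.fderiv (f := fun z => h (f z)) this]; rfl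

theorem contDiffOn_pd {f : EuclideanSpace ℝ (Fin n) → ℝ} {Ω : Set (EuclideanSpace ℝ (Fin n))}
    (hΩ : IsOpen Ω) (hf : ContDiffOn ℝ ∞ f Ω)
    (i : Fin n) : ContDiffOn ℝ ∞ (pd i f) Ω := by
  have h := hf.fderiv_of_isOpen (m := ∞) hΩ (by simp)
  exact h.clm_apply contDiffOn_const

theorem pd_comm {f : EuclideanSpace ℝ (Fin n) → ℝ} {Ω : Set (EuclideanSpace ℝ (Fin n))}
    (hΩ : IsOpen Ω) (hf : ContDiffOn ℝ ∞ f Ω)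
    {y : EuclideanSpace ℝ (Fin n)} (hy : y ∈ Ω) (i j : Fin n) :
    pd i (pd j f) y = pd j (pd i f) y := by
  have hf' : ContDiffAt ℝ ∞ f y := hf.contDiffAt (hΩ.mem_nhds hy)
  have hs : IsSymmSndFDerivAt ℝ f y := hf'.isSymmSndFDerivAt (by
    simpa using (by exact_mod_cast le_top : ((2 : ℕ∞) : WithTop ℕ∞) ≤ ((⊤ : ℕ∞) : WithTop ℕ∞)))
  have hd : DifferentiableAt ℝ (fderiv ℝ f) y :=
    (hf'.fderiv_right (m := 1) (by norm_cast)).differentiableAt (by simp)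
  have key : ∀ a b : Fin n, pd a (pd b f) y
      = fderiv ℝ (fderiv ℝ f) y (EuclideanSpace.single a 1) (EuclideanSpace.single b 1) := by
    intro a b
    have : fderiv ℝ (fun z => fderiv ℝ f z (EuclideanSpace.single b 1)) y
        = (fderiv ℝ (fderiv ℝ f) y).flip (EuclideanSpace.single b 1) := by
      rw [fderiv_clm_apply hd (by fun_prop)]
      simp
    change fderiv ℝ (fun z => fderiv ℝ f z (EuclideanSpace.single b 1)) y _ = _
    rw [this]; rfl
  rw [key, key]
  exact hs _ _

end pd

/-! ### Algebra of the conformal change of connection -/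

section algebra

open Finset

/-- The difference of the Levi-Civita connections of `e^{-2w} g` and `g`. -/
def confDiff (g : Fin n → Fin n → ℝ) (w N : Fin n → ℝ) (k i j : Fin n) : ℝ :=
  -((if k = i then w j else 0) + (if k = j then w i else 0) - g i j * N k)

variable {Γ : Fin n → Fin n → Fin n → ℝ} {g : Fin n → Fin n → ℝ} {w N : Fin n → ℝ}

/-- The two terms w i cancel after contraction; what is left is the change -n w of the logarithm of
the volume density. -/
theorem sum_confDiff (hg : ∀ i j, g i j = g j i) (hN : ∀ i, ∑ l, g i l * N l = w i) (i : Fin n) :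
    ∑ k, confDiff g w N k i k = -(n * w i) := by
  simp only [confDiff, sum_neg_distrib, sum_sub_distrib, sum_add_distrib, hN, sum_ite_eq',
    sum_ite_eq, mem_univ, if_true, sum_const, card_univ, Fintype.card_fin, nsmul_eq_mul]
  ring

theorem sum_confDiff' (hg : ∀ i j, g i j = g j i) (hN : ∀ i, ∑ l, g i l * N l = w i) (i : Fin n) :
    ∑ k, confDiff g w N k k i = -(n * w i) := by
  rw [← sum_confDiff hg hN i]
  refine sum_congr rfl fun k _ => ?_
  simp only [confDiff, hg k i]; ring

theorem sum_confDiff_mul (f : Fin n → ℝ) (i j : Fin n) :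
    ∑ k, confDiff g w N k i j * f k = -(w j * f i + w i * f j - g i j * ∑ k, N k * f k) := by
  simp only [confDiff, neg_mul, sub_mul, add_mul, ite_mul, zero_mul, sum_neg_distrib,
    sum_sub_distrib, sum_add_distrib, sum_ite_eq', sum_ite_eq, mem_univ, if_true, mul_assoc,
    ← mul_sum]

/-- The part of the conformal change of Ricci that is quadratic in the connections, as pure algebra
in Γ. The two non-tensorial terms are left in the form in which they meet the derivative terms
later: the contraction of Γ with N completes div N to a Laplacian, and the last sum is N(g i j) by
metric compatibility. -/
theorem ricci_quadratic_confDiff (hg : ∀ i j, g i j = g j i)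
    (hN : ∀ i, ∑ l, g i l * N l = w i) (hΓ : ∀ k i j, Γ k i j = Γ k j i) (i j : Fin n) :
    ∑ k, ∑ l, ((Γ k k l + confDiff g w N k k l) * (Γ l i j + confDiff g w N l i j)
      - (Γ k j l + confDiff g w N k j l) * (Γ l i k + confDiff g w N l i k))
    = ∑ k, ∑ l, (Γ k k l * Γ l i j - Γ k j l * Γ l i k)
      + g i j * ∑ l, (∑ k, Γ k k l) * N l - (n - 2) * ∑ k, Γ k i j * w k
      + (n - 2) * (w i * w j) + (2 - n) * g i j * ∑ k, N k * w k
      - ∑ k, N k * ∑ l, (Γ l k i * g l j + Γ l k j * g l i) := by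
  set D := confDiff g w N with hD
  -- Expansion of (Γ+D)(Γ+D): `e1` to `e3` treat the mixed and quadratic parts of the first product,
  -- `e4` and `e5` the mixed parts of the second, `e6` its quadratic part.
  have e1 : ∑ k, ∑ l, Γ k k l * D l i j =
      -(w j * ∑ k, Γ k k i + w i * ∑ k, Γ k k j - g i j * ∑ l, (∑ k, Γ k k l) * N l) := by
    rw [sum_comm]
    have : ∀ l, ∑ k, Γ k k l * D l i j = D l i j * ∑ k, Γ k k l := fun l => by
      rw [mul_sum]; exact sum_congr rfl fun _ _ => mul_comm _ _
    simp_rw [this]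
    rw [hD, sum_confDiff_mul]
    simp_rw [mul_comm (N _)]
  have e2 : ∑ k, ∑ l, D k k l * Γ l i j = -(n * ∑ l, Γ l i j * w l) := by
    rw [sum_comm]
    simp_rw [← sum_mul, hD, sum_confDiff' hg hN, mul_sum, ← sum_neg_distrib]
    exact sum_congr rfl fun _ _ => by ring
  have e3 : ∑ k, ∑ l, D k k l * D l i j = n * (2 * (w i * w j) - g i j * ∑ k, N k * w k) := by
    rw [sum_comm]
    simp_rw [← sum_mul, hD, sum_confDiff' hg hN]
    have : ∀ l, -(n * w l) * confDiff g w N l i j = -(n:ℝ) * (confDiff g w N l i j * w l) :=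
      fun l => by ring
    simp_rw [this, ← mul_sum, sum_confDiff_mul]
    ring
  have e4 : ∀ a b : Fin n, ∑ k, ∑ l, Γ k a l * D l b k =
      -(∑ k, Γ k a b * w k + w b * ∑ k, Γ k k a - ∑ k, N k * ∑ l, Γ l k a * g l b) := by
    intro a b
    have : ∀ k, ∑ l, Γ k a l * D l b k = -(w k * Γ k a b + w b * Γ k a k
        - g b k * ∑ l, N l * Γ k a l) := fun k => by
      rw [← sum_confDiff_mul]; exact sum_congr rfl fun _ _ => mul_comm _ _
    simp_rw [this, sum_neg_distrib, sum_sub_distrib, sum_add_distrib, ← mul_sum]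
    congr 2
    · congr 1
      · exact sum_congr rfl fun _ _ => mul_comm _ _
      · congr 1
        exact sum_congr rfl fun _ _ => hΓ _ _ _
    · simp_rw [mul_sum]
      rw [sum_comm]
      refine sum_congr rfl fun k _ => sum_congr rfl fun l _ => ?_
      rw [hΓ l a k, hg b l]; ring
  have e5 : ∑ k, ∑ l, D k j l * Γ l i k = ∑ k, ∑ l, Γ k i l * D l j k := by
    rw [sum_comm]; exact sum_congr rfl fun _ _ => sum_congr rfl fun _ _ => mul_comm _ _
  have e6 : ∑ k, ∑ l, D k j l * D l i k
      = (n + 2) * (w i * w j) - 2 * g i j * ∑ k, N k * w k := by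
    have h1 : ∀ k, ∑ l, D k j l * D l i k = -(w k * D k j i + w i * D k j k
        - g i k * ∑ l, N l * D k j l) := fun k => by
      rw [← sum_confDiff_mul]; exact sum_congr rfl fun _ _ => mul_comm _ _
    have h2 : ∀ k, ∑ l, N l * D k j l = -((if k = j then ∑ l, N l * w l else 0)
        + N k * w j - w j * N k) := fun k => by
      have : ∀ l, N l * D k j l = -((if k = j then N l * w l else 0)
          + (if k = l then N l * w j else 0) - g j l * N l * N k) := fun l => by
        simp only [hD, confDiff]; split_ifs <;> ring
      simp_rw [this, sum_neg_distrib, sum_sub_distrib, sum_add_distrib, ← sum_mul, hN]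
      simp only [sum_ite_eq, mem_univ, if_true]
      split_ifs <;> simp
    have h3 : ∑ k, w k * D k j i = -(2 * (w i * w j) - g i j * ∑ k, N k * w k) := by
      rw [sum_congr rfl fun k _ => mul_comm (w k) (D k j i), hD, sum_confDiff_mul, hg j i]; ring
    have h4 : ∑ k, g i k * ∑ l, N l * D k j l = -(g i j * ∑ l, N l * w l) := by
      have : ∀ k, g i k * ∑ l, N l * D k j l
          = -(if k = j then g i k * ∑ l, N l * w l else 0) := fun k => by
        rw [h2]; split_ifs <;> ring
      simp_rw [this, sum_neg_distrib]
      simp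
    simp_rw [h1, sum_neg_distrib, sum_sub_distrib, sum_add_distrib, ← mul_sum, h3, h4, hD,
      sum_confDiff hg hN]
    ring
  have hc : ∑ k, Γ k j i * w k = ∑ k, Γ k i j * w k := sum_congr rfl fun k _ => by rw [hΓ]
  have hlin : ∑ k, N k * ∑ l, (Γ l k i * g l j + Γ l k j * g l i)
      = ∑ k, N k * ∑ l, Γ l k i * g l j + ∑ k, N k * ∑ l, Γ l k j * g l i := by
    simp_rw [sum_add_distrib, mul_add, sum_add_distrib]
  have hexp : ∀ k l, (Γ k k l + D k k l) * (Γ l i j + D l i j)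
      - (Γ k j l + D k j l) * (Γ l i k + D l i k)
      = (Γ k k l * Γ l i j - Γ k j l * Γ l i k) + Γ k k l * D l i j + D k k l * Γ l i j
        + D k k l * D l i j - Γ k j l * D l i k - D k j l * Γ l i k - D k j l * D l i k :=
    fun k l => by ring
  have hs : ∀ a b c d e f h : Fin n → Fin n → ℝ,
      ∑ k, ∑ l, (a k l + b k l + c k l + d k l - e k l - f k l - h k l)
      = ∑ k, ∑ l, a k l + ∑ k, ∑ l, b k l + ∑ k, ∑ l, c k l + ∑ k, ∑ l, d k l
        - ∑ k, ∑ l, e k l - ∑ k, ∑ l, f k l - ∑ k, ∑ l, h k l := fun a b c d e f h => by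
    simp only [sum_add_distrib, sum_sub_distrib]
  simp_rw [hexp]
  rw [hs, e1, e2, e3, e4, e5, e4, e6, hlin, hc]
  ring

end algebra

/-! ### Levi-Civita calculus of a coordinate metric -/

section metric

open Finset

/-- `G` is a smooth field of nondegenerate symmetric matrices on `Ω`. -/
structure IsMetricOn (G : EuclideanSpace ℝ (Fin n) → Matrix (Fin n) (Fin n) ℝ)
    (Ω : Set (EuclideanSpace ℝ (Fin n))) : Prop where
  isOpen : IsOpen Ω
  smooth : ∀ i j, ContDiffOn ℝ ∞ (fun z => G z i j) Ω
  symm : ∀ z ∈ Ω, ∀ i j, G z i j = G z j i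
  unit : ∀ z ∈ Ω, IsUnit (G z).det

variable {G G' : EuclideanSpace ℝ (Fin n) → Matrix (Fin n) (Fin n) ℝ}
    {Ω : Set (EuclideanSpace ℝ (Fin n))}

namespace IsMetricOn

theorem diffAt {f : EuclideanSpace ℝ (Fin n) → ℝ} {y : EuclideanSpace ℝ (Fin n)} (hΩ : IsOpen Ω)
    (hf : ContDiffOn ℝ ∞ f Ω) (hy : y ∈ Ω) :
    DifferentiableAt ℝ f y :=
  (hf.contDiffAt (hΩ.mem_nhds hy)).differentiableAt (by simp)

theorem inv_mul (hG : IsMetricOn G Ω) {y : EuclideanSpace ℝ (Fin n)} (hy : y ∈ Ω) (a b : Fin n) :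
    ∑ m, (G y)⁻¹ a m * G y m b = if a = b then 1 else 0 := by
  have := congrFun (congrFun (Matrix.nonsing_inv_mul _ (hG.unit y hy)) a) b
  rwa [Matrix.mul_apply, Matrix.one_apply] at this

theorem mul_inv (hG : IsMetricOn G Ω) {y : EuclideanSpace ℝ (Fin n)} (hy : y ∈ Ω) (a b : Fin n) :
    ∑ m, G y a m * (G y)⁻¹ m b = if a = b then 1 else 0 := by
  have := congrFun (congrFun (Matrix.mul_nonsing_inv _ (hG.unit y hy)) a) b
  rwa [Matrix.mul_apply, Matrix.one_apply] at this

theorem inv_symm (hG : IsMetricOn G Ω) {y : EuclideanSpace ℝ (Fin n)} (hy : y ∈ Ω) (a b : Fin n) :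
    (G y)⁻¹ a b = (G y)⁻¹ b a := by
  have h : (G y).transpose = G y := by ext i j; exact hG.symm y hy _ _
  have := Matrix.transpose_nonsing_inv (G y)
  rw [h] at this
  exact congrFun (congrFun this b) a

theorem _root_.LocalCoord.contDiffOn_det {ι : Type*} [Fintype ι] [DecidableEq ι]
    {A : EuclideanSpace ℝ (Fin n) → Matrix ι ι ℝ} (h : ∀ i j, ContDiffOn ℝ ∞ (fun z => A z i j) Ω) :
    ContDiffOn ℝ ∞ (fun z => (A z).det) Ω := by
  simp only [Matrix.det_apply]
  refine ContDiffOn.sum fun σ _ => ?_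
  refine ContDiffOn.const_smul _ ?_
  exact contDiffOn_prod fun i _ => h _ _

theorem smooth_inv (hG : IsMetricOn G Ω) (i j : Fin n) :
    ContDiffOn ℝ ∞ (fun z => (G z)⁻¹ i j) Ω := by
  have : ∀ z, (G z)⁻¹ i j = ((G z).det)⁻¹ * (G z).adjugate i j := fun z => by
    rw [Matrix.inv_def, Ring.inverse_eq_inv']; rfl
  simp_rw [this]
  refine ContDiffOn.mul ((contDiffOn_det hG.smooth).inv fun z hz => (hG.unit z hz).ne_zero) ?_
  simp_rw [Matrix.adjugate_apply]
  refine contDiffOn_det fun a b => ?_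
  by_cases hab : a = j
  · subst hab; simp only [Matrix.updateRow_self]; exact contDiffOn_const
  · simp only [Matrix.updateRow_ne hab]; exact hG.smooth a b

theorem smooth_christoffel (hG : IsMetricOn G Ω) (k i j : Fin n) :
    ContDiffOn ℝ ∞ (christoffel G k i j) Ω := by
  unfold christoffel
  refine contDiffOn_const.mul (ContDiffOn.sum fun l _ => (hG.smooth_inv k l).mul ?_)
  exact ((contDiffOn_pd hG.isOpen (hG.smooth _ _) _).add
    (contDiffOn_pd hG.isOpen (hG.smooth _ _) _)).sub (contDiffOn_pd hG.isOpen (hG.smooth _ _) _)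

theorem pd_symm (hG : IsMetricOn G Ω) {y : EuclideanSpace ℝ (Fin n)} (hy : y ∈ Ω) (k i j : Fin n) :
    pd k (fun z => G z i j) y = pd k (fun z => G z j i) y :=
  pd_congr k (by filter_upwards [hG.isOpen.mem_nhds hy] with z hz using hG.symm z hz i j)

theorem christoffel_symm (hG : IsMetricOn G Ω) {y : EuclideanSpace ℝ (Fin n)} (hy : y ∈ Ω)
    (k i j : Fin n) :
    christoffel G k i j y = christoffel G k j i y := by
  unfold christoffel
  congr 1
  refine sum_congr rfl fun l _ => ?_
  rw [hG.pd_symm hy l i j]; ring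

theorem lower_christoffel (hG : IsMetricOn G Ω) {y : EuclideanSpace ℝ (Fin n)} (hy : y ∈ Ω)
    (m i j : Fin n) :
    ∑ l, christoffel G l i j y * G y l m
      = (1 / 2) * (pd i (fun z => G z j m) y + pd j (fun z => G z i m) y
        - pd m (fun z => G z i j) y) := by
  unfold christoffel
  simp_rw [mul_assoc, ← mul_sum, sum_mul]
  rw [sum_comm]
  have : ∀ a l, (G y)⁻¹ l a * (pd i (fun z => G z j a) y + pd j (fun z => G z i a) y
        - pd a (fun z => G z i j) y) * G y l m
      = (pd i (fun z => G z j a) y + pd j (fun z => G z i a) y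
        - pd a (fun z => G z i j) y) * ((G y)⁻¹ a l * G y l m) := fun a l => by
    rw [hG.inv_symm hy l a]; ring
  simp_rw [this, ← mul_sum, hG.inv_mul hy]
  simp

/-- Metric compatibility ∇g = 0: add two lowered Christoffel symbols and use the symmetry of g. -/
theorem compat (hG : IsMetricOn G Ω) {y : EuclideanSpace ℝ (Fin n)} (hy : y ∈ Ω) (k i j : Fin n) :
    pd k (fun z => G z i j) y
      = ∑ l, (christoffel G l k i y * G y l j + christoffel G l k j y * G y l i) := by
  rw [sum_add_distrib, hG.lower_christoffel hy, hG.lower_christoffel hy, hG.pd_symm hy k j i,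
    hG.pd_symm hy i k j, hG.pd_symm hy j k i, hG.pd_symm hy i j k]
  rw [hG.pd_symm hy j i k]
  ring

/-- The components `Nᵏ` of the gradient of `w`. -/
def _root_.LocalCoord.grad (G : EuclideanSpace ℝ (Fin n) → Matrix (Fin n) (Fin n) ℝ)
    (w : EuclideanSpace ℝ (Fin n) → ℝ) (k : Fin n) (y : EuclideanSpace ℝ (Fin n)) : ℝ :=
  ∑ l, (G y)⁻¹ k l * pd l w y

theorem smooth_grad (hG : IsMetricOn G Ω) {w : EuclideanSpace ℝ (Fin n) → ℝ}
    (hw : ContDiffOn ℝ ∞ w Ω) (k : Fin n) :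
    ContDiffOn ℝ ∞ (grad G w k) Ω :=
  ContDiffOn.sum fun l _ => (hG.smooth_inv k l).mul (contDiffOn_pd hG.isOpen hw l)

theorem lower_grad (hG : IsMetricOn G Ω) (w : EuclideanSpace ℝ (Fin n) → ℝ)
    {y : EuclideanSpace ℝ (Fin n)} (hy : y ∈ Ω) (i : Fin n) :
    ∑ l, G y i l * grad G w l y = pd i w y := by
  unfold grad
  simp_rw [mul_sum]
  rw [sum_comm]
  simp_rw [← mul_assoc, ← sum_mul, hG.mul_inv hy]
  simp

theorem gradSq_eq (hG : IsMetricOn G Ω) (w : EuclideanSpace ℝ (Fin n) → ℝ)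
    {y : EuclideanSpace ℝ (Fin n)} (hy : y ∈ Ω) :
    gradSq G w y = ∑ k, grad G w k y * pd k w y := by
  unfold gradSq trace grad
  refine sum_congr rfl fun k _ => ?_
  rw [sum_mul]
  exact sum_congr rfl fun l _ => by ring

theorem pd_lower_grad (hG : IsMetricOn G Ω) {w : EuclideanSpace ℝ (Fin n) → ℝ}
    (hw : ContDiffOn ℝ ∞ w Ω) {y : EuclideanSpace ℝ (Fin n)}
    (hy : y ∈ Ω) (k i : Fin n) :
    ∑ l, G y i l * pd k (grad G w l) y
      = pd k (pd i w) y - ∑ l, grad G w l y * pd k (fun z => G z i l) y := by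
  have h1 : pd k (fun z => ∑ l, G z i l * grad G w l z) y = pd k (pd i w) y :=
    pd_congr k (by filter_upwards [hG.isOpen.mem_nhds hy] with z hz using hG.lower_grad w hz i)
  rw [pd_sum (f := fun l z => G z i l * grad G w l z) _ _ fun l _ =>
    (diffAt hG.isOpen (hG.smooth i l) hy).mul
    (diffAt hG.isOpen (hG.smooth_grad hw l) hy)] at h1
  rw [← h1, ← sum_sub_distrib]
  refine sum_congr rfl fun l _ => ?_
  rw [pd_mul k (diffAt hG.isOpen (hG.smooth i l) hy) (diffAt hG.isOpen (hG.smooth_grad hw l) hy)]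
  ring

/-- Differentiating G · grad w = dw avoids derivatives of the inverse matrix. By `compat` the
derivative of G splits in two: one half is the Christoffel correction in the Hessian, the other
cancels the trace term on the left. -/
theorem div_grad (hG : IsMetricOn G Ω) {w : EuclideanSpace ℝ (Fin n) → ℝ} (hw : ContDiffOn ℝ ∞ w Ω)
    {y : EuclideanSpace ℝ (Fin n)}
    (hy : y ∈ Ω) :
    ∑ k, pd k (grad G w k) y + ∑ l, (∑ k, christoffel G k k l y) * grad G w l y
      = laplacian G w y := by
  have h1 : ∀ k, pd k (grad G w k) y = ∑ m, (G y)⁻¹ k m *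
      (pd k (pd m w) y - ∑ l, grad G w l y * pd k (fun z => G z m l) y) := fun k => by
    simp_rw [← hG.pd_lower_grad hw hy, mul_sum]
    rw [sum_comm]
    simp_rw [← mul_assoc, ← sum_mul, hG.inv_mul hy]
    simp
  have h2 : ∀ k m, ∑ l, grad G w l y * pd k (fun z => G z m l) y
      = ∑ a, christoffel G a k m y * pd a w y
        + ∑ a, G y m a * ∑ l, christoffel G a k l y * grad G w l y := fun k m => by
    simp_rw [hG.compat hy, sum_add_distrib, mul_add, sum_add_distrib, mul_sum]
    congr 1
    · rw [sum_comm]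
      refine sum_congr rfl fun a _ => ?_
      rw [← hG.lower_grad w hy, mul_sum]
      exact sum_congr rfl fun l _ => by ring
    · rw [sum_comm]
      refine sum_congr rfl fun a _ => sum_congr rfl fun l _ => ?_
      rw [hG.symm y hy a m]; ring
  have h3 : ∀ k, ∑ m, (G y)⁻¹ k m * ∑ a, G y m a * ∑ l, christoffel G a k l y * grad G w l y
      = ∑ l, christoffel G k k l y * grad G w l y := fun k => by
    have aux : ∀ c : Fin n → ℝ, ∑ m, (G y)⁻¹ k m * ∑ a, G y m a * c a = c k := fun c => by
      simp_rw [mul_sum]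
      rw [sum_comm]
      simp_rw [← mul_assoc, ← sum_mul, hG.inv_mul hy]
      simp
    exact aux fun a => ∑ l, christoffel G a k l y * grad G w l y
  have h4 : ∑ l, (∑ k, christoffel G k k l y) * grad G w l y
      = ∑ k, ∑ l, christoffel G k k l y * grad G w l y := by
    simp_rw [sum_mul]; rw [sum_comm]
  rw [h4, ← sum_add_distrib]
  unfold laplacian trace
  refine sum_congr rfl fun k _ => ?_
  rw [h1, ← h3, ← sum_add_distrib]
  refine sum_congr rfl fun m _ => ?_
  rw [h2, hessian]
  ring

end IsMetricOn

/-! ### Conformal transformation laws -/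

section conformal

variable {w : EuclideanSpace ℝ (Fin n) → ℝ}

theorem conformal_inv (hG : IsMetricOn G Ω)
    (hG' : ∀ z ∈ Ω, G' z = Real.exp (-2 * w z) • G z) {y : EuclideanSpace ℝ (Fin n)} (hy : y ∈ Ω) :
    (G' y)⁻¹ = Real.exp (2 * w y) • (G y)⁻¹ := by
  refine Matrix.inv_eq_right_inv ?_
  rw [hG' y hy, Matrix.smul_mul, Matrix.mul_smul, smul_smul, ← Real.exp_add,
    Matrix.mul_nonsing_inv _ (hG.unit y hy)]
  simp

theorem conformal_trace (hG : IsMetricOn G Ω)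
    (hG' : ∀ z ∈ Ω, G' z = Real.exp (-2 * w z) • G z) {y : EuclideanSpace ℝ (Fin n)} (hy : y ∈ Ω)
    (T : Fin n → Fin n → EuclideanSpace ℝ (Fin n) → ℝ) :
    trace G' T y = Real.exp (2 * w y) * trace G T y := by
  simp only [trace, conformal_inv hG hG' hy, Matrix.smul_apply, smul_eq_mul, mul_assoc, ← mul_sum]

theorem conformal_christoffel (hG : IsMetricOn G Ω) (hw : ContDiffOn ℝ ∞ w Ω)
    (hG' : ∀ z ∈ Ω, G' z = Real.exp (-2 * w z) • G z) {y : EuclideanSpace ℝ (Fin n)} (hy : y ∈ Ω)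
    (k i j : Fin n) :
    christoffel G' k i j y = christoffel G k i j y
      + confDiff (fun a b => G y a b) (fun a => pd a w y) (fun a => grad G w a y) k i j := by
  have hpd : ∀ a b c, pd a (fun z => G' z b c) y
      = Real.exp (-2 * w y) * (pd a (fun z => G z b c) y - 2 * pd a w y * G y b c) := by
    intro a b c
    have h1 : pd a (fun z => G' z b c) y = pd a (fun z => Real.exp (-2 * w z) * G z b c) y :=
      pd_congr a (by filter_upwards [hG.isOpen.mem_nhds hy] with z hz; rw [hG' z hz]; rfl)
    have hwd := IsMetricOn.diffAt hG.isOpen hw hy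
    have h2 : pd a (fun z => Real.exp (-2 * w z)) y = Real.exp (-2 * w y) * (-2 * pd a w y) := by
      rw [pd_comp (f := fun z => -2 * w z) a (Real.hasDerivAt_exp _) (hwd.const_mul _),
        pd_const_mul a _ hwd]
    rw [h1, pd_mul a (hwd.const_mul _).exp (IsMetricOn.diffAt hG.isOpen (hG.smooth b c) hy), h2]
    ring
  unfold christoffel
  rw [conformal_inv hG hG' hy]
  have hexp : Real.exp (2 * w y) * Real.exp (-2 * w y) = 1 := by
    rw [← Real.exp_add]; simp
  have : ∀ l, (Real.exp (2 * w y) • (G y)⁻¹) k l *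
      (pd i (fun z => G' z j l) y + pd j (fun z => G' z i l) y - pd l (fun z => G' z i j) y)
      = (G y)⁻¹ k l * (pd i (fun z => G z j l) y + pd j (fun z => G z i l) y
          - pd l (fun z => G z i j) y)
        - 2 * (pd i w y * ((G y)⁻¹ k l * G y l j) + pd j w y * ((G y)⁻¹ k l * G y l i)
          - G y i j * ((G y)⁻¹ k l * pd l w y)) := fun l => by
    rw [hpd, hpd, hpd, Matrix.smul_apply, smul_eq_mul, hG.symm y hy l j, hG.symm y hy l i]
    linear_combination ((G y)⁻¹ k l * (pd i (fun z => G z j l) y + pd j (fun z => G z i l) y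
          - pd l (fun z => G z i j) y)
        - 2 * (pd i w y * ((G y)⁻¹ k l * G y j l) + pd j w y * ((G y)⁻¹ k l * G y i l)
          - G y i j * ((G y)⁻¹ k l * pd l w y))) * hexp
  simp_rw [this, sum_sub_distrib, ← mul_sum, sum_sub_distrib, sum_add_distrib, ← mul_sum,
    hG.inv_mul hy]
  simp only [confDiff, grad]
  split_ifs <;> ring

theorem conformal_hessian (hG : IsMetricOn G Ω) (hw : ContDiffOn ℝ ∞ w Ω)
    (hG' : ∀ z ∈ Ω, G' z = Real.exp (-2 * w z) • G z) {y : EuclideanSpace ℝ (Fin n)} (hy : y ∈ Ω)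
    (f : EuclideanSpace ℝ (Fin n) → ℝ)
    (i j : Fin n) :
    hessian G' f i j y = hessian G f i j y + pd i w y * pd j f y + pd j w y * pd i f y
      - G y i j * ∑ k, grad G w k y * pd k f y := by
  unfold hessian
  simp_rw [conformal_christoffel hG hw hG' hy, add_mul, sum_add_distrib, sum_confDiff_mul]
  ring

/-- The new connection is Γ + D with D explicit in dw and grad w. The terms with ∂D and the terms
quadratic in Γ + D are separately not tensorial; `compat` cancels N(g i j) between them, and
`div_grad` assembles the Laplacian. -/
theorem conformal_ricci (hG : IsMetricOn G Ω) (hw : ContDiffOn ℝ ∞ w Ω)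
    (hG' : ∀ z ∈ Ω, G' z = Real.exp (-2 * w z) • G z) {y : EuclideanSpace ℝ (Fin n)} (hy : y ∈ Ω)
    (i j : Fin n) :
    ricci G' i j y = ricci G i j y
      + (n - 2) * (hessian G w i j y + pd i w y * pd j w y - gradSq G w y * G y i j)
      + laplacian G w y * G y i j := by
  have hΩ := hG.isOpen
  have hnhds := hΩ.mem_nhds hy
  set D : Fin n → Fin n → Fin n → EuclideanSpace ℝ (Fin n) → ℝ := fun k i j z =>
    confDiff (fun a b => G z a b) (fun a => pd a w z) (fun a => grad G w a z) k i j with hD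
  have hDs : ∀ k i j, ContDiffOn ℝ ∞ (D k i j) Ω := fun k i j => by
    simp only [hD, confDiff]
    have hp := fun a => contDiffOn_pd hΩ hw a
    refine (((ContDiffOn.add ?_ ?_).sub ((hG.smooth i j).mul (hG.smooth_grad hw k)))).neg
    · split_ifs
      exacts [hp j, contDiffOn_const]
    · split_ifs
      exacts [hp i, contDiffOn_const]
  have hpd : ∀ a k i j, pd a (christoffel G' k i j) y
      = pd a (christoffel G k i j) y + pd a (D k i j) y := fun a k i j => by
    rw [← pd_add a (IsMetricOn.diffAt hΩ (hG.smooth_christoffel k i j) hy)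
      (IsMetricOn.diffAt hΩ (hDs k i j) hy)]
    exact pd_congr a (by
      filter_upwards [hnhds] with z hz using conformal_christoffel hG hw hG' hz k i j)
  -- The trace of D is -n dw in a whole neighbourhood, so it can be differentiated.
  have h1 : ∑ k, pd j (D k i k) y = -(n * pd j (pd i w) y) := by
    rw [← pd_sum _ _ fun k _ => IsMetricOn.diffAt hΩ (hDs k i k) hy]
    have : pd j (fun z => ∑ k, D k i k z) y = pd j (fun z => -(n : ℝ) * pd i w z) y :=
      pd_congr j (by
        filter_upwards [hnhds] with z hz
        rw [hD, sum_confDiff (hG.symm z hz) (hG.lower_grad w hz)]; ring)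
    rw [this, pd_const_mul j _ (IsMetricOn.diffAt hΩ (contDiffOn_pd hΩ hw i) hy)]
    ring
  have h2 : ∑ k, pd k (D k i j) y = -(2 * pd i (pd j w) y
      - ∑ k, grad G w k y * pd k (fun z => G z i j) y - G y i j * ∑ k, pd k (grad G w k) y) := by
    have : ∀ k, pd k (D k i j) y = -((if k = i then pd k (pd j w) y else 0)
        + (if k = j then pd k (pd i w) y else 0)
        - (grad G w k y * pd k (fun z => G z i j) y + G y i j * pd k (grad G w k) y)) := fun k => by
      have hp := fun a => IsMetricOn.diffAt hΩ (contDiffOn_pd hΩ hw a) hy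
      have hgi := IsMetricOn.diffAt hΩ (hG.smooth i j) hy
      have hgr := IsMetricOn.diffAt hΩ (hG.smooth_grad hw k) hy
      simp only [hD, confDiff]
      have hite : ∀ a b : Fin n, DifferentiableAt ℝ (fun z => if k = a then pd b w z else 0) y :=
        fun a b => by split_ifs; exacts [hp b, differentiableAt_const _]
      have hpite : ∀ a b : Fin n, pd k (fun z => if k = a then pd b w z else 0) y
          = if k = a then pd k (pd b w) y else 0 := fun a b => by
        split_ifs
        exacts [rfl, pd_const _ _ _]
      rw [pd_neg, pd_sub k ((hite i j).fun_add (hite j i)) (hgi.fun_mul hgr), pd_add k (hite i j) (hite j i),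
        pd_mul k hgi hgr, hpite, hpite]
      ring
    simp_rw [this, sum_neg_distrib, sum_sub_distrib, sum_add_distrib, ← mul_sum]
    rw [pd_comm hΩ hw hy i j]
    simp only [sum_ite_eq', mem_univ, if_true]
    rw [pd_comm hΩ hw hy i j]
    ring
  have h3 := ricci_quadratic_confDiff (Γ := fun k i j => christoffel G k i j y) (hG.symm y hy)
    (hG.lower_grad w hy) (hG.christoffel_symm hy) i j
  have h4 := hG.div_grad hw hy
  have h5 := fun k => hG.compat hy k i j
  unfold ricci
  simp_rw [hpd, sum_add_distrib, conformal_christoffel hG hw hG' hy]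
  rw [h3, h1, h2, hG.gradSq_eq w hy, ← h4, hessian]
  simp_rw [h5]
  rw [pd_comm hΩ hw hy j i]
  ring

/-- The trace-adjusted Bakry-Émery tensor `Ric_φ^m - R_φ^m / (2(m+n-1)) G`. -/
def weightedEinstein (G : EuclideanSpace ℝ (Fin n) → Matrix (Fin n) (Fin n) ℝ)
    (φ : EuclideanSpace ℝ (Fin n) → ℝ) (m : ℝ) (i j : Fin n)
    (y : EuclideanSpace ℝ (Fin n)) : ℝ :=
  bakryEmeryRicci G φ m i j y - weightedScalarCurvature G φ m y / (2 * (m + n - 1)) * G y i j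

theorem trace_metric (hG : IsMetricOn G Ω) {y : EuclideanSpace ℝ (Fin n)} (hy : y ∈ Ω) :
    trace G (fun i j z => G z i j) y = n := by
  have : ∀ i, ∑ j, (G y)⁻¹ i j * G y i j = 1 := fun i => by
    simpa [hG.symm y hy i] using hG.inv_mul hy i i
  simp [trace, this]

theorem trace_congr {T T' : Fin n → Fin n → EuclideanSpace ℝ (Fin n) → ℝ}
    {y : EuclideanSpace ℝ (Fin n)} (h : ∀ i j, T i j y = T' i j y) :
    trace G T y = trace G T' y := by
  simp [trace, h]

theorem trace_add (T T' : Fin n → Fin n → EuclideanSpace ℝ (Fin n) → ℝ)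
    (y : EuclideanSpace ℝ (Fin n)) :
    trace G (fun i j z => T i j z + T' i j z) y = trace G T y + trace G T' y := by
  simp [trace, mul_add, sum_add_distrib]

theorem trace_smul (T : Fin n → Fin n → EuclideanSpace ℝ (Fin n) → ℝ)
    (a : EuclideanSpace ℝ (Fin n) → ℝ) (y : EuclideanSpace ℝ (Fin n)) :
    trace G (fun i j z => a z * T i j z) y = a y * trace G T y := by
  simp [trace, mul_sum, mul_left_comm]

theorem trace_prod (hG : IsMetricOn G Ω) (f h : EuclideanSpace ℝ (Fin n) → ℝ)
    {y : EuclideanSpace ℝ (Fin n)} (hy : y ∈ Ω) :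
    trace G (fun i j z => pd i f z * pd j h z) y = ∑ k, grad G f k y * pd k h y := by
  unfold trace grad
  rw [sum_comm]
  refine sum_congr rfl fun k _ => ?_
  rw [sum_mul]
  exact sum_congr rfl fun l _ => by rw [hG.inv_symm hy]; ring

theorem trace_prod' (hG : IsMetricOn G Ω) (f h : EuclideanSpace ℝ (Fin n) → ℝ)
    {y : EuclideanSpace ℝ (Fin n)} (hy : y ∈ Ω) :
    trace G (fun i j z => pd j f z * pd i h z) y = ∑ k, grad G f k y * pd k h y := by
  unfold trace grad
  refine sum_congr rfl fun k _ => ?_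
  rw [sum_mul]
  exact sum_congr rfl fun l _ => by ring

/-- With φ' = φ + m w, the cross terms between dw and dφ in Ric and in the scalar part cancel, and
the weight contributes exactly as m extra dimensions. Both scalar curvatures scale by e^{2w} against
the factor e^{-2w} of the metric, so the difference is free of exponentials. -/
theorem conformal_weightedEinstein (hG : IsMetricOn G Ω) (hw : ContDiffOn ℝ ∞ w Ω)
    (hG' : ∀ z ∈ Ω, G' z = Real.exp (-2 * w z) • G z) {φ φ' : EuclideanSpace ℝ (Fin n) → ℝ}
    (hφ : ContDiffOn ℝ ∞ φ Ω)
    {m : ℝ} (hmn : m + n - 1 ≠ 0) (hm : m = 0 → ∀ z, φ z = 0)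
    (hφ' : ∀ z ∈ Ω, φ' z = φ z + m * w z)
    {y : EuclideanSpace ℝ (Fin n)} (hy : y ∈ Ω) (i j : Fin n) :
    weightedEinstein G' φ' m i j y = weightedEinstein G φ m i j y
      + (m + n - 2) *
        (hessian G w i j y + pd i w y * pd j w y - 1 / 2 * gradSq G w y * G y i j) := by
  have hΩ := hG.isOpen
  have hnhds := hΩ.mem_nhds hy
  have hpφ : ∀ z ∈ Ω, ∀ a, pd a φ' z = pd a φ z + m * pd a w z := fun z hz a => by
    rw [← pd_const_mul a m (IsMetricOn.diffAt hΩ hw hz),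
      ← pd_add a (IsMetricOn.diffAt hΩ hφ hz) ((IsMetricOn.diffAt hΩ hw hz).const_mul m)]
    exact pd_congr a (by filter_upwards [hΩ.mem_nhds hz] with x hx using hφ' x hx)
  have hppφ : ∀ a b, pd a (pd b φ') y = pd a (pd b φ) y + m * pd a (pd b w) y := fun a b => by
    have h1 := IsMetricOn.diffAt hΩ (contDiffOn_pd hΩ hφ b) hy
    have h2 := IsMetricOn.diffAt hΩ (contDiffOn_pd hΩ hw b) hy
    rw [← pd_const_mul a m h2, ← pd_add a h1 (h2.const_mul m)]
    exact pd_congr a (by filter_upwards [hnhds] with x hx using hpφ x hx b)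
  -- Linearity of the Hessian in the function, for an arbitrary connection so as to apply to that of
  -- G' as well.
  have hsplit : ∀ H : EuclideanSpace ℝ (Fin n) → Matrix (Fin n) (Fin n) ℝ, ∀ a b, hessian H φ' a b y
      = hessian H φ a b y + m * hessian H w a b y := fun H a b => by
    simp only [hessian, hppφ, hpφ y hy, mul_add, sum_add_distrib, mul_sub, mul_sum]
    have : ∀ k, christoffel H k a b y * (m * pd k w y) = m * (christoffel H k a b y * pd k w y) :=
      fun k => by ring
    simp_rw [this]; ring
  set S := ∑ k, grad G w k y * pd k φ y with hS
  have hQ : ∑ k, grad G w k y * pd k w y = gradSq G w y := (hG.gradSq_eq w hy).symm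
  have hHφ : ∀ a b, hessian G' φ' a b y = hessian G φ a b y + m * hessian G w a b y
      + (pd a w y * pd b φ y + pd b w y * pd a φ y - G y a b * S)
      + m * (2 * (pd a w y * pd b w y) - G y a b * gradSq G w y) := fun a b => by
    rw [hsplit, conformal_hessian hG hw hG' hy, conformal_hessian hG hw hG' hy, hQ]; ring
  have hn := trace_metric hG hy
  have hww := trace_prod hG w w hy
  have hwφ := trace_prod hG w φ hy
  have hwφ' := trace_prod' hG w φ hy
  rw [hQ] at hww
  have hR : scalarCurvature G' y = Real.exp (2 * w y) * (scalarCurvature G y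
      + 2 * (n - 1) * laplacian G w y - (n - 2) * (n - 1) * gradSq G w y) := by
    rw [scalarCurvature, conformal_trace hG hG' hy]
    congr 1
    rw [trace_congr (T' := fun i j z => (ricci G i j z
      + (n - 2 : ℝ) * (hessian G w i j z + pd i w z * pd j w z)) + (laplacian G w z
        - (n - 2) * gradSq G w z) * G z i j)
      fun a b => by rw [conformal_ricci hG hw hG' hy]; ring]
    rw [trace_add, trace_add, trace_smul (a := fun z => laplacian G w z - (n - 2) * gradSq G w z),
      trace_smul (a := fun _ => (n - 2 : ℝ)), trace_add, hn, hww]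
    simp only [scalarCurvature, laplacian]
    ring
  have hL : laplacian G' φ' y = Real.exp (2 * w y) * (laplacian G φ y + m * laplacian G w y
      + (2 - n) * S + m * (2 - n) * gradSq G w y) := by
    rw [laplacian, conformal_trace hG hG' hy]
    congr 1
    rw [trace_congr (T' := fun a b z => hessian G φ a b z + m * hessian G w a b z
      + (pd a w z * pd b φ z + pd b w z * pd a φ z) + (2 * m) * (pd a w z * pd b w z)
      + (-S - m * gradSq G w z) * G z a b) fun a b => by rw [hHφ]; ring]
    rw [trace_add, trace_add, trace_add, trace_add, trace_add,
      trace_smul (a := fun z => -S - m * gradSq G w z),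
      trace_smul (a := fun _ => 2 * m), trace_smul (a := fun _ => m), hn, hww, hwφ, hwφ']
    simp only [laplacian]
    ring
  have hgφ : gradSq G' φ' y = Real.exp (2 * w y) * (gradSq G φ y + 2 * m * S
      + m ^ 2 * gradSq G w y) := by
    rw [gradSq, conformal_trace hG hG' hy]
    congr 1
    rw [trace_congr (T' := fun a b z => pd a φ z * pd b φ z
      + m * (pd a w z * pd b φ z + pd b w z * pd a φ z) + m ^ 2 * (pd a w z * pd b w z))
      fun a b => by rw [hpφ y hy, hpφ y hy]; ring]
    rw [trace_add, trace_add, trace_smul (a := fun _ => m ^ 2), trace_smul (a := fun _ => m),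
      trace_add, hww, hwφ, hwφ']
    simp only [gradSq]
    ring
  have hexp : Real.exp (2 * w y) * Real.exp (-2 * w y) = 1 := by
    rw [← Real.exp_add]; simp
  have hGy : G' y i j = Real.exp (-2 * w y) * G y i j := by rw [hG' y hy]; rfl
  have hW : weightedScalarCurvature G' φ' m y = Real.exp (2 * w y) *
      (weightedScalarCurvature G φ m y + 2 * (m + n - 1) * (laplacian G w y - S)
        - (m + n - 1) * (m + n - 2) * gradSq G w y) := by
    rw [weightedScalarCurvature, hR, hL, hgφ, weightedScalarCurvature]
    -- For m = 0 the quotient (m + 1) / m has the value 0, in accordance with the convention that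
    -- the term is absent, and φ = 0 removes the cross term S.
    rcases eq_or_ne m 0 with h0 | h0
    · have : S = 0 := by
        have : φ = fun _ => 0 := funext (hm h0)
        simp [hS, this, pd_const]
      rw [this, h0]; ring
    · field_simp; ring
  rw [weightedEinstein, hW, hGy, weightedEinstein, bakryEmeryRicci, bakryEmeryRicci,
    conformal_ricci hG hw hG' hy, hHφ, hpφ y hy, hpφ y hy]
  have hφm : 1 / m * ((pd i φ y + m * pd i w y) * (pd j φ y + m * pd j w y))
      = 1 / m * (pd i φ y * pd j φ y) + pd i w y * pd j φ y + pd j w y * pd i φ y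
        + m * (pd i w y * pd j w y) := by
    rcases eq_or_ne m 0 with h0 | h0
    · have : φ = fun _ => 0 := funext (hm h0)
      simp [this, pd_const, h0]
    · field_simp; ring
  rw [hφm]
  have hrew : ∀ X : ℝ, Real.exp (2 * w y) * X / (2 * (m + n - 1)) *
      (Real.exp (-2 * w y) * G y i j) = X / (2 * (m + n - 1)) * G y i j := fun X => by
    linear_combination X / (2 * (m + n - 1)) * G y i j * hexp
  rw [hrew]
  field_simp
  ring

end conformal

end metric

end LocalCoord

end

noncomputable section
open scoped Topology
open Filter Set

/-! ### Smooth dependence of flows on initial data -/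

namespace SmoothFlow

universe u

set_option maxSynthPendingDepth 3

local notation "𝕀" => Set.Icc (0 : ℝ) 1

section omega

variable {E : Type u} [NormedAddCommGroup E] [NormedSpace ℝ E]
  {E' : Type u} [NormedAddCommGroup E'] [NormedSpace ℝ E']

/-- Pointwise application of a bilinear map to two continuous paths. -/
def bilinCurve {A : Type u} [NormedAddCommGroup A] [NormedSpace ℝ A] (B : A →L[ℝ] E →L[ℝ] E') :
    C(𝕀, A) →L[ℝ] C(𝕀, E) →L[ℝ] C(𝕀, E') :=
  LinearMap.mkContinuous₂
    (LinearMap.mk₂ ℝ (fun (a : C(𝕀, A)) (h : C(𝕀, E)) =>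
        (⟨fun t => B (a t) (h t), (B.continuous.comp a.continuous).clm_apply h.continuous⟩ :
          C(𝕀, E')))
      (fun a b h => ContinuousMap.ext fun t => by simp)
      (fun c a h => ContinuousMap.ext fun t => by simp)
      (fun a h h' => ContinuousMap.ext fun t => by simp)
      (fun c a h => ContinuousMap.ext fun t => by simp)) ‖B‖
    (fun a h => by
      rw [ContinuousMap.norm_le _ (by positivity)]
      intro t
      exact (B.le_opNorm₂ _ _).trans (mul_le_mul
        (mul_le_mul_of_nonneg_left (a.norm_coe_le_norm t) (norm_nonneg B)) (h.norm_coe_le_norm t)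
        (norm_nonneg _) (by positivity)))

/-- Pointwise application of a continuous path of operators to a continuous path of vectors. -/
def applyCurve : C(𝕀, E →L[ℝ] E') →L[ℝ] C(𝕀, E) →L[ℝ] C(𝕀, E') :=
  bilinCurve (ContinuousLinearMap.id ℝ (E →L[ℝ] E'))

/-- Composition of paths with a fixed continuous map. -/
def compCurve (f : C(E, E')) (γ : C(𝕀, E)) : C(𝕀, E') := f.comp γ

/-- The mean value inequality on the segment from γ(t) to h(t), with a Lipschitz derivative, bounds
the remainder by K‖h - γ‖², uniformly in t. -/
theorem hasFDerivAt_compCurve {f : C(E, E')} {f' : C(E, E →L[ℝ] E')}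
    (hf : ∀ x, HasFDerivAt f (f' x) x) {K : NNReal} (hK : LipschitzWith K f') (γ : C(𝕀, E)) :
    HasFDerivAt (compCurve f) (applyCurve (compCurve f' γ)) γ := by
  have hO : (fun h => (compCurve f h - compCurve f γ - applyCurve (compCurve f' γ) (h - γ)))
      =O[𝓝 γ] fun h => ‖h - γ‖ ^ 2 := by
    refine Asymptotics.IsBigO.of_bound K (Eventually.of_forall fun h => ?_)
    rw [Real.norm_of_nonneg (by positivity), ContinuousMap.norm_le _ (by positivity)]
    intro t
    have hle : ‖h t - γ t‖ ≤ ‖h - γ‖ := (h - γ).norm_coe_le_norm t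
    have := (convex_segment (𝕜 := ℝ) (γ t) (h t)).norm_image_sub_le_of_norm_hasFDerivWithin_le'
      (f := f) (f' := f') (φ := f' (γ t)) (C := K * ‖h - γ‖)
      (fun x _ => (hf x).hasFDerivWithinAt)
      (fun x hx => by
        have h1 := hK.dist_le_mul x (γ t)
        rw [dist_eq_norm, dist_eq_norm] at h1
        refine h1.trans (mul_le_mul_of_nonneg_left ?_ K.2)
        refine le_trans ?_ hle
        obtain ⟨a, b, ha, hb, hab, rfl⟩ := hx
        have : a • γ t + b • h t - γ t = b • (h t - γ t) := by
          have : a = 1 - b := by linarith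
          rw [this]; module
        rw [this, norm_smul, Real.norm_of_nonneg hb]
        exact mul_le_of_le_one_left (norm_nonneg _) (by linarith))
      (left_mem_segment ℝ _ _) (right_mem_segment ℝ _ _)
    change ‖f (h t) - f (γ t) - f' (γ t) (h t - γ t)‖ ≤ _
    calc ‖f (h t) - f (γ t) - f' (γ t) (h t - γ t)‖ ≤ K * ‖h - γ‖ * ‖h t - γ t‖ := this
      _ ≤ K * ‖h - γ‖ * ‖h - γ‖ := by gcongr
      _ = K * ‖h - γ‖ ^ 2 := by ring
  have h0 : HasFDerivAt (fun h => compCurve f h - compCurve f γ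
      - applyCurve (compCurve f' γ) (h - γ)) (0 : C(𝕀, E) →L[ℝ] C(𝕀, E')) γ := hO.hasFDerivAt (by norm_num)
  have h1 : HasFDerivAt (fun h => applyCurve (compCurve f' γ) (h - γ))
      (applyCurve (compCurve f' γ)) γ :=
    (applyCurve (compCurve f' γ)).hasFDerivAt.comp γ ((hasFDerivAt_id γ).sub_const γ)
  have h2 := (h0.add h1).add_const (compCurve f γ)
  rw [zero_add] at h2
  refine h2.congr_of_eventuallyEq (Eventually.of_forall fun h => ?_)
  simp

/-- The derivative of composition with f is composition with f', followed by a fixed bounded linear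
map. Hence induction on k with the target space generalized; source and target share a universe so
that spaces of operators remain admissible targets. -/
theorem contDiff_compCurve_nat [FiniteDimensional ℝ E] (k : ℕ) :
    ∀ {E' : Type u} [NormedAddCommGroup E'] [NormedSpace ℝ E'] (f : C(E, E')),
      ContDiff ℝ ∞ f → HasCompactSupport f → ContDiff ℝ k (compCurve (E' := E') f) := by
  induction k with
  | zero =>
    intro E' _ _ f hf hc
    exact contDiff_zero.2 (ContinuousMap.continuous_postcomp f)
  | succ k ih =>
    intro E' _ _ f hf hc
    have hf' : ContDiff ℝ ∞ (fderiv ℝ f) := hf.fderiv_right (by simp)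
    have hc' : HasCompactSupport (fderiv ℝ f) := hc.fderiv ℝ
    obtain ⟨K, hK⟩ := hf'.lipschitzWith_of_hasCompactSupport hc' (by simp)
    let f' : C(E, E →L[ℝ] E') := ⟨fderiv ℝ f, hf'.continuous⟩
    push_cast
    rw [contDiff_succ_iff_hasFDerivAt]
    refine ⟨fun γ => applyCurve (compCurve f' γ), ?_, fun γ => ?_⟩
    · have hL : ContDiff ℝ k fun A : C(𝕀, E →L[ℝ] E') => (applyCurve A : C(𝕀, E) →L[ℝ] C(𝕀, E')) :=
        ContinuousLinearMap.contDiff (𝕜 := ℝ) (E := C(𝕀, E →L[ℝ] E'))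
          (F := C(𝕀, E) →L[ℝ] C(𝕀, E')) applyCurve
      exact hL.comp (ih f' hf' hc')
    · exact hasFDerivAt_compCurve (f' := f')
        (fun x => (hf.differentiable (by simp) x).hasFDerivAt) hK γ

theorem contDiff_compCurve [FiniteDimensional ℝ E] (f : C(E, E')) (hf : ContDiff ℝ ∞ f)
    (hc : HasCompactSupport f) : ContDiff ℝ ∞ (compCurve f) :=
  contDiff_infty.2 fun k => contDiff_compCurve_nat k f hf hc

end omega

section integral

variable {E : Type u} [NormedAddCommGroup E] [NormedSpace ℝ E] [CompleteSpace E]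

theorem continuous_extend (γ : C(𝕀, E)) : Continuous (IccExtend zero_le_one γ) :=
  γ.continuous.Icc_extend'

/-- The primitive of a continuous path. -/
def primitive : C(𝕀, E) →L[ℝ] C(𝕀, E) :=
  LinearMap.mkContinuous
    { toFun := fun γ => ⟨fun t => ∫ s in (0 : ℝ)..t, IccExtend zero_le_one γ s,
        (intervalIntegral.continuous_primitive
          (fun a b => (continuous_extend γ).intervalIntegrable a b) 0).comp continuous_subtype_val⟩
      map_add' := fun γ γ' => by
        ext t
        change ∫ s in (0 : ℝ)..t, IccExtend zero_le_one (γ + γ') s = _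
        rw [ContinuousMap.add_apply]
        exact intervalIntegral.integral_add ((continuous_extend γ).intervalIntegrable _ _)
          ((continuous_extend γ').intervalIntegrable _ _)
      map_smul' := fun c γ => by
        ext t
        exact intervalIntegral.integral_smul c _ } 1
    (fun γ => by
      rw [one_mul, ContinuousMap.norm_le _ (by positivity)]
      intro t
      have h := intervalIntegral.norm_integral_le_of_norm_le_const (a := 0) (b := (t : ℝ))
        (f := IccExtend zero_le_one γ) (C := ‖γ‖) (fun s _ => γ.norm_coe_le_norm _)
      refine h.trans ?_
      rw [sub_zero, abs_of_nonneg t.2.1]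
      exact mul_le_of_le_one_right (norm_nonneg _) t.2.2)

theorem primitive_apply (γ : C(𝕀, E)) (t : 𝕀) :
    primitive γ t = ∫ s in (0 : ℝ)..t, IccExtend zero_le_one γ s := rfl

/-- Constant paths. -/
def constCurve : E →L[ℝ] C(𝕀, E) :=
  LinearMap.mkContinuous
    { toFun := fun x => ContinuousMap.const _ x
      map_add' := fun x y => by ext; rfl
      map_smul' := fun c x => by ext; rfl } 1
    (fun x => by
      rw [one_mul, ContinuousMap.norm_le _ (by positivity)]
      intro t; exact le_rfl)

theorem constCurve_apply (x : E) (t : 𝕀) : constCurve x t = x := rfl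

/-- The map whose zeros are the solutions of `γ' = s F(γ)`, `γ(0) = x`. -/
def picardMap (F : C(E, E)) (p : (E × ℝ) × C(𝕀, E)) : (E × ℝ) × C(𝕀, E) :=
  (p.1, p.2 - constCurve p.1.1 - p.1.2 • primitive (compCurve F p.2))

theorem contDiff_picardMap [FiniteDimensional ℝ E] {F : C(E, E)} (hF : ContDiff ℝ ∞ F)
    (hc : HasCompactSupport F) : ContDiff ℝ ∞ (picardMap F) := by
  have h1 : ContDiff ℝ ∞ fun p : (E × ℝ) × C(𝕀, E) => compCurve F p.2 :=
    (contDiff_compCurve F hF hc).comp contDiff_snd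
  have h2 : ContDiff ℝ ∞ fun p : (E × ℝ) × C(𝕀, E) => primitive (compCurve F p.2) :=
    (primitive (E := E)).contDiff.comp h1
  have h3 : ContDiff ℝ ∞ fun p : (E × ℝ) × C(𝕀, E) => constCurve p.1.1 :=
    (constCurve (E := E)).contDiff.comp (contDiff_fst.comp contDiff_fst)
  exact contDiff_fst.prodMk ((contDiff_snd.sub h3).sub
    ((contDiff_snd.comp contDiff_fst).smul h2))

/-- The derivative of `picardMap` at a constant path, with time `0`. -/
def picardDeriv (F : C(E, E)) (x₀ : E) : ((E × ℝ) × C(𝕀, E)) ≃L[ℝ] (E × ℝ) × C(𝕀, E) :=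
  (ContinuousLinearEquiv.refl ℝ (E × ℝ)).skewProd (ContinuousLinearEquiv.refl ℝ C(𝕀, E))
    (-(constCurve.comp (ContinuousLinearMap.fst ℝ E ℝ)
      + (ContinuousLinearMap.snd ℝ E ℝ).smulRight (primitive (compCurve F (constCurve x₀)))))

/-- At s = 0 the factor s kills the derivative of the nonlinear term, which therefore need not be
computed. The total derivative is a shear over the parameters (x, s), hence invertible. -/
theorem hasFDerivAt_picardMap [FiniteDimensional ℝ E] {F : C(E, E)} (hF : ContDiff ℝ ∞ F)
    (hc : HasCompactSupport F) (x₀ : E) :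
    HasFDerivAt (picardMap F)
      (picardDeriv F x₀ : (E × ℝ) × C(𝕀, E) →L[ℝ] (E × ℝ) × C(𝕀, E))
      ((x₀, 0), constCurve x₀) := by
  set P : (E × ℝ) × C(𝕀, E) := ((x₀, 0), constCurve x₀)
  have h1 : HasFDerivAt (fun p : (E × ℝ) × C(𝕀, E) => primitive (compCurve F p.2))
      (fderiv ℝ (fun p : (E × ℝ) × C(𝕀, E) => primitive (compCurve F p.2)) P) P :=
    (((primitive (E := E)).contDiff.comp ((contDiff_compCurve F hF hc).comp contDiff_snd)).differentiable
      (by simp) P).hasFDerivAt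
  have h2 : HasFDerivAt (fun p : (E × ℝ) × C(𝕀, E) => p.1) (ContinuousLinearMap.fst ℝ _ _) P :=
    hasFDerivAt_fst
  have h3 : HasFDerivAt (fun p : (E × ℝ) × C(𝕀, E) => p.2) (ContinuousLinearMap.snd ℝ _ _) P :=
    hasFDerivAt_snd
  have h4 : HasFDerivAt (fun p : (E × ℝ) × C(𝕀, E) => p.1.2)
      ((ContinuousLinearMap.snd ℝ E ℝ).comp (ContinuousLinearMap.fst ℝ _ _)) P :=
    hasFDerivAt_snd.comp P h2
  have h5 : HasFDerivAt (fun p : (E × ℝ) × C(𝕀, E) => constCurve p.1.1)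
      (constCurve.comp ((ContinuousLinearMap.fst ℝ E ℝ).comp (ContinuousLinearMap.fst ℝ _ _))) P :=
    HasFDerivAt.comp P (g := constCurve (E := E)) (f := fun p : (E × ℝ) × C(𝕀, E) => p.1.1)
      (constCurve (E := E)).hasFDerivAt
      (HasFDerivAt.comp P (g := Prod.fst) hasFDerivAt_fst h2)
  have h6 := h2.prodMk ((h3.sub h5).sub (h4.smul h1))
  refine h6.congr_fderiv ?_
  refine ContinuousLinearMap.ext fun p => ?_
  obtain ⟨⟨a, b⟩, h⟩ := p
  simp [picardDeriv, P]
  abel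

/-- The integral equation gives right derivatives only, as the extension of γ is constant outside
[0, 1]; that is enough for uniqueness of solutions. -/
theorem hasDerivWithinAt_of_picardMap {F : C(E, E)} {x : E} {s : ℝ} {γ : C(𝕀, E)}
    (h : picardMap F ((x, s), γ) = ((x, s), 0)) :
    γ ⟨0, by simp⟩ = x ∧ ∀ t ∈ Ico (0 : ℝ) 1,
      HasDerivWithinAt (IccExtend zero_le_one γ) (s • F (IccExtend zero_le_one γ t)) (Ici t) t := by
  have h1 : ∀ t : 𝕀, γ t = x + s • ∫ r in (0 : ℝ)..t, F (IccExtend zero_le_one γ r) := fun t => by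
    have := congrArg (fun q : (E × ℝ) × C(𝕀, E) => q.2 t) h
    simp only [picardMap, ContinuousMap.sub_apply, ContinuousMap.smul_apply, constCurve_apply,
      primitive_apply, ContinuousMap.zero_apply] at this
    rw [sub_sub, sub_eq_zero] at this
    exact this
  refine ⟨by simp [h1], fun t ht => ?_⟩
  have hcont : Continuous fun r => F (IccExtend zero_le_one γ r) :=
    F.continuous.comp (continuous_extend γ)
  have h2 : HasDerivAt (fun t => x + s • ∫ r in (0 : ℝ)..t, F (IccExtend zero_le_one γ r))
      (s • F (IccExtend zero_le_one γ t)) t :=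
    ((intervalIntegral.integral_hasDerivAt_right (hcont.intervalIntegrable _ _)
      (hcont.stronglyMeasurableAtFilter _ _) hcont.continuousAt).const_smul s).const_add x
  refine h2.hasDerivWithinAt.congr_of_eventuallyEq ?_ ?_
  · filter_upwards [self_mem_nhdsWithin, mem_nhdsWithin_of_mem_nhds (Iio_mem_nhds ht.2)]
      with r hr hr1
    have : r ∈ 𝕀 := ⟨ht.1.trans hr, le_of_lt hr1⟩
    rw [IccExtend_of_mem _ _ this, h1]
  · have : t ∈ 𝕀 := ⟨ht.1, ht.2.le⟩
    rw [IccExtend_of_mem _ _ this, h1]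

end integral

section flow

variable {E : Type u} [NormedAddCommGroup E] [NormedSpace ℝ E] [FiniteDimensional ℝ E]

/-- Rescaling time to [0, 1] makes the true time s a parameter of γ' = s F(γ). The inverse function
theorem for `picardMap` on the Banach space of paths then gives solutions depending smoothly on (x,
s) jointly. Evaluated at 1 they agree, by uniqueness, with the Picard-Lindelöf solution at time s.
-/
theorem exists_local_flow_of_hasCompactSupport (F : C(E, E)) (hF : ContDiff ℝ ∞ F)
    (hc : HasCompactSupport F) (x₀ : E) :
    ∃ Ψ : E × ℝ → E, ∃ ε > 0, ∀ x ∈ Metric.ball x₀ ε, ∀ s ∈ Ioo (-ε) ε,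
      ContDiffAt ℝ ∞ Ψ (x, s) ∧ Ψ (x, 0) = x ∧
        HasDerivAt (fun s => Ψ (x, s)) (F (Ψ (x, s))) s := by
  haveI : CompleteSpace E := FiniteDimensional.complete ℝ E
  obtain ⟨K, hK⟩ := hF.lipschitzWith_of_hasCompactSupport hc (by simp)
  set P : (E × ℝ) × C(𝕀, E) := ((x₀, 0), constCurve x₀)
  have hΦ := contDiff_picardMap hF hc
  have hΦ' := hasFDerivAt_picardMap hF hc x₀
  set e := (hΦ.contDiffAt (x := P)).toOpenPartialHomeomorph (picardMap F) hΦ' (by simp) with he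
  have hecoe : ⇑e = picardMap F := rfl
  have hPs : P ∈ e.source := ContDiffAt.mem_toOpenPartialHomeomorph_source _ hΦ' (by simp)
  have hP0 : picardMap F P = ((x₀, 0), 0) := by simp [picardMap, P]
  have hQt : (((x₀, 0), 0) : (E × ℝ) × C(𝕀, E)) ∈ e.target := by
    rw [← hP0, ← hecoe]; exact e.map_source hPs
  have hQs : e.symm ((x₀, 0), 0) = P := by rw [← hP0, ← hecoe]; exact e.left_inv hPs
  have hsymm : ContinuousAt e.symm ((x₀, 0), 0) := e.continuousAt_symm hQt
  -- Smoothness of the local inverse is needed on a neighbourhood, not only at the base point;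
  -- invertibility of the derivative is an open condition.
  have hev : ∀ᶠ q in 𝓝 (((x₀, 0), 0) : (E × ℝ) × C(𝕀, E)), ContDiffAt ℝ ∞ e.symm q := by
    have h1 : ∀ᶠ p in 𝓝 P, fderiv ℝ (picardMap F) p ∈
        range ((↑) : (((E × ℝ) × C(𝕀, E)) ≃L[ℝ] (E × ℝ) × C(𝕀, E)) → _) := by
      have hcf : ContinuousAt (fderiv ℝ (picardMap F)) P :=
        (hΦ.continuous_fderiv (by simp)).continuousAt
      refine hcf.eventually ?_
      rw [hΦ'.fderiv]
      exact ContinuousLinearEquiv.nhds _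
    have h2 : ∀ᶠ q in 𝓝 (((x₀, 0), 0) : (E × ℝ) × C(𝕀, E)), fderiv ℝ (picardMap F) (e.symm q) ∈
        range ((↑) : (((E × ℝ) × C(𝕀, E)) ≃L[ℝ] (E × ℝ) × C(𝕀, E)) → _) :=
      hsymm.eventually (by rw [hQs]; exact h1)
    filter_upwards [h2, e.open_target.mem_nhds hQt] with q ⟨f, hf⟩ hqt
    refine e.contDiffAt_symm (f₀' := f) hqt ?_ (by rw [hecoe]; exact hΦ.contDiffAt)
    rw [hf, hecoe]
    exact (hΦ.differentiable (by simp) _).hasFDerivAt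
  let ι : E × ℝ → (E × ℝ) × C(𝕀, E) := fun q => (q, 0)
  have hι : ContDiff ℝ ∞ ι := contDiff_id.prodMk contDiff_const
  let Ψ : E × ℝ → E := fun q => (e.symm (ι q)).2 ⟨1, by simp⟩
  have hιc : ContinuousAt ι (x₀, 0) := hι.continuous.continuousAt
  have hev1 : ∀ᶠ q in 𝓝 ((x₀, 0) : E × ℝ), ContDiffAt ℝ ∞ Ψ q ∧ ι q ∈ e.target := by
    filter_upwards [hιc.eventually hev, hιc.eventually (e.open_target.mem_nhds hQt)] with q hq hqt
    refine ⟨?_, hqt⟩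
    have h1 : ContDiffAt ℝ ∞ (fun q => (e.symm (ι q)).2) q :=
      (hq.comp q hι.contDiffAt).snd
    exact (ContinuousMap.evalCLM ℝ (⟨1, by simp⟩ : 𝕀)).contDiff.contDiffAt.comp q h1
  obtain ⟨r, hr, δ, hδ, hsol⟩ :=
    (hF.contDiffAt (x := x₀)).of_le (m := 1) (by simp)
      |>.exists_forall_mem_closedBall_exists_eq_forall_mem_Ioo_hasDerivAt 0
  obtain ⟨ρ, hρ, hball⟩ := Metric.eventually_nhds_iff_ball.1 hev1
  refine ⟨Ψ, min (min r δ) ρ, by positivity, fun x hx s hs => ?_⟩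
  have hmem : ∀ s ∈ Ioo (-(min (min r δ) ρ)) (min (min r δ) ρ), (x, s) ∈ Metric.ball (x₀, (0:ℝ)) ρ := by
    intro s hs
    rw [Metric.mem_ball, Prod.dist_eq, max_lt_iff]
    refine ⟨(Metric.mem_ball.1 hx).trans_le (min_le_right _ _), ?_⟩
    rw [Real.dist_eq, sub_zero, abs_lt]
    exact ⟨by linarith [hs.1, min_le_right (min r δ) ρ], hs.2.trans_le (min_le_right _ _)⟩
  obtain ⟨α, hα0, hα⟩ := hsol x (Metric.ball_subset_closedBall
    (Metric.ball_subset_ball ((min_le_left _ _).trans (min_le_left _ _)) hx))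
  have key : ∀ s ∈ Ioo (-(min (min r δ) ρ)) (min (min r δ) ρ), Ψ (x, s) = α s := by
    intro s hs
    have hs' : |s| < δ := abs_lt.2
      ⟨by linarith [hs.1, (min_le_left (min r δ) ρ).trans (min_le_right r δ)],
        hs.2.trans_le ((min_le_left _ _).trans (min_le_right _ _))⟩
    have hq := (hball _ (hmem s hs)).2
    have h1 : picardMap F (e.symm (ι (x, s))) = ((x, s), 0) := e.right_inv hq
    have h2 : (e.symm (ι (x, s))).1 = (x, s) := congrArg Prod.fst h1
    set γ := (e.symm (ι (x, s))).2 with hγ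
    have h3 : e.symm (ι (x, s)) = ((x, s), γ) := Prod.ext h2 rfl
    rw [h3] at h1
    obtain ⟨h4, h5⟩ := hasDerivWithinAt_of_picardMap h1
    -- The rescaled Picard-Lindelöf solution t ↦ α(st) solves the same equation as γ.
    have hd : ∀ t ∈ Icc (0 : ℝ) 1, HasDerivAt (fun t => α (s * t)) (s • F (α (s * t))) t := by
      intro t ht
      have hst : s * t ∈ Ioo (0 - δ) (0 + δ) := by
        rw [zero_sub, zero_add, mem_Ioo, ← abs_lt, abs_mul, abs_of_nonneg ht.1]
        exact (mul_le_of_le_one_right (abs_nonneg _) ht.2).trans_lt hs'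
      have := HasDerivAt.scomp (h := fun t => s * t) (h' := s) t (hα _ hst)
        (by simpa using (hasDerivAt_id t).const_mul s)
      exact this
    have huniq := ODE_solution_unique (v := fun _ y => s • F y) (K := ‖s‖₊ * K) (a := 0) (b := 1)
      (f := IccExtend zero_le_one γ) (g := fun t => α (s * t))
      (fun _ => LipschitzWith.of_dist_le_mul fun y z => by
        have h6 := hK.dist_le_mul y z
        rw [dist_smul₀]
        push_cast
        rw [mul_assoc]
        exact mul_le_mul_of_nonneg_left h6 (norm_nonneg _))
      (continuous_extend γ).continuousOn h5
      (fun t ht => (hd t ht).continuousAt.continuousWithinAt)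
      (fun t ht => (hd t (Ico_subset_Icc_self ht)).hasDerivWithinAt)
      (by
        rw [IccExtend_of_mem _ _ (by simp : (0:ℝ) ∈ 𝕀), h4, mul_zero, hα0])
    have h7 := huniq (by simp : (1 : ℝ) ∈ Icc (0:ℝ) 1)
    rw [IccExtend_of_mem _ _ (by simp : (1:ℝ) ∈ 𝕀)] at h7
    simp only [mul_one] at h7
    exact h7
  have hs0 : (0 : ℝ) ∈ Ioo (-(min (min r δ) ρ)) (min (min r δ) ρ) := by
    have : 0 < min (min r δ) ρ := by positivity
    exact ⟨by linarith, this⟩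
  refine ⟨(hball _ (hmem s hs)).1, by rw [key 0 hs0, hα0], ?_⟩
  rw [key s hs]
  refine (hα s ?_).congr_of_eventuallyEq ?_
  · exact ⟨by linarith [hs.1, (min_le_left (min r δ) ρ).trans (min_le_right r δ)],
        by linarith [hs.2, (min_le_left (min r δ) ρ).trans (min_le_right r δ)]⟩
  · filter_upwards [Ioo_mem_nhds hs.1 hs.2] with t ht using key t ht

/-- A smooth vector field has a smooth local flow. -/
theorem exists_local_flow {F : E → E} {Ω : Set E} (hΩ : IsOpen Ω) (hF : ContDiffOn ℝ ∞ F Ω)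
    {x₀ : E} (hx₀ : x₀ ∈ Ω) :
    ∃ Ψ : E × ℝ → E, ∃ ε > 0, ∀ x ∈ Metric.ball x₀ ε, ∀ s ∈ Ioo (-ε) ε,
      ContDiffAt ℝ ∞ Ψ (x, s) ∧ Ψ (x, 0) = x ∧ Ψ (x, s) ∈ Ω ∧
        HasDerivAt (fun s => Ψ (x, s)) (F (Ψ (x, s))) s := by
  obtain ⟨ρ, hρ, hball⟩ := Metric.isOpen_iff.1 hΩ x₀ hx₀
  -- The field is cut off outside the ball of radius ρ/2; for small data orbits stay in the ball of
  -- radius ρ/4, where the cut-off is 1 and the field is the original one.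
  let χ : ContDiffBump x₀ := ⟨ρ / 4, ρ / 2, by positivity, by linarith⟩
  have hsub : tsupport χ ⊆ Ω := by
    rw [χ.tsupport_eq]
    exact (Metric.closedBall_subset_ball (by change ρ / 2 < ρ; linarith)).trans hball
  have hsm : ContDiff ℝ ∞ fun x => χ x • F x := by
    rw [contDiff_iff_contDiffAt]
    intro x
    by_cases hx : x ∈ tsupport χ
    · exact χ.contDiff.contDiffAt.smul (hF.contDiffAt (hΩ.mem_nhds (hsub hx)))
    · have : (fun x => χ x • F x) =ᶠ[𝓝 x] fun _ => 0 := by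
        filter_upwards [(isClosed_tsupport χ).isOpen_compl.mem_nhds hx] with y hy
        rw [image_eq_zero_of_notMem_tsupport hy, zero_smul]
      exact contDiffAt_const.congr_of_eventuallyEq this
  have hcs : HasCompactSupport fun x => χ x • F x := χ.hasCompactSupport.smul_right
  obtain ⟨Ψ, ε, hε, h⟩ := exists_local_flow_of_hasCompactSupport ⟨_, hsm.continuous⟩ hsm hcs x₀
  have hcont : ContinuousAt Ψ (x₀, 0) :=
    (h x₀ (Metric.mem_ball_self hε) 0 ⟨by linarith, hε⟩).1.continuousAt
  have hΨ0 : Ψ (x₀, 0) = x₀ := (h x₀ (Metric.mem_ball_self hε) 0 ⟨by linarith, hε⟩).2.1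
  have hev : ∀ᶠ p in 𝓝 (x₀, (0 : ℝ)), Ψ p ∈ Metric.ball x₀ (ρ / 4) :=
    hcont.eventually (by rw [hΨ0]; exact Metric.ball_mem_nhds _ (by positivity))
  obtain ⟨δ, hδ, hδb⟩ := Metric.eventually_nhds_iff_ball.1 hev
  refine ⟨Ψ, min ε δ, by positivity, fun x hx s hs => ?_⟩
  have h1 := h x (Metric.ball_subset_ball (min_le_left _ _) hx) s
    ⟨by linarith [hs.1, min_le_left ε δ], hs.2.trans_le (min_le_left _ _)⟩
  have h2 : Ψ (x, s) ∈ Metric.ball x₀ (ρ / 4) := by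
    refine hδb _ ?_
    rw [Metric.mem_ball, Prod.dist_eq, max_lt_iff]
    refine ⟨(Metric.mem_ball.1 hx).trans_le (min_le_right _ _), ?_⟩
    rw [Real.dist_eq, sub_zero, abs_lt]
    exact ⟨by linarith [hs.1, min_le_right ε δ], hs.2.trans_le (min_le_right _ _)⟩
  refine ⟨h1.1, h1.2.1, hball (Metric.ball_subset_ball (by linarith) h2), ?_⟩
  have h3 : χ (Ψ (x, s)) = 1 := χ.one_of_mem_closedBall (Metric.ball_subset_closedBall h2)
  have h4 := h1.2.2
  simp only [ContinuousMap.coe_mk] at h4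
  rwa [h3, one_smul] at h4

end flow

end SmoothFlow

/-! ### Christoffel forms and the affinity of homotheties -/

namespace LocalMetric

set_option maxSynthPendingDepth 3

section riemannian

variable {E : Type*} [NormedAddCommGroup E] [NormedSpace ℝ E] [FiniteDimensional ℝ E]

/-- `H` is a smooth field of positive definite symmetric bilinear forms on `Ω`. -/
structure IsRiemannianOn (H : E → E →L[ℝ] E →L[ℝ] ℝ) (Ω : Set E) : Prop where
  isOpen : IsOpen Ω
  smooth : ContDiffOn ℝ ∞ H Ω
  symm : ∀ y ∈ Ω, ∀ v w, H y v w = H y w v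
  pos : ∀ y ∈ Ω, ∀ v, v ≠ 0 → 0 < H y v v

/-- The trilinear form `∂ₐH(b, w) + ∂_bH(a, w) - ∂_wH(a, b)`. -/
def koszul (H : E → E →L[ℝ] E →L[ℝ] ℝ) (y : E) : E →L[ℝ] E →L[ℝ] E →L[ℝ] ℝ :=
  fderiv ℝ H y + (fderiv ℝ H y).flip
    - (ContinuousLinearMap.flipₗᵢ ℝ E E ℝ).toContinuousLinearEquiv.toContinuousLinearMap.comp
        (fderiv ℝ H y).flip

theorem koszul_apply (H : E → E →L[ℝ] E →L[ℝ] ℝ) (y a b w : E) :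
    koszul H y a b w = fderiv ℝ H y a b w + fderiv ℝ H y b a w - fderiv ℝ H y w a b := rfl

/-- The Christoffel form: `2 H(Γ(a, b), w) = koszul(a, b, w)`. -/
def gamma (H : E → E →L[ℝ] E →L[ℝ] ℝ) (y : E) : E →L[ℝ] E →L[ℝ] E :=
  (1 / 2 : ℝ) • (ContinuousLinearMap.compL ℝ E (E →L[ℝ] ℝ) E (H y).inverse).comp (koszul H y)

namespace IsRiemannianOn

variable {H : E → E →L[ℝ] E →L[ℝ] ℝ} {Ω : Set E}

theorem mono (hH : IsRiemannianOn H Ω) {Ω' : Set E} (h : Ω' ⊆ Ω) (ho : IsOpen Ω') :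
    IsRiemannianOn H Ω' :=
  ⟨ho, hH.smooth.mono h, fun y hy => hH.symm y (h hy), fun y hy => hH.pos y (h hy)⟩

theorem exists_equiv (hH : IsRiemannianOn H Ω) {y : E} (hy : y ∈ Ω) :
    ∃ e : E ≃L[ℝ] (E →L[ℝ] ℝ), (e : E →L[ℝ] E →L[ℝ] ℝ) = H y := by
  have hinj : Function.Injective (H y).toLinearMap := by
    rw [← LinearMap.ker_eq_bot, LinearMap.ker_eq_bot']
    intro v hv
    by_contra h
    have h1 := hH.pos y hy v h
    have h2 : H y v = 0 := hv
    rw [h2] at h1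
    simp at h1
  have hfin : Module.finrank ℝ E = Module.finrank ℝ (E →L[ℝ] ℝ) :=
    Subspace.dual_finrank_eq.symm.trans LinearMap.toContinuousLinearMap.finrank_eq
  exact ⟨(LinearEquiv.ofInjectiveOfFinrankEq _ hinj hfin).toContinuousLinearEquiv, by ext v : 1; rfl⟩

theorem gamma_spec (hH : IsRiemannianOn H Ω) {y : E} (hy : y ∈ Ω) (a b w : E) :
    2 * H y (gamma H y a b) w = koszul H y a b w := by
  obtain ⟨e, he⟩ := hH.exists_equiv hy
  have h1 : gamma H y a b = (1 / 2 : ℝ) • e.symm (koszul H y a b) := by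
    simp [gamma, ← he]
  rw [h1, ← he]
  simp

theorem contDiffOn_gamma (hH : IsRiemannianOn H Ω) : ContDiffOn ℝ ∞ (gamma H) Ω := by
  have h1 : ContDiffOn ℝ ∞ (fderiv ℝ H) Ω := hH.smooth.fderiv_of_isOpen hH.isOpen (by simp)
  have h2 : ContDiffOn ℝ ∞ (fun y => (fderiv ℝ H y).flip) Ω :=
    (ContinuousLinearMap.flipₗᵢ ℝ E E (E →L[ℝ] ℝ)).contDiff.comp_contDiffOn h1
  have h3 : ContDiffOn ℝ ∞ (koszul H) Ω :=
    (h1.add h2).sub (contDiffOn_const.clm_comp h2)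
  have h4 : ContDiffOn ℝ ∞ (fun y => (H y).inverse) Ω := by
    intro y hy
    obtain ⟨e, he⟩ := hH.exists_equiv hy
    have : ContDiffAt ℝ ∞ ContinuousLinearMap.inverse (H y) := by
      rw [← he]; exact contDiffAt_map_inverse e
    exact this.comp_contDiffWithinAt y (hH.smooth y hy)
  exact (((ContinuousLinearMap.compL ℝ E (E →L[ℝ] ℝ) E).contDiff.comp_contDiffOn h4).clm_comp
    h3).const_smul _

end IsRiemannianOn

section affine

variable {F : E → E} {H₁ H₂ : E → E →L[ℝ] E →L[ℝ] ℝ} {Ω₁ Ω₂ : Set E} {c : ℝ}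

/-- Koszul's trick: differentiate the homothety relation in three directions and combine the cyclic
permutations; by symmetry of the second derivative of F only D²F(a, b) survives. -/
theorem second_fderiv_koszul (h₁ : IsRiemannianOn H₁ Ω₁) (h₂ : IsRiemannianOn H₂ Ω₂) {y₀ : E}
    (hy₁ : y₀ ∈ Ω₁) (hy₂ : F y₀ ∈ Ω₂) (hF : ContDiffAt ℝ ∞ F y₀)
    (hc : ∀ᶠ y in 𝓝 y₀, ∀ v w, H₂ (F y) (fderiv ℝ F y v) (fderiv ℝ F y w) = c * H₁ y v w)
    (a b w : E) :
    2 * H₂ (F y₀) (fderiv ℝ (fderiv ℝ F) y₀ a b) (fderiv ℝ F y₀ w)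
      + koszul H₂ (F y₀) (fderiv ℝ F y₀ a) (fderiv ℝ F y₀ b) (fderiv ℝ F y₀ w)
      = c * koszul H₁ y₀ a b w := by
  have hFd : HasFDerivAt F (fderiv ℝ F y₀) y₀ := (hF.differentiableAt (by simp)).hasFDerivAt
  have hF2 : HasFDerivAt (fderiv ℝ F) (fderiv ℝ (fderiv ℝ F) y₀) y₀ :=
    ((hF.fderiv_right (m := ∞) (by simp)).differentiableAt (by simp)).hasFDerivAt
  have hH1 : HasFDerivAt H₁ (fderiv ℝ H₁ y₀) y₀ :=
    ((h₁.smooth.contDiffAt (h₁.isOpen.mem_nhds hy₁)).differentiableAt (by simp)).hasFDerivAt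
  have hH2 : HasFDerivAt H₂ (fderiv ℝ H₂ (F y₀)) (F y₀) :=
    ((h₂.smooth.contDiffAt (h₂.isOpen.mem_nhds hy₂)).differentiableAt (by simp)).hasFDerivAt
  have hsymm : ∀ a b, fderiv ℝ (fderiv ℝ F) y₀ a b = fderiv ℝ (fderiv ℝ F) y₀ b a :=
    hF.isSymmSndFDerivAt (by
      simpa using (by exact_mod_cast le_top : ((2 : ℕ∞) : WithTop ℕ∞) ≤ ((⊤ : ℕ∞) : WithTop ℕ∞)))
  have key : ∀ a v w, fderiv ℝ H₂ (F y₀) (fderiv ℝ F y₀ a) (fderiv ℝ F y₀ v) (fderiv ℝ F y₀ w)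
      + H₂ (F y₀) (fderiv ℝ (fderiv ℝ F) y₀ a v) (fderiv ℝ F y₀ w)
      + H₂ (F y₀) (fderiv ℝ F y₀ v) (fderiv ℝ (fderiv ℝ F) y₀ a w)
      = c * fderiv ℝ H₁ y₀ a v w := by
    intro a v w
    have e1 : HasFDerivAt (fun y => H₂ (F y) (fderiv ℝ F y v) (fderiv ℝ F y w)) _ y₀ :=
      ((hH2.comp y₀ hFd).clm_apply (hF2.clm_apply (hasFDerivAt_const v y₀))).clm_apply
        (hF2.clm_apply (hasFDerivAt_const w y₀))
    have e2 : HasFDerivAt (fun y => c * H₁ y v w) _ y₀ :=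
      ((hH1.clm_apply (hasFDerivAt_const v y₀)).clm_apply (hasFDerivAt_const w y₀)).const_mul c
    have e3 := (e1.congr_of_eventuallyEq (f₁ := fun y => c * H₁ y v w)
      (by filter_upwards [hc] with y hy using (hy v w).symm)).unique e2
    have e4 := congrArg (fun A : E →L[ℝ] ℝ => A a) e3
    simp at e4
    linarith
  have k1 := key a b w
  have k2 := key b a w
  have k3 := key w a b
  have s2 := h₂.symm (F y₀) hy₂
  rw [koszul_apply, koszul_apply, mul_sub, mul_add, ← k1, ← k2, ← k3, hsymm b a, hsymm w a,
    hsymm w b, s2 (fderiv ℝ (fderiv ℝ F) y₀ a w) (fderiv ℝ F y₀ b)]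
  ring

/-- A homothety maps one Levi-Civita connection to the other, because the constant c drops out of
the Christoffel form. Thus the second derivative is determined by the first. This gives both the
regularity of the linearization and the linearity of flat isometries. -/
theorem second_fderiv_gamma (h₁ : IsRiemannianOn H₁ Ω₁) (h₂ : IsRiemannianOn H₂ Ω₂) {y₀ : E}
    (hy₁ : y₀ ∈ Ω₁) (hy₂ : F y₀ ∈ Ω₂) (hF : ContDiffAt ℝ ∞ F y₀) (hc0 : 0 < c)
    (hc : ∀ᶠ y in 𝓝 y₀, ∀ v w, H₂ (F y) (fderiv ℝ F y v) (fderiv ℝ F y w) = c * H₁ y v w)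
    (a b : E) :
    fderiv ℝ (fderiv ℝ F) y₀ a b = fderiv ℝ F y₀ (gamma H₁ y₀ a b)
      - gamma H₂ (F y₀) (fderiv ℝ F y₀ a) (fderiv ℝ F y₀ b) := by
  have hinj : Function.Injective (fderiv ℝ F y₀).toLinearMap := by
    rw [← LinearMap.ker_eq_bot, LinearMap.ker_eq_bot']
    intro v hv
    by_contra h
    have h1 := h₁.pos y₀ hy₁ v h
    have h2 := hc.self_of_nhds v v
    have h3 : fderiv ℝ F y₀ v = 0 := hv
    rw [h3] at h2
    simp at h2
    rcases h2 with h2 | h2 <;> linarith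
  have hsurj : Function.Surjective (fderiv ℝ F y₀).toLinearMap :=
    LinearMap.surjective_of_injective hinj
  -- The difference X of the two sides is orthogonal to the image of the derivative of F, which is
  -- everything, hence to itself.
  by_contra hne
  set X := fderiv ℝ (fderiv ℝ F) y₀ a b - (fderiv ℝ F y₀ (gamma H₁ y₀ a b)
      - gamma H₂ (F y₀) (fderiv ℝ F y₀ a) (fderiv ℝ F y₀ b)) with hX
  have hX0 : X ≠ 0 := sub_ne_zero.2 hne
  obtain ⟨w, hw⟩ := hsurj X
  have hw' : fderiv ℝ F y₀ w = X := hw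
  have h1 := second_fderiv_koszul h₁ h₂ hy₁ hy₂ hF hc a b w
  rw [← h₁.gamma_spec hy₁, ← h₂.gamma_spec hy₂] at h1
  have h2 := hc.self_of_nhds (gamma H₁ y₀ a b) w
  have h3 : H₂ (F y₀) X (fderiv ℝ F y₀ w) = 0 := by
    simp only [hX, map_sub, ContinuousLinearMap.sub_apply]
    linarith
  rw [hw'] at h3
  exact (h₂.pos _ hy₂ X hX0).ne' h3

end affine

end riemannian

variable {E : Type*} [NormedAddCommGroup E] [InnerProductSpace ℝ E] [FiniteDimensional ℝ E]

/-- A homothety of a Riemannian metric on a ball, with a fixed point at the centre, together with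
the bounds used to linearize it. -/
structure IsContractingHomothety (H : E → E →L[ℝ] E →L[ℝ] ℝ) (T : E → E) (L : E ≃L[ℝ] E)
    (μ ν C r : ℝ) : Prop where
  r_pos : 0 < r
  μ_pos : 0 < μ
  μ_lt : μ < 1
  ν_nonneg : 0 ≤ ν
  ν_lt : ν < 1
  riem : IsRiemannianOn H (Metric.ball 0 r)
  smooth : ContDiffOn ℝ ∞ T (Metric.ball 0 r)
  map_zero : T 0 = 0
  norm_L : ∀ v, ‖L v‖ = μ * ‖v‖
  homothety : ∀ y ∈ Metric.ball (0 : E) r, ∀ v w,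
    H (T y) (fderiv ℝ T y v) (fderiv ℝ T y w) = μ ^ 2 * H y v w
  H_zero : ∀ v w, H 0 v w = inner ℝ v w
  contr : ∀ y ∈ Metric.ball (0 : E) r, ‖T y‖ ≤ ν * ‖y‖
  lip_H : ∀ y ∈ Metric.ball (0 : E) r, ‖H y - H 0‖ ≤ C * ‖y‖
  C_nonneg : 0 ≤ C
  C_small : C * r ≤ 1 / 2
  lip_T : ∀ y ∈ Metric.ball (0 : E) r,
    ‖(L.symm : E →L[ℝ] E).comp (fderiv ℝ T y) - ContinuousLinearMap.id ℝ E‖ ≤ C * ‖y‖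
  bound_gamma : ∃ B, ∀ y ∈ Metric.ball (0 : E) r, ‖gamma H y‖ ≤ B

namespace IsContractingHomothety

variable {H : E → E →L[ℝ] E →L[ℝ] ℝ} {T : E → E} {L : E ≃L[ℝ] E} {μ ν C r : ℝ}

/-- The `k`-th approximation `L⁻ᵏ Tᵏ` of the linearization. -/
def approx (T : E → E) (L : E ≃L[ℝ] E) (k : ℕ) (y : E) : E := ((L.symm : E →L[ℝ] E) ^ k) (T^[k] y)

variable (h : IsContractingHomothety H T L μ ν C r)
include h

end IsContractingHomothety

end LocalMetric

/-! ### Linearization of a contracting homothety -/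

namespace LocalMetric

set_option maxSynthPendingDepth 3

variable {E : Type*} [NormedAddCommGroup E] [InnerProductSpace ℝ E] [FiniteDimensional ℝ E]

namespace IsContractingHomothety

variable {H : E → E →L[ℝ] E →L[ℝ] ℝ} {T : E → E} {L : E ≃L[ℝ] E} {μ ν C r : ℝ}

variable (h : IsContractingHomothety H T L μ ν C r)
include h

theorem iterate_mem {y : E} (hy : y ∈ Metric.ball (0 : E) r) (k : ℕ) :
    T^[k] y ∈ Metric.ball (0 : E) r ∧ ‖T^[k] y‖ ≤ ν ^ k * ‖y‖ := by
  induction k with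
  | zero => simpa using hy
  | succ k ih =>
    rw [Function.iterate_succ_apply']
    have h1 := h.contr _ ih.1
    have h2 : ‖T (T^[k] y)‖ ≤ ‖T^[k] y‖ :=
      h1.trans (mul_le_of_le_one_left (norm_nonneg _) h.ν_lt.le)
    refine ⟨?_, ?_⟩
    · rw [mem_ball_zero_iff] at ih ⊢
      exact h2.trans_lt ih.1
    · calc ‖T (T^[k] y)‖ ≤ ν * (ν ^ k * ‖y‖) :=
            h1.trans (mul_le_mul_of_nonneg_left ih.2 h.ν_nonneg)
        _ = ν ^ (k + 1) * ‖y‖ := by ring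

theorem contDiffOn_iterate (k : ℕ) : ContDiffOn ℝ ∞ T^[k] (Metric.ball 0 r) := by
  induction k with
  | zero => exact contDiffOn_id
  | succ k ih =>
    rw [Function.iterate_succ']
    exact h.smooth.comp ih fun y hy => (h.iterate_mem hy k).1

theorem differentiableAt_iterate {y : E} (hy : y ∈ Metric.ball (0 : E) r) (k : ℕ) :
    DifferentiableAt ℝ T^[k] y :=
  ((h.contDiffOn_iterate k).contDiffAt (Metric.isOpen_ball.mem_nhds hy)).differentiableAt (by simp)

theorem fderiv_iterate_succ {y : E} (hy : y ∈ Metric.ball (0 : E) r) (k : ℕ) :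
    fderiv ℝ T^[k + 1] y = (fderiv ℝ T (T^[k] y)).comp (fderiv ℝ T^[k] y) := by
  rw [Function.iterate_succ']
  exact fderiv_comp y (h.differentiableAt_iterate (h.iterate_mem hy k).1 1)
    (h.differentiableAt_iterate hy k)

theorem homothety_iterate {y : E} (hy : y ∈ Metric.ball (0 : E) r) (k : ℕ) (v w : E) :
    H (T^[k] y) (fderiv ℝ T^[k] y v) (fderiv ℝ T^[k] y w) = (μ ^ 2) ^ k * H y v w := by
  induction k with
  | zero => simp
  | succ k ih =>
    rw [h.fderiv_iterate_succ hy, Function.iterate_succ_apply', ContinuousLinearMap.comp_apply,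
      ContinuousLinearMap.comp_apply, h.homothety _ (h.iterate_mem hy k).1, ih]
    ring

theorem abs_sub_inner_le {y : E} (hy : y ∈ Metric.ball (0 : E) r) (v w : E) :
    |H y v w - inner ℝ v w| ≤ C * ‖y‖ * ‖v‖ * ‖w‖ := by
  have h1 := (H y - H 0).le_opNorm₂ v w
  rw [ContinuousLinearMap.sub_apply, ContinuousLinearMap.sub_apply, h.H_zero] at h1
  refine h1.trans ?_
  gcongr
  exact h.lip_H y hy

theorem bounds {y : E} (hy : y ∈ Metric.ball (0 : E) r) (v : E) :
    ‖v‖ ^ 2 ≤ 2 * H y v v ∧ H y v v ≤ 2 * ‖v‖ ^ 2 := by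
  have h1 := h.abs_sub_inner_le hy v v
  rw [real_inner_self_eq_norm_sq] at h1
  have h2 : C * ‖y‖ ≤ 1 / 2 :=
    (mul_le_mul_of_nonneg_left (mem_ball_zero_iff.1 hy).le h.C_nonneg).trans h.C_small
  have h3 : C * ‖y‖ * ‖v‖ * ‖v‖ ≤ 1 / 2 * ‖v‖ ^ 2 := by nlinarith [sq_nonneg ‖v‖]
  have h4 := abs_le.1 (h1.trans h3)
  constructor <;> nlinarith [sq_nonneg ‖v‖]

/-- Every iterate scales H by exactly μ²ᵏ, and H is comparable with the Euclidean product up to a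
factor 2. So the constant is paid once, not at each step as the chain rule would suggest. -/
theorem norm_fderiv_iterate_le {y : E} (hy : y ∈ Metric.ball (0 : E) r) (k : ℕ) :
    ‖fderiv ℝ T^[k] y‖ ≤ 2 * μ ^ k := by
  have hμ := h.μ_pos
  refine ContinuousLinearMap.opNorm_le_bound _ (by positivity) fun v => ?_
  have h1 := (h.bounds (h.iterate_mem hy k).1 (fderiv ℝ T^[k] y v)).1
  rw [h.homothety_iterate hy] at h1
  have h2 := (h.bounds hy v).2
  refine abs_le_of_sq_le_sq' ?_ (by positivity) |>.2
  calc _ ≤ _ := h1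
    _ ≤ 2 * ((μ ^ 2) ^ k * (2 * ‖v‖ ^ 2)) := by gcongr
    _ = _ := by ring

theorem norm_pow_symm (k : ℕ) (v : E) : μ ^ k * ‖((L.symm : E →L[ℝ] E) ^ k) v‖ = ‖v‖ := by
  induction k generalizing v with
  | zero => simp
  | succ k ih =>
    rw [pow_succ (L.symm : E →L[ℝ] E), ContinuousLinearMap.mul_apply, pow_succ, mul_comm (μ ^ k), mul_assoc, ih]
    rw [ContinuousLinearEquiv.coe_coe, ← h.norm_L, L.apply_symm_apply]

theorem norm_pow_symm' (k : ℕ) (v : E) : ‖((L.symm : E →L[ℝ] E) ^ k) v‖ = (μ ^ k)⁻¹ * ‖v‖ := by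
  rw [← h.norm_pow_symm k v, inv_mul_cancel_left₀ (pow_pos h.μ_pos k).ne']

theorem inner_pow_symm (k : ℕ) (v w : E) :
    inner ℝ (((L.symm : E →L[ℝ] E) ^ k) v) (((L.symm : E →L[ℝ] E) ^ k) w)
      = ((μ ^ 2) ^ k)⁻¹ * inner ℝ v w := by
  have hμ := (pow_pos h.μ_pos k).ne'
  rw [real_inner_eq_norm_add_mul_self_sub_norm_mul_self_sub_norm_mul_self_div_two,
    real_inner_eq_norm_add_mul_self_sub_norm_mul_self_sub_norm_mul_self_div_two, ← map_add,
    h.norm_pow_symm', h.norm_pow_symm', h.norm_pow_symm', ← pow_mul, mul_comm 2 k, pow_mul]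
  field_simp

theorem hasFDerivAt_approx {y : E} (hy : y ∈ Metric.ball (0 : E) r) (k : ℕ) :
    HasFDerivAt (approx T L k) (((L.symm : E →L[ℝ] E) ^ k).comp (fderiv ℝ T^[k] y)) y :=
  ((L.symm : E →L[ℝ] E) ^ k).hasFDerivAt.comp y (h.differentiableAt_iterate hy k).hasFDerivAt

theorem fderiv_approx {y : E} (hy : y ∈ Metric.ball (0 : E) r) (k : ℕ) :
    fderiv ℝ (approx T L k) y = ((L.symm : E →L[ℝ] E) ^ k).comp (fderiv ℝ T^[k] y) :=
  (h.hasFDerivAt_approx hy k).fderiv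

/-- The difference is L⁻ᵏ (L⁻¹ DT(Tᵏy) - id) DTᵏ. The outer factors have norms μ⁻ᵏ and at most 2μᵏ,
which cancel, and the middle one is at most C‖Tᵏy‖ ≤ C νᵏ r. -/
theorem norm_fderiv_approx_sub_le {y : E} (hy : y ∈ Metric.ball (0 : E) r) (k : ℕ) :
    ‖fderiv ℝ (approx T L (k + 1)) y - fderiv ℝ (approx T L k) y‖ ≤ 2 * C * r * ν ^ k := by
  have hμ := h.μ_pos
  have hC := h.C_nonneg
  have hr := h.r_pos
  have hν := h.ν_nonneg
  rw [h.fderiv_approx hy, h.fderiv_approx hy, h.fderiv_iterate_succ hy]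
  refine ContinuousLinearMap.opNorm_le_bound _ (by positivity) fun v => ?_
  set D := fderiv ℝ T^[k] y v with hD
  have h1 : ((((L.symm : E →L[ℝ] E) ^ (k + 1)).comp
      ((fderiv ℝ T (T^[k] y)).comp (fderiv ℝ T^[k] y))) - ((L.symm : E →L[ℝ] E) ^ k).comp
        (fderiv ℝ T^[k] y)) v
      = ((L.symm : E →L[ℝ] E) ^ k) (((L.symm : E →L[ℝ] E).comp (fderiv ℝ T (T^[k] y))
        - ContinuousLinearMap.id ℝ E) D) := by
    rw [pow_succ]; simp [hD]
  rw [h1, h.norm_pow_symm']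
  have h2 : ‖((L.symm : E →L[ℝ] E).comp (fderiv ℝ T (T^[k] y)) - ContinuousLinearMap.id ℝ E) D‖
      ≤ (C * (ν ^ k * r)) * ((2 * μ ^ k) * ‖v‖) := by
    refine (ContinuousLinearMap.le_opNorm _ _).trans (mul_le_mul ?_ ?_ (norm_nonneg _)
      (by positivity))
    · refine (h.lip_T _ (h.iterate_mem hy k).1).trans (mul_le_mul_of_nonneg_left ?_ hC)
      exact (h.iterate_mem hy k).2.trans (mul_le_mul_of_nonneg_left (mem_ball_zero_iff.1 hy).le
        (by positivity))
    · exact (ContinuousLinearMap.le_opNorm _ _).trans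
        (mul_le_mul_of_nonneg_right (h.norm_fderiv_iterate_le hy k) (norm_nonneg _))
  calc _ ≤ (μ ^ k)⁻¹ * ((C * (ν ^ k * r)) * ((2 * μ ^ k) * ‖v‖)) := by gcongr
    _ = 2 * C * r * ν ^ k * ‖v‖ := by field_simp

theorem summable_bound : Summable fun k : ℕ => 2 * C * r * ν ^ k :=
  (summable_geometric_of_lt_one h.ν_nonneg h.ν_lt).mul_left _

omit h in
/-- The linearization of a contracting homothety. -/
def _root_.LocalMetric.linearization (T : E → E) (L : E ≃L[ℝ] E) (y : E) : E :=
  approx T L 0 y + ∑' k, (approx T L (k + 1) y - approx T L k y)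

omit h in
/-- The derivative of the linearization of a contracting homothety. -/
def _root_.LocalMetric.linearizationDeriv (T : E → E) (L : E ≃L[ℝ] E) (y : E) : E →L[ℝ] E :=
  fderiv ℝ (approx T L 0) y
    + ∑' k, (fderiv ℝ (approx T L (k + 1)) y - fderiv ℝ (approx T L k) y)

theorem approx_zero_right (k : ℕ) : approx T L k 0 = 0 := by
  have : T^[k] 0 = 0 := Function.iterate_fixed h.map_zero k
  simp [approx, this]

theorem summable_approx_zero : Summable fun k => approx T L (k + 1) 0 - approx T L k 0 := by
  simp_rw [h.approx_zero_right, sub_zero]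
  exact summable_zero

theorem hasFDerivAt_linearization {y : E} (hy : y ∈ Metric.ball (0 : E) r) :
    HasFDerivAt (linearization T L) (linearizationDeriv T L y) y := by
  have hd := fun k y (hy : y ∈ Metric.ball (0 : E) r) => (h.hasFDerivAt_approx hy k).differentiableAt.hasFDerivAt
  refine (hd 0 y hy).add ?_
  exact hasFDerivAt_tsum_of_isPreconnected (f := fun k y => approx T L (k + 1) y - approx T L k y)
    h.summable_bound Metric.isOpen_ball
    (convex_ball (0 : E) r).isPreconnected (fun k y hy => (hd (k + 1) y hy).sub (hd k y hy))
    (fun k y hy => h.norm_fderiv_approx_sub_le hy k) (Metric.mem_ball_self h.r_pos)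
    h.summable_approx_zero hy

theorem tendsto_approx {y : E} (hy : y ∈ Metric.ball (0 : E) r) :
    Tendsto (fun k => approx T L k y) atTop (𝓝 (linearization T L y)) := by
  have hd := fun k y (hy : y ∈ Metric.ball (0 : E) r) => (h.hasFDerivAt_approx hy k).differentiableAt.hasFDerivAt
  have hs : Summable fun k => approx T L (k + 1) y - approx T L k y :=
    summable_of_summable_hasFDerivAt_of_isPreconnected
      (f := fun k y => approx T L (k + 1) y - approx T L k y) h.summable_bound Metric.isOpen_ball
      (convex_ball (0 : E) r).isPreconnected (fun k y hy => (hd (k + 1) y hy).sub (hd k y hy))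
      (fun k y hy => h.norm_fderiv_approx_sub_le hy k) (Metric.mem_ball_self h.r_pos)
      h.summable_approx_zero hy
  have h1 := hs.hasSum.tendsto_sum_nat.const_add (approx T L 0 y)
  refine h1.congr fun k => ?_
  rw [Finset.sum_range_sub (fun k => approx T L k y)]
  abel

theorem tendstoUniformlyOn_fderiv_approx :
    TendstoUniformlyOn (fun k y => fderiv ℝ (approx T L k) y) (linearizationDeriv T L) atTop
      (Metric.ball 0 r) := by
  have h1 := tendstoUniformlyOn_tsum_nat h.summable_bound
    (f := fun k y => fderiv ℝ (approx T L (k + 1)) y - fderiv ℝ (approx T L k) y)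
    (s := Metric.ball 0 r) fun k y hy => h.norm_fderiv_approx_sub_le hy k
  rw [Metric.tendstoUniformlyOn_iff] at h1 ⊢
  intro ε hε
  filter_upwards [h1 ε hε] with k hk y hy
  have := hk y hy
  rw [Finset.sum_range_sub (fun k => fderiv ℝ (approx T L k) y)] at this
  rw [linearizationDeriv]
  rw [dist_eq_norm] at this ⊢
  convert this using 2
  abel

/-- The Euclidean product of the approximate derivatives is μ⁻²ᵏ times that of the vectors DTᵏv,
DTᵏw. With H at Tᵏy in place of the Euclidean product one would get H y v w exactly; the error is
O(νᵏ) because Tᵏy tends to 0, where H is Euclidean. The limit is therefore an isometry to flat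
space. -/
theorem inner_linearizationDeriv {y : E} (hy : y ∈ Metric.ball (0 : E) r) (v w : E) :
    inner ℝ (linearizationDeriv T L y v) (linearizationDeriv T L y w) = H y v w := by
  have hμ := h.μ_pos
  have h1 := h.tendstoUniformlyOn_fderiv_approx.tendsto_at hy
  have happ : ∀ v, Tendsto (fun k => fderiv ℝ (approx T L k) y v) atTop
      (𝓝 (linearizationDeriv T L y v)) := fun v =>
    ((ContinuousLinearMap.apply ℝ E v).continuous.tendsto _).comp h1
  refine tendsto_nhds_unique ((happ v).inner (happ w)) ?_
  rw [tendsto_iff_norm_sub_tendsto_zero]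
  have h2 : Tendsto (fun k : ℕ => 4 * C * r * ‖v‖ * ‖w‖ * ν ^ k) atTop (𝓝 0) := by
    simpa using (tendsto_pow_atTop_nhds_zero_of_lt_one h.ν_nonneg h.ν_lt).const_mul
      (4 * C * r * ‖v‖ * ‖w‖)
  refine squeeze_zero (fun _ => norm_nonneg _) (fun k => ?_) h2
  have hmem := h.iterate_mem hy k
  have h3 := h.abs_sub_inner_le hmem.1 (fderiv ℝ T^[k] y v) (fderiv ℝ T^[k] y w)
  rw [h.homothety_iterate hy] at h3
  rw [h.fderiv_approx hy, ContinuousLinearMap.comp_apply, ContinuousLinearMap.comp_apply,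
    h.inner_pow_symm, Real.norm_eq_abs]
  have hp : 0 < (μ ^ 2) ^ k := by positivity
  have h4 : ((μ ^ 2) ^ k)⁻¹ * inner ℝ (fderiv ℝ T^[k] y v) (fderiv ℝ T^[k] y w) - H y v w
      = -(((μ ^ 2) ^ k)⁻¹ * ((μ ^ 2) ^ k * H y v w
        - inner ℝ (fderiv ℝ T^[k] y v) (fderiv ℝ T^[k] y w))) := by
    field_simp; ring
  rw [h4, abs_neg, abs_mul, abs_of_pos (inv_pos.2 hp)]
  have hn : ∀ v, ‖fderiv ℝ T^[k] y v‖ ≤ 2 * μ ^ k * ‖v‖ := fun v =>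
    (ContinuousLinearMap.le_opNorm _ _).trans
        (mul_le_mul_of_nonneg_right (h.norm_fderiv_iterate_le hy k) (norm_nonneg _))
  have hC := h.C_nonneg
  have hr := h.r_pos
  have hν := h.ν_nonneg
  have h5 : ‖T^[k] y‖ ≤ ν ^ k * r :=
    hmem.2.trans (mul_le_mul_of_nonneg_left (mem_ball_zero_iff.1 hy).le (by positivity))
  calc _ ≤ ((μ ^ 2) ^ k)⁻¹ * (C * (ν ^ k * r) * (2 * μ ^ k * ‖v‖) * (2 * μ ^ k * ‖w‖)) := by
        refine mul_le_mul_of_nonneg_left (h3.trans ?_) (by positivity)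
        gcongr
        exacts [hn v, hn w]
    _ = 4 * C * r * ‖v‖ * ‖w‖ * ν ^ k := by
        rw [← pow_mul, mul_comm 2 k, pow_mul]; field_simp; ring

/-- By `second_fderiv_gamma` the second derivative of the k-th approximation is its first derivative
composed with Γ, minus L⁻ᵏ Γ(DTᵏ, DTᵏ). The latter is O(μ⁻ᵏ μ²ᵏ) = O(μᵏ), so second derivatives
converge uniformly too. -/
theorem hasFDerivAt_linearizationDeriv {y : E} (hy : y ∈ Metric.ball (0 : E) r) :
    HasFDerivAt (linearizationDeriv T L)
      ((ContinuousLinearMap.compL ℝ E E E (linearizationDeriv T L y)).comp (gamma H y)) y := by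
  have hμ := h.μ_pos
  obtain ⟨B, hB⟩ := h.bound_gamma
  have hB0 : 0 ≤ B := (norm_nonneg _).trans (hB 0 (Metric.mem_ball_self h.r_pos))
  have h1 := h.tendstoUniformlyOn_fderiv_approx
  have hsm : ∀ k, ∀ y ∈ Metric.ball (0 : E) r, HasFDerivAt (fun y => fderiv ℝ (approx T L k) y)
      (fderiv ℝ (fderiv ℝ (approx T L k)) y) y := fun k y hy => by
    have : ContDiffAt ℝ ∞ (approx T L k) y := ((L.symm : E →L[ℝ] E) ^ k).contDiff.contDiffAt.comp y
      ((h.contDiffOn_iterate k).contDiffAt (Metric.isOpen_ball.mem_nhds hy))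
    exact ((this.fderiv_right (m := ∞) (by simp)).differentiableAt (by simp)).hasFDerivAt
  refine hasFDerivAt_of_tendstoUniformlyOn Metric.isOpen_ball
    (f' := fun k y => fderiv ℝ (fderiv ℝ (approx T L k)) y)
    (g' := fun y => (ContinuousLinearMap.compL ℝ E E E (linearizationDeriv T L y)).comp (gamma H y))
    ?_ hsm (fun y hy => h1.tendsto_at hy) hy
  rw [Metric.tendstoUniformlyOn_iff] at h1 ⊢
  intro ε hε
  have hlim : Tendsto (fun k : ℕ => 4 * B * μ ^ k) atTop (𝓝 0) := by
    simpa using (tendsto_pow_atTop_nhds_zero_of_lt_one hμ.le h.μ_lt).const_mul (4 * B)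
  filter_upwards [h1 (ε / (2 * (B + 1))) (by positivity), hlim.eventually_lt_const (half_pos hε)]
    with k hk hk2 z hz
  have hk1 := hk z hz
  rw [dist_eq_norm] at hk1 ⊢
  have hn : ∀ v, ‖fderiv ℝ T^[k] z v‖ ≤ 2 * μ ^ k * ‖v‖ := fun v =>
    (ContinuousLinearMap.le_opNorm _ _).trans
        (mul_le_mul_of_nonneg_right (h.norm_fderiv_iterate_le hz k) (norm_nonneg _))
  have hsecond : ∀ a b, fderiv ℝ (fderiv ℝ (approx T L k)) z a b
      = fderiv ℝ (approx T L k) z (gamma H z a b) - ((L.symm : E →L[ℝ] E) ^ k)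
        (gamma H (T^[k] z) (fderiv ℝ T^[k] z a) (fderiv ℝ T^[k] z b)) := fun a b => by
    have hev : fderiv ℝ (approx T L k) =ᶠ[𝓝 z] fun y =>
        ((L.symm : E →L[ℝ] E) ^ k).comp (fderiv ℝ T^[k] y) := by
      filter_upwards [Metric.isOpen_ball.mem_nhds hz] with y hy using h.fderiv_approx hy k
    have hca := ((h.contDiffOn_iterate k).contDiffAt (Metric.isOpen_ball.mem_nhds hz))
    have hd : HasFDerivAt (fderiv ℝ T^[k]) (fderiv ℝ (fderiv ℝ T^[k]) z) z :=
      ((hca.fderiv_right (m := ∞) (by simp)).differentiableAt (by simp)).hasFDerivAt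
    have hd2 := (hasFDerivAt_const ((L.symm : E →L[ℝ] E) ^ k) z).clm_comp hd
    have h2 := second_fderiv_gamma h.riem h.riem (c := (μ ^ 2) ^ k) hz (h.iterate_mem hz k).1
      hca (by positivity)
      (by filter_upwards [Metric.isOpen_ball.mem_nhds hz] with y hy using h.homothety_iterate hy k) a b
    rw [hev.fderiv_eq, hd2.fderiv, h.fderiv_approx hz]
    simp [h2]
  refine lt_of_le_of_lt (ContinuousLinearMap.opNorm_le_bound₂ _ (C := ε / (2 * (B + 1)) * B
    + 4 * B * μ ^ k) (by positivity) fun a b => ?_) ?_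
  · have h3 : (((ContinuousLinearMap.compL ℝ E E E (linearizationDeriv T L z)).comp (gamma H z))
        - fderiv ℝ (fderiv ℝ (approx T L k)) z) a b
        = (linearizationDeriv T L z - fderiv ℝ (approx T L k) z) (gamma H z a b)
          + ((L.symm : E →L[ℝ] E) ^ k)
            (gamma H (T^[k] z) (fderiv ℝ T^[k] z a) (fderiv ℝ T^[k] z b)) := by
      simp [hsecond]
      abel
    rw [h3]
    have e1 : ‖(linearizationDeriv T L z - fderiv ℝ (approx T L k) z) (gamma H z a b)‖
        ≤ ε / (2 * (B + 1)) * (B * ‖a‖ * ‖b‖) := by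
      refine (ContinuousLinearMap.le_opNorm _ _).trans (mul_le_mul hk1.le ?_ (norm_nonneg _)
        (by positivity))
      refine ((gamma H z).le_opNorm₂ a b).trans ?_
      gcongr
      exact hB z hz
    have e2 : ‖((L.symm : E →L[ℝ] E) ^ k)
        (gamma H (T^[k] z) (fderiv ℝ T^[k] z a) (fderiv ℝ T^[k] z b))‖
        ≤ (μ ^ k)⁻¹ * (B * (2 * μ ^ k * ‖a‖) * (2 * μ ^ k * ‖b‖)) := by
      rw [h.norm_pow_symm']
      refine mul_le_mul_of_nonneg_left ?_ (by positivity)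
      refine ((gamma H _).le_opNorm₂ _ _).trans ?_
      gcongr
      exacts [hB _ (h.iterate_mem hz k).1, hn a, hn b]
    calc _ ≤ _ := (norm_add_le _ _).trans (add_le_add e1 e2)
      _ = _ := by field_simp; ring
  · have : ε / (2 * (B + 1)) * B ≤ ε / 2 := by
      rw [div_mul_eq_mul_div, div_le_div_iff₀ (by positivity) (by positivity)]
      nlinarith
    linarith

/-- Bootstrapping: the derivative of the field is the field itself composed with the smooth form Γ,
so each order of regularity yields the next. -/
theorem contDiffOn_linearizationDeriv :
    ContDiffOn ℝ ∞ (linearizationDeriv T L) (Metric.ball 0 r) := by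
  rw [contDiffOn_infty]
  intro k
  induction k with
  | zero =>
    exact contDiffOn_zero.2 fun y hy =>
      (h.hasFDerivAt_linearizationDeriv hy).continuousAt.continuousWithinAt
  | succ k ih =>
    push_cast
    rw [contDiffOn_succ_iff_hasFDerivWithinAt_of_uniqueDiffOn Metric.isOpen_ball.uniqueDiffOn]
    refine ⟨by simp, _, ?_, fun y hy => (h.hasFDerivAt_linearizationDeriv hy).hasFDerivWithinAt⟩
    exact ((ContinuousLinearMap.compL ℝ E E E).contDiff.comp_contDiffOn ih).clm_comp
      (h.riem.contDiffOn_gamma.of_le (by exact_mod_cast le_top))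

theorem contDiffOn_linearization : ContDiffOn ℝ ∞ (linearization T L) (Metric.ball 0 r) := by
  rw [contDiffOn_infty_iff_fderiv_of_isOpen Metric.isOpen_ball]
  refine ⟨fun y hy => (h.hasFDerivAt_linearization hy).differentiableAt.differentiableWithinAt, ?_⟩
  exact h.contDiffOn_linearizationDeriv.congr fun y hy => (h.hasFDerivAt_linearization hy).fderiv

theorem linearization_zero : linearization T L 0 = 0 := by
  simp [linearization, h.approx_zero_right]

theorem linearization_map {y : E} (hy : y ∈ Metric.ball (0 : E) r) :
    linearization T L (T y) = L (linearization T L y) := by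
  have h1 := h.tendsto_approx (h.iterate_mem hy 1).1
  have h2 := (L.continuous.tendsto _).comp ((tendsto_add_atTop_iff_nat 1).2 (h.tendsto_approx hy))
  refine tendsto_nhds_unique h1 (h2.congr fun k => ?_)
  simp only [Function.comp, approx, Function.iterate_one, ← Function.iterate_succ_apply]
  rw [pow_succ']
  simp

/-- The linearization has injective derivative since H is positive definite, so it is a local
diffeomorphism. Taking a ball as its target makes the domain invariant under T, for L maps the ball
into itself. -/
theorem exists_linearizing_chart :
    ∃ (e : OpenPartialHomeomorph E E) (ρ : ℝ), 0 < ρ ∧ (0 : E) ∈ e.source ∧ e 0 = 0 ∧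
      e.source ⊆ Metric.ball 0 r ∧ e.target = Metric.ball 0 ρ ∧
      ContDiffOn ℝ ∞ e e.source ∧ ContDiffOn ℝ ∞ e.symm e.target ∧
      (∀ y ∈ e.source, T y ∈ e.source ∧ e (T y) = L (e y)) ∧
      ∀ y ∈ e.source, ∀ v w, inner ℝ (fderiv ℝ e y v) (fderiv ℝ e y w) = H y v w := by
  set A := linearization T L with hA
  have h0 : (0 : E) ∈ Metric.ball (0 : E) r := Metric.mem_ball_self h.r_pos
  have hequiv : ∀ y ∈ Metric.ball (0 : E) r, ∃ f : E ≃L[ℝ] E,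
      HasFDerivAt A (f : E →L[ℝ] E) y := fun y hy => by
    have hinj : Function.Injective (linearizationDeriv T L y).toLinearMap := by
      rw [← LinearMap.ker_eq_bot, LinearMap.ker_eq_bot']
      intro v hv
      by_contra hne
      have h1 := h.riem.pos y hy v hne
      rw [← h.inner_linearizationDeriv hy, show linearizationDeriv T L y v = 0 from hv] at h1
      simp at h1
    exact ⟨(LinearEquiv.ofInjectiveEndo _ hinj).toContinuousLinearEquiv,
      (h.hasFDerivAt_linearization hy).congr_fderiv (by ext; rfl)⟩
  have hsm : ∀ y ∈ Metric.ball (0 : E) r, ContDiffAt ℝ ∞ A y := fun y hy =>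
    h.contDiffOn_linearization.contDiffAt (Metric.isOpen_ball.mem_nhds hy)
  obtain ⟨f, hf⟩ := hequiv 0 h0
  set e₀ := (hsm 0 h0).toOpenPartialHomeomorph A hf (by simp) with he₀
  have hcoe : ⇑e₀ = A := rfl
  have h0s : (0 : E) ∈ e₀.source := ContDiffAt.mem_toOpenPartialHomeomorph_source _ hf (by simp)
  have hA0 : A 0 = 0 := h.linearization_zero
  have h0t : (0 : E) ∈ e₀.target := by
    have := e₀.map_source h0s; rwa [hcoe, hA0] at this
  have hs0 : e₀.symm 0 = 0 := by
    have := e₀.left_inv h0s; rwa [hcoe, hA0] at this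
  have hTc : ContinuousAt T 0 := (h.differentiableAt_iterate h0 1).continuousAt
  -- T y must lie in the region where the linearization is known to be injective before invariance
  -- of the smaller domain makes sense.
  have hW : {y | y ∈ e₀.source ∧ y ∈ Metric.ball (0 : E) r ∧ T y ∈ e₀.source} ∈ 𝓝 (0 : E) := by
    filter_upwards [e₀.open_source.mem_nhds h0s, Metric.isOpen_ball.mem_nhds h0,
      hTc.preimage_mem_nhds (e₀.open_source.mem_nhds (by rwa [h.map_zero]))] with y h1 h2 h3
    exact ⟨h1, h2, h3⟩
  have hev : ∀ᶠ x in 𝓝 (0 : E), x ∈ e₀.target ∧ e₀.symm x ∈ Metric.ball (0 : E) r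
      ∧ T (e₀.symm x) ∈ e₀.source := by
    have hc : ContinuousAt e₀.symm 0 := e₀.continuousAt_symm h0t
    filter_upwards [e₀.open_target.mem_nhds h0t, hc.preimage_mem_nhds (by rwa [hs0])] with x h1 h2
    exact ⟨h1, h2.2⟩
  obtain ⟨ρ, hρ, hball⟩ := Metric.eventually_nhds_iff_ball.1 hev
  set e := e₀.symm.restrOpen (Metric.ball 0 ρ) Metric.isOpen_ball |>.symm with he
  have hes : ∀ y, y ∈ e.source ↔ y ∈ e₀.source ∧ A y ∈ Metric.ball (0 : E) ρ := fun y => by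
    simp [he, hcoe]
  have het : e.target = Metric.ball 0 ρ := by
    ext x
    simp only [he, OpenPartialHomeomorph.symm_target, OpenPartialHomeomorph.restrOpen_source,
      OpenPartialHomeomorph.symm_source, mem_inter_iff]
    exact ⟨fun hx => hx.2, fun hx => ⟨(hball x hx).1, hx⟩⟩
  have hecoe : ∀ y, e y = A y := fun y => by simp [he, hcoe]
  have hecoe' : ⇑e = A := funext hecoe
  have hesymm : ∀ x, e.symm x = e₀.symm x := fun x => by simp [he]
  have hsub : ∀ y ∈ e.source, y ∈ Metric.ball (0 : E) r ∧ T y ∈ e₀.source := fun y hy => by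
    obtain ⟨h1, h2⟩ := (hes y).1 hy
    have := (hball _ h2).2
    rwa [← hcoe, e₀.left_inv h1] at this
  refine ⟨e, ρ, hρ, (hes 0).2 ⟨h0s, by rw [hA0]; exact Metric.mem_ball_self hρ⟩,
    by rw [hecoe, hA0], fun y hy => (hsub y hy).1, het, ?_, ?_, ?_, ?_⟩
  · rw [hecoe']; exact h.contDiffOn_linearization.mono fun y hy => (hsub y hy).1
  · intro x hx
    rw [het] at hx
    have hx' := hball x hx
    obtain ⟨f, hf⟩ := hequiv _ hx'.2.1
    have h1 : ContDiffAt ℝ ∞ e₀.symm x :=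
      e₀.contDiffAt_symm hx'.1 (by rwa [hcoe]) (by rw [hcoe]; exact hsm _ hx'.2.1)
    exact (h1.congr_of_eventuallyEq (Eventually.of_forall hesymm)).contDiffWithinAt
  · intro y hy
    have h1 := hsub y hy
    have h2 : A (T y) = L (A y) := h.linearization_map h1.1
    refine ⟨(hes _).2 ⟨h1.2, ?_⟩, by rw [hecoe, hecoe, h2]⟩
    have h3 := ((hes y).1 hy).2
    rw [h2, mem_ball_zero_iff, h.norm_L]
    rw [mem_ball_zero_iff] at h3
    exact (mul_le_of_le_one_left (norm_nonneg _) h.μ_lt.le).trans_lt h3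
  · intro y hy v w
    rw [hecoe', (h.hasFDerivAt_linearization (hsub y hy).1).fderiv]
    exact h.inner_linearizationDeriv (hsub y hy).1 v w

end IsContractingHomothety

end LocalMetric

/-! ### Riemannian metrics on manifolds, read in charts -/

namespace SmoothMetric
set_option maxSynthPendingDepth 3
variable {n : ℕ} {M : Type*} [TopologicalSpace M]
  [ChartedSpace (EuclideanSpace ℝ (Fin n)) M]

/-- The derivative of a coordinate parametrization, with values in the model space. -/
def frame (c : OpenPartialHomeomorph M (EuclideanSpace ℝ (Fin n)))
    (y : EuclideanSpace ℝ (Fin n)) :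
    EuclideanSpace ℝ (Fin n) →L[ℝ] EuclideanSpace ℝ (Fin n) :=
  mfderiv (𝓡 n) (𝓡 n) c.symm y

/-- The derivative of a chart, as an endomorphism of the model space. -/
def coframe (c : OpenPartialHomeomorph M (EuclideanSpace ℝ (Fin n)))
    (x : M) : EuclideanSpace ℝ (Fin n) →L[ℝ] EuclideanSpace ℝ (Fin n) :=
  mfderiv (𝓡 n) (𝓡 n) c x

variable [IsManifold (𝓡 n) ∞ M]

/-- The metric at `x` as a bilinear form on the model space. -/
def form (g : SmoothMetric n M) (x : M) :
    EuclideanSpace ℝ (Fin n) →L[ℝ] EuclideanSpace ℝ (Fin n) →L[ℝ] ℝ := g.inner x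

/-- The coordinate expression of the metric, as a field of bilinear forms. -/
def chartForm (g : SmoothMetric n M) (c : OpenPartialHomeomorph M (EuclideanSpace ℝ (Fin n)))
    (y : EuclideanSpace ℝ (Fin n)) :
    EuclideanSpace ℝ (Fin n) →L[ℝ] EuclideanSpace ℝ (Fin n) →L[ℝ] ℝ :=
  (g.form (c.symm y)).bilinearComp (frame c y) (frame c y)

theorem inChart_apply (g : SmoothMetric n M)
    (c : OpenPartialHomeomorph M (EuclideanSpace ℝ (Fin n)))
    (y) (i j) : g.inChart c y i j =
    g.chartForm c y (EuclideanSpace.single i 1) (EuclideanSpace.single j 1) := rfl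

variable {c : OpenPartialHomeomorph M (EuclideanSpace ℝ (Fin n))}
  (hc : c ∈ IsManifold.maximalAtlas (𝓡 n) ∞ M)
include hc

theorem mdifferentiableAt_chart {x : M} (hx : x ∈ c.source) : MDifferentiableAt (𝓡 n) (𝓡 n) c x :=
  ((contMDiffOn_of_mem_maximalAtlas hc).contMDiffAt (c.open_source.mem_nhds hx)).mdifferentiableAt (by simp)

theorem mdifferentiableAt_chart_symm {y} (hy : y ∈ c.target) :
    MDifferentiableAt (𝓡 n) (𝓡 n) c.symm y :=
  ((contMDiffOn_symm_of_mem_maximalAtlas hc).contMDiffAt (c.open_target.mem_nhds hy)).mdifferentiableAt (by simp)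

theorem mdifferentiable_chart : c.MDifferentiable (𝓡 n) (𝓡 n) :=
  ⟨fun _ hx => (mdifferentiableAt_chart hc hx).mdifferentiableWithinAt,
   fun _ hx => (mdifferentiableAt_chart_symm hc hx).mdifferentiableWithinAt⟩

theorem frame_coframe {x : M} (hx : x ∈ c.source) (v : EuclideanSpace ℝ (Fin n)) :
    frame c (c x) (coframe c x v) = v :=
  congrArg (fun A => A v) ((mdifferentiable_chart hc).symm_comp_deriv hx)

theorem coframe_frame {y} (hy : y ∈ c.target) (v : EuclideanSpace ℝ (Fin n)) :
    coframe c (c.symm y) (frame c y v) = v :=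
  congrArg (fun A => A v) ((mdifferentiable_chart hc).comp_symm_deriv hy)

theorem frame_coframe' {y} (hy : y ∈ c.target) (v : EuclideanSpace ℝ (Fin n)) :
    frame c y (coframe c (c.symm y) v) = v := by
  have := frame_coframe hc (c.map_target hy) v
  rwa [c.right_inv hy] at this

theorem contMDiffOn_frame {V : EuclideanSpace ℝ (Fin n) → EuclideanSpace ℝ (Fin n)}
    {U : Set (EuclideanSpace ℝ (Fin n))} (hU : U ⊆ c.target) (hV : ContDiffOn ℝ ∞ V U) :
   ContMDiffOn (𝓡 n) (𝓡 n).tangent ∞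
    (fun y => (⟨c.symm y, frame c y (V y)⟩ : TangentBundle (𝓡 n) M)) U := by
  have h := (contMDiffOn_symm_of_mem_maximalAtlas hc)
  have h2 := h.contMDiffOn_tangentMapWithin (m := ∞) (by simp) c.open_target.uniqueMDiffOn
  have h3 : ContMDiffOn (𝓡 n) (𝓡 n).tangent ∞
      (fun y => (⟨y, V y⟩ : TangentBundle (𝓡 n) (EuclideanSpace ℝ (Fin n)))) U :=
    contMDiffOn_vectorSpace_iff_contDiffOn.2 hV
  refine (h2.comp h3 (fun y hy => hU hy)).congr fun y hy => ?_
  simp only [Function.comp, tangentMapWithin, frame]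
  rw [mfderivWithin_of_isOpen c.open_target (hU hy)]
  rfl

theorem contDiffOn_chartForm (g : SmoothMetric n M) : ContDiffOn ℝ ∞ (g.chartForm c) c.target := by
  refine contDiffOn_clm_apply.2 fun v => contDiffOn_clm_apply.2 fun w => ?_
  rw [← contMDiffOn_iff_contDiffOn]
  intro y hy
  have hv := contMDiffOn_frame hc subset_rfl (contDiffOn_const (c := v)) y hy
  have hw := contMDiffOn_frame hc subset_rfl (contDiffOn_const (c := w)) y hy
  letI : Bundle.RiemannianBundle (fun x : M => TangentSpace (𝓡 n) x) := ⟨g.toRiemannianMetric⟩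
  exact ContMDiffWithinAt.inner_bundle (IB := 𝓡 n) (F := EuclideanSpace ℝ (Fin n))
    (E := fun x : M => TangentSpace (𝓡 n) x) (b := c.symm) (v := fun y => frame c y v)
    (w := fun y => frame c y w) hv hw

theorem isRiemannianOn_chartForm (g : SmoothMetric n M) :
    LocalMetric.IsRiemannianOn (g.chartForm c) c.target where
  isOpen := c.open_target
  smooth := contDiffOn_chartForm hc g
  symm y _ v w := g.symm (c.symm y) (frame c y v) (frame c y w)
  pos y hy v hv := by
    refine g.pos (c.symm y) (frame c y v) fun h => hv ?_
    have := coframe_frame hc hy v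
    rw [← this]
    exact (congrArg (coframe c (c.symm y)) h).trans (map_zero _)

omit hc in
theorem _root_.EuclideanSpace.sum_smul_single (v : EuclideanSpace ℝ (Fin n)) :
    ∑ i, v i • EuclideanSpace.single i (1 : ℝ) = v := by
  ext j
  simp [Pi.single_apply, Finset.sum_apply]

omit hc in
theorem bilin_eq_sum (B : EuclideanSpace ℝ (Fin n) →L[ℝ] EuclideanSpace ℝ (Fin n) →L[ℝ] ℝ)
    (v w : EuclideanSpace ℝ (Fin n)) : B v w = ∑ i, ∑ j, v i * w j *
      B (EuclideanSpace.single i 1) (EuclideanSpace.single j 1) := by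
  conv_lhs => rw [← EuclideanSpace.sum_smul_single v, ← EuclideanSpace.sum_smul_single w]
  simp only [map_sum, map_smul, ContinuousLinearMap.sum_apply, ContinuousLinearMap.smul_apply, smul_eq_mul]
  rw [Finset.sum_comm]
  refine (Finset.sum_congr rfl fun i _ => ?_)
  try rw [Finset.mul_sum]
  exact Finset.sum_congr rfl fun j _ => by ring

omit hc in
theorem chartForm_eq_sum (g : SmoothMetric n M) (y v w : EuclideanSpace ℝ (Fin n)) :
    g.chartForm c y v w = ∑ i, ∑ j, v i * w j * g.inChart c y i j := bilin_eq_sum _ _ _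

theorem isMetricOn_inChart (g : SmoothMetric n M) :
    LocalCoord.IsMetricOn (g.inChart c) c.target where
  isOpen := c.open_target
  smooth i j := ((contDiffOn_chartForm hc g).clm_apply contDiffOn_const).clm_apply contDiffOn_const
  symm y _ i j := g.symm (c.symm y) (frame c y _) (frame c y _)
  unit y hy := by
    rw [isUnit_iff_ne_zero]
    intro h0
    obtain ⟨v, hv, hGv⟩ := Matrix.exists_mulVec_eq_zero_iff.2 h0
    have hpos := (isRiemannianOn_chartForm hc g).pos y hy (WithLp.toLp 2 v) (by simpa using hv)
    rw [chartForm_eq_sum] at hpos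
    refine hpos.ne' (Finset.sum_eq_zero fun i _ => ?_)
    have := congrFun hGv i
    simp only [Matrix.mulVec, dotProduct, Pi.zero_apply] at this
    calc _ = v i * ∑ j, g.inChart c y i j * v j := by
          rw [Finset.mul_sum]; exact Finset.sum_congr rfl fun j _ => by simp; ring
      _ = 0 := by rw [this, mul_zero]

end SmoothMetric

/-! ### Variational equation and Lie derivative -/

namespace SmoothFlow
set_option maxSynthPendingDepth 3

section local_flow

variable {E : Type*} [NormedAddCommGroup E] [NormedSpace ℝ E]

variable {F : E → E} {Ω : Set E} {Ψ : E × ℝ → E} {x₀ : E} {ε : ℝ}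

theorem fderiv_localFlow_apply_left
    (hΨ : ∀ x ∈ Metric.ball x₀ ε, ∀ s ∈ Ioo (-ε) ε,
      ContDiffAt ℝ ∞ Ψ (x, s) ∧ Ψ (x, 0) = x ∧ Ψ (x, s) ∈ Ω ∧
        HasDerivAt (fun s => Ψ (x, s)) (F (Ψ (x, s))) s)
    {y : E} (hy : y ∈ Metric.ball x₀ ε) {s : ℝ} (hs : s ∈ Ioo (-ε) ε) :
    HasFDerivAt (fun x => Ψ (x, s))
    ((fderiv ℝ Ψ (y, s)).comp (ContinuousLinearMap.inl ℝ E ℝ)) y := by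
  have h1 : HasFDerivAt Ψ (fderiv ℝ Ψ (y, s)) (y, s) :=
    ((hΨ y hy s hs).1.differentiableAt (by simp)).hasFDerivAt
  exact h1.comp y (hasFDerivAt_prodMk_left y s)

/-- The variational equation for a local flow. -/
theorem hasDerivAt_fderiv_localFlow (hΩ : IsOpen Ω) (hF : ContDiffOn ℝ ∞ F Ω)
    (hΨ : ∀ x ∈ Metric.ball x₀ ε, ∀ s ∈ Ioo (-ε) ε,
      ContDiffAt ℝ ∞ Ψ (x, s) ∧ Ψ (x, 0) = x ∧ Ψ (x, s) ∈ Ω ∧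
        HasDerivAt (fun s => Ψ (x, s)) (F (Ψ (x, s))) s)
    {y : E} (hy : y ∈ Metric.ball x₀ ε) {s : ℝ} (hs : s ∈ Ioo (-ε) ε) (v : E) :
    HasDerivAt (fun s => fderiv ℝ Ψ (y, s) (v, 0))
      (fderiv ℝ F (Ψ (y, s)) (fderiv ℝ Ψ (y, s) (v, 0))) s := by
  obtain ⟨hsm, -, hmem, -⟩ := hΨ y hy s hs
  have hdd : DifferentiableAt ℝ (fderiv ℝ Ψ) (y, s) :=
    (hsm.fderiv_right (m := ∞) (by simp)).differentiableAt (by simp)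
  have h1 : HasDerivAt (fun s => fderiv ℝ Ψ (y, s)) (fderiv ℝ (fderiv ℝ Ψ) (y, s) (0, 1)) s := by
    have := hdd.hasFDerivAt.comp_hasDerivAt s ((hasDerivAt_const s y).prodMk (hasDerivAt_id s))
    exact this
  have h2 : HasDerivAt (fun s => fderiv ℝ Ψ (y, s) (v, 0))
      (fderiv ℝ (fderiv ℝ Ψ) (y, s) (0, 1) (v, 0)) s := by
    simpa using h1.clm_apply (hasDerivAt_const s ((v, 0) : E × ℝ))
  have hsymm : IsSymmSndFDerivAt ℝ Ψ (y, s) := hsm.isSymmSndFDerivAt (by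
    simpa using (by exact_mod_cast le_top : ((2 : ℕ∞) : WithTop ℕ∞) ≤ ((⊤ : ℕ∞) : WithTop ℕ∞)))
  -- The identity ∂ₛΨ = F ∘ Ψ holds on an open set in (y, s), so it may be differentiated in y;
  -- symmetry of second derivatives then exchanges the two variables.
  have hev : (fun p : E × ℝ => fderiv ℝ Ψ p (0, 1)) =ᶠ[𝓝 (y, s)] fun p => F (Ψ p) := by
    have : Metric.ball x₀ ε ×ˢ Ioo (-ε) ε ∈ 𝓝 (y, s) :=
      (Metric.isOpen_ball.prod isOpen_Ioo).mem_nhds ⟨hy, hs⟩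
    filter_upwards [this] with p hp
    obtain ⟨hsm', -, -, hd⟩ := hΨ p.1 hp.1 p.2 hp.2
    have := ((hsm'.differentiableAt (by simp)).hasFDerivAt.comp_hasDerivAt p.2
      ((hasDerivAt_const p.2 p.1).prodMk (hasDerivAt_id p.2))).unique hd
    exact this
  have h3 : fderiv ℝ (fun p : E × ℝ => fderiv ℝ Ψ p (0, 1)) (y, s) (v, 0)
      = fderiv ℝ (fderiv ℝ Ψ) (y, s) (v, 0) (0, 1) := by
    have := hdd.hasFDerivAt.clm_apply (hasFDerivAt_const ((0, 1) : E × ℝ) (y, s))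
    rw [this.fderiv]
    simp
  have h4 : fderiv ℝ (fun p : E × ℝ => F (Ψ p)) (y, s) (v, 0)
      = fderiv ℝ F (Ψ (y, s)) (fderiv ℝ Ψ (y, s) (v, 0)) := by
    have hFd : DifferentiableAt ℝ F (Ψ (y, s)) :=
      (hF.contDiffAt (hΩ.mem_nhds hmem)).differentiableAt (by simp)
    have : HasFDerivAt (fun p => F (Ψ p)) _ (y, s) :=
      hFd.hasFDerivAt.comp (y, s) (hsm.differentiableAt (by simp)).hasFDerivAt
    rw [this.fderiv]
    rfl
  rw [hsymm.eq, ← h3, hev.fderiv_eq, h4] at h2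
  exact h2

/-- If a field of bilinear forms is scaled by the Lie derivative along a vector field, then it is
scaled exponentially by the flow. -/
theorem localFlow_homothety {U : Set E} {H : E → E →L[ℝ] E →L[ℝ] ℝ} {κ : ℝ}
    (hΩ : IsOpen Ω) (hF : ContDiffOn ℝ ∞ F Ω) (hU : IsOpen U) (hH : ContDiffOn ℝ ∞ H U)
    (hLie : ∀ y ∈ U, ∀ v w, fderiv ℝ H y (F y) v w + H y (fderiv ℝ F y v) w
      + H y v (fderiv ℝ F y w) = -2 * κ * H y v w)
    (hΨ : ∀ x ∈ Metric.ball x₀ ε, ∀ s ∈ Ioo (-ε) ε,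
      ContDiffAt ℝ ∞ Ψ (x, s) ∧ Ψ (x, 0) = x ∧ Ψ (x, s) ∈ Ω ∧
        HasDerivAt (fun s => Ψ (x, s)) (F (Ψ (x, s))) s)
    {y : E} (hy : y ∈ Metric.ball x₀ ε) (hyU : ∀ s ∈ Ioo (-ε) ε, Ψ (y, s) ∈ U)
    {s : ℝ} (hs : s ∈ Ioo (-ε) ε) (v w : E) :
    H (Ψ (y, s)) (fderiv ℝ (fun x => Ψ (x, s)) y v) (fderiv ℝ (fun x => Ψ (x, s)) y w)
      = Real.exp (-2 * κ * s) * H y v w := by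
  have hε : 0 < ε := by linarith [hs.1, hs.2]
  have h0 : (0 : ℝ) ∈ Ioo (-ε) ε := ⟨by linarith, hε⟩
  -- The pulled-back form on fixed vectors. By the variational equation its s-derivative is the Lie
  -- derivative of H, so m' = -2κm.
  let m : ℝ → ℝ := fun s => H (Ψ (y, s)) (fderiv ℝ Ψ (y, s) (v, 0)) (fderiv ℝ Ψ (y, s) (w, 0))
  have hm : ∀ s ∈ Ioo (-ε) ε, HasDerivAt m (-2 * κ * m s) s := by
    intro s hs
    have hHd : DifferentiableAt ℝ H (Ψ (y, s)) :=
      (hH.contDiffAt (hU.mem_nhds (hyU s hs))).differentiableAt (by simp)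
    have h1 := hHd.hasFDerivAt.comp_hasDerivAt s (hΨ y hy s hs).2.2.2
    have h2 := (h1.clm_apply (hasDerivAt_fderiv_localFlow hΩ hF hΨ hy hs v)).clm_apply
      (hasDerivAt_fderiv_localFlow hΩ hF hΨ hy hs w)
    refine h2.congr_deriv ?_
    rw [← hLie _ (hyU s hs)]
    simp
  have hconst : ∀ s ∈ Ioo (-ε) ε, Real.exp (2 * κ * s) * m s = m 0 := by
    intro s hs
    have hd : ∀ s ∈ Ioo (-ε) ε, HasDerivAt (fun s => Real.exp (2 * κ * s) * m s) 0 s := by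
      intro s hs
      have h1 : HasDerivAt (fun s => Real.exp (2 * κ * s)) (Real.exp (2 * κ * s) * (2 * κ)) s := by
        simpa using ((hasDerivAt_id s).const_mul (2 * κ)).exp
      refine (h1.mul (hm s hs)).congr_deriv ?_
      ring
    have := (convex_Ioo (-ε) ε).is_const_of_fderivWithin_eq_zero (𝕜 := ℝ)
      (f := fun s => Real.exp (2 * κ * s) * m s)
      (fun s hs => (hd s hs).differentiableAt.differentiableWithinAt)
      (fun s hs => by
        rw [fderivWithin_of_isOpen isOpen_Ioo hs, (hd s hs).hasFDerivAt.fderiv]; ext; simp)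
      hs h0
    simpa using this
  have hm0 : m 0 = H y v w := by
    have hid : HasFDerivAt (fun x => Ψ (x, 0)) (ContinuousLinearMap.id ℝ E) y := by
      refine (hasFDerivAt_id y).congr_of_eventuallyEq ?_
      filter_upwards [Metric.isOpen_ball.mem_nhds hy] with x hx using (hΨ x hx 0 h0).2.1
    have h1 := (fderiv_localFlow_apply_left hΨ hy h0).unique hid
    have h2 : ∀ v, fderiv ℝ Ψ (y, 0) (v, 0) = v := fun v => congrArg (fun A => A v) h1
    simp only [m, h2, (hΨ y hy 0 h0).2.1]
  rw [(fderiv_localFlow_apply_left hΨ hy hs).fderiv]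
  have h3 := hconst s hs
  rw [hm0] at h3
  change m s = _
  rw [← h3, ← mul_assoc, ← Real.exp_add]
  simp [show -2 * κ * s + 2 * κ * s = 0 by ring]

end local_flow

end SmoothFlow

/-! ### Flows of vector fields on manifolds -/

namespace SmoothMetric
set_option maxSynthPendingDepth 3
variable {n : ℕ} {M : Type*} [TopologicalSpace M]
  [ChartedSpace (EuclideanSpace ℝ (Fin n)) M]

/-- The coordinate expression of a vector field. -/
def push (c : OpenPartialHomeomorph M (EuclideanSpace ℝ (Fin n)))
    (X : M → EuclideanSpace ℝ (Fin n)) (y : EuclideanSpace ℝ (Fin n)) : EuclideanSpace ℝ (Fin n) :=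
  coframe c (c.symm y) (X (c.symm y))

/-- A vector field with smooth coordinate expressions. -/
def IsSmoothField (X : M → EuclideanSpace ℝ (Fin n)) : Prop :=
  ∀ c ∈ IsManifold.maximalAtlas (𝓡 n) ∞ M, ContDiffOn ℝ ∞ (push c X) c.target

/-- `φ` is the flow of the vector field `X`. -/
structure IsFlow (X : M → EuclideanSpace ℝ (Fin n)) (φ : ℝ → M → M) : Prop where
  zero : ∀ x, φ 0 x = x
  curve : ∀ x, IsMIntegralCurve (I := 𝓡 n) (fun t => φ t x) (fun x => X x)

variable [IsManifold (𝓡 n) ∞ M] {X : M → EuclideanSpace ℝ (Fin n)}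

theorem frame_push {c : OpenPartialHomeomorph M (EuclideanSpace ℝ (Fin n))}
    (hc : c ∈ IsManifold.maximalAtlas (𝓡 n) ∞ M) {y : EuclideanSpace ℝ (Fin n)}
    (hy : y ∈ c.target) :
    frame c y (push c X y) = X (c.symm y) := frame_coframe' hc hy _

theorem IsSmoothField.contMDiff (hX : IsSmoothField X) :
    ContMDiff (𝓡 n) (𝓡 n).tangent ∞ (fun x => (⟨x, X x⟩ : TangentBundle (𝓡 n) M)) := by
  intro x
  set c := chartAt (EuclideanSpace ℝ (Fin n)) x
  have hc : c ∈ IsManifold.maximalAtlas (𝓡 n) ∞ M := IsManifold.chart_mem_maximalAtlas x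
  have hx : x ∈ c.source := mem_chart_source _ x
  have h1 := (contMDiffOn_frame hc subset_rfl (hX c hc)).comp (contMDiffOn_of_mem_maximalAtlas hc)
    (fun x hx => c.map_source hx)
  refine (h1.contMDiffAt (c.open_source.mem_nhds hx)).congr_of_eventuallyEq ?_
  filter_upwards [c.open_source.mem_nhds hx] with z hz
  have key : ∀ p q : M × EuclideanSpace ℝ (Fin n), p = q →
    (⟨p.1, p.2⟩ : TangentBundle (𝓡 n) M) = ⟨q.1, q.2⟩ := by rintro _ _ rfl; rfl
  refine key (z, X z) (c.symm (c z), frame c (c z) (push c X (c z))) ?_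
  rw [frame_push hc (c.map_source hz), c.left_inv hz]

theorem hasMFDerivAt_chart_symm_curve {c : OpenPartialHomeomorph M (EuclideanSpace ℝ (Fin n))}
    (hc : c ∈ IsManifold.maximalAtlas (𝓡 n) ∞ M) {α : ℝ → EuclideanSpace ℝ (Fin n)} {s : ℝ}
    (hs : α s ∈ c.target) (hα : HasDerivAt α (push c X (α s)) s) :
    HasMFDerivAt 𝓘(ℝ, ℝ) (𝓡 n) (fun s => c.symm (α s)) s
      ((1 : ℝ →L[ℝ] ℝ).smulRight (X (c.symm (α s)))) := by
  have h := (mdifferentiableAt_chart_symm hc hs).hasMFDerivAt.comp s hα.hasFDerivAt.hasMFDerivAt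
  refine h.congr_mfderiv ?_
  ext
  change frame c (α s) ((1 : ℝ) • push c X (α s)) = (1 : ℝ) • X (c.symm (α s))
  rw [one_smul, one_smul, frame_push hc hs]

theorem IsSmoothField.exists_flowBox (hX : IsSmoothField X)
    {c : OpenPartialHomeomorph M (EuclideanSpace ℝ (Fin n))}
    (hc : c ∈ IsManifold.maximalAtlas (𝓡 n) ∞ M) {z : M} (hz : z ∈ c.source) :
    ∃ Ψ : EuclideanSpace ℝ (Fin n) × ℝ → EuclideanSpace ℝ (Fin n), ∃ ε > 0,
      (∀ y ∈ Metric.ball (c z) ε, ∀ s ∈ Ioo (-ε) ε,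
        ContDiffAt ℝ ∞ Ψ (y, s) ∧ Ψ (y, 0) = y ∧ Ψ (y, s) ∈ c.target ∧
        HasDerivAt (fun s => Ψ (y, s)) (push c X (Ψ (y, s))) s) ∧
      ∀ y ∈ Metric.ball (c z) ε,
        IsMIntegralCurveOn (I := 𝓡 n) (fun s => c.symm (Ψ (y, s))) (fun x => X x) (Ioo (-ε) ε) := by
  obtain ⟨Ψ, ε, hε, h⟩ := SmoothFlow.exists_local_flow c.open_target (hX c hc) (c.map_source hz)
  exact ⟨Ψ, ε, hε, h, fun y hy s hs =>
    (hasMFDerivAt_chart_symm_curve hc (h y hy s hs).2.2.1 (h y hy s hs).2.2.2).hasMFDerivWithinAt⟩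

variable [T2Space M]

theorem IsSmoothField.contMDiff_one (hX : IsSmoothField X) :
    ContMDiff (𝓡 n) (𝓡 n).tangent 1 (fun x => (⟨x, X x⟩ : TangentBundle (𝓡 n) M)) :=
  hX.contMDiff.of_le (by simp)

theorem IsFlow.add {φ : ℝ → M → M} (hφ : IsFlow X φ) (hX : IsSmoothField X) (s t : ℝ) (x : M) :
    φ (s + t) x = φ s (φ t x) := by
  have := isMIntegralCurve_Ioo_eq_of_contMDiff_boundaryless (I := 𝓡 n) (t₀ := 0) hX.contMDiff_one
    ((hφ.curve x).comp_add t) (hφ.curve (φ t x)) (by simp [hφ.zero])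
  exact congrFun this s

theorem IsFlow.eq_flowBox {φ : ℝ → M → M} (hφ : IsFlow X φ) (hX : IsSmoothField X)
    {c : OpenPartialHomeomorph M (EuclideanSpace ℝ (Fin n))} {x : M} (hx : x ∈ c.source) {ε : ℝ}
    {Ψ : EuclideanSpace ℝ (Fin n) × ℝ → EuclideanSpace ℝ (Fin n)}
    (h0 : Ψ (c x, 0) = c x)
    (hΨ : IsMIntegralCurveOn (I := 𝓡 n) (fun s => c.symm (Ψ (c x, s))) (fun x => X x) (Ioo (-ε) ε))
    {s : ℝ} (hs : s ∈ Ioo (-ε) ε) : φ s x = c.symm (Ψ (c x, s)) := by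
  have hε : (0 : ℝ) ∈ Ioo (-ε) ε := ⟨by linarith [hs.1, hs.2], by linarith [hs.1, hs.2]⟩
  exact isMIntegralCurveOn_Ioo_eqOn_of_contMDiff_boundaryless (I := 𝓡 n) hε hX.contMDiff_one
    ((hφ.curve x).isMIntegralCurveOn _) hΨ (by simp [hφ.zero, h0, c.left_inv hx]) hs

end SmoothMetric

namespace SmoothMetric
set_option maxSynthPendingDepth 3
variable {n : ℕ} {M : Type*} [TopologicalSpace M]
  [ChartedSpace (EuclideanSpace ℝ (Fin n)) M] [IsManifold (𝓡 n) ∞ M]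
  {X : M → EuclideanSpace ℝ (Fin n)}

/-- The derivative of a self-map of `M`, as an endomorphism of the model space. -/
def tder (f : M → M) (x : M) : EuclideanSpace ℝ (Fin n) →L[ℝ] EuclideanSpace ℝ (Fin n) :=
  mfderiv (𝓡 n) (𝓡 n) f x

/-- The coordinate expression of the conformally related form `ψ g`. -/
def scaledForm (g : SmoothMetric n M) (ψ : M → ℝ)
    (c : OpenPartialHomeomorph M (EuclideanSpace ℝ (Fin n))) (y : EuclideanSpace ℝ (Fin n)) :
    EuclideanSpace ℝ (Fin n) →L[ℝ] EuclideanSpace ℝ (Fin n) →L[ℝ] ℝ :=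
  ψ (c.symm y) • g.chartForm c y

/-- On the open set `O`, the metric `ψ g` satisfies `L_X (ψ g) = -2 κ ψ g`. -/
structure IsHomotheticField (g : SmoothMetric n M) (ψ : M → ℝ) (O : Set M)
    (X : M → EuclideanSpace ℝ (Fin n)) (κ : ℝ) : Prop where
  isOpen : IsOpen O
  field : IsSmoothField X
  smooth : ContMDiffOn (𝓡 n) 𝓘(ℝ) ∞ ψ O
  pos : ∀ x ∈ O, 0 < ψ x
  lie : ∀ c ∈ IsManifold.maximalAtlas (𝓡 n) ∞ M, ∀ y ∈ c.target, c.symm y ∈ O → ∀ v w,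
    fderiv ℝ (scaledForm g ψ c) y (push c X y) v w
      + scaledForm g ψ c y (fderiv ℝ (push c X) y v) w
      + scaledForm g ψ c y v (fderiv ℝ (push c X) y w) = -2 * κ * scaledForm g ψ c y v w

theorem isOpen_inter_symm_preimage (c : OpenPartialHomeomorph M (EuclideanSpace ℝ (Fin n)))
    {O : Set M} (hO : IsOpen O) : IsOpen (c.target ∩ c.symm ⁻¹' O) :=
  c.symm.isOpen_inter_preimage hO

theorem contDiffOn_comp_symm {c : OpenPartialHomeomorph M (EuclideanSpace ℝ (Fin n))}
    (hc : c ∈ IsManifold.maximalAtlas (𝓡 n) ∞ M) {O : Set M} {ψ : M → ℝ}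
    (hψ : ContMDiffOn (𝓡 n) 𝓘(ℝ) ∞ ψ O) :
    ContDiffOn ℝ ∞ (ψ ∘ c.symm) (c.target ∩ c.symm ⁻¹' O) := by
  rw [← contMDiffOn_iff_contDiffOn]
  exact hψ.comp ((contMDiffOn_symm_of_mem_maximalAtlas hc).mono inter_subset_left)
    inter_subset_right

theorem isRiemannianOn_scaledForm (g : SmoothMetric n M)
    {c : OpenPartialHomeomorph M (EuclideanSpace ℝ (Fin n))}
    (hc : c ∈ IsManifold.maximalAtlas (𝓡 n) ∞ M) {O : Set M} {ψ : M → ℝ} (hO : IsOpen O)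
    (hψ : ContMDiffOn (𝓡 n) 𝓘(ℝ) ∞ ψ O) (hpos : ∀ x ∈ O, 0 < ψ x) :
    LocalMetric.IsRiemannianOn (scaledForm g ψ c) (c.target ∩ c.symm ⁻¹' O) where
  isOpen := isOpen_inter_symm_preimage c hO
  smooth := (contDiffOn_comp_symm hc hψ).smul ((contDiffOn_chartForm hc g).mono inter_subset_left)
  symm y hy v w := by
    change ψ (c.symm y) * g.chartForm c y v w = ψ (c.symm y) * g.chartForm c y w v
    rw [(isRiemannianOn_chartForm hc g).symm y hy.1]
  pos y hy v hv := mul_pos (hpos _ hy.2) ((isRiemannianOn_chartForm hc g).pos y hy.1 v hv)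

section flow

/-- The hypothesis makes the set where P holds and its complement both open in the connected line.
This carries statements about flow maps from time 0 to all times, although flow boxes only cover
short times. -/
theorem _root_.eq_of_locally_iff {P : ℝ → Prop} (h0 : P 0)
    (h : ∀ t₀, ∃ W ∈ 𝓝 t₀, ∀ t ∈ W, ∀ t' ∈ W, P t → P t') (t : ℝ) : P t := by
  have h1 : IsClopen {t | P t} := by
    refine ⟨⟨?_⟩, ?_⟩
    · rw [isOpen_iff_mem_nhds]
      intro t₀ ht₀
      obtain ⟨W, hW, hP⟩ := h t₀
      filter_upwards [hW] with t ht h'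
      exact ht₀ (hP t ht t₀ (mem_of_mem_nhds hW) h')
    · rw [isOpen_iff_mem_nhds]
      intro t₀ ht₀
      obtain ⟨W, hW, hP⟩ := h t₀
      filter_upwards [hW] with t ht
      exact hP t₀ (mem_of_mem_nhds hW) t ht ht₀
  have h2 := h1.eq_univ ⟨0, h0⟩
  exact (h2 ▸ mem_univ t : t ∈ {t | P t})

variable [T2Space M]

/-- For times t, t' near t₀ the points φ_t q lie in one flow box whose lifetime exceeds |t' - t|.
There φ_{t'} is φ_t followed by the coordinate flow, which is explicit and smooth. -/
theorem IsFlow.exists_transition {φ : ℝ → M → M} (hφ : IsFlow X φ) (hX : IsSmoothField X)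
    (q : M) (t₀ : ℝ) :
    ∃ c ∈ IsManifold.maximalAtlas (𝓡 n) ∞ M, ∃ W ∈ 𝓝 t₀, ∃ V : Set M, IsOpen V ∧ V ⊆ c.source ∧
      (∀ t ∈ W, φ t q ∈ V) ∧ ∃ Ψ : EuclideanSpace ℝ (Fin n) × ℝ → EuclideanSpace ℝ (Fin n),
      ∃ z : EuclideanSpace ℝ (Fin n), ∃ ε : ℝ, (∀ y ∈ Metric.ball z ε, ∀ s ∈ Ioo (-ε) ε,
        ContDiffAt ℝ ∞ Ψ (y, s) ∧ Ψ (y, 0) = y ∧ Ψ (y, s) ∈ c.target ∧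
        HasDerivAt (fun s => Ψ (y, s)) (push c X (Ψ (y, s))) s) ∧
      (∀ x ∈ V, c x ∈ Metric.ball z ε) ∧ (∀ x ∈ V, ∀ s ∈ Ioo (-ε) ε, φ s x = c.symm (Ψ (c x, s))) ∧
      ∀ t ∈ W, ∀ t' ∈ W, t' - t ∈ Ioo (-ε) ε := by
  set c := chartAt (EuclideanSpace ℝ (Fin n)) (φ t₀ q)
  have hc : c ∈ IsManifold.maximalAtlas (𝓡 n) ∞ M := IsManifold.chart_mem_maximalAtlas _
  have hz : φ t₀ q ∈ c.source := mem_chart_source _ _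
  obtain ⟨Ψ, ε, hε, hΨ, hΨc⟩ := hX.exists_flowBox hc hz
  have hVo : IsOpen (c.source ∩ c ⁻¹' Metric.ball (c (φ t₀ q)) ε) :=
    c.isOpen_inter_preimage Metric.isOpen_ball
  have hW1 : ∀ᶠ t in 𝓝 t₀, φ t q ∈ c.source ∩ c ⁻¹' Metric.ball (c (φ t₀ q)) ε :=
    (hφ.curve q).continuous.continuousAt.eventually_mem
      (hVo.mem_nhds ⟨hz, Metric.mem_ball_self hε⟩)
  -- Radius ε/2, so that two times in the ball differ by less than ε.
  refine ⟨c, hc, _, inter_mem hW1 (Metric.ball_mem_nhds t₀ (half_pos hε)), _, hVo,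
    inter_subset_left, fun t ht => ht.1, Ψ, c (φ t₀ q), ε, hΨ, fun x hx => hx.2,
    fun x hx s hs => hφ.eq_flowBox hX hx.1 (hΨ _ hx.2 0 ⟨by linarith, hε⟩).2.1 (hΨc _ hx.2) hs, ?_⟩
  intro t ht t' ht'
  have h1 := ht.2
  have h2 := ht'.2
  rw [Real.ball_eq_Ioo] at h1 h2
  constructor <;> linarith [h1.1, h1.2, h2.1, h2.2]

theorem IsFlow.contMDiff {φ : ℝ → M → M} (hφ : IsFlow X φ) (hX : IsSmoothField X) (t : ℝ) :
    ContMDiff (𝓡 n) (𝓡 n) ∞ (φ t) := by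
  intro q
  refine eq_of_locally_iff (P := fun t => ContMDiffAt (𝓡 n) (𝓡 n) ∞ (φ t) q) ?_ ?_ t
  · exact contMDiffAt_id.congr_of_eventuallyEq (Eventually.of_forall hφ.zero)
  intro t₀
  obtain ⟨c, hc, W, hW, V, hVo, hVc, hWV, Ψ, z, ε, hΨ, hVz, hflow, hWε⟩ :=
    hφ.exists_transition hX q t₀
  refine ⟨W, hW, fun t ht t' ht' hP => ?_⟩
  have hs := hWε t ht t' ht'
  have hq := hWV t ht
  have h1 : ContMDiffAt (𝓡 n) (𝓡 n) ∞ (fun x => c.symm (Ψ (c x, t' - t))) (φ t q) := by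
    have hc1 : ContMDiffAt (𝓡 n) (𝓡 n) ∞ c (φ t q) :=
      (contMDiffOn_of_mem_maximalAtlas hc).contMDiffAt (c.open_source.mem_nhds (hVc hq))
    obtain ⟨hsm, -, hmem, -⟩ := hΨ _ (hVz _ hq) _ hs
    have hc2 : ContMDiffAt (𝓡 n) (𝓡 n) ∞ c.symm (Ψ (c (φ t q), t' - t)) :=
      (contMDiffOn_symm_of_mem_maximalAtlas hc).contMDiffAt (c.open_target.mem_nhds hmem)
    have hd : ContDiffAt ℝ ∞ (fun y => Ψ (y, t' - t)) (c (φ t q)) :=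
      hsm.comp (c (φ t q)) (contDiffAt_id.prodMk contDiffAt_const)
    exact hc2.comp (φ t q) (hd.contMDiffAt.comp (φ t q) hc1)
  refine (h1.comp q hP).congr_of_eventuallyEq ?_
  filter_upwards [hP.continuousAt.eventually_mem (hVo.mem_nhds hq)] with x hx
  have := hφ.add hX (t' - t) t x
  rw [sub_add_cancel] at this
  rw [this, hflow _ hx _ hs]
  rfl

/-- The infinitesimal relation integrates to e^{-2κs} inside a flow box; the factors multiply under
composition, and `eq_of_locally_iff` reaches every time. -/
theorem IsFlow.homothety {g : SmoothMetric n M} {ψ : M → ℝ} {O : Set M} {κ : ℝ}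
    {φ : ℝ → M → M} (hφ : IsFlow X φ) (h : IsHomotheticField g ψ O X κ)
    (hO : ∀ x ∈ O, ∀ t, φ t x ∈ O) {q : M} (hq : q ∈ O) (t : ℝ) (v w : EuclideanSpace ℝ (Fin n)) :
    ψ (φ t q) * g.form (φ t q) (tder (φ t) q v) (tder (φ t) q w)
      = Real.exp (-2 * κ * t) * (ψ q * g.form q v w) := by
  have hX := h.field
  revert v w
  refine eq_of_locally_iff (P := fun t => ∀ v w : EuclideanSpace ℝ (Fin n),
    ψ (φ t q) * g.form (φ t q) (tder (φ t) q v) (tder (φ t) q w)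
      = Real.exp (-2 * κ * t) * (ψ q * g.form q v w)) ?_ ?_ t
  · intro v w
    have hid : ∀ v, tder (φ 0) q v = v := fun v =>
      congrArg (fun B : EuclideanSpace ℝ (Fin n) →L[ℝ] EuclideanSpace ℝ (Fin n) => B v)
        ((hasMFDerivAt_id (I := 𝓡 n) q).congr_of_eventuallyEq
          (Eventually.of_forall hφ.zero : φ 0 =ᶠ[𝓝 q] id)).mfderiv
    rw [hid, hid, hφ.zero]
    simp
  intro t₀
  obtain ⟨c, hc, W, hW, V, hVo, hVc, hWV, Ψ, z, ε, hΨ, hVz, hflow, hWε⟩ :=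
    hφ.exists_transition hX q t₀
  refine ⟨W, hW, fun t ht t' ht' hP v w => ?_⟩
  have hs := hWε t ht t' ht'
  have hqV := hWV t ht
  obtain ⟨hsm, -, hmem, -⟩ := hΨ _ (hVz _ hqV) _ hs
  have hH := isRiemannianOn_scaledForm g hc h.isOpen h.smooth h.pos
  have key := SmoothFlow.localFlow_homothety (κ := κ) c.open_target (hX c hc) hH.isOpen hH.smooth
    (fun y hy => h.lie c hc y hy.1 hy.2) hΨ (hVz _ hqV)
    (fun s hs => ⟨(hΨ _ (hVz _ hqV) s hs).2.2.1, by
      have := hO _ (hO q hq t) s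
      rw [hflow _ hqV s hs] at this
      exact this⟩) hs
  set A : EuclideanSpace ℝ (Fin n) →L[ℝ] EuclideanSpace ℝ (Fin n) :=
    fderiv ℝ (fun y => Ψ (y, t' - t)) (c (φ t q)) with hA
  have hd : HasFDerivAt (fun y => Ψ (y, t' - t)) A (c (φ t q)) := by
    rw [hA, (SmoothFlow.fderiv_localFlow_apply_left hΨ (hVz _ hqV) hs).fderiv]
    exact SmoothFlow.fderiv_localFlow_apply_left hΨ (hVz _ hqV) hs
  have hdt : MDifferentiableAt (𝓡 n) (𝓡 n) (φ t) q :=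
    (hφ.contMDiff hX t q).mdifferentiableAt (by simp)
  have hcomp := (mdifferentiableAt_chart_symm hc hmem).hasMFDerivAt.comp (φ t q)
    (hd.hasMFDerivAt.comp (φ t q) (mdifferentiableAt_chart hc (hVc hqV)).hasMFDerivAt)
  have hcomp2 := hcomp.comp q hdt.hasMFDerivAt
  have hev : φ t' =ᶠ[𝓝 q] (fun x => c.symm (Ψ (c (φ t x), t' - t))) := by
    filter_upwards [hdt.continuousAt.eventually_mem (hVo.mem_nhds hqV)] with x hx
    have := hφ.add hX (t' - t) t x
    rw [sub_add_cancel] at this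
    rw [this, hflow _ hx _ hs]
  have hpt : φ t' q = c.symm (Ψ (c (φ t q), t' - t)) := hev.self_of_nhds
  have hmf : ∀ v, tder (φ t') q v
      = frame c (Ψ (c (φ t q), t' - t)) (A (coframe c (φ t q) (tder (φ t) q v))) :=
    fun v => congrArg (fun B : EuclideanSpace ℝ (Fin n) →L[ℝ] EuclideanSpace ℝ (Fin n) => B v)
      (hcomp2.congr_of_eventuallyEq hev).mfderiv
  rw [hmf v, hmf w, hpt]
  have h2 := key (coframe c (φ t q) (tder (φ t) q v))
    (coframe c (φ t q) (tder (φ t) q w))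
  have h3 : scaledForm g ψ c (c (φ t q)) (coframe c (φ t q) (tder (φ t) q v))
    (coframe c (φ t q) (tder (φ t) q w)) =
    ψ (φ t q) * g.form (φ t q) (tder (φ t) q v)
      (tder (φ t) q w) := by
    change ψ (c.symm (c (φ t q))) * g.form (c.symm (c (φ t q)))
      (frame c (c (φ t q)) (coframe c (φ t q) (tder (φ t) q v)))
      (frame c (c (φ t q)) (coframe c (φ t q) (tder (φ t) q w))) = _
    rw [c.left_inv (hVc hqV)]
    rw [frame_coframe hc (hVc hqV), frame_coframe hc (hVc hqV)]
  rw [h3, hP v w, ← mul_assoc, ← Real.exp_add] at h2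
  refine Eq.trans h2 ?_
  congr 2
  ring

end flow

section complete

theorem IsSmoothField.exists_uniform_time (hX : IsSmoothField X) (z : M) :
    ∃ ε > 0, ∃ V ∈ 𝓝 z, ∀ x ∈ V, ∃ β : ℝ → M, β 0 = x ∧
      IsMIntegralCurveOn (I := 𝓡 n) β (fun x => X x) (Ioo (-ε) ε) := by
  set c := chartAt (EuclideanSpace ℝ (Fin n)) z
  have hc : c ∈ IsManifold.maximalAtlas (𝓡 n) ∞ M := IsManifold.chart_mem_maximalAtlas _
  have hz : z ∈ c.source := mem_chart_source _ _
  obtain ⟨Ψ, ε, hε, hΨ, hΨc⟩ := hX.exists_flowBox hc hz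
  refine ⟨ε, hε, _, (c.isOpen_inter_preimage Metric.isOpen_ball).mem_nhds
    ⟨hz, Metric.mem_ball_self hε⟩, fun x hx => ⟨_, ?_, hΨc (c x) hx.2⟩⟩
  rw [(hΨ _ hx.2 0 ⟨by linarith, hε⟩).2.1, c.left_inv hx.1]

variable [T2Space M]

/-- Near a cluster point all solutions live for a common time ε. Restarting at a time less than ε/2
before the end, at a point close to the cluster point, carries the curve ε/2 beyond it. -/
theorem IsSmoothField.extend_right (hX : IsSmoothField X) {γ : ℝ → M} {a b : ℝ} (hab : b < a)
    (hγ : IsMIntegralCurveOn (I := 𝓡 n) γ (fun x => X x) (Ioo b a))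
    (hcl : ∃ z, MapClusterPt z (𝓝[<] a) γ) :
    ∃ δ > 0, ∃ γ' : ℝ → M, EqOn γ' γ (Ioo b a) ∧
      IsMIntegralCurveOn (I := 𝓡 n) γ' (fun x => X x) (Ioo b (a + δ)) := by
  obtain ⟨z, hz⟩ := hcl
  obtain ⟨ε, hε, V, hV, hβ⟩ := hX.exists_uniform_time z
  have h1 := (hz.frequently hV).and_eventually
    (Ioo_mem_nhdsLT (show max b (a - ε / 2) < a from max_lt hab (by linarith)))
  obtain ⟨t, htV, ht⟩ := h1.exists
  obtain ⟨β, hβ0, hβ⟩ := hβ _ htV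
  have ht1 := (le_max_left b (a - ε / 2)).trans_lt ht.1
  have ht2 := (le_max_right b (a - ε / 2)).trans_lt ht.1
  have hβ' : IsMIntegralCurveOn (I := 𝓡 n) (β ∘ (· + -t)) (fun x => X x) (Ioo (t - ε) (t + ε)) := by
    refine (hβ.comp_add (-t)).mono fun s hs => ?_
    exact ⟨by linarith [hs.1], by linarith [hs.2]⟩
  have h2 := isMIntegralCurveOn_piecewise (I := 𝓡 n) hX.contMDiff_one hγ hβ' (t₀ := t)
    ⟨⟨ht1, ht.2⟩, by linarith, by linarith⟩ (by simp [hβ0])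
  refine ⟨ε / 2, half_pos hε, _, fun s hs => piecewise_eq_of_mem _ _ _ hs, h2.mono fun s hs => ?_⟩
  by_cases h : s < a
  · exact Or.inl ⟨hs.1, h⟩
  · exact Or.inr ⟨by linarith, by linarith [hs.2]⟩

theorem IsSmoothField.extend_left (hX : IsSmoothField X) {γ : ℝ → M} {a b : ℝ} (hab : b < a)
    (hγ : IsMIntegralCurveOn (I := 𝓡 n) γ (fun x => X x) (Ioo b a))
    (hcl : ∃ z, MapClusterPt z (𝓝[>] b) γ) :
    ∃ δ > 0, ∃ γ' : ℝ → M, EqOn γ' γ (Ioo b a) ∧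
      IsMIntegralCurveOn (I := 𝓡 n) γ' (fun x => X x) (Ioo (b - δ) a) := by
  obtain ⟨z, hz⟩ := hcl
  obtain ⟨ε, hε, V, hV, hβ⟩ := hX.exists_uniform_time z
  have h1 := (hz.frequently hV).and_eventually
    (Ioo_mem_nhdsGT (show b < min a (b + ε / 2) from lt_min hab (by linarith)))
  obtain ⟨t, htV, ht⟩ := h1.exists
  obtain ⟨β, hβ0, hβ⟩ := hβ _ htV
  have ht1 := ht.2.trans_le (min_le_left a (b + ε / 2))
  have ht2 := ht.2.trans_le (min_le_right a (b + ε / 2))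
  have hβ' : IsMIntegralCurveOn (I := 𝓡 n) (β ∘ (· + -t)) (fun x => X x) (Ioo (t - ε) (t + ε)) := by
    refine (hβ.comp_add (-t)).mono fun s hs => ?_
    exact ⟨by linarith [hs.1], by linarith [hs.2]⟩
  have h2 := isMIntegralCurveOn_piecewise (I := 𝓡 n) hX.contMDiff_one hγ hβ' (t₀ := t)
    ⟨⟨ht.1, ht1⟩, by linarith, by linarith⟩ (by simp [hβ0])
  refine ⟨ε / 2, half_pos hε, _, fun s hs => piecewise_eq_of_mem _ _ _ hs, h2.mono fun s hs => ?_⟩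
  by_cases h : b < s
  · exact Or.inl ⟨h, hs.2⟩
  · exact Or.inr ⟨by linarith [hs.1], by linarith⟩

/-- A smooth vector field whose integral curves do not leave every compact set in finite time has a
global flow. -/
theorem IsSmoothField.exists_flow (hX : IsSmoothField X)
    (hcl : ∀ (γ : ℝ → M) (a : ℝ), 0 < a →
      IsMIntegralCurveOn (I := 𝓡 n) γ (fun x => X x) (Ioo (-a) a) →
      (∃ z, MapClusterPt z (𝓝[<] a) γ) ∧ ∃ z, MapClusterPt z (𝓝[>] (-a)) γ) :
    ∃ φ : ℝ → M → M, IsFlow X φ := by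
  suffices h : ∀ x : M, ∃ γ : ℝ → M, γ 0 = x ∧ IsMIntegralCurve (I := 𝓡 n) γ (fun x => X x) by
    choose γ h0 hγ using h
    exact ⟨fun t x => γ x t, h0, hγ⟩
  intro x
  rw [exists_isMIntegralCurve_iff_exists_isMIntegralCurveOn_Ioo (I := 𝓡 n) hX.contMDiff_one]
  -- Symmetric existence intervals. If S were bounded, the solutions would glue to one on (-a, a)
  -- with a = sup S, and this could be prolonged at both ends.
  let S : Set ℝ := {a | 0 < a ∧ ∃ γ : ℝ → M, γ 0 = x ∧
    IsMIntegralCurveOn (I := 𝓡 n) γ (fun x => X x) (Ioo (-a) a)}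
  have hne : S.Nonempty := by
    obtain ⟨ε, hε, V, hV, h⟩ := hX.exists_uniform_time x
    exact ⟨ε, hε, h x (mem_of_mem_nhds hV)⟩
  have hnb : ¬ BddAbove S := by
    intro hb
    set a := sSup S
    obtain ⟨a₀, ha₀⟩ := hne
    have ha : 0 < a := ha₀.1.trans_le (le_csSup hb ha₀)
    have hS : ∀ b, 0 < b → b < a → b ∈ S := by
      intro b hb0 hba
      obtain ⟨b', hb', hbb'⟩ := exists_lt_of_lt_csSup ⟨a₀, ha₀⟩ hba
      obtain ⟨γ, h0, hγ⟩ := hb'.2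
      exact ⟨hb0, γ, h0, hγ.mono (Ioo_subset_Ioo (by linarith) hbb'.le)⟩
    have hex : ∀ b, ∃ γ : ℝ → M, 0 < b → b < a → γ 0 = x ∧
        IsMIntegralCurveOn (I := 𝓡 n) γ (fun x => X x) (Ioo (-b) b) := by
      intro b
      by_cases h : 0 < b ∧ b < a
      · obtain ⟨γ, hγ⟩ := (hS b h.1 h.2).2
        exact ⟨γ, fun _ _ => hγ⟩
      · exact ⟨fun _ => x, fun h1 h2 => (h ⟨h1, h2⟩).elim⟩
    choose γ hγ using hex
    have heq : ∀ b b', 0 < b → b ≤ b' → b' < a → EqOn (γ b) (γ b') (Ioo (-b) b) := by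
      intro b b' hb0 hbb' hb'
      exact isMIntegralCurveOn_Ioo_eqOn_of_contMDiff_boundaryless (I := 𝓡 n) (t₀ := 0)
        ⟨by linarith, hb0⟩ hX.contMDiff_one (hγ b hb0 (by linarith)).2
        ((hγ b' (by linarith) hb').2.mono (Ioo_subset_Ioo (by linarith) hbb'))
        (by rw [(hγ b hb0 (by linarith)).1, (hγ b' (by linarith) hb').1])
    -- The midpoint of |t| and a labels a solution whose interval contains t, with label still below
    -- a; by uniqueness the choice is immaterial.
    let Γ : ℝ → M := fun t => γ ((|t| + a) / 2) t
    have hΓ : ∀ b, 0 < b → b < a → EqOn Γ (γ b) (Ioo (-b) b) := by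
      intro b hb0 hba t ht
      have htb : |t| < b := abs_lt.2 ht
      rcases le_total ((|t| + a) / 2) b with h | h
      · exact heq _ b (by positivity) h hba ⟨by linarith [neg_abs_le t], by linarith [le_abs_self t]⟩
      · exact (heq b _ hb0 h (by linarith) ht).symm
    have hΓ0 : Γ 0 = x := by
      have := hΓ (a / 2) (by positivity) (by linarith) (x := 0) ⟨by linarith, by linarith⟩
      rw [this, (hγ (a / 2) (by positivity) (by linarith)).1]
    have hΓc : IsMIntegralCurveOn (I := 𝓡 n) Γ (fun x => X x) (Ioo (-a) a) := by
      refine (isMIntegralCurveOn_iff_isMIntegralCurveAt isOpen_Ioo).2 fun t ht => ?_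
      have hta : |t| < a := abs_lt.2 ht
      set b := (|t| + a) / 2 with hbdef
      have hb0 : 0 < b := by positivity
      have hba : b < a := by linarith
      have htb : t ∈ Ioo (-b) b := ⟨by linarith [neg_abs_le t], by linarith [le_abs_self t]⟩
      have h1 := (hγ b hb0 hba).2.isMIntegralCurveAt (isOpen_Ioo.mem_nhds htb)
      have h2 : IsMIntegralCurveOn (I := 𝓡 n) Γ (fun x => X x) (Ioo (-b) b) := by
        intro s hs
        have h3 := (hγ b hb0 hba).2 s hs
        have h4 := HasMFDerivWithinAt.congr_of_eventuallyEq (f₁ := Γ) h3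
          (eventually_nhdsWithin_of_forall (hΓ b hb0 hba)) (hΓ b hb0 hba hs)
        rw [← hΓ b hb0 hba hs] at h4
        exact h4
      exact h2.isMIntegralCurveAt (isOpen_Ioo.mem_nhds htb)
    obtain ⟨δ, hδ, γ₁, heq₁, hγ₁⟩ := hX.extend_right (by linarith) hΓc (hcl Γ a ha hΓc).1
    have hcl' : ∃ z, MapClusterPt z (𝓝[>] (-a)) γ₁ := by
      obtain ⟨z, hz⟩ := (hcl Γ a ha hΓc).2
      refine ⟨z, hz.congrFun ?_⟩
      filter_upwards [Ioo_mem_nhdsGT (show -a < a by linarith)] with s hs using (heq₁ hs).symm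
    obtain ⟨δ', hδ', γ₂, heq₂, hγ₂⟩ := hX.extend_left (by linarith) hγ₁ hcl'
    have : a + min δ δ' ∈ S := by
      have hm : 0 < min δ δ' := lt_min hδ hδ'
      refine ⟨by linarith, γ₂, ?_, hγ₂.mono (Ioo_subset_Ioo ?_ ?_)⟩
      · rw [heq₂ ⟨by linarith, by linarith⟩, heq₁ ⟨by linarith, by linarith⟩, hΓ0]
      · linarith [min_le_right δ δ']
      · linarith [min_le_left δ δ']
    have := le_csSup hb this
    linarith [lt_min hδ hδ']
  intro a
  rw [not_bddAbove_iff] at hnb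
  obtain ⟨b, hb, hab⟩ := hnb a
  obtain ⟨γ, h0, hγ⟩ := hb.2
  exact ⟨γ, h0, hγ.mono (Ioo_subset_Ioo (by linarith) hab.le)⟩

theorem IsSmoothField.exists_flow_of_compact [CompactSpace M] (hX : IsSmoothField X) :
    ∃ φ : ℝ → M → M, IsFlow X φ := by
  refine hX.exists_flow fun γ a ha _ => ⟨?_, ?_⟩
  · exact exists_clusterPt_of_compactSpace _
  · exact exists_clusterPt_of_compactSpace _

end complete

end SmoothMetric

/-! ### Basins of attraction of homothetic flows -/

namespace LocalMetric
set_option maxSynthPendingDepth 3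
variable {E : Type*} [NormedAddCommGroup E] [InnerProductSpace ℝ E] [FiniteDimensional ℝ E]

/-- In coordinates that are orthonormal at the fixed point, the derivative there is μ times an
isometry. All required bounds hold near 0: H and DT are locally Lipschitz, Γ is locally bounded, and
T contracts by the intermediate factor (1 + μ)/2. -/
theorem exists_isContractingHomothety {H : E → E →L[ℝ] E →L[ℝ] ℝ} {T : E → E} {U : Set E} {μ : ℝ}
    (hH : IsRiemannianOn H U) (h0 : (0 : E) ∈ U) (hT : ContDiffOn ℝ ∞ T U) (hT0 : T 0 = 0)
    (hμ0 : 0 < μ) (hμ1 : μ < 1)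
    (hhom : ∀ y ∈ U, ∀ v w, H (T y) (fderiv ℝ T y v) (fderiv ℝ T y w) = μ ^ 2 * H y v w)
    (hH0 : ∀ v w, H 0 v w = inner ℝ v w) :
    ∃ (L : E ≃L[ℝ] E) (ν C r : ℝ), Metric.ball 0 r ⊆ U ∧
      IsContractingHomothety H T L μ ν C r := by
  have hUn : U ∈ 𝓝 (0 : E) := hH.isOpen.mem_nhds h0
  have hTs : ContDiffAt ℝ ∞ T 0 := hT.contDiffAt hUn
  have hTd : HasFDerivAt T (fderiv ℝ T 0) 0 := (hTs.differentiableAt (by simp)).hasFDerivAt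
  have hnorm : ∀ v, ‖fderiv ℝ T 0 v‖ = μ * ‖v‖ := by
    intro v
    have h := hhom 0 h0 v v
    rw [hT0, hH0, hH0, real_inner_self_eq_norm_sq, real_inner_self_eq_norm_sq, ← mul_pow] at h
    exact (pow_left_inj₀ (norm_nonneg _) (by positivity) two_ne_zero).1 h
  have hinj : Function.Injective (fderiv ℝ T 0).toLinearMap := by
    rw [← LinearMap.ker_eq_bot, LinearMap.ker_eq_bot']
    intro v hv
    have h := hnorm v
    rw [show fderiv ℝ T 0 v = 0 from hv, norm_zero] at h
    exact norm_eq_zero.1 ((mul_eq_zero.1 h.symm).resolve_left hμ0.ne')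
  let L : E ≃L[ℝ] E := (LinearEquiv.ofInjectiveEndo _ hinj).toContinuousLinearEquiv
  have hL : (L : E →L[ℝ] E) = fderiv ℝ T 0 := by ext; rfl
  have hL' : ∀ v, L v = fderiv ℝ T 0 v := fun v => rfl
  obtain ⟨K₁, t₁, ht₁, hK₁⟩ := ((hH.smooth.contDiffAt hUn).of_le (by simp)).exists_lipschitzOnWith
  obtain ⟨K₂, t₂, ht₂, hK₂⟩ : ∃ K, ∃ t ∈ 𝓝 (0 : E), LipschitzOnWith K
      (fun y => (L.symm : E →L[ℝ] E).comp (fderiv ℝ T y)) t := by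
    refine ContDiffAt.exists_lipschitzOnWith (𝕂 := ℝ) ?_
    have : ContDiffAt ℝ 1 (fderiv ℝ T) 0 := (hTs.fderiv_right (m := ∞) (by simp)).of_le (by simp)
    exact contDiffAt_const.clm_comp this
  obtain ⟨C, hC0, hC1, hC2⟩ : ∃ C : ℝ, 0 ≤ C ∧ (K₁ : ℝ) ≤ C ∧ (K₂ : ℝ) ≤ C :=
    ⟨max K₁ K₂, le_max_of_le_left K₁.2, le_max_left _ _, le_max_right _ _⟩
  have hcontr : ∀ᶠ y in 𝓝 (0 : E), ‖T y‖ ≤ (1 + μ) / 2 * ‖y‖ := by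
    have := hTd.isLittleO.def (show 0 < (1 - μ) / 2 by linarith)
    filter_upwards [this] with y hy
    rw [hT0, sub_zero, sub_zero] at hy
    calc ‖T y‖ = ‖(T y - fderiv ℝ T 0 y) + fderiv ℝ T 0 y‖ := by rw [sub_add_cancel]
      _ ≤ (1 - μ) / 2 * ‖y‖ + μ * ‖y‖ := (norm_add_le _ _).trans (add_le_add hy (hnorm y).le)
      _ = _ := by ring
  have hgam : ∀ᶠ y in 𝓝 (0 : E), ‖gamma H y‖ ≤ ‖gamma H 0‖ + 1 := by
    have := ((hH.contDiffOn_gamma.continuousOn.continuousAt hUn).norm).eventually_le_const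
      (show ‖gamma H 0‖ < ‖gamma H 0‖ + 1 by linarith)
    exact this
  obtain ⟨r₀, hr₀, hball⟩ := Metric.eventually_nhds_iff_ball.1
    ((eventually_mem_set.2 hUn).and ((eventually_mem_set.2 ht₁).and
      ((eventually_mem_set.2 ht₂).and (hcontr.and hgam))))
  -- The second radius ensures C r ≤ 1/2, which makes H comparable with the Euclidean product.
  set r := min r₀ (1 / (2 * (C + 1)))
  have hr : 0 < r := lt_min hr₀ (by positivity)
  have hb : ∀ y ∈ Metric.ball (0 : E) r, y ∈ Metric.ball (0 : E) r₀ :=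
    fun y hy => Metric.ball_subset_ball (min_le_left _ _) hy
  have hb0 : (0 : E) ∈ Metric.ball (0 : E) r₀ := Metric.mem_ball_self hr₀
  have hsub : Metric.ball 0 r ⊆ U := fun y hy => (hball y (hb y hy)).1
  refine ⟨L, (1 + μ) / 2, C, r, hsub,
    { r_pos := hr, μ_pos := hμ0, μ_lt := hμ1, ν_nonneg := by linarith, ν_lt := by linarith,
      riem := hH.mono hsub Metric.isOpen_ball, smooth := hT.mono hsub, map_zero := hT0,
      norm_L := hnorm, homothety := fun y hy => hhom y (hsub hy), H_zero := hH0,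
      contr := fun y hy => (hball y (hb y hy)).2.2.2.1, lip_H := ?_, C_nonneg := hC0,
      C_small := ?_, lip_T := ?_,
      bound_gamma := ⟨_, fun y hy => (hball y (hb y hy)).2.2.2.2⟩ }⟩
  · intro y hy
    have := hK₁.norm_sub_le (hball y (hb y hy)).2.1 (hball 0 hb0).2.1
    rw [sub_zero] at this
    exact this.trans (mul_le_mul_of_nonneg_right hC1 (norm_nonneg _))
  · have : r ≤ 1 / (2 * (C + 1)) := min_le_right _ _
    calc C * r ≤ (C + 1) * (1 / (2 * (C + 1))) :=
          mul_le_mul (by linarith) this hr.le (by linarith)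
      _ = 1 / 2 := by field_simp
  · intro y hy
    have := hK₂.norm_sub_le (hball y (hb y hy)).2.2.1 (hball 0 hb0).2.2.1
    have hid : (L.symm : E →L[ℝ] E).comp (fderiv ℝ T 0) = ContinuousLinearMap.id ℝ E := by
      ext v
      change L.symm (L v) = v
      simp
    rw [sub_zero, hid] at this
    exact this.trans (mul_le_mul_of_nonneg_right hC2 (norm_nonneg _))
end LocalMetric

/-- A positive definite symmetric bilinear form has an orthonormal basis. -/
theorem LinearMap.exists_equiv_inner {V : Type*} [AddCommGroup V] [Module ℝ V]
    [FiniteDimensional ℝ V] (n : ℕ) (hn : Module.finrank ℝ V = n) (B : V →ₗ[ℝ] V →ₗ[ℝ] ℝ)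
    (hs : ∀ v w, B v w = B w v) (hpos : ∀ v, v ≠ 0 → 0 < B v v) :
    ∃ A : EuclideanSpace ℝ (Fin n) ≃ₗ[ℝ] V, ∀ v w, B (A v) (A w) = inner ℝ v w := by
  let core : InnerProductSpace.Core ℝ V :=
    { inner := fun v w => B v w
      conj_inner_symm := fun v w => by simpa using hs w v
      re_inner_nonneg := fun v => by
        by_cases h : v = 0
        · simp [h]
        · exact (hpos v h).le
      add_left := fun u v w => by simp
      smul_left := fun v w r => by simp
      definite := fun v h => by
        by_contra hv
        exact (hpos v hv).ne' h }
  letI : NormedAddCommGroup V := core.toNormedAddCommGroup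
  letI : InnerProductSpace ℝ V := InnerProductSpace.ofCore core.toCore
  let b := (stdOrthonormalBasis ℝ V).reindex (finCongr hn)
  refine ⟨b.repr.symm.toLinearEquiv, fun v w => ?_⟩
  exact b.repr.symm.inner_map_map v w

namespace SmoothMetric
set_option maxSynthPendingDepth 3
variable {n : ℕ} {M : Type*} [TopologicalSpace M]
  [ChartedSpace (EuclideanSpace ℝ (Fin n)) M] [IsManifold (𝓡 n) ∞ M]
  {X : M → EuclideanSpace ℝ (Fin n)}

theorem trans_mem_maximalAtlas {c : OpenPartialHomeomorph M (EuclideanSpace ℝ (Fin n))}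
    (hc : c ∈ IsManifold.maximalAtlas (𝓡 n) ∞ M)
    {e : OpenPartialHomeomorph (EuclideanSpace ℝ (Fin n)) (EuclideanSpace ℝ (Fin n))}
    (he : ContDiffOn ℝ ∞ e e.source) (he' : ContDiffOn ℝ ∞ e.symm e.target) :
    c.trans e ∈ IsManifold.maximalAtlas (𝓡 n) ∞ M := by
  refine OpenPartialHomeomorph.mem_maximalAtlas_of_contMDiffOn _ ?_ ?_
  · exact he.contMDiffOn.comp ((contMDiffOn_of_mem_maximalAtlas hc).mono fun x hx => hx.1)
      fun x hx => hx.2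
  · exact (contMDiffOn_symm_of_mem_maximalAtlas hc).comp (he'.contMDiffOn.mono fun x hx => hx.1)
      fun x hx => hx.2

theorem frame_trans {c : OpenPartialHomeomorph M (EuclideanSpace ℝ (Fin n))}
    (hc : c ∈ IsManifold.maximalAtlas (𝓡 n) ∞ M)
    {e : OpenPartialHomeomorph (EuclideanSpace ℝ (Fin n)) (EuclideanSpace ℝ (Fin n))}
    (he' : ContDiffOn ℝ ∞ e.symm e.target) {y : EuclideanSpace ℝ (Fin n)}
    (hy : y ∈ e.target) (hy' : e.symm y ∈ c.target) (v : EuclideanSpace ℝ (Fin n)) :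
    frame (c.trans e) y v = frame c (e.symm y) (fderiv ℝ e.symm y v) := by
  have h1 : HasFDerivAt e.symm (fderiv ℝ e.symm y) y :=
    ((he'.contDiffAt (e.open_target.mem_nhds hy)).differentiableAt (by simp)).hasFDerivAt
  exact congrArg (fun B : EuclideanSpace ℝ (Fin n) →L[ℝ] EuclideanSpace ℝ (Fin n) => B v)
    ((mdifferentiableAt_chart_symm hc hy').hasMFDerivAt.comp y h1.hasMFDerivAt).mfderiv

theorem scaledForm_trans (g : SmoothMetric n M) (ψ : M → ℝ)
    {c : OpenPartialHomeomorph M (EuclideanSpace ℝ (Fin n))}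
    (hc : c ∈ IsManifold.maximalAtlas (𝓡 n) ∞ M)
    {e : OpenPartialHomeomorph (EuclideanSpace ℝ (Fin n)) (EuclideanSpace ℝ (Fin n))}
    (he' : ContDiffOn ℝ ∞ e.symm e.target) {y : EuclideanSpace ℝ (Fin n)}
    (hy : y ∈ e.target) (hy' : e.symm y ∈ c.target) (v w : EuclideanSpace ℝ (Fin n)) :
    scaledForm g ψ (c.trans e) y v w
      = scaledForm g ψ c (e.symm y) (fderiv ℝ e.symm y v) (fderiv ℝ e.symm y w) := by
  change ψ (c.symm (e.symm y)) * g.form (c.symm (e.symm y)) (frame (c.trans e) y v)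
    (frame (c.trans e) y w) = _
  rw [frame_trans hc he' hy hy', frame_trans hc he' hy hy']
  rfl

/-- Around every point there is a chart, centred at the point, in which the metric `ψ g` is standard
at the centre. -/
theorem exists_normal_chart (g : SmoothMetric n M) (ψ : M → ℝ) {p : M} (hp : 0 < ψ p) :
    ∃ c ∈ IsManifold.maximalAtlas (𝓡 n) ∞ M, p ∈ c.source ∧ c p = 0 ∧
      ∀ v w, scaledForm g ψ c 0 v w = inner ℝ v w := by
  set c := chartAt (EuclideanSpace ℝ (Fin n)) p with hcdef
  have hc : c ∈ IsManifold.maximalAtlas (𝓡 n) ∞ M := IsManifold.chart_mem_maximalAtlas p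
  have hpc : p ∈ c.source := mem_chart_source _ p
  have hform := isRiemannianOn_chartForm hc g
  have hcp := c.map_source hpc
  -- An orthonormal basis of ψg at p; a translation and the inverse of A normalize the chart.
  obtain ⟨A, hA⟩ := LinearMap.exists_equiv_inner n (finrank_euclideanSpace_fin)
    (ψ p • (ContinuousLinearMap.coeLM ℝ).comp (g.chartForm c (c p)).toLinearMap)
    (fun v w => congrArg (ψ p * ·) (hform.symm _ hcp v w))
    (fun v hv => mul_pos hp (hform.pos _ hcp v hv))
  let e : OpenPartialHomeomorph (EuclideanSpace ℝ (Fin n)) (EuclideanSpace ℝ (Fin n)) :=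
    ((Homeomorph.subRight (c p)).trans
      A.symm.toContinuousLinearEquiv.toHomeomorph).toOpenPartialHomeomorph
  have he : ∀ y, e y = A.symm.toContinuousLinearEquiv (y - c p) := fun y => rfl
  have he' : ∀ y, e.symm y = A.toContinuousLinearEquiv y + c p := fun y => rfl
  have hes : ContDiff ℝ ∞ e := by
    have := A.symm.toContinuousLinearEquiv.contDiff (n := ∞)
    exact this.comp (contDiff_id.sub contDiff_const)
  have hes' : ContDiff ℝ ∞ e.symm :=
    (A.toContinuousLinearEquiv.contDiff (n := ∞)).add contDiff_const
  refine ⟨c.trans e, trans_mem_maximalAtlas hc hes.contDiffOn hes'.contDiffOn, ?_, ?_, ?_⟩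
  · exact ⟨hpc, mem_univ _⟩
  · change e (c p) = 0
    rw [he, sub_self, map_zero]
  · intro v w
    have h0 : e.symm 0 = c p := by rw [he', map_zero, zero_add]
    have hd : ∀ v, fderiv ℝ e.symm 0 v = A v := by
      intro v
      have : HasFDerivAt e.symm (A.toContinuousLinearEquiv : EuclideanSpace ℝ (Fin n) →L[ℝ] _) 0 :=
        A.toContinuousLinearEquiv.hasFDerivAt.add_const (c p)
      rw [this.fderiv]
      rfl
    rw [scaledForm_trans g ψ hc hes'.contDiffOn (mem_univ _) (by rw [h0]; exact hcp), hd, hd, h0,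
      ← hA v w]
    change ψ (c.symm (c p)) * _ = ψ p * _
    rw [c.left_inv hpc]
    rfl

theorem tder_chart {T : M → M} (hT : ContMDiff (𝓡 n) (𝓡 n) ∞ T)
    {c c' : OpenPartialHomeomorph M (EuclideanSpace ℝ (Fin n))}
    (hc : c ∈ IsManifold.maximalAtlas (𝓡 n) ∞ M) (hc' : c' ∈ IsManifold.maximalAtlas (𝓡 n) ∞ M)
    {y : EuclideanSpace ℝ (Fin n)}
    (hy : y ∈ c.target) (hy' : T (c.symm y) ∈ c'.source) (v : EuclideanSpace ℝ (Fin n)) :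
    fderiv ℝ (fun y => c' (T (c.symm y))) y v
      = coframe c' (T (c.symm y)) (tder T (c.symm y) (frame c y v)) := by
  have h := (mdifferentiableAt_chart hc' hy').hasMFDerivAt.comp y
    ((hT.mdifferentiable (by simp) _).hasMFDerivAt.comp y
      (mdifferentiableAt_chart_symm hc hy).hasMFDerivAt)
  have h2 := h.mfderiv
  rw [mfderiv_eq_fderiv] at h2
  exact congrArg (fun B : EuclideanSpace ℝ (Fin n) →L[ℝ] EuclideanSpace ℝ (Fin n) => B v) h2

theorem contDiffOn_chart_comp {T : M → M} (hT : ContMDiff (𝓡 n) (𝓡 n) ∞ T)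
    {c c' : OpenPartialHomeomorph M (EuclideanSpace ℝ (Fin n))}
    (hc : c ∈ IsManifold.maximalAtlas (𝓡 n) ∞ M) (hc' : c' ∈ IsManifold.maximalAtlas (𝓡 n) ∞ M) :
    ContDiffOn ℝ ∞ (fun y => c' (T (c.symm y))) (c.target ∩ c.symm ⁻¹' (T ⁻¹' c'.source)) := by
  rw [← contMDiffOn_iff_contDiffOn]
  exact (contMDiffOn_of_mem_maximalAtlas hc').comp
    (hT.comp_contMDiffOn ((contMDiffOn_symm_of_mem_maximalAtlas hc).mono inter_subset_left))
    fun y hy => hy.2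

theorem scaledForm_map {T : M → M} (hT : ContMDiff (𝓡 n) (𝓡 n) ∞ T) (g : SmoothMetric n M)
    (ψ : M → ℝ) {c c' : OpenPartialHomeomorph M (EuclideanSpace ℝ (Fin n))}
    (hc : c ∈ IsManifold.maximalAtlas (𝓡 n) ∞ M) (hc' : c' ∈ IsManifold.maximalAtlas (𝓡 n) ∞ M)
    {y : EuclideanSpace ℝ (Fin n)}
    (hy : y ∈ c.target) (hy' : T (c.symm y) ∈ c'.source) (v w : EuclideanSpace ℝ (Fin n)) :
    scaledForm g ψ c' (c' (T (c.symm y))) (fderiv ℝ (fun y => c' (T (c.symm y))) y v)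
      (fderiv ℝ (fun y => c' (T (c.symm y))) y w)
      = ψ (T (c.symm y)) * g.form (T (c.symm y)) (tder T (c.symm y) (frame c y v))
        (tder T (c.symm y) (frame c y w)) := by
  rw [tder_chart hT hc hc' hy hy', tder_chart hT hc hc' hy hy']
  change ψ (c'.symm (c' (T (c.symm y)))) * g.form (c'.symm (c' (T (c.symm y))))
    (frame c' _ _) (frame c' _ _) = _
  rw [c'.left_inv hy', frame_coframe hc' hy', frame_coframe hc' hy']

/-- A contracting homothety of `ψ g` is linear in a suitable chart around a fixed point, and `ψ g` is
flat there. -/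
theorem exists_linearizing_chart {g : SmoothMetric n M} {ψ : M → ℝ} {O : Set M} (hO : IsOpen O)
    (hψ : ContMDiffOn (𝓡 n) 𝓘(ℝ) ∞ ψ O) (hpos : ∀ x ∈ O, 0 < ψ x)
    {T : M → M} (hT : ContMDiff (𝓡 n) (𝓡 n) ∞ T) {μ : ℝ} (hμ0 : 0 < μ) (hμ1 : μ < 1)
    (hhom : ∀ x ∈ O, ∀ v w, ψ (T x) * g.form (T x) (tder T x v) (tder T x w)
      = μ ^ 2 * (ψ x * g.form x v w))
    {p : M} (hp : p ∈ O) (hTp : T p = p) :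
    ∃ c ∈ IsManifold.maximalAtlas (𝓡 n) ∞ M, ∃ ρ > 0,
      ∃ L : EuclideanSpace ℝ (Fin n) ≃L[ℝ] EuclideanSpace ℝ (Fin n),
      p ∈ c.source ∧ c p = 0 ∧ c.source ⊆ O ∧ c.target = Metric.ball 0 ρ ∧
      (∀ v, ‖L v‖ = μ * ‖v‖) ∧ (∀ x ∈ c.source, T x ∈ c.source ∧ c (T x) = L (c x)) ∧
      ∀ y ∈ Metric.ball (0 : EuclideanSpace ℝ (Fin n)) ρ, ∀ v w,
        scaledForm g ψ c y v w = inner ℝ v w := by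
  obtain ⟨c, hc, hpc, hcp, hc0⟩ := exists_normal_chart g ψ (hpos p hp)
  have hcs0 : c.symm 0 = p := by rw [← hcp, c.left_inv hpc]
  have h0c : (0 : EuclideanSpace ℝ (Fin n)) ∈ c.target := hcp ▸ c.map_source hpc
  -- The points whose image under T is still covered by the same chart, so that T has a coordinate
  -- expression there.
  let U : Set (EuclideanSpace ℝ (Fin n)) := c.target ∩ c.symm ⁻¹' (O ∩ T ⁻¹' c.source)
  have hUo : IsOpen (O ∩ T ⁻¹' c.source) := hO.inter (c.open_source.preimage hT.continuous)
  have h0U : (0 : EuclideanSpace ℝ (Fin n)) ∈ U :=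
    ⟨h0c, by rw [mem_preimage, hcs0]; exact ⟨hp, by rw [mem_preimage, hTp]; exact hpc⟩⟩
  have hH : LocalMetric.IsRiemannianOn (scaledForm g ψ c) U :=
    (isRiemannianOn_scaledForm g hc hO hψ hpos).mono
      (fun y hy => ⟨hy.1, hy.2.1⟩) (isOpen_inter_symm_preimage c hUo)
  obtain ⟨L, ν, C, r, hr, hL⟩ := LocalMetric.exists_isContractingHomothety hH h0U
    ((contDiffOn_chart_comp hT hc hc).mono fun y hy => ⟨hy.1, hy.2.2⟩)
    (by rw [hcs0, hTp, hcp]) hμ0 hμ1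
    (fun y hy v w => by
      rw [scaledForm_map hT g ψ hc hc hy.1 hy.2.2, hhom _ hy.2.1]
      rfl) hc0
  obtain ⟨e, ρ, hρ, he0, he00, hes, het, hesm, hesm', heT, heH⟩ := hL.exists_linearizing_chart
  have hsub : e.source ⊆ U := hes.trans hr
  have htarget : (c.trans e).target = Metric.ball 0 ρ := by
    rw [OpenPartialHomeomorph.trans_target, het]
    refine inter_eq_left.2 fun y hy => ?_
    exact (hsub (e.map_target (het ▸ hy))).1
  have hmem : ∀ x, x ∈ (c.trans e).source ↔ x ∈ c.source ∧ c x ∈ e.source := fun x => Iff.rfl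
  refine ⟨c.trans e, trans_mem_maximalAtlas hc hesm hesm', ρ, hρ, L, (hmem p).2 ⟨hpc, ?_⟩, ?_, ?_,
    htarget, hL.norm_L, ?_, ?_⟩
  · rw [hcp]; exact he0
  · change e (c p) = 0
    rw [hcp, he00]
  · intro x hx
    obtain ⟨hx1, hx2⟩ := (hmem x).1 hx
    have := (hsub hx2).2.1
    rwa [c.left_inv hx1] at this
  · intro x hx
    obtain ⟨hx1, hx2⟩ := (hmem x).1 hx
    have h1 := (hsub hx2).2.2
    have h2 := heT _ hx2
    rw [c.left_inv hx1] at h1 h2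
    exact ⟨(hmem _).2 ⟨h1, h2.1⟩, h2.2⟩
  · intro y hy v w
    have hyt : y ∈ e.target := het ▸ hy
    have hys := e.map_target hyt
    rw [scaledForm_trans g ψ hc hesm' hyt (hsub hys).1, ← heH _ hys]
    have hd : ∀ v, fderiv ℝ e (e.symm y) (fderiv ℝ e.symm y v) = v := by
      intro v
      have h1 : HasFDerivAt e.symm (fderiv ℝ e.symm y) y :=
        ((hesm'.contDiffAt (e.open_target.mem_nhds hyt)).differentiableAt (by simp)).hasFDerivAt
      have h2 : HasFDerivAt e (fderiv ℝ e (e.symm y)) (e.symm y) :=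
        ((hesm.contDiffAt (e.open_source.mem_nhds hys)).differentiableAt (by simp)).hasFDerivAt
      have h3 : HasFDerivAt (fun y => e (e.symm y)) (ContinuousLinearMap.id ℝ _) y := by
        refine (hasFDerivAt_id y).congr_of_eventuallyEq ?_
        filter_upwards [e.open_target.mem_nhds hyt] with z hz using e.right_inv hz
      exact congrArg (fun B : EuclideanSpace ℝ (Fin n) →L[ℝ] EuclideanSpace ℝ (Fin n) => B v)
        ((h2.comp y h1).unique h3)
    rw [hd, hd]
end SmoothMetric

theorem LinearMap.inner_map_map_of_norm {E : Type*} [NormedAddCommGroup E] [InnerProductSpace ℝ E]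
    (A : E →ₗ[ℝ] E) {a : ℝ} (h : ∀ v, ‖A v‖ = a * ‖v‖) (v w : E) :
    inner ℝ (A v) (A w) = a ^ 2 * inner ℝ v w := by
  rw [real_inner_eq_norm_add_mul_self_sub_norm_mul_self_sub_norm_mul_self_div_two,
    real_inner_eq_norm_add_mul_self_sub_norm_mul_self_sub_norm_mul_self_div_two v w, ← map_add,
    h, h, h]
  ring

namespace SmoothMetric
set_option maxSynthPendingDepth 3
variable {n : ℕ} {M : Type*} [TopologicalSpace M]
  [ChartedSpace (EuclideanSpace ℝ (Fin n)) M] [IsManifold (𝓡 n) ∞ M]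
  {X : M → EuclideanSpace ℝ (Fin n)} [T2Space M]

/-- The basin of attraction of a fixed point of a contracting homothetic flow is flat. -/
theorem IsFlow.exists_basin_chart {g : SmoothMetric n M} {ψ : M → ℝ} {O : Set M} {κ : ℝ}
    {φ : ℝ → M → M} (hφ : IsFlow X φ) (h : IsHomotheticField g ψ O X κ) (hκ : 0 < κ)
    (hO : ∀ x ∈ O, ∀ t, φ t x ∈ O) {p : M} (hp : p ∈ O) (hpf : ∀ t, φ t p = p) :
    ∃ B ∈ IsManifold.maximalAtlas (𝓡 n) ∞ M, B.target = univ ∧ B.source ⊆ O ∧ p ∈ B.source ∧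
      B p = 0 ∧ (∀ q, q ∈ B.source ↔ Tendsto (fun k : ℕ => φ k q) atTop (𝓝 p)) ∧
      ∀ y v w, scaledForm g ψ B y v w = inner ℝ v w := by
  have hX := h.field
  have hadd := hφ.add hX
  have hsm := hφ.contMDiff hX
  -- The time-one map scales ψg by e^{-2κ} = μ².
  set μ : ℝ := Real.exp (-κ) with hμ
  have hμ0 : 0 < μ := Real.exp_pos _
  have hμ1 : μ < 1 := by
    rw [hμ, ← Real.exp_zero]; exact Real.exp_lt_exp.2 (by linarith)
  obtain ⟨c, hc, ρ, hρ, L, hpc, hcp, hcO, hct, hLn, hcL, hflat⟩ := exists_linearizing_chart h.isOpen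
    h.smooth h.pos (hsm 1) hμ0 hμ1
    (fun x hx v w => by
      rw [hφ.homothety h hO hx, hμ, ← Real.exp_nat_mul]; congr 2; push_cast; ring) hp (hpf 1)
  have hfwd : ∀ x ∈ c.source, ∀ j : ℕ, φ j x ∈ c.source ∧ c (φ j x) = L^[j] (c x) := by
    intro x hx j
    induction j with
    | zero => simp [hφ.zero, hx]
    | succ j ih =>
      have h1 : φ ((j + 1 : ℕ) : ℝ) x = φ 1 (φ j x) := by
        rw [← hadd]; congr 1; push_cast; ring
      rw [h1, Function.iterate_succ_apply', ← ih.2]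
      exact hcL _ ih.1
  have hneg : ∀ t x, φ (-t) (φ t x) = x := fun t x => by rw [← hadd, neg_add_cancel, hφ.zero]
  have hneg' : ∀ t x, φ t (φ (-t) x) = x := fun t x => by rw [← hadd, add_neg_cancel, hφ.zero]
  have hsplit : ∀ (k l : ℕ) x, k ≤ l → φ l x = φ ((l - k : ℕ) : ℝ) (φ k x) := fun k l x hkl => by
    rw [← hadd]; congr 1; rw [Nat.cast_sub hkl]; ring
  have hLnk : ∀ (k : ℕ) x, ‖L^[k] x‖ = μ ^ k * ‖x‖ := by
    intro k x
    induction k with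
    | zero => simp
    | succ k ih => rw [Function.iterate_succ_apply', hLn, ih]; ring
  have hpow : ∀ (k : ℕ), ⇑((L : EuclideanSpace ℝ (Fin n) →L[ℝ] EuclideanSpace ℝ (Fin n)) ^ k)
      = L^[k] := by
    intro k
    induction k with
    | zero => rfl
    | succ k ih =>
      ext1 x
      rw [pow_succ, ContinuousLinearMap.mul_apply, ih]
      rfl
  have hLl : ∀ k : ℕ, Function.LeftInverse L.symm^[k] L^[k] := fun k =>
    Function.LeftInverse.iterate L.symm_apply_apply k
  have hLr : ∀ k : ℕ, Function.LeftInverse L^[k] L.symm^[k] := fun k =>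
    Function.LeftInverse.iterate L.apply_symm_apply k
  have htend : ∀ x, Tendsto (fun k : ℕ => L^[k] x) atTop (𝓝 0) := by
    intro x
    rw [tendsto_zero_iff_norm_tendsto_zero]
    simp only [hLnk]
    simpa using (tendsto_pow_atTop_nhds_zero_of_lt_one hμ0.le hμ1).mul_const ‖x‖
  let W : Set M := {q | ∃ k : ℕ, φ k q ∈ c.source}
  -- The candidate L⁻ᵏ c(φ_k q) does not depend on k since c conjugates φ₁ to L. One value thus
  -- serves all admissible k, and smoothness near a point can be tested with a fixed k.
  have hbex : ∀ q, ∃ z : EuclideanSpace ℝ (Fin n), ∀ k : ℕ, φ k q ∈ c.source →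
      z = L.symm^[k] (c (φ k q)) := by
    intro q
    by_cases hq : ∃ k : ℕ, φ k q ∈ c.source
    · obtain ⟨k, hk⟩ := hq
      have key : ∀ k l : ℕ, k ≤ l → φ k q ∈ c.source →
          L.symm^[k] (c (φ k q)) = L.symm^[l] (c (φ l q)) := by
        intro k l hkl hk
        rw [hsplit k l q hkl, (hfwd _ hk (l - k)).2]
        obtain ⟨j, rfl⟩ := Nat.exists_eq_add_of_le hkl
        rw [Nat.add_sub_cancel_left, Function.iterate_add_apply, hLl]
      refine ⟨L.symm^[k] (c (φ k q)), fun l hl => ?_⟩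
      rcases le_total k l with hkl | hkl
      · exact key k l hkl hk
      · exact (key l k hkl hl).symm
    · exact ⟨0, fun k hk => (hq ⟨k, hk⟩).elim⟩
  choose b hb using hbex
  -- The inverse: L contracts any x into the ball `c.target`, and flowing back by time k undoes
  -- this. Hence the extended chart is onto all of ℝⁿ.
  have hiex : ∀ x : EuclideanSpace ℝ (Fin n), ∃ q : M, ∀ k : ℕ, L^[k] x ∈ c.target →
      q = φ (-k) (c.symm (L^[k] x)) := by
    intro x
    have key : ∀ k l : ℕ, k ≤ l → L^[k] x ∈ c.target →
        φ (-k) (c.symm (L^[k] x)) = φ (-l) (c.symm (L^[l] x)) := by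
      intro k l hkl hk
      obtain ⟨j, rfl⟩ := Nat.exists_eq_add_of_le hkl
      have h1 := hfwd _ (c.map_target hk) j
      rw [c.right_inv hk] at h1
      have h2 : c.symm (L^[k + j] x) = φ j (c.symm (L^[k] x)) := by
        rw [add_comm k j, Function.iterate_add_apply, ← h1.2, c.left_inv h1.1]
      rw [h2, ← hadd]
      congr 1; push_cast; ring
    have hex : ∃ k : ℕ, L^[k] x ∈ c.target := by
      have := (htend x).eventually_mem (hct ▸ Metric.ball_mem_nhds _ hρ : c.target ∈ 𝓝 0)
      exact this.exists
    obtain ⟨k, hk⟩ := hex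
    refine ⟨φ (-k) (c.symm (L^[k] x)), fun l hl => ?_⟩
    rcases le_total k l with hkl | hkl
    · exact key k l hkl hk
    · exact (key l k hkl hl).symm
  choose a ha using hiex
  have hex : ∀ x : EuclideanSpace ℝ (Fin n), ∃ k : ℕ, L^[k] x ∈ c.target := fun x =>
    ((htend x).eventually_mem (hct ▸ Metric.ball_mem_nhds _ hρ : c.target ∈ 𝓝 0)).exists
  have hφa : ∀ (x : EuclideanSpace ℝ (Fin n)) (k : ℕ), L^[k] x ∈ c.target →
      φ k (a x) = c.symm (L^[k] x) := fun x k hk => by rw [ha x k hk, hneg']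
  have hLsm : ∀ k : ℕ, ContDiff ℝ ∞ L^[k] := fun k => by
    induction k with
    | zero => exact contDiff_id
    | succ k ih => exact ih.comp L.contDiff
  have hLsm' : ∀ k : ℕ, ContDiff ℝ ∞ L.symm^[k] := fun k => by
    induction k with
    | zero => exact contDiff_id
    | succ k ih => exact ih.comp L.symm.contDiff
  have hsource : ∀ k : ℕ, IsOpen {q | φ k q ∈ c.source} := fun k =>
    c.open_source.preimage (hsm k).continuous
  have hbsm : ContMDiffOn (𝓡 n) (𝓡 n) ∞ b W := by
    rintro q ⟨k, hk⟩
    have h1 : ContMDiffAt (𝓡 n) (𝓡 n) ∞ (fun q => L.symm^[k] (c (φ k q))) q :=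
      (hLsm' k).contMDiff.contMDiffAt.comp q
        (((contMDiffOn_of_mem_maximalAtlas hc).contMDiffAt (c.open_source.mem_nhds hk)).comp q
          (hsm k q))
    refine (h1.congr_of_eventuallyEq ?_).contMDiffWithinAt
    filter_upwards [(hsource k).mem_nhds hk] with q' hq' using hb q' k hq'
  have htarget : ∀ k : ℕ, IsOpen {x | L^[k] x ∈ c.target} := fun k =>
    c.open_target.preimage (hLsm k).continuous
  have hasm : ContMDiff (𝓡 n) (𝓡 n) ∞ a := by
    intro x
    obtain ⟨k, hk⟩ := hex x
    have h1 : ContMDiffAt (𝓡 n) (𝓡 n) ∞ (fun x => φ (-k) (c.symm (L^[k] x))) x :=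
      (hsm (-k) _).comp x
        (((contMDiffOn_symm_of_mem_maximalAtlas hc).contMDiffAt (c.open_target.mem_nhds hk)).comp x
          (hLsm k).contMDiff.contMDiffAt)
    refine h1.congr_of_eventuallyEq ?_
    filter_upwards [(htarget k).mem_nhds hk] with x' hx' using ha x' k hx'
  have hWo : IsOpen W := by
    have : W = ⋃ k : ℕ, {q | φ k q ∈ c.source} := by ext; simp [W]
    rw [this]
    exact isOpen_iUnion hsource
  let B : OpenPartialHomeomorph M (EuclideanSpace ℝ (Fin n)) :=
    { toFun := b
      invFun := a
      source := W
      target := univ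
      map_source' := fun _ _ => mem_univ _
      map_target' := fun x _ => by
        obtain ⟨k, hk⟩ := hex x
        exact ⟨k, by rw [hφa x k hk]; exact c.map_target hk⟩
      left_inv' := by
        rintro q ⟨k, hk⟩
        have h1 : L^[k] (b q) = c (φ k q) := by rw [hb q k hk, hLr]
        rw [ha (b q) k (by rw [h1]; exact c.map_source hk), h1, c.left_inv hk, hneg]
      right_inv' := fun x _ => by
        obtain ⟨k, hk⟩ := hex x
        have h1 := hφa x k hk
        rw [hb (a x) k (by rw [h1]; exact c.map_target hk), h1, c.right_inv hk, hLl]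
      open_source := hWo
      open_target := isOpen_univ
      continuousOn_toFun := hbsm.continuousOn
      continuousOn_invFun := hasm.continuous.continuousOn }
  have hpW : φ ((0 : ℕ) : ℝ) p ∈ c.source := by rw [hpf]; exact hpc
  have hcs0 : c.symm 0 = p := by rw [← hcp, c.left_inv hpc]
  refine ⟨B, B.mem_maximalAtlas_of_contMDiffOn hbsm hasm.contMDiffOn, rfl, ?_, ⟨0, hpW⟩, ?_, ?_, ?_⟩
  · rintro q ⟨k, hk⟩
    have := hO _ (hcO hk) (-k)
    rwa [hneg] at this
  · change b p = 0
    rw [hb p 0 hpW, hpf, hcp]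
    rfl
  · intro q
    constructor
    · rintro ⟨k, hk⟩
      rw [← tendsto_add_atTop_iff_nat k]
      have h1 : ∀ j : ℕ, φ ((j + k : ℕ) : ℝ) q = c.symm (L^[j] (c (φ k q))) := by
        intro j
        have h2 := hfwd _ hk j
        rw [← h2.2, c.left_inv h2.1, ← hadd]
        congr 1; push_cast; ring
      simp only [h1]
      have h2 : ContinuousAt c.symm 0 :=
        c.continuousAt_symm (by rw [hct]; exact Metric.mem_ball_self hρ)
      have h3 : Tendsto c.symm (𝓝 0) (𝓝 p) := by
        have := h2.tendsto
        rwa [hcs0] at this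
      exact h3.comp (htend _)
    · intro ht
      exact (ht.eventually_mem (c.open_source.mem_nhds hpc)).exists
  · intro y v w
    obtain ⟨k, hk⟩ := hex y
    set z := c.symm (L^[k] y) with hz
    have hd : HasFDerivAt L^[k] ((L : EuclideanSpace ℝ (Fin n) →L[ℝ] EuclideanSpace ℝ (Fin n)) ^ k)
        y := by
      have := ((L : EuclideanSpace ℝ (Fin n) →L[ℝ] EuclideanSpace ℝ (Fin n)) ^ k).hasFDerivAt (x := y)
      rwa [hpow] at this
    have h1 := ((hsm (-k)).mdifferentiable (by simp) z).hasMFDerivAt.comp y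
      ((mdifferentiableAt_chart_symm hc hk).hasMFDerivAt.comp y hd.hasMFDerivAt)
    have hev : a =ᶠ[𝓝 y] fun x => φ (-k) (c.symm (L^[k] x)) := by
      filter_upwards [(htarget k).mem_nhds hk] with x' hx' using ha x' k hx'
    have h2 : ∀ v, frame B y v = tder (φ (-k)) z (frame c (L^[k] y) (L^[k] v)) := fun v => by
      have := congrArg (fun B : EuclideanSpace ℝ (Fin n) →L[ℝ] EuclideanSpace ℝ (Fin n) => B v)
        (h1.congr_of_eventuallyEq hev).mfderiv
      refine Eq.trans this ?_
      change tder (φ (-k)) z (frame c (L^[k] y)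
        (((L : EuclideanSpace ℝ (Fin n) →L[ℝ] EuclideanSpace ℝ (Fin n)) ^ k) v)) = _
      rw [hpow]
    have hLin : ∀ v w, inner ℝ (L^[k] v) (L^[k] w) = (μ ^ k) ^ 2 * inner ℝ v w := by
      intro v w
      have := LinearMap.inner_map_map_of_norm
        (((L : EuclideanSpace ℝ (Fin n) →L[ℝ] EuclideanSpace ℝ (Fin n)) ^ k).toLinearMap)
        (a := μ ^ k) (fun v => by
          rw [ContinuousLinearMap.coe_coe, hpow]; exact hLnk k v) v w
      rwa [ContinuousLinearMap.coe_coe, hpow] at this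
    change ψ (a y) * g.form (a y) (frame B y v) (frame B y w) = _
    have hzO : z ∈ O := hcO (c.map_target hk)
    rw [h2, h2, ha y k hk, hφ.homothety h hO hzO]
    have h3 := hflat (L^[k] y) (hct ▸ hk) (L^[k] v) (L^[k] w)
    change ψ z * g.form z (frame c (L^[k] y) (L^[k] v)) (frame c (L^[k] y) (L^[k] w)) = _ at h3
    rw [h3, hLin, ← mul_assoc]
    -- The backward flow expands ψg by e^{2κk}, which is exactly what Lᵏ contracted, so flatness
    -- near p spreads over the basin without any factor.
    have : Real.exp (-2 * κ * -k) * (μ ^ k) ^ 2 = 1 := by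
      rw [hμ, ← Real.exp_nat_mul, ← Real.exp_nat_mul, ← Real.exp_add]
      push_cast
      rw [show -2 * κ * -(k : ℝ) + 2 * (k * -κ) = 0 by ring, Real.exp_zero]
    rw [this, one_mul]

end SmoothMetric

/-! ### Gradients and functions with ∇²u = f g -/

namespace SmoothMetric
set_option maxSynthPendingDepth 3
variable {n : ℕ} {M : Type*} [TopologicalSpace M]
  [ChartedSpace (EuclideanSpace ℝ (Fin n)) M]

/-- The differential of a function, as a functional on the model space. -/
def du (u : M → ℝ) (x : M) : EuclideanSpace ℝ (Fin n) →L[ℝ] ℝ := mfderiv (𝓡 n) 𝓘(ℝ) u x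

variable [IsManifold (𝓡 n) ∞ M] {u f : M → ℝ} {X : M → EuclideanSpace ℝ (Fin n)}
  {g : SmoothMetric n M} {c : OpenPartialHomeomorph M (EuclideanSpace ℝ (Fin n))}

theorem contDiffOn_comp_symm' (hc : c ∈ IsManifold.maximalAtlas (𝓡 n) ∞ M)
    (hu : ContMDiff (𝓡 n) 𝓘(ℝ) ∞ u) : ContDiffOn ℝ ∞ (u ∘ c.symm) c.target :=
  (contDiffOn_comp_symm hc (hu.contMDiffOn (s := univ))).mono fun _ hy => ⟨hy, mem_univ _⟩

theorem fderiv_comp_symm (hc : c ∈ IsManifold.maximalAtlas (𝓡 n) ∞ M)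
    (hu : ContMDiff (𝓡 n) 𝓘(ℝ) ∞ u) {y : EuclideanSpace ℝ (Fin n)} (hy : y ∈ c.target)
    (v : EuclideanSpace ℝ (Fin n)) :
    fderiv ℝ (u ∘ c.symm) y v = du u (c.symm y) (frame c y v) := by
  have h := (((hu.mdifferentiable (by simp)) (c.symm y)).hasMFDerivAt.comp y
    (mdifferentiableAt_chart_symm hc hy).hasMFDerivAt).mfderiv
  rw [mfderiv_eq_fderiv] at h
  exact congrArg (fun B : EuclideanSpace ℝ (Fin n) →L[ℝ] ℝ => B v) h

theorem form_pos (g : SmoothMetric n M) (x : M) {v : EuclideanSpace ℝ (Fin n)} (hv : v ≠ 0) :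
    0 < g.form x v v := g.pos x v hv

theorem form_symm (g : SmoothMetric n M) (x : M) (v w : EuclideanSpace ℝ (Fin n)) :
    g.form x v w = g.form x w v := g.symm x v w

theorem exists_form_equiv (g : SmoothMetric n M) (x : M) :
    ∃ e : EuclideanSpace ℝ (Fin n) ≃L[ℝ] (EuclideanSpace ℝ (Fin n) →L[ℝ] ℝ),
      (e : EuclideanSpace ℝ (Fin n) →L[ℝ] EuclideanSpace ℝ (Fin n) →L[ℝ] ℝ) = g.form x :=
  LocalMetric.IsRiemannianOn.exists_equiv (H := fun _ => g.form x) (Ω := univ) (y := 0)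
    ⟨isOpen_univ, contDiffOn_const, fun _ _ => g.form_symm x, fun _ _ _ => g.form_pos x⟩ (mem_univ _)

/-- The gradient of a function. -/
def gradient (g : SmoothMetric n M) (u : M → ℝ) (x : M) : EuclideanSpace ℝ (Fin n) :=
  (g.form x).inverse (du u x)

theorem form_gradient (g : SmoothMetric n M) (u : M → ℝ) (x : M) :
    g.form x (g.gradient u x) = du u x := by
  obtain ⟨e, he⟩ := g.exists_form_equiv x
  rw [gradient, ← he, ContinuousLinearMap.inverse_equiv]
  exact e.apply_symm_apply _

theorem chartForm_push_gradient (hc : c ∈ IsManifold.maximalAtlas (𝓡 n) ∞ M)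
    (hu : ContMDiff (𝓡 n) 𝓘(ℝ) ∞ u) {y : EuclideanSpace ℝ (Fin n)} (hy : y ∈ c.target) :
    g.chartForm c y (push c (g.gradient u) y) = fderiv ℝ (u ∘ c.symm) y := by
  ext v
  rw [fderiv_comp_symm hc hu hy, ← form_gradient]
  change g.form (c.symm y) (frame c y (push c (g.gradient u) y)) (frame c y v) = _
  rw [frame_push hc hy]

theorem isSmoothField_gradient (g : SmoothMetric n M) (hu : ContMDiff (𝓡 n) 𝓘(ℝ) ∞ u) :
    IsSmoothField (g.gradient u) := by
  intro c hc
  have hH := isRiemannianOn_chartForm hc g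
  have h1 : ContDiffOn ℝ ∞ (fun y => (g.chartForm c y).inverse (fderiv ℝ (u ∘ c.symm) y))
      c.target := by
    intro y hy
    obtain ⟨e, he⟩ := hH.exists_equiv hy
    have hinv : ContDiffAt ℝ ∞ (fun y => (g.chartForm c y).inverse) y := by
      have h2 := contDiffAt_map_inverse (𝕜 := ℝ) (n := ∞) e
      rw [he] at h2
      exact h2.comp y (hH.smooth.contDiffAt (c.open_target.mem_nhds hy))
    exact (hinv.clm_apply (((contDiffOn_comp_symm' hc hu).fderiv_of_isOpen (m := ∞) c.open_target
      (by simp)).contDiffAt (c.open_target.mem_nhds hy))).contDiffWithinAt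
  refine h1.congr fun y hy => ?_
  obtain ⟨e, he⟩ := hH.exists_equiv hy
  rw [← chartForm_push_gradient (g := g) hc hu hy, ← he, ContinuousLinearMap.inverse_equiv]
  exact (e.symm_apply_apply _).symm

/-- `∇²u = f g`. -/
structure IsConcircular (g : SmoothMetric n M) (u f : M → ℝ) : Prop where
  smooth : ContMDiff (𝓡 n) 𝓘(ℝ) ∞ u
  hess : ∀ c ∈ IsManifold.maximalAtlas (𝓡 n) ∞ M, ∀ y ∈ c.target, ∀ v w,
    fderiv ℝ (fderiv ℝ (u ∘ c.symm)) y v w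
      - 1 / 2 * LocalMetric.koszul (g.chartForm c) y v w (push c (g.gradient u) y)
      = f (c.symm y) * g.chartForm c y v w

namespace IsConcircular

variable (h : IsConcircular g u f) (hc : c ∈ IsManifold.maximalAtlas (𝓡 n) ∞ M)
  {y : EuclideanSpace ℝ (Fin n)} (hy : y ∈ c.target)
include h hc hy

/-- Differentiate the defining relation g(∇u, ·) = du in coordinates. -/
theorem chartForm_fderiv_push (v w : EuclideanSpace ℝ (Fin n)) :
    g.chartForm c y (fderiv ℝ (push c (g.gradient u)) y v) w
      = fderiv ℝ (fderiv ℝ (u ∘ c.symm)) y v w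
        - fderiv ℝ (g.chartForm c) y v (push c (g.gradient u) y) w := by
  have hn := c.open_target.mem_nhds hy
  have hH : DifferentiableAt ℝ (g.chartForm c) y :=
    ((contDiffOn_chartForm hc g).contDiffAt hn).differentiableAt (by simp)
  have hF : DifferentiableAt ℝ (push c (g.gradient u)) y :=
    ((isSmoothField_gradient g h.smooth c hc).contDiffAt hn).differentiableAt (by simp)
  have h1 : (fun y => g.chartForm c y (push c (g.gradient u) y)) =ᶠ[𝓝 y] fderiv ℝ (u ∘ c.symm) := by
    filter_upwards [hn] with z hz using chartForm_push_gradient hc h.smooth hz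
  rw [← h1.fderiv_eq, (hH.hasFDerivAt.clm_apply hF.hasFDerivAt).fderiv]
  simp

/-- `L_{∇u} g = 2 f g`. -/
theorem lie_chartForm (v w : EuclideanSpace ℝ (Fin n)) :
    fderiv ℝ (g.chartForm c) y (push c (g.gradient u) y) v w
      + g.chartForm c y (fderiv ℝ (push c (g.gradient u)) y v) w
      + g.chartForm c y v (fderiv ℝ (push c (g.gradient u)) y w)
      = 2 * f (c.symm y) * g.chartForm c y v w := by
  have hn := c.open_target.mem_nhds hy
  have hH := isRiemannianOn_chartForm hc g
  have hs : ∀ a v w, fderiv ℝ (g.chartForm c) y a v w = fderiv ℝ (g.chartForm c) y a w v := by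
    intro a v w
    have hHd : DifferentiableAt ℝ (g.chartForm c) y :=
      (hH.smooth.contDiffAt hn).differentiableAt (by simp)
    have h1 : ∀ v w, fderiv ℝ (fun z => g.chartForm c z v w) y a
        = fderiv ℝ (g.chartForm c) y a v w := fun v w => by
      rw [((hHd.hasFDerivAt.clm_apply (hasFDerivAt_const v y)).clm_apply
        (hasFDerivAt_const w y)).fderiv]
      simp
    rw [← h1, ← h1]
    congr 1
    refine Filter.EventuallyEq.fderiv_eq ?_
    filter_upwards [hn] with z hz using hH.symm z hz v w
  have hsy : fderiv ℝ (fderiv ℝ (u ∘ c.symm)) y v w = fderiv ℝ (fderiv ℝ (u ∘ c.symm)) y w v :=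
    (((contDiffOn_comp_symm' hc h.smooth).contDiffAt hn).isSymmSndFDerivAt (by
      simpa using (by exact_mod_cast le_top : ((2 : ℕ∞) : WithTop ℕ∞) ≤ ((⊤ : ℕ∞) : WithTop ℕ∞)))).eq v w
  have h1 := h.hess c hc y hy v w
  rw [LocalMetric.koszul_apply] at h1
  rw [hH.symm y hy v (fderiv ℝ (push c (g.gradient u)) y w), h.chartForm_fderiv_push hc hy,
    h.chartForm_fderiv_push hc hy, ← hsy, hs v (push c (g.gradient u) y) w,
    hs w (push c (g.gradient u) y) v]
  linarith

/-- `d|∇u|² = 2 f du`. -/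
theorem fderiv_normSq (v : EuclideanSpace ℝ (Fin n)) :
    fderiv ℝ ((fun x => g.form x (g.gradient u x) (g.gradient u x)) ∘ c.symm) y v
      = 2 * f (c.symm y) * fderiv ℝ (u ∘ c.symm) y v := by
  have hn := c.open_target.mem_nhds hy
  have hH := isRiemannianOn_chartForm hc g
  have hF : DifferentiableAt ℝ (push c (g.gradient u)) y :=
    ((isSmoothField_gradient g h.smooth c hc).contDiffAt hn).differentiableAt (by simp)
  have h1 : ((fun x => g.form x (g.gradient u x) (g.gradient u x)) ∘ c.symm)
      =ᶠ[𝓝 y] fun y => fderiv ℝ (u ∘ c.symm) y (push c (g.gradient u) y) := by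
    filter_upwards [hn] with z hz
    rw [fderiv_comp_symm hc h.smooth hz, frame_push hc hz, ← form_gradient (g := g)]
    rfl
  have hd : DifferentiableAt ℝ (fderiv ℝ (u ∘ c.symm)) y :=
    (((contDiffOn_comp_symm' hc h.smooth).fderiv_of_isOpen (m := ∞) c.open_target
      (by simp)).contDiffAt hn).differentiableAt (by simp)
  have h2 := h.chartForm_fderiv_push hc hy v (push c (g.gradient u) y)
  have h3 := h.hess c hc y hy v (push c (g.gradient u) y)
  rw [LocalMetric.koszul_apply] at h3
  rw [h1.fderiv_eq, (hd.hasFDerivAt.clm_apply hF.hasFDerivAt).fderiv]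
  simp only [ContinuousLinearMap.add_apply, ContinuousLinearMap.comp_apply,
    ContinuousLinearMap.flip_apply]
  rw [← chartForm_push_gradient (g := g) hc h.smooth hy, hH.symm y hy _ v,
    hH.symm y hy _ (fderiv ℝ (push c (g.gradient u)) y v)]
  linarith

end IsConcircular

end SmoothMetric

/-! ### Passage between components and bilinear forms -/

namespace LocalCoord
variable {n : ℕ} {G : EuclideanSpace ℝ (Fin n) → Matrix (Fin n) (Fin n) ℝ}
  {w : EuclideanSpace ℝ (Fin n) → ℝ} {Ω : Set (EuclideanSpace ℝ (Fin n))}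
  {y : EuclideanSpace ℝ (Fin n)}

theorem pd_pd {f : EuclideanSpace ℝ (Fin n) → ℝ} (hf : DifferentiableAt ℝ (fderiv ℝ f) y)
    (i j : Fin n) : pd i (pd j f) y
      = fderiv ℝ (fderiv ℝ f) y (EuclideanSpace.single i 1) (EuclideanSpace.single j 1) := by
  change fderiv ℝ (fun z => fderiv ℝ f z (EuclideanSpace.single j 1)) y _ = _
  rw [fderiv_clm_apply hf (by fun_prop)]
  simp

theorem pd_exp (hΩ : IsOpen Ω) (hw : ContDiffOn ℝ ∞ w Ω) (hy : y ∈ Ω) (i : Fin n) :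
    pd i (fun z => Real.exp (w z)) y = Real.exp (w y) * pd i w y :=
  pd_comp i (Real.hasDerivAt_exp _) (IsMetricOn.diffAt hΩ hw hy)

/-- The combination ∇²w + dw⊗dw of the conformal law is linear in e^w; this is why the equation is
stated for u and not for its logarithm. -/
theorem hessian_exp (hΩ : IsOpen Ω) (hw : ContDiffOn ℝ ∞ w Ω) (hy : y ∈ Ω) (i j : Fin n) :
    hessian G (fun z => Real.exp (w z)) i j y
      = Real.exp (w y) * (hessian G w i j y + pd i w y * pd j w y) := by
  have h1 : pd i (pd j fun z => Real.exp (w z)) y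
      = Real.exp (w y) * pd i (pd j w) y + pd j w y * (Real.exp (w y) * pd i w y) := by
    rw [← pd_exp hΩ hw hy, ← pd_mul i (IsMetricOn.diffAt hΩ hw.exp hy)
      (IsMetricOn.diffAt hΩ (contDiffOn_pd hΩ hw j) hy)]
    exact pd_congr i (by filter_upwards [hΩ.mem_nhds hy] with z hz using pd_exp hΩ hw hz j)
  unfold hessian
  rw [h1]
  simp_rw [pd_exp hΩ hw hy, mul_left_comm _ (Real.exp (w y)), ← Finset.mul_sum]
  ring

theorem gradSq_exp (hΩ : IsOpen Ω) (hw : ContDiffOn ℝ ∞ w Ω) (hy : y ∈ Ω) :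
    gradSq G (fun z => Real.exp (w z)) y = Real.exp (w y) ^ 2 * gradSq G w y := by
  unfold gradSq trace
  simp_rw [pd_exp hΩ hw hy, Finset.mul_sum]
  exact Finset.sum_congr rfl fun i _ => Finset.sum_congr rfl fun j _ => by ring

end LocalCoord

namespace SmoothMetric
set_option maxSynthPendingDepth 3
open LocalCoord
variable {n : ℕ} {M : Type*} [TopologicalSpace M]
  [ChartedSpace (EuclideanSpace ℝ (Fin n)) M] [IsManifold (𝓡 n) ∞ M] {u f : M → ℝ}
  {g : SmoothMetric n M} {c : OpenPartialHomeomorph M (EuclideanSpace ℝ (Fin n))}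

theorem pd_inChart (hc : c ∈ IsManifold.maximalAtlas (𝓡 n) ∞ M) {y : EuclideanSpace ℝ (Fin n)}
    (hy : y ∈ c.target) (i j k : Fin n) : pd k (fun z => g.inChart c z i j) y
      = fderiv ℝ (g.chartForm c) y (EuclideanSpace.single k 1) (EuclideanSpace.single i 1)
        (EuclideanSpace.single j 1) := by
  have hd : DifferentiableAt ℝ (g.chartForm c) y :=
    ((contDiffOn_chartForm hc g).contDiffAt (c.open_target.mem_nhds hy)).differentiableAt (by simp)
  change fderiv ℝ (fun z => g.chartForm c z (EuclideanSpace.single i 1)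
    (EuclideanSpace.single j 1)) y _ = _
  rw [((hd.hasFDerivAt.clm_apply (hasFDerivAt_const _ y)).clm_apply
        (hasFDerivAt_const _ y)).fderiv]
  simp

theorem pd_comp_symm (hc : c ∈ IsManifold.maximalAtlas (𝓡 n) ∞ M)
    (hu : ContMDiff (𝓡 n) 𝓘(ℝ) ∞ u) {y : EuclideanSpace ℝ (Fin n)} (hy : y ∈ c.target) (k : Fin n) :
    pd k (u ∘ c.symm) y = ∑ l, push c (g.gradient u) y l * g.inChart c y l k := by
  rw [pd, ← chartForm_push_gradient (g := g) hc hu hy]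
  conv_lhs => rw [← EuclideanSpace.sum_smul_single (push c (g.gradient u) y)]
  simp [ContinuousLinearMap.sum_apply, inChart_apply]

theorem hessian_inChart (hc : c ∈ IsManifold.maximalAtlas (𝓡 n) ∞ M)
    (hu : ContMDiff (𝓡 n) 𝓘(ℝ) ∞ u) {y : EuclideanSpace ℝ (Fin n)} (hy : y ∈ c.target)
    (i j : Fin n) :
    hessian (g.inChart c) (u ∘ c.symm) i j y
      = fderiv ℝ (fderiv ℝ (u ∘ c.symm)) y (EuclideanSpace.single i 1) (EuclideanSpace.single j 1)
        - 1 / 2 * LocalMetric.koszul (g.chartForm c) y (EuclideanSpace.single i 1)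
          (EuclideanSpace.single j 1) (push c (g.gradient u) y) := by
  have hG := isMetricOn_inChart hc g
  have hn := c.open_target.mem_nhds hy
  have hd : DifferentiableAt ℝ (fderiv ℝ (u ∘ c.symm)) y :=
    (((contDiffOn_comp_symm' hc hu).fderiv_of_isOpen (m := ∞) c.open_target
      (by simp)).contDiffAt hn).differentiableAt (by simp)
  rw [hessian, pd_pd hd]
  congr 1
  conv_rhs => rw [← EuclideanSpace.sum_smul_single (push c (g.gradient u) y)]
  simp only [pd_comp_symm (g := g) hc hu hy, map_sum, map_smul, smul_eq_mul, Finset.mul_sum]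
  rw [Finset.sum_comm]
  refine Finset.sum_congr rfl fun l _ => ?_
  have h1 := hG.lower_christoffel hy l i j
  simp only [pd_inChart hc hy] at h1
  rw [LocalMetric.koszul_apply, mul_left_comm, ← h1, Finset.mul_sum]
  exact Finset.sum_congr rfl fun k _ => by rw [hG.symm y hy l k]; ring

theorem gradSq_inChart (hc : c ∈ IsManifold.maximalAtlas (𝓡 n) ∞ M)
    (hu : ContMDiff (𝓡 n) 𝓘(ℝ) ∞ u) {y : EuclideanSpace ℝ (Fin n)} (hy : y ∈ c.target) :
    gradSq (g.inChart c) (u ∘ c.symm) y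
      = g.form (c.symm y) (g.gradient u (c.symm y)) (g.gradient u (c.symm y)) := by
  have hG := isMetricOn_inChart hc g
  have h1 : g.form (c.symm y) (g.gradient u (c.symm y)) (g.gradient u (c.symm y))
      = fderiv ℝ (u ∘ c.symm) y (push c (g.gradient u) y) := by
    rw [fderiv_comp_symm hc hu hy, frame_push hc hy, ← form_gradient (g := g)]
  rw [h1, hG.gradSq_eq _ hy]
  conv_rhs => rw [← EuclideanSpace.sum_smul_single (push c (g.gradient u) y)]
  simp only [pd_comp_symm (g := g) hc hu hy, map_sum, map_smul, smul_eq_mul, Finset.mul_sum]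
  rw [Finset.sum_comm]
  refine Finset.sum_congr rfl fun l _ => ?_
  change _ = _ * pd l (u ∘ c.symm) y
  rw [← hG.lower_grad _ hy, Finset.mul_sum]
  exact Finset.sum_congr rfl fun k _ => by ring

omit [IsManifold (𝓡 n) ∞ M] [TopologicalSpace M] [ChartedSpace (EuclideanSpace ℝ (Fin n)) M] in
theorem bilin_linear_ext
    {B₁ B₃ : EuclideanSpace ℝ (Fin n) →L[ℝ] EuclideanSpace ℝ (Fin n) →L[ℝ] ℝ}
    {K : EuclideanSpace ℝ (Fin n) →L[ℝ] EuclideanSpace ℝ (Fin n) →L[ℝ]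
      EuclideanSpace ℝ (Fin n) →L[ℝ] ℝ} {F : EuclideanSpace ℝ (Fin n)} {a b : ℝ}
    (h : ∀ i j, B₁ (EuclideanSpace.single i 1) (EuclideanSpace.single j 1)
      - a * K (EuclideanSpace.single i 1) (EuclideanSpace.single j 1) F
      = b * B₃ (EuclideanSpace.single i 1) (EuclideanSpace.single j 1))
    (v w : EuclideanSpace ℝ (Fin n)) : B₁ v w - a * K v w F = b * B₃ v w := by
  let B₂ : EuclideanSpace ℝ (Fin n) →L[ℝ] EuclideanSpace ℝ (Fin n) →L[ℝ] ℝ :=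
    (ContinuousLinearMap.compL ℝ (EuclideanSpace ℝ (Fin n)) (EuclideanSpace ℝ (Fin n) →L[ℝ] ℝ) ℝ
      (ContinuousLinearMap.apply ℝ ℝ F)).comp K
  have hB : ∀ v w, K v w F = B₂ v w := fun v w => rfl
  simp only [hB] at h ⊢
  rw [bilin_eq_sum B₁, bilin_eq_sum B₂, bilin_eq_sum B₃]
  simp only [Finset.mul_sum, ← Finset.sum_sub_distrib]
  refine Finset.sum_congr rfl fun i _ => Finset.sum_congr rfl fun j _ => ?_
  linear_combination v i * w j * h i j

theorem IsConcircular.of_hessian (hu : ContMDiff (𝓡 n) 𝓘(ℝ) ∞ u)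
    (h : ∀ c ∈ IsManifold.maximalAtlas (𝓡 n) ∞ M, ∀ y ∈ c.target, ∀ i j,
      hessian (g.inChart c) (u ∘ c.symm) i j y = f (c.symm y) * g.inChart c y i j) :
    IsConcircular g u f where
  smooth := hu
  hess c hc y hy v w :=
    bilin_linear_ext (fun i j => (hessian_inChart hc hu hy i j).symm.trans (h c hc y hy i j)) v w

theorem det_form_pos (g : SmoothMetric n M) (x : M) :
    0 < (Matrix.of fun i j => g.form x (EuclideanSpace.single i (1 : ℝ))
      (EuclideanSpace.single j (1 : ℝ))).det := by
  refine Matrix.PosDef.det_pos (Matrix.PosDef.of_dotProduct_mulVec_pos ?_ fun v hv => ?_)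
  · ext i j
    exact g.form_symm x _ _
  · have := g.form_pos x (v := WithLp.toLp 2 v) (by simpa using hv)
    rw [bilin_eq_sum] at this
    simp only [dotProduct, Matrix.mulVec, Finset.mul_sum]
    refine this.trans_eq (Finset.sum_congr rfl fun i _ => Finset.sum_congr rfl fun j _ => ?_)
    simp
    ring

end SmoothMetric

/-! ### The equation of the conformal factor -/

namespace SmoothMetricMeasureSpace
open LocalCoord SmoothMetric
variable {n : ℕ} {M : Type*} [TopologicalSpace M]
  [ChartedSpace (EuclideanSpace ℝ (Fin n)) M] [IsManifold (𝓡 n) ∞ M]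
  {S S' : SmoothMetricMeasureSpace n M} {u : M → ℝ}

/-- The conformal factor of pointwise conformally equivalent spaces is smooth, and it determines
the relation between the weights. -/
theorem PointwiseConformal.exists_log (hn : 0 < n) (hmn : 2 < S.m + n)
    (hconf : S.PointwiseConformal S') (hu_pos : ∀ x, 0 < u x)
    (hu : ∀ (x : M) (v w : TangentSpace (𝓡 n) x),
      S'.g.inner x v w = (u x ^ 2)⁻¹ * S.g.inner x v w) :
    ∃ w : M → ℝ, ContMDiff (𝓡 n) 𝓘(ℝ) ∞ w ∧ (∀ x, u x = Real.exp (w x)) ∧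
      ∀ x, S'.φ x = S.φ x + S.m * w x := by
  obtain ⟨-, σ, hσ, hg, hd⟩ := hconf
  have hN : S.m + n - 2 ≠ 0 := by linarith
  have h1 : ∀ x, u x = Real.exp (-(S.m + n - 2)⁻¹ * σ x) := fun x => by
    have hv : (EuclideanSpace.single (⟨0, hn⟩ : Fin n) (1 : ℝ)) ≠ 0 := by simp
    have h := (hu x (EuclideanSpace.single ⟨0, hn⟩ (1 : ℝ))
      (EuclideanSpace.single ⟨0, hn⟩ (1 : ℝ))).symm.trans (hg x _ _)
    have h2 := mul_right_cancel₀ (S.g.form_pos x hv).ne' h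
    rw [inv_eq_iff_eq_inv, ← Real.exp_neg] at h2
    refine (pow_left_inj₀ (hu_pos x).le (Real.exp_pos _).le two_ne_zero).1 (h2.trans ?_)
    rw [← Real.exp_nat_mul]
    congr 1
    push_cast
    field_simp
  refine ⟨fun x => -(S.m + n - 2)⁻¹ * σ x, contMDiff_const.mul hσ, h1, fun x => ?_⟩
  -- Evaluate both densities on the standard frame. The determinant scales by the n-th power of the
  -- conformal factor, so comparing exponents leaves the weight with the share m of m + n.
  have h2 := hd x fun i => EuclideanSpace.single i (1 : ℝ)
  have hpos := S.g.det_form_pos x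
  have h3 : S'.density x (fun i => EuclideanSpace.single i (1 : ℝ))
      = Real.exp (-S'.φ x + n * ((S.m + n - 2)⁻¹ * σ x))
        * √(Matrix.of fun i j => S.g.form x (EuclideanSpace.single i (1 : ℝ))
      (EuclideanSpace.single j (1 : ℝ))).det := by
    have h4 : (Matrix.of fun i j => S'.g.inner x (EuclideanSpace.single i (1 : ℝ) : EuclideanSpace ℝ (Fin n))
        (EuclideanSpace.single j (1 : ℝ) : EuclideanSpace ℝ (Fin n)))
        = Real.exp (2 / (S.m + n - 2) * σ x) • Matrix.of fun i j => S.g.form x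
          (EuclideanSpace.single i (1 : ℝ)) (EuclideanSpace.single j (1 : ℝ)) := by
      ext i j
      exact hg x _ _
    have h5 : Real.exp (2 / (S.m + n - 2) * σ x) ^ n = Real.exp (n * ((S.m + n - 2)⁻¹ * σ x)) ^ 2 := by
      rw [← Real.exp_nat_mul, ← Real.exp_nat_mul]
      congr 1
      push_cast
      field_simp
    refine (congrArg (fun A : Matrix (Fin n) (Fin n) ℝ => Real.exp (-S'.φ x) * √A.det) h4).trans ?_
    rw [Matrix.det_smul, Fintype.card_fin, h5, Real.sqrt_mul (by positivity),
      Real.sqrt_sq (Real.exp_pos _).le, ← mul_assoc, ← Real.exp_add]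
  have h4 := h3.symm.trans h2
  have h5 : S.density x (fun i => EuclideanSpace.single i (1 : ℝ)) = Real.exp (-S.φ x)
      * √(Matrix.of fun i j => S.g.form x (EuclideanSpace.single i (1 : ℝ))
      (EuclideanSpace.single j (1 : ℝ))).det := rfl
  rw [h5, ← mul_assoc (Real.exp ((S.m + n) / (S.m + n - 2) * σ x)), ← Real.exp_add] at h4
  have h6 := Real.exp_injective (mul_right_cancel₀ (Real.sqrt_pos.2 hpos).ne' h4)
  field_simp at h6 ⊢
  linarith

/-- Subtracting the two Einstein-type equations through `conformal_weightedEinstein` leaves only the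
Hessian of w. The common factor m + n - 2 cancels, and multiplying by u = e^w gives the equation for
∇²u. -/
theorem isConcircular_of_conformal (hn : 0 < n) (hmn : 2 < S.m + n)
    (hconf : S.PointwiseConformal S') {lam lam' : ℝ} (hS : S.SatisfiesEinsteinType lam)
    (hS' : S'.SatisfiesEinsteinType lam') (hu_pos : ∀ x, 0 < u x)
    (hu : ∀ (x : M) (v w : TangentSpace (𝓡 n) x),
      S'.g.inner x v w = (u x ^ 2)⁻¹ * S.g.inner x v w) :
    IsConcircular S.g u fun x => S.g.form x (S.g.gradient u x) (S.g.gradient u x) / (2 * u x)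
      + lam' / (2 * (S.m + n - 1)) / u x - lam / (2 * (S.m + n - 1)) * u x := by
  obtain ⟨w, hw, huw, hφ⟩ := hconf.exists_log hn hmn hu_pos hu
  have hus : ContMDiff (𝓡 n) 𝓘(ℝ) ∞ u := by
    rw [show u = fun x => Real.exp (w x) from funext huw]
    exact Real.contDiff_exp.contMDiff.comp hw
  refine IsConcircular.of_hessian hus fun c hc y hy i j => ?_
  have hG := isMetricOn_inChart hc S.g
  have hwc := contDiffOn_comp_symm' hc hw
  have hφc := contDiffOn_comp_symm' hc S.contMDiff_φ
  have huc : u ∘ c.symm = fun z => Real.exp ((w ∘ c.symm) z) := funext fun z => huw _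
  have hG' : ∀ z ∈ c.target, S'.g.inChart c z = Real.exp (-2 * (w ∘ c.symm) z) • S.g.inChart c z :=
    fun z _ => by
      ext i j
      refine (hu (c.symm z) _ _).trans ?_
      rw [huw, ← Real.exp_nat_mul, ← Real.exp_neg]
      simp only [Matrix.smul_apply, smul_eq_mul, Function.comp_apply, Nat.cast_ofNat, neg_mul]
      rfl
  have h1 := conformal_weightedEinstein hG hwc hG' (m := S.m) hφc (by linarith)
    (fun h z => S.φ_eq_zero h _) (φ' := S'.φ ∘ c.symm) (fun z _ => hφ _) hy i j
  have h2 : weightedEinstein (S.g.inChart c) (S.φ ∘ c.symm) S.m i j y = _ := hS c hc y hy i j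
  have h3 : weightedEinstein (S'.g.inChart c) (S'.φ ∘ c.symm) S'.m i j y = _ := hS' c hc y hy i j
  rw [hconf.1, h1, h2, hG' y hy] at h3
  have hN : S.m + n - 2 ≠ 0 := by linarith
  have hN' : S.m + n - 1 ≠ 0 := by linarith
  have h4 : hessian (S.g.inChart c) (w ∘ c.symm) i j y + pd i (w ∘ c.symm) y * pd j (w ∘ c.symm) y
      = (1 / 2 * gradSq (S.g.inChart c) (w ∘ c.symm) y
        + lam' / (2 * (S.m + n - 1)) * Real.exp (-2 * (w ∘ c.symm) y) - lam / (2 * (S.m + n - 1)))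
        * S.g.inChart c y i j := by
    refine mul_left_cancel₀ hN ?_
    simp only [Matrix.smul_apply, smul_eq_mul] at h3
    linear_combination h3
  have h5 := gradSq_inChart (g := S.g) hc hus hy
  rw [huc, gradSq_exp c.open_target hwc hy] at h5
  rw [← h5, huc, hessian_exp c.open_target hwc hy, h4, huw]
  have h6 : Real.exp (-2 * (w ∘ c.symm) y) = (Real.exp ((w ∘ c.symm) y) ^ 2)⁻¹ := by
    rw [← Real.exp_nat_mul, ← Real.exp_neg]
    simp
  rw [h6]
  have h7 := (Real.exp_pos ((w ∘ c.symm) y)).ne'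
  simp only [Function.comp_apply] at h7 ⊢
  field_simp
end SmoothMetricMeasureSpace

/-! ### First integral and homothetic gradient fields -/

namespace SmoothMetric
set_option maxSynthPendingDepth 3
variable {n : ℕ} {M : Type*} [TopologicalSpace M]
  [ChartedSpace (EuclideanSpace ℝ (Fin n)) M] [IsManifold (𝓡 n) ∞ M] {u f : M → ℝ}
  {g : SmoothMetric n M} {c : OpenPartialHomeomorph M (EuclideanSpace ℝ (Fin n))}
  {X : M → EuclideanSpace ℝ (Fin n)}

/-- The squared length of the gradient. -/
def normSq (g : SmoothMetric n M) (u : M → ℝ) (x : M) : ℝ :=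
  g.form x (g.gradient u x) (g.gradient u x)

theorem normSq_nonneg (g : SmoothMetric n M) (u : M → ℝ) (x : M) : 0 ≤ g.normSq u x := by
  by_cases h : g.gradient u x = 0
  · simp [normSq, h]
  · exact (g.form_pos x h).le

theorem normSq_eq_zero_iff {x : M} : g.normSq u x = 0 ↔ g.gradient u x = 0 := by
  refine ⟨fun h => ?_, fun h => by simp [normSq, h]⟩
  by_contra h0
  exact (g.form_pos x h0).ne' h

theorem du_gradient (g : SmoothMetric n M) (u : M → ℝ) (x : M) :
    du u x (g.gradient u x) = g.normSq u x := by
  rw [← form_gradient (g := g), normSq]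

theorem gradient_eq_zero_iff {x : M} : g.gradient u x = 0 ↔ du (n := n) u x = 0 := by
  refine ⟨fun h => ?_, fun h => ?_⟩
  · rw [← form_gradient (g := g), h, map_zero]
  · rw [← normSq_eq_zero_iff, ← du_gradient, h]
    rfl

theorem contDiffOn_normSq (hc : c ∈ IsManifold.maximalAtlas (𝓡 n) ∞ M)
    (hu : ContMDiff (𝓡 n) 𝓘(ℝ) ∞ u) : ContDiffOn ℝ ∞ (g.normSq u ∘ c.symm) c.target := by
  have h1 : ContDiffOn ℝ ∞ (fun y => fderiv ℝ (u ∘ c.symm) y (push c (g.gradient u) y)) c.target :=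
    ((contDiffOn_comp_symm' hc hu).fderiv_of_isOpen (m := ∞) c.open_target (by simp)).clm_apply
      (isSmoothField_gradient g hu c hc)
  refine h1.congr fun y hy => ?_
  rw [fderiv_comp_symm hc hu hy, frame_push hc hy, du_gradient]
  rfl

/-- A function whose differential vanishes in all charts is constant. -/
theorem exists_eq_const [ConnectedSpace M] {F : M → ℝ}
    (h : ∀ c ∈ IsManifold.maximalAtlas (𝓡 n) ∞ M, ∀ y ∈ c.target, HasFDerivAt (F ∘ c.symm)
      (0 : EuclideanSpace ℝ (Fin n) →L[ℝ] ℝ) y) : ∃ a, ∀ x, F x = a := by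
  have hF : IsLocallyConstant F := by
    rw [IsLocallyConstant.iff_eventually_eq]
    intro x
    set c := chartAt (EuclideanSpace ℝ (Fin n)) x
    have hc : c ∈ IsManifold.maximalAtlas (𝓡 n) ∞ M := IsManifold.chart_mem_maximalAtlas x
    have hx : x ∈ c.source := mem_chart_source _ x
    obtain ⟨r, hr, hb⟩ := Metric.isOpen_iff.1 c.open_target _ (c.map_source hx)
    have h1 : c.source ∩ c ⁻¹' Metric.ball (c x) r ∈ 𝓝 x :=
      (c.isOpen_inter_preimage Metric.isOpen_ball).mem_nhds ⟨hx, Metric.mem_ball_self hr⟩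
    filter_upwards [h1] with z hz
    have h2 := (convex_ball (c x) r).is_const_of_fderivWithin_eq_zero (𝕜 := ℝ) (f := F ∘ c.symm)
      (fun y hy => (h c hc y (hb hy)).differentiableAt.differentiableWithinAt)
      (fun y hy => ((h c hc y (hb hy)).hasFDerivWithinAt.fderivWithin
        (Metric.isOpen_ball.uniqueDiffWithinAt hy))) hz.2 (Metric.mem_ball_self hr)
    simpa [c.left_inv hz.1, c.left_inv hx] using h2
  obtain ⟨x⟩ := (inferInstance : Nonempty M)
  exact ⟨F x, fun z => hF.apply_eq_of_preconnectedSpace z x⟩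

/-- The first integral of the equation `∇²u = f g` for the conformal factor of two Einstein-type
spaces. -/
theorem IsConcircular.exists_first_integral [ConnectedSpace M] {a b : ℝ} (hpos : ∀ x, 0 < u x)
    (h : IsConcircular g u fun x => g.normSq u x / (2 * u x) + a / u x - b * u x) :
    ∃ s, (∀ x, g.normSq u x = -2 * a - 2 * b * u x ^ 2 + 2 * s * u x) ∧
      IsConcircular g u fun x => s - 2 * b * u x := by
  -- The differential of this quotient vanishes by d|∇u|² = 2f du; its constant value is s.
  obtain ⟨s, hs⟩ := exists_eq_const (n := n) (F := fun x => (g.normSq u x + 2 * a + 2 * b * u x ^ 2) / (2 * u x))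
    fun c hc y hy => by
      have hn := c.open_target.mem_nhds hy
      have h1 : HasFDerivAt (u ∘ c.symm) (fderiv ℝ (u ∘ c.symm) y) y :=
        (((contDiffOn_comp_symm' hc h.smooth).contDiffAt hn).differentiableAt
          (by simp)).hasFDerivAt
      have h2 : HasFDerivAt (g.normSq u ∘ c.symm) (fderiv ℝ (g.normSq u ∘ c.symm) y) y :=
        (((contDiffOn_normSq hc h.smooth).contDiffAt hn).differentiableAt (by simp)).hasFDerivAt
      have h0 : (2 * (u ∘ c.symm) y) ≠ 0 := by have := hpos (c.symm y); simp [this.ne']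
      have h3 := ((h2.add_const (2 * a)).add ((h1.pow 2).const_mul (2 * b))).mul
        ((hasDerivAt_inv h0).comp_hasFDerivAt y (h1.const_mul 2))
      refine (HasFDerivAt.congr_fderiv h3 ?_).congr_of_eventuallyEq ?_
      · ext v
        have h4 : fderiv ℝ (g.normSq u ∘ c.symm) y v = _ := h.fderiv_normSq hc hy v
        simp only [ContinuousLinearMap.add_apply, ContinuousLinearMap.smul_apply, smul_eq_mul, h4,
          ContinuousLinearMap.zero_apply, Function.comp_apply, Pi.add_apply]
        have := (hpos (c.symm y)).ne'
        field_simp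
        ring
      · exact Eventually.of_forall fun z => div_eq_mul_inv _ _
  have hs' : ∀ x, g.normSq u x = -2 * a - 2 * b * u x ^ 2 + 2 * s * u x := fun x => by
    have h1 := hs x
    have := (hpos x).ne'
    rw [div_eq_iff (by simp [this])] at h1
    linarith
  refine ⟨s, hs', h.smooth, fun c hc y hy v w => ?_⟩
  rw [h.hess c hc y hy, hs']
  congr 1
  have := (hpos (c.symm y)).ne'
  field_simp
  ring

theorem du_affine (hu : ContMDiff (𝓡 n) 𝓘(ℝ) ∞ u) (s a : ℝ) (x : M) :
    du (n := n) (fun x => s * u x + a) x = s • du u x := by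
  have h := ((hu.mdifferentiable (by simp)) x).hasMFDerivAt
  have hA : HasFDerivAt (fun t : ℝ => s * t + a) (s • (1 : ℝ →L[ℝ] ℝ)) (u x) :=
    ((hasFDerivAt_id (u x)).const_mul s).add_const a
  exact (hA.hasMFDerivAt.comp x h).mfderiv

theorem gradient_affine (hu : ContMDiff (𝓡 n) 𝓘(ℝ) ∞ u) (s a : ℝ) :
    g.gradient (fun x => s * u x + a) = fun x => s • g.gradient u x := by
  funext x
  rw [gradient, du_affine hu, map_smul]
  rfl

theorem IsConcircular.affine (h : IsConcircular g u f) (s a : ℝ) :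
    IsConcircular g (fun x => s * u x + a) (fun x => s * f x) where
  smooth := (contMDiff_const.mul h.smooth).add contMDiff_const
  hess c hc y hy v w := by
    have hn := c.open_target.mem_nhds hy
    have hd := contDiffOn_comp_symm' hc h.smooth
    have h1 : fderiv ℝ ((fun x => s * u x + a) ∘ c.symm) =ᶠ[𝓝 y] s • fderiv ℝ (u ∘ c.symm) := by
      filter_upwards [hn] with z hz
      exact ((((hd.contDiffAt (c.open_target.mem_nhds hz)).differentiableAt
        (by simp)).hasFDerivAt.const_mul s).add_const a).fderiv
    have h2 : DifferentiableAt ℝ (fderiv ℝ (u ∘ c.symm)) y :=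
      ((hd.fderiv_of_isOpen (m := ∞) c.open_target (by simp)).contDiffAt hn).differentiableAt
        (by simp)
    have h3 : push c (g.gradient fun x => s * u x + a) y = s • push c (g.gradient u) y := by
      rw [gradient_affine h.smooth]
      exact map_smul (coframe c (c.symm y)) _ _
    rw [h1.fderiv_eq, fderiv_const_smul h2, h3, map_smul]
    simp only [ContinuousLinearMap.smul_apply, smul_eq_mul]
    linear_combination s * h.hess c hc y hy v w

theorem normSq_affine (hu : ContMDiff (𝓡 n) 𝓘(ℝ) ∞ u) (s a : ℝ) (x : M) :
    g.normSq (fun x => s * u x + a) x = s ^ 2 * g.normSq u x := by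
  rw [normSq, gradient_affine hu]
  simp [normSq]
  ring

/-- Along X = ∇u, L_X(ψg) = (Xψ + 2fψ) g, so the assumption on Xψ is precisely the homothety
equation for ψg. -/
theorem IsConcircular.isHomotheticField (h : IsConcircular g u f) {ψ : M → ℝ} {O : Set M} {κ : ℝ}
    (hO : IsOpen O) (hψ : ContMDiffOn (𝓡 n) 𝓘(ℝ) ∞ ψ O) (hpos : ∀ x ∈ O, 0 < ψ x)
    (hf : ∀ c ∈ IsManifold.maximalAtlas (𝓡 n) ∞ M, ∀ y ∈ c.target, c.symm y ∈ O →
      fderiv ℝ (ψ ∘ c.symm) y (push c (g.gradient u) y)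
        = -2 * (κ + f (c.symm y)) * ψ (c.symm y)) :
    IsHomotheticField g ψ O (g.gradient u) κ where
  isOpen := hO
  field := isSmoothField_gradient g h.smooth
  smooth := hψ
  pos := hpos
  lie c hc y hy hyO v w := by
    have hψd : DifferentiableAt ℝ (ψ ∘ c.symm) y := ((contDiffOn_comp_symm hc hψ).contDiffAt
      ((isOpen_inter_symm_preimage c hO).mem_nhds ⟨hy, hyO⟩)).differentiableAt (by simp)
    have hHd : DifferentiableAt ℝ (g.chartForm c) y :=
      ((contDiffOn_chartForm hc g).contDiffAt (c.open_target.mem_nhds hy)).differentiableAt (by simp)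
    have h1 := (hψd.hasFDerivAt.smul hHd.hasFDerivAt).fderiv
    have h2 : fderiv ℝ (scaledForm g ψ c) y = _ := h1
    have h3 := h.lie_chartForm hc hy v w
    rw [h2]
    simp only [ContinuousLinearMap.add_apply, ContinuousLinearMap.smul_apply,
      ContinuousLinearMap.smulRight_apply, hf c hc y hy hyO, scaledForm, smul_eq_mul,
      Function.comp_apply]
    linear_combination ψ (c.symm y) * h3

theorem hasDerivAt_comp_curve (hu : ContMDiff (𝓡 n) 𝓘(ℝ) ∞ u) {γ : ℝ → M} {t : ℝ}
    {v : EuclideanSpace ℝ (Fin n)}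
    (hγ : HasMFDerivAt 𝓘(ℝ) (𝓡 n) γ t ((1 : ℝ →L[ℝ] ℝ).smulRight v)) :
    HasDerivAt (fun t => u (γ t)) (du u (γ t) v) t := by
  have h : HasFDerivAt (fun t => u (γ t)) ((du u (γ t)).comp ((1 : ℝ →L[ℝ] ℝ).smulRight v)) t :=
    (((hu.mdifferentiable (by simp)) (γ t)).hasMFDerivAt.comp t hγ).hasFDerivAt
  refine h.hasDerivAt.congr_deriv ?_
  change du u (γ t) ((1 : ℝ) • v) = _
  rw [one_smul]

theorem IsFlow.hasDerivAt_comp {φ : ℝ → M → M} (hφ : IsFlow X φ) (hu : ContMDiff (𝓡 n) 𝓘(ℝ) ∞ u)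
    (x : M) (t : ℝ) : HasDerivAt (fun t => u (φ t x)) (du u (φ t x) (X (φ t x))) t :=
  hasDerivAt_comp_curve hu (hφ.curve x t)

theorem IsFlow.fixed [T2Space M] {φ : ℝ → M → M} (hφ : IsFlow X φ) (hX : IsSmoothField X) {p : M}
    (hp : X p = 0) (t : ℝ) : φ t p = p := by
  have h := isMIntegralCurve_Ioo_eq_of_contMDiff_boundaryless (I := 𝓡 n) (t₀ := 0) hX.contMDiff_one
    (hφ.curve p) (isMIntegralCurve_const (I := 𝓡 n) (x := p) (v := fun x => X x) hp) (hφ.zero p)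
  exact congrFun h t

theorem gradient_eq_zero_of_isLocalExtr (g : SmoothMetric n M) (hu : ContMDiff (𝓡 n) 𝓘(ℝ) ∞ u)
    {p : M} (hp : IsLocalExtr u p) : g.gradient u p = 0 := by
  rw [gradient_eq_zero_iff]
  set c := chartAt (EuclideanSpace ℝ (Fin n)) p
  have hc : c ∈ IsManifold.maximalAtlas (𝓡 n) ∞ M := IsManifold.chart_mem_maximalAtlas p
  have hx : p ∈ c.source := mem_chart_source _ p
  have h1 : IsLocalExtr (u ∘ c.symm) (c p) := by
    have h2 : Tendsto c.symm (𝓝 (c p)) (𝓝 p) := by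
      have := c.continuousAt_symm (c.map_source hx)
      rwa [ContinuousAt, c.left_inv hx] at this
    have h3 := IsExtrFilter.comp_tendsto (g := c.symm) (l' := 𝓝 (c p)) (b := c p)
      (f := u) (l := 𝓝 p) (by rwa [c.left_inv hx]) h2
    exact h3
  ext v
  have h2 := fderiv_comp_symm hc hu (c.map_source hx) (coframe c p v)
  rw [h1.fderiv_eq_zero, c.left_inv hx, frame_coframe hc hx] at h2
  exact h2.symm

end SmoothMetric

/-! ### Completeness and integral curves -/

namespace SmoothMetric
set_option maxSynthPendingDepth 3
variable {n : ℕ} {M : Type*} [TopologicalSpace M]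
  [ChartedSpace (EuclideanSpace ℝ (Fin n)) M] [IsManifold (𝓡 n) ∞ M]
  {X : M → EuclideanSpace ℝ (Fin n)}

/-- The distance is an infimum over C¹ paths. An integral curve is one, since its velocity X ∘ γ is
continuous. -/
theorem IsSmoothField.contMDiffAt_curve (hX : IsSmoothField X) {γ : ℝ → M} {s : Set ℝ}
    (hs : IsOpen s) (hγ : IsMIntegralCurveOn (I := 𝓡 n) γ (fun x => X x) s) {t₀ : ℝ}
    (ht₀ : t₀ ∈ s) :
    ContMDiffAt 𝓘(ℝ) (𝓡 n) 1 γ t₀ := by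
  set c := chartAt (EuclideanSpace ℝ (Fin n)) (γ t₀)
  have hc : c ∈ IsManifold.maximalAtlas (𝓡 n) ∞ M := IsManifold.chart_mem_maximalAtlas _
  have hx : γ t₀ ∈ c.source := mem_chart_source _ _
  have hγ' : ∀ t ∈ s, HasMFDerivAt 𝓘(ℝ) (𝓡 n) γ t ((1 : ℝ →L[ℝ] ℝ).smulRight (X (γ t))) :=
    fun t ht => (hγ t ht).hasMFDerivAt (hs.mem_nhds ht)
  have hcont : ContinuousOn γ s := fun t ht => (hγ' t ht).continuousAt.continuousWithinAt
  have hW : IsOpen (s ∩ γ ⁻¹' c.source) := hcont.isOpen_inter_preimage hs c.open_source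
  have h1 : ContDiffAt ℝ 1 (c ∘ γ) t₀ := by
    refine contDiffAt_one_iff.2 ⟨fun t => (1 : ℝ →L[ℝ] ℝ).smulRight (push c X (c (γ t))),
      s ∩ γ ⁻¹' c.source, hW.mem_nhds ⟨ht₀, hx⟩, ?_, fun t ht => ?_⟩
    · have h2 : ContinuousOn (fun t => push c X (c (γ t))) (s ∩ γ ⁻¹' c.source) :=
        (hX c hc).continuousOn.comp (c.continuousOn.comp (hcont.mono inter_subset_left)
          fun t ht => ht.2) fun t ht => c.map_source ht.2
      exact ((ContinuousLinearMap.smulRightL ℝ ℝ (EuclideanSpace ℝ (Fin n))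
        (1 : ℝ →L[ℝ] ℝ)).continuous.comp_continuousOn h2)
    · have h2 := ((mdifferentiableAt_chart hc ht.2).hasMFDerivAt.comp t (hγ' t ht.1)).hasFDerivAt
      refine HasFDerivAt.congr_fderiv (f' := (coframe c (γ t)).comp
        ((1 : ℝ →L[ℝ] ℝ).smulRight (X (γ t)))) h2 ?_
      ext
      simp [push, c.left_inv ht.2]
  have h2 : ContMDiffAt 𝓘(ℝ) (𝓡 n) 1 (c.symm ∘ (c ∘ γ)) t₀ :=
    (((contMDiffOn_symm_of_mem_maximalAtlas hc).contMDiffAt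
      (c.open_target.mem_nhds (c.map_source hx))).of_le (by simp)).comp t₀ h1.contMDiffAt
  refine h2.congr_of_eventuallyEq ?_
  filter_upwards [hW.mem_nhds ⟨ht₀, hx⟩] with t ht using (c.left_inv ht.2).symm

theorem enorm_le_ofReal (g : SmoothMetric n M) {x : M} {v : TangentSpace (𝓡 n) x} {C : ℝ}
    (hC : 0 ≤ C)
    (h : g.inner x v v ≤ C ^ 2) :
    letI : Bundle.RiemannianBundle (fun x : M => TangentSpace (𝓡 n) x) := ⟨g.toRiemannianMetric⟩
    ‖v‖ₑ ≤ ENNReal.ofReal C := by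
  letI : Bundle.RiemannianBundle (fun x : M => TangentSpace (𝓡 n) x) := ⟨g.toRiemannianMetric⟩
  have h1 : ‖v‖ ^ 2 ≤ C ^ 2 := by
    rw [← real_inner_self_eq_norm_sq]
    exact h
  rw [← ofReal_norm]
  exact ENNReal.ofReal_le_ofReal ((le_abs_self _).trans (abs_le_of_sq_le_sq h1 hC))

theorem isContinuousRiemannianBundle (g : SmoothMetric n M) :
    letI : Bundle.RiemannianBundle (fun x : M => TangentSpace (𝓡 n) x) := ⟨g.toRiemannianMetric⟩
    IsContinuousRiemannianBundle (EuclideanSpace ℝ (Fin n))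
    (fun x : M => TangentSpace (𝓡 n) x) := by
  letI : Bundle.RiemannianBundle (fun x : M => TangentSpace (𝓡 n) x) := ⟨g.toRiemannianMetric⟩
  exact ⟨⟨g.inner, g.contMDiff.continuous, fun _ _ _ => rfl⟩⟩

/-- The distance of two points on an integral curve is at most the length of the curve. -/
theorem dist_curve_le (g : SmoothMetric n M) (hX : IsSmoothField X) {γ : ℝ → M} {s : Set ℝ}
    (hs : IsOpen s) (hγ : IsMIntegralCurveOn (I := 𝓡 n) γ (fun x => X x) s) {a b C : ℝ}
    (hab : a ≤ b) (hC : 0 ≤ C) (hI : Icc a b ⊆ s)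
    (hb : ∀ t ∈ Icc a b, g.form (γ t) (X (γ t)) (X (γ t)) ≤ C ^ 2) :
    g.dist (γ a) (γ b) ≤ ENNReal.ofReal (C * (b - a)) := by
  letI : Bundle.RiemannianBundle (fun x : M => TangentSpace (𝓡 n) x) := ⟨g.toRiemannianMetric⟩
  have h1 : ContMDiffOn 𝓘(ℝ) (𝓡 n) 1 γ (Icc a b) := fun t ht =>
    (hX.contMDiffAt_curve hs hγ (hI ht)).contMDiffWithinAt
  refine (Manifold.riemannianEDist_le_pathELength h1 rfl rfl hab).trans ?_
  rw [Manifold.pathELength_eq_lintegral_mfderiv_Icc]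
  refine (MeasureTheory.setLIntegral_mono' (g := fun _ => ENNReal.ofReal C) measurableSet_Icc
    fun t ht => ?_).trans ?_
  · have h2 := ((hγ t (hI ht)).hasMFDerivAt (hs.mem_nhds (hI ht))).mfderiv
    have h3 : mfderiv 𝓘(ℝ) (𝓡 n) γ t (1 : ℝ) = (X (γ t) : TangentSpace (𝓡 n) (γ t)) := by
      rw [h2]
      exact one_smul ℝ (X (γ t))
    have h4 := g.enorm_le_ofReal (v := mfderiv 𝓘(ℝ) (𝓡 n) γ t (1 : ℝ)) hC (by
      rw [h3]
      exact hb t ht)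
    exact h4
  · rw [MeasureTheory.setLIntegral_const, Real.volume_Icc, ENNReal.ofReal_mul hC]

theorem dist_comm (g : SmoothMetric n M) (x y : M) : g.dist x y = g.dist y x := by
  letI : Bundle.RiemannianBundle (fun x : M => TangentSpace (𝓡 n) x) := ⟨g.toRiemannianMetric⟩
  exact Manifold.riemannianEDist_comm

variable [T2Space M]

theorem regularSpace_of_chartedSpace (n : ℕ) (M : Type*) [TopologicalSpace M]
    [ChartedSpace (EuclideanSpace ℝ (Fin n)) M] [T2Space M] : RegularSpace M := by
  haveI := ChartedSpace.locallyCompactSpace (EuclideanSpace ℝ (Fin n)) M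
  infer_instance

/-- Every neighbourhood of a point contains a small ball of the Riemannian distance, so convergence
in distance is convergence in the topology of M. -/
theorem IsComplete.exists_tendsto {g : SmoothMetric n M} (hg : g.IsComplete) {s : ℕ → M}
    (h : ∀ ε : ENNReal, 0 < ε → ∃ N, ∀ i ≥ N, ∀ j ≥ N, g.dist (s i) (s j) < ε) :
    ∃ x, Tendsto s atTop (𝓝 x) := by
  haveI := regularSpace_of_chartedSpace n M
  letI : Bundle.RiemannianBundle (fun x : M => TangentSpace (𝓡 n) x) := ⟨g.toRiemannianMetric⟩
  haveI := g.isContinuousRiemannianBundle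
  obtain ⟨x, hx⟩ := hg s h
  refine ⟨x, fun U hU => ?_⟩
  obtain ⟨c, hc, hcU⟩ := setOfPred_riemannianEDist_lt_subset_nhds' (𝓡 n) hU
  refine mem_map.2 ?_
  filter_upwards [hx.eventually (gt_mem_nhds hc)] with i hi
  refine hcU ?_
  change Manifold.riemannianEDist (𝓡 n) x (s i) < c
  rw [Manifold.riemannianEDist_comm]
  exact hi

theorem IsComplete.exists_tendsto_of_geometric {g : SmoothMetric n M} (hg : g.IsComplete)
    {s : ℕ → M} {C r : ℝ} (hr : r < 1) (hr0 : 0 ≤ r) (hC : 0 ≤ C)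
    (h : ∀ k, g.dist (s k) (s (k + 1)) ≤ ENNReal.ofReal (C * r ^ k)) :
    ∃ x, Tendsto s atTop (𝓝 x) := by
  haveI := regularSpace_of_chartedSpace n M
  refine hg.exists_tendsto ?_
  letI : Bundle.RiemannianBundle (fun x : M => TangentSpace (𝓡 n) x) := ⟨g.toRiemannianMetric⟩
  haveI := g.isContinuousRiemannianBundle
  letI := PseudoEMetricSpace.ofRiemannianMetric (𝓡 n) M
  have h1 : CauchySeq s := by
    refine cauchySeq_of_edist_le_geometric (ENNReal.ofReal r) (ENNReal.ofReal C) ?_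
      ENNReal.ofReal_ne_top fun k => ?_
    · rw [← ENNReal.ofReal_one]
      exact (ENNReal.ofReal_lt_ofReal_iff one_pos).2 hr
    · rw [← ENNReal.ofReal_pow hr0, ← ENNReal.ofReal_mul hC]
      exact h k
  exact fun ε hε => EMetric.cauchySeq_iff.1 h1 ε hε

/-- Bounded speed makes the curve Lipschitz in time, so Cauchy times give Cauchy points. -/
theorem IsComplete.exists_tendsto_curve {g : SmoothMetric n M} (hg : g.IsComplete)
    (hX : IsSmoothField X) {γ : ℝ → M} {s : Set ℝ}
    (hs : IsOpen s) (hsc : s.OrdConnected)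
    (hγ : IsMIntegralCurveOn (I := 𝓡 n) γ (fun x => X x) s) {C : ℝ} (hC : 0 ≤ C)
    (hb : ∀ t ∈ s, g.form (γ t) (X (γ t)) (X (γ t)) ≤ C ^ 2) {t : ℕ → ℝ} (ht : ∀ i, t i ∈ s)
    (htc : CauchySeq t) : ∃ z, Tendsto (fun i => γ (t i)) atTop (𝓝 z) := by
  have hd : ∀ a ∈ s, ∀ b ∈ s, g.dist (γ a) (γ b) ≤ ENNReal.ofReal (C * |a - b|) := by
    have h1 : ∀ a ∈ s, ∀ b ∈ s, a ≤ b → g.dist (γ a) (γ b) ≤ ENNReal.ofReal (C * |a - b|) :=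
      fun a ha b hb' hab => by
        rw [abs_sub_comm, abs_of_nonneg (sub_nonneg.2 hab)]
        exact g.dist_curve_le hX hs hγ hab hC (hsc.out ha hb') fun t ht =>
          hb t (hsc.out ha hb' ht)
    intro a ha b hb'
    rcases le_total a b with hab | hab
    · exact h1 a ha b hb' hab
    · rw [abs_sub_comm a b]
      refine le_trans (le_of_eq ?_) (h1 b hb' a ha hab)
      exact g.dist_comm _ _
  refine hg.exists_tendsto fun ε hε => ?_
  obtain ⟨δ, hδ, hδε⟩ : ∃ δ : ℝ, 0 < δ ∧ ENNReal.ofReal δ < ε := by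
    obtain ⟨δ, h0, h1⟩ := ENNReal.lt_iff_exists_nnreal_btwn.1 hε
    exact ⟨δ, by exact_mod_cast h0, by simpa using h1⟩
  obtain ⟨N, hN⟩ := Metric.cauchySeq_iff.1 htc (δ / (C + 1)) (by positivity)
  refine ⟨N, fun i hi j hj => (hd _ (ht i) _ (ht j)).trans_lt (lt_of_le_of_lt ?_ hδε)⟩
  refine ENNReal.ofReal_le_ofReal ?_
  have h1 := (hN i hi j hj).le
  rw [le_div_iff₀ (by positivity), Real.dist_eq] at h1
  nlinarith [abs_nonneg (t i - t j)]

/-- A vector field on a complete manifold whose speed is bounded on bounded pieces of integral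
curves is complete. -/
theorem IsComplete.exists_flow {g : SmoothMetric n M} (hg : g.IsComplete) (hX : IsSmoothField X)
    (hb : ∀ (γ : ℝ → M) (a : ℝ), 0 < a →
      IsMIntegralCurveOn (I := 𝓡 n) γ (fun x => X x) (Ioo (-a) a) →
      ∃ C, 0 ≤ C ∧ ∀ t ∈ Ioo (-a) a, g.form (γ t) (X (γ t)) (X (γ t)) ≤ C ^ 2) :
    ∃ φ : ℝ → M → M, IsFlow X φ := by
  refine hX.exists_flow fun γ a ha hγ => ?_
  obtain ⟨C, hC, hbC⟩ := hb γ a ha hγ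
  have key : ∀ (l : ℝ) (F : Filter ℝ), F ≤ 𝓝 l → F.NeBot → F.IsCountablyGenerated →
      Ioo (-a) a ∈ F → ∃ z, MapClusterPt z F γ := by
    intro l F hF hne hcg hmem
    obtain ⟨t, ht⟩ := F.exists_seq_tendsto
    obtain ⟨N, hN⟩ := eventually_atTop.1 (ht.eventually hmem)
    have ht' : Tendsto (fun i => t (i + N)) atTop F := (tendsto_add_atTop_iff_nat N).2 ht
    obtain ⟨z, hz⟩ := hg.exists_tendsto_curve hX isOpen_Ioo ordConnected_Ioo hγ hC hbC
      (t := fun i => t (i + N)) (fun i => hN _ (by omega)) (ht'.mono_right hF).cauchySeq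
    exact ⟨z, hz.mapClusterPt.of_comp ht'⟩
  exact ⟨key a _ nhdsWithin_le_nhds inferInstance inferInstance (Ioo_mem_nhdsLT (by linarith)),
    key (-a) _ nhdsWithin_le_nhds inferInstance inferInstance (Ioo_mem_nhdsGT (by linarith))⟩

end SmoothMetric

/-! ### The complete flat case -/

theorem eq_mul_exp_of_hasDerivAt {s : Set ℝ} (hs : IsOpen s) (hc : Convex ℝ s) {y : ℝ → ℝ} {k : ℝ}
    (h : ∀ t ∈ s, HasDerivAt y (k * y t) t) (h0 : (0 : ℝ) ∈ s) {t : ℝ} (ht : t ∈ s) :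
    y t = y 0 * Real.exp (k * t) := by
  have h1 : ∀ t ∈ s, HasDerivAt (fun t => y t * Real.exp (-k * t)) 0 t := fun t ht => by
    have h2 := (h t ht).mul (((hasDerivAt_id t).const_mul (-k)).exp)
    refine h2.congr_deriv ?_
    simp only [id_eq]
    ring
  have h2 := hc.is_const_of_fderivWithin_eq_zero (𝕜 := ℝ)
    (fun t ht => (h1 t ht).differentiableAt.differentiableWithinAt)
    (fun t ht => by
      rw [fderivWithin_of_isOpen hs ht, (h1 t ht).hasFDerivAt.fderiv]
      ext
      simp) ht h0
  have h3 : Real.exp (-k * t) * Real.exp (k * t) = 1 := by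
    rw [← Real.exp_add]
    simp
  simp only [mul_zero, Real.exp_zero, mul_one] at h2
  rw [← h2, mul_assoc, h3, mul_one]

theorem eq_quadratic_of_fderiv_fderiv {E : Type*} [NormedAddCommGroup E] [InnerProductSpace ℝ E]
    {f : E → ℝ} (hf : ContDiff ℝ ∞ f) {s : ℝ}
    (h : ∀ y v w, fderiv ℝ (fderiv ℝ f) y v w = s * inner ℝ v w) (y : E) :
    f y = f 0 + fderiv ℝ f 0 y + s / 2 * ‖y‖ ^ 2 := by
  have hd : Differentiable ℝ (fderiv ℝ f) :=
    (hf.fderiv_right (m := ∞) (by simp)).differentiable (by simp)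
  let I : E →L[ℝ] E →L[ℝ] ℝ := innerSL ℝ
  have h1 : ∀ y, fderiv ℝ f y = fderiv ℝ f 0 + s • I y := by
    intro y
    have h2 : ∀ y, HasFDerivAt (fun y => fderiv ℝ f y - s • I y) (0 : E →L[ℝ] E →L[ℝ] ℝ) y := by
      intro y
      refine ((hd y).hasFDerivAt.sub (I.hasFDerivAt.const_smul s)).congr_fderiv ?_
      ext v w
      have h3 : I v w = inner ℝ v w := rfl
      simp [h, h3]
    have h3 := is_const_of_fderiv_eq_zero (𝕜 := ℝ) (fun y => (h2 y).differentiableAt)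
      (fun y => (h2 y).fderiv) y 0
    simp only [map_zero, smul_zero, sub_zero] at h3
    rw [← h3]
    abel
  have h2 : ∀ y, HasFDerivAt (fun y => f y - fderiv ℝ f 0 y - s / 2 * ‖y‖ ^ 2)
      (0 : E →L[ℝ] ℝ) y := by
    intro y
    have h3 := (((hf.differentiable (by simp)) y).hasFDerivAt.sub (fderiv ℝ f 0).hasFDerivAt).sub
      ((hasStrictFDerivAt_norm_sq y).hasFDerivAt.const_mul (s / 2))
    refine h3.congr_fderiv ?_
    ext v
    have h4 : innerSL ℝ y v = inner ℝ y v := rfl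
    have h5 : I y v = inner ℝ y v := rfl
    rw [h1 y]
    simp only [ContinuousLinearMap.sub_apply, ContinuousLinearMap.add_apply,
      ContinuousLinearMap.smul_apply, smul_eq_mul, h4, h5, ContinuousLinearMap.zero_apply]
    ring
  have h3 := is_const_of_fderiv_eq_zero (𝕜 := ℝ) (fun y => (h2 y).differentiableAt)
    (fun y => (h2 y).fderiv) y 0
  simp at h3
  linarith

namespace SmoothMetric
set_option maxSynthPendingDepth 3
variable {n : ℕ} {M : Type*} [TopologicalSpace M]
  [ChartedSpace (EuclideanSpace ℝ (Fin n)) M] [IsManifold (𝓡 n) ∞ M]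
  {g : SmoothMetric n M} {u : M → ℝ}

/-- The parametrization by a chart onto the whole model space. -/
def chartDiffeo {B : OpenPartialHomeomorph M (EuclideanSpace ℝ (Fin n))}
    (hB : B ∈ IsManifold.maximalAtlas (𝓡 n) ∞ M) (ht : B.target = univ) (hs : B.source = univ) :
    EuclideanSpace ℝ (Fin n) ≃ₘ^∞⟮𝓡 n, 𝓡 n⟯ M where
  toFun := B.symm
  invFun := B
  left_inv y := B.right_inv (ht ▸ mem_univ y)
  right_inv x := B.left_inv (hs ▸ mem_univ x)
  contMDiff_toFun := by
    have h := contMDiffOn_symm_of_mem_maximalAtlas hB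
    rw [ht] at h
    exact contMDiffOn_univ.1 h
  contMDiff_invFun := by
    have h := contMDiffOn_of_mem_maximalAtlas hB
    rw [hs] at h
    exact contMDiffOn_univ.1 h

theorem scaledForm_one (c : OpenPartialHomeomorph M (EuclideanSpace ℝ (Fin n))) :
    scaledForm g (fun _ => 1) c = g.chartForm c := by
  funext y
  exact one_smul ℝ _

variable [T2Space M]

/-- A complete manifold carrying a function with `∇²u = s g`, `s > 0`, and a critical point
is the Euclidean space. -/
theorem IsComplete.exists_flat_diffeo [ConnectedSpace M] (hg : g.IsComplete) {s a : ℝ} (hs : 0 < s)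
    (h : IsConcircular g u fun _ => s) (hq : ∀ x, g.normSq u x = 2 * s * u x - 2 * a) :
    ∃ Ψ : EuclideanSpace ℝ (Fin n) ≃ₘ^∞⟮𝓡 n, 𝓡 n⟯ M,
      (∀ x v w, g.form (Ψ x) (mfderiv (𝓡 n) (𝓡 n) Ψ x v) (mfderiv (𝓡 n) (𝓡 n) Ψ x w)
        = inner ℝ v w) ∧ ∀ x, u (Ψ x) = s / 2 * ‖x‖ ^ 2 + a / s := by
  -- The flow of -∇u is used because it contracts: L_{-∇u} g = -2s g.
  set U : M → ℝ := fun x => (-1) * u x + 0 with hU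
  have hUc := h.affine (-1) 0
  set X := g.gradient U with hXdef
  have hXs : IsSmoothField X := isSmoothField_gradient g hUc.smooth
  have hXu : ∀ x, X x = -g.gradient u x := fun x => by
    rw [hXdef, hU, gradient_affine h.smooth]
    exact neg_one_smul ℝ _
  have hX2 : ∀ x, g.form x (X x) (X x) = g.normSq u x := fun x => by
    refine (normSq_affine (g := g) h.smooth (-1) 0 x).trans ?_
    norm_num
  have hdX : ∀ x, du u x (X x) = -g.normSq u x := fun x => by
    rw [hXu, map_neg, du_gradient]
  have hhom : IsHomotheticField g (fun _ => 1) univ X s := by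
    refine hUc.isHomotheticField isOpen_univ contMDiffOn_const (fun _ _ => one_pos)
      fun c hc y hy _ => ?_
    have : fderiv ℝ ((fun _ : M => (1 : ℝ)) ∘ c.symm) y = 0 := fderiv_const_apply 1
    rw [this]
    simp
  -- As |∇u|² is affine in u with slope 2s, it satisfies a linear equation with rate -2s along -∇u.
  -- This bounds the speed on finite intervals, so the flow is global, and gives exponential decay.
  have hder : ∀ x (d : ℝ), d = -g.normSq u x → 2 * s * d = -(2 * s) * g.normSq u x := by
    rintro x _ rfl
    ring
  have hfun : ∀ γ : ℝ → M, (fun t => g.normSq u (γ t)) = fun t => 2 * s * u (γ t) - 2 * a :=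
    fun γ => funext fun t => hq _
  obtain ⟨φ, hφ⟩ := hg.exists_flow hXs fun γ b hb hγ => by
    have h1 : ∀ t ∈ Ioo (-b) b, HasDerivAt (fun t => g.normSq u (γ t))
        (-(2 * s) * g.normSq u (γ t)) t := fun t ht => by
      rw [hfun]
      exact (((hasDerivAt_comp_curve h.smooth ((hγ t ht).hasMFDerivAt
        (isOpen_Ioo.mem_nhds ht))).const_mul (2 * s)).sub_const (2 * a)).congr_deriv
          (hder _ _ (hdX _))
    refine ⟨√(g.normSq u (γ 0) * Real.exp (2 * s * b)), Real.sqrt_nonneg _, fun t ht => ?_⟩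
    rw [Real.sq_sqrt (mul_nonneg (normSq_nonneg _ _ _) (Real.exp_pos _).le)]
    refine (hX2 (γ t)).trans_le ?_
    rw [eq_mul_exp_of_hasDerivAt isOpen_Ioo (convex_Ioo _ _) h1 ⟨by linarith, hb⟩ ht]
    refine mul_le_mul_of_nonneg_left (Real.exp_le_exp.2 ?_) (normSq_nonneg _ _ _)
    nlinarith [ht.1]
  have hdecay : ∀ q t, g.normSq u (φ t q) = g.normSq u q * Real.exp (-(2 * s) * t) := fun q t => by
    have h1 : ∀ t ∈ (univ : Set ℝ), HasDerivAt (fun t => g.normSq u (φ t q))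
        (-(2 * s) * g.normSq u (φ t q)) t := fun t _ => by
      rw [hfun]
      exact (((hφ.hasDerivAt_comp h.smooth q t).const_mul (2 * s)).sub_const (2 * a)).congr_deriv
          (hder _ _ (hdX _))
    have h2 := eq_mul_exp_of_hasDerivAt isOpen_univ convex_univ h1 (mem_univ _) (mem_univ t)
    rwa [hφ.zero] at h2
  -- The speed at time t is the initial speed times e^{-st}, so the points at integer times form a
  -- geometric Cauchy sequence. Its limit is a critical point, since |∇u|² tends to 0 along the
  -- orbit.
  have hlim : ∀ q, ∃ p, Tendsto (fun k : ℕ => φ k q) atTop (𝓝 p) := fun q => by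
    refine hg.exists_tendsto_of_geometric (C := √(g.normSq u q)) (r := Real.exp (-s))
      (by simpa using hs) (Real.exp_pos _).le (Real.sqrt_nonneg _) fun k => ?_
    have h1 := g.dist_curve_le hXs isOpen_univ ((hφ.curve q).isMIntegralCurveOn univ)
      (a := k) (b := k + 1) (C := √(g.normSq u q) * Real.exp (-s) ^ k) (by linarith) (by positivity)
      (subset_univ _) fun t ht => by
        refine (hX2 (φ t q)).trans_le ?_
        rw [hdecay, mul_pow, Real.sq_sqrt (normSq_nonneg _ _ _), ← Real.exp_nat_mul,
          ← Real.exp_nat_mul]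
        refine mul_le_mul_of_nonneg_left (Real.exp_le_exp.2 ?_) (normSq_nonneg _ _ _)
        push_cast
        nlinarith [ht.1]
    push_cast
    refine h1.trans_eq ?_
    congr 1
    ring
  have hcont : Continuous (g.normSq u) := by
    rw [show g.normSq u = fun x => 2 * s * u x - 2 * a from funext hq]
    exact (continuous_const.mul h.smooth.continuous).sub continuous_const
  have hzero : ∀ q p, Tendsto (fun k : ℕ => φ k q) atTop (𝓝 p) → g.normSq u p = 0 := by
    intro q p hp
    refine tendsto_nhds_unique ((hcont.tendsto p).comp hp) ?_
    have h1 : ∀ k : ℕ, (g.normSq u ∘ fun k : ℕ => φ k q) k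
        = g.normSq u q * Real.exp (-(2 * s)) ^ k := fun k => by
      rw [Function.comp_apply, hdecay, ← Real.exp_nat_mul]
      congr 2
      ring
    rw [funext h1]
    have h2 := (tendsto_pow_atTop_nhds_zero_of_lt_one (Real.exp_pos (-(2 * s))).le
      (by simpa using hs)).const_mul (g.normSq u q)
    simpa using h2
  have hfix : ∀ p, g.normSq u p = 0 → ∀ t, φ t p = p := fun p hp t =>
    hφ.fixed hXs (by rw [hXu, normSq_eq_zero_iff.1 hp, neg_zero]) t
  have hbasin : ∀ p, g.normSq u p = 0 → IsOpen {q | Tendsto (fun k : ℕ => φ k q) atTop (𝓝 p)} := by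
    intro p hp
    obtain ⟨B, -, -, -, -, -, hB, -⟩ := hφ.exists_basin_chart hhom hs (fun _ _ _ => mem_univ _)
      (mem_univ p) (hfix p hp)
    rw [← show B.source = {q | Tendsto (fun k : ℕ => φ k q) atTop (𝓝 p)} from ext hB]
    exact B.open_source
  obtain ⟨q₀⟩ := (inferInstance : Nonempty M)
  obtain ⟨p, hp⟩ := hlim q₀
  have hp0 := hzero q₀ p hp
  obtain ⟨B, hBm, hBt, -, hpB, hBp, hB, hBf⟩ := hφ.exists_basin_chart hhom hs
    (fun _ _ _ => mem_univ _) (mem_univ p) (hfix p hp0)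
  -- A point outside the basin of p has another limit, whose open basin is disjoint from that of p.
  -- So the basin is clopen.
  have hBs : B.source = univ := by
    refine IsClopen.eq_univ ⟨⟨?_⟩, B.open_source⟩ ⟨p, hpB⟩
    rw [isOpen_iff_mem_nhds]
    intro q hq
    obtain ⟨p', hp'⟩ := hlim q
    filter_upwards [(hbasin p' (hzero q p' hp')).mem_nhds hp'] with q' hq' hmem
    have : p' = p := tendsto_nhds_unique hq' ((hB q').1 hmem)
    exact hq ((hB q).2 (this ▸ hp'))
  refine ⟨chartDiffeo hBm hBt hBs, fun x v w => ?_, fun x => ?_⟩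
  · have := hBf x v w
    rw [scaledForm_one] at this
    exact this
  -- The metric is constant in this chart, so the Hessian equation becomes D²u = s times the inner
  -- product, and u is quadratic with its critical point at 0.
  · have hflat : ∀ y, g.chartForm B y = innerSL ℝ := fun y => by
      ext v w
      rw [← scaledForm_one]
      exact hBf y v w
    have hD : fderiv ℝ (g.chartForm B) = 0 := by
      rw [funext hflat]
      funext y
      exact fderiv_const_apply _
    have hus : ContDiff ℝ ∞ (u ∘ B.symm) := by
      have := contDiffOn_comp_symm' hBm h.smooth
      rwa [hBt, contDiffOn_univ] at this
    have hmem : ∀ y, y ∈ B.target := fun y => hBt ▸ mem_univ y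
    have h1 : ∀ y v w, fderiv ℝ (fderiv ℝ (u ∘ B.symm)) y v w = s * inner ℝ v w := fun y v w => by
      have h2 := h.hess B hBm y (hmem y) v w
      rw [LocalMetric.koszul_apply, hD, hflat] at h2
      have h3 : innerSL ℝ v w = inner ℝ v w := rfl
      rw [h3] at h2
      simpa using h2
    have h2 := eq_quadratic_of_fderiv_fderiv hus h1 x
    have hB0 : B.symm 0 = p := by rw [← hBp, B.left_inv hpB]
    have h3 : fderiv ℝ (u ∘ B.symm) 0 x = 0 := by
      rw [fderiv_comp_symm hBm h.smooth (hmem 0), hB0,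
        gradient_eq_zero_iff.1 (normSq_eq_zero_iff.1 hp0)]
      rfl
    have h4 : (u ∘ B.symm) 0 = a / s := by
      have := hq p
      rw [hp0] at this
      rw [Function.comp_apply, hB0, eq_div_iff hs.ne']
      linarith
    rw [h3, h4] at h2
    exact h2.trans (by ring)

end SmoothMetric

/-! ### Height functions on compact manifolds -/

namespace SmoothMetric
set_option maxSynthPendingDepth 3
variable {n : ℕ} {M : Type*} [TopologicalSpace M]
  [ChartedSpace (EuclideanSpace ℝ (Fin n)) M] [IsManifold (𝓡 n) ∞ M]
  {g : SmoothMetric n M} {y : M → ℝ} {k D : ℝ}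

/-- A function with the properties of an affine height function on a round sphere, with values
in `[0, D]`, up to a conformal change of the metric. -/
structure IsHeight (g : SmoothMetric n M) (y : M → ℝ) (k D : ℝ) : Prop where
  k_pos : 0 < k
  D_pos : 0 < D
  conc : IsConcircular g y fun x => k * D - 2 * k * y x
  normSq_eq : ∀ x, g.normSq y x = 2 * k * y x * (D - y x)
  nonneg : ∀ x, 0 ≤ y x
  le : ∀ x, y x ≤ D

namespace IsHeight

/-- The equations are invariant under y ↦ D - y, which exchanges minimum and maximum and reverses
the gradient flow; every statement about maxima then serves for minima. -/
theorem compl (h : IsHeight g y k D) : IsHeight g (fun x => -1 * y x + D) k D where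
  k_pos := h.k_pos
  D_pos := h.D_pos
  conc := by
    have h1 := h.conc.affine (-1) D
    rwa [show (fun x => -1 * (k * D - 2 * k * y x)) = fun x => k * D - 2 * k * (-1 * y x + D) from
      funext fun x => by ring] at h1
  normSq_eq x := by
    rw [normSq_affine h.conc.smooth, h.normSq_eq]
    ring
  nonneg x := by linarith [h.le x]
  le x := by linarith [h.nonneg x]

theorem gradient_eq_zero_iff (h : IsHeight g y k D) {x : M} :
    g.gradient y x = 0 ↔ y x = 0 ∨ y x = D := by
  rw [← normSq_eq_zero_iff, h.normSq_eq]
  simp [h.k_pos.ne', sub_eq_zero, eq_comm]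

/-- Along ∇y the factor y⁻² contributes -2y⁻³|∇y|² = -4k(D - y) y⁻², and g contributes 2(kD - 2ky)
y⁻². The sum -2kD y⁻² has constant rate, which singles out this conformal factor. -/
theorem isHomotheticField (h : IsHeight g y k D) :
    IsHomotheticField g (fun x => (y x ^ 2)⁻¹) {x | 0 < y x} (g.gradient y) (k * D) := by
  have hO : IsOpen {x | 0 < y x} := isOpen_lt continuous_const h.conc.smooth.continuous
  refine h.conc.isHomotheticField hO ?_ (fun x hx => inv_pos.2 (pow_pos hx 2)) fun c hc z hz hzO => ?_
  · intro x hx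
    have h1 : ContDiffAt ℝ ∞ (fun t : ℝ => (t ^ 2)⁻¹) (y x) :=
      (contDiffAt_id.pow 2).inv (pow_pos hx 2).ne'
    exact (h1.contMDiffAt.comp x h.conc.smooth.contMDiffAt).contMDiffWithinAt
  · have hzO' : 0 < y (c.symm z) := hzO
    have hn := c.open_target.mem_nhds hz
    have h1 : HasFDerivAt (y ∘ c.symm) (fderiv ℝ (y ∘ c.symm) z) z :=
      (((contDiffOn_comp_symm' hc h.conc.smooth).contDiffAt hn).differentiableAt
        (by simp)).hasFDerivAt
    have h2 : HasDerivAt (fun t : ℝ => (t ^ 2)⁻¹) (-(2 * y (c.symm z)) / (y (c.symm z) ^ 2) ^ 2)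
        ((y ∘ c.symm) z) := by
      refine (((hasDerivAt_id ((y ∘ c.symm) z)).pow 2).inv (pow_pos hzO' 2).ne').congr_deriv ?_
      simp
    have h3 : fderiv ℝ ((fun x => (y x ^ 2)⁻¹) ∘ c.symm) z = _ :=
      (h2.comp_hasFDerivAt z h1).fderiv
    rw [h3, ContinuousLinearMap.smul_apply, fderiv_comp_symm hc h.conc.smooth hz, frame_push hc hz,
      du_gradient, h.normSq_eq, smul_eq_mul]
    field_simp
    ring

variable [T2Space M] {φ : ℝ → M → M} (h : IsHeight g y k D) (hφ : IsFlow (g.gradient y) φ)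
include h hφ

theorem flow_fixed {p : M} (hp : y p = 0 ∨ y p = D) (t : ℝ) : φ t p = p :=
  hφ.fixed (isSmoothField_gradient g h.conc.smooth) (h.gradient_eq_zero_iff.2 hp) t

theorem flow_neg_flow (t : ℝ) (q : M) : φ (-t) (φ t q) = q := by
  rw [← hφ.add (isSmoothField_gradient g h.conc.smooth), neg_add_cancel, hφ.zero]

theorem flow_eq_of_critical {t : ℝ} {q : M} (hq : y (φ t q) = 0 ∨ y (φ t q) = D) : φ t q = q := by
  have h1 := h.flow_fixed hφ hq (-t)
  rwa [h.flow_neg_flow hφ, eq_comm] at h1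

theorem flow_pos {q : M} (hq : 0 < y q) (t : ℝ) : 0 < y (φ t q) := by
  refine (h.nonneg _).lt_of_ne' fun h0 => hq.ne' ?_
  rwa [h.flow_eq_of_critical hφ (Or.inl h0)] at h0

/-- Along the flow y' = 2ky(D - y) is a logistic equation; D/y - 1 linearizes it, with rate -2kD. -/
theorem tendsto_flow {q : M} (hq : 0 < y q) :
    Tendsto (fun i : ℕ => y (φ i q)) atTop (𝓝 D) := by
  have hd : ∀ t ∈ (univ : Set ℝ), HasDerivAt (fun t => D * (y (φ t q))⁻¹ - 1)
      (-(2 * k * D) * (D * (y (φ t q))⁻¹ - 1)) t := fun t _ => by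
    have h0 := (h.flow_pos hφ hq t).ne'
    refine ((((hφ.hasDerivAt_comp h.conc.smooth q t).inv h0).const_mul D).sub_const 1).congr_deriv ?_
    rw [du_gradient, h.normSq_eq]
    field_simp
  have h1 : ∀ i : ℕ, y (φ i q) = D * ((D * (y q)⁻¹ - 1) * Real.exp (-(2 * k * D)) ^ i + 1)⁻¹ :=
    fun i => by
      have h2 := eq_mul_exp_of_hasDerivAt isOpen_univ convex_univ hd (mem_univ _) (mem_univ (i : ℝ))
      rw [hφ.zero] at h2
      have h0 := (h.flow_pos hφ hq i).ne'
      have hD := h.D_pos.ne'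
      rw [← Real.exp_nat_mul, mul_comm (i : ℝ), ← h2]
      field_simp
      simp [hD]
  rw [funext h1]
  have h2 := (tendsto_pow_atTop_nhds_zero_of_lt_one (Real.exp_pos (-(2 * k * D))).le (by
    have := h.k_pos
    have := h.D_pos
    have : 0 < 2 * k * D := by positivity
    simpa using this)).const_mul (D * (y q)⁻¹ - 1)
  have h3 := ((h2.add_const 1).inv₀ (by simp)).const_mul D
  simpa using h3

theorem exists_basin_chart {p : M} (hp : y p = D) :
    ∃ B ∈ IsManifold.maximalAtlas (𝓡 n) ∞ M, B.target = univ ∧ p ∈ B.source ∧ B p = 0 ∧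
      (∀ q ∈ B.source, 0 < y q) ∧
      (∀ q, q ∈ B.source ↔ Tendsto (fun i : ℕ => φ i q) atTop (𝓝 p)) ∧
      ∀ x v w, g.chartForm B x v w = y (B.symm x) ^ 2 * inner ℝ v w := by
  obtain ⟨B, hBm, hBt, hBs, hpB, hBp, hB, hBf⟩ := hφ.exists_basin_chart h.isHomotheticField
    (mul_pos h.k_pos h.D_pos) (fun x hx t => h.flow_pos hφ hx t) (p := p)
    (show 0 < y p from hp ▸ h.D_pos) (h.flow_fixed hφ (Or.inr hp))
  refine ⟨B, hBm, hBt, hpB, hBp, hBs, hB, fun x v w => ?_⟩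
  have h1 : (y (B.symm x) ^ 2)⁻¹ * g.chartForm B x v w = inner ℝ v w := hBf x v w
  have h2 : 0 < y (B.symm x) := hBs (B.map_target (hBt ▸ mem_univ x))
  rw [← h1, mul_inv_cancel_left₀ (pow_pos h2 2).ne']

/-- Compactness gives a cluster point of the orbit, at which y = D. Its basin is open, so the orbit
enters it and from then on converges. -/
theorem exists_tendsto [CompactSpace M] {q : M} (hq : 0 < y q) :
    ∃ p, y p = D ∧ Tendsto (fun i : ℕ => φ i q) atTop (𝓝 p) := by
  obtain ⟨p, -, hp⟩ := isCompact_univ.exists_mapClusterPt (f := atTop) (u := fun i : ℕ => φ i q)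
    (by simp)
  have hpD : y p = D := by
    have h1 := hp.continuousAt_comp h.conc.smooth.continuous.continuousAt
    haveI : (𝓝 (y p) ⊓ 𝓝 D).NeBot :=
      h1.neBot.mono (inf_le_inf_left _ (h.tendsto_flow hφ hq))
    exact eq_of_nhds_neBot this
  obtain ⟨B, -, -, hpB, -, -, hB, -⟩ := h.exists_basin_chart hφ hpD
  obtain ⟨i, hi⟩ := (hp.frequently (B.open_source.mem_nhds hpB)).exists
  refine ⟨p, hpD, (tendsto_add_atTop_iff_nat i).1 ?_⟩
  have h1 := (hB _).1 hi
  refine h1.congr fun j => ?_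
  rw [← hφ.add (isSmoothField_gradient g h.conc.smooth), Nat.cast_add]

end IsHeight
end SmoothMetric

namespace SmoothMetric
set_option maxSynthPendingDepth 3
variable {n : ℕ} {M : Type*} [TopologicalSpace M]
  [ChartedSpace (EuclideanSpace ℝ (Fin n)) M] [IsManifold (𝓡 n) ∞ M]
  {g : SmoothMetric n M} {y y' : M → ℝ} {k D : ℝ}

theorem IsFlow.comp_neg {X X' : M → EuclideanSpace ℝ (Fin n)} {φ : ℝ → M → M} (hφ : IsFlow X φ)
    (h : ∀ x, X' x = -X x) : IsFlow X' fun t => φ (-t) where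
  zero x := by simpa using hφ.zero x
  curve x := by
    intro t
    have h1 := (hφ.curve x).comp_mul (-1) t
    have h3 : ((fun t => φ t x) ∘ fun x => x * -1) = fun t => φ (-t) x := by
      funext t
      simp
    rw [h3] at h1
    refine h1.congr_mfderiv ?_
    exact congrArg (fun v : EuclideanSpace ℝ (Fin n) => (1 : ℝ →L[ℝ] ℝ).smulRight v)
      ((neg_one_smul ℝ (X (φ (-t) x))).trans (h _).symm)

namespace IsHeight

variable [T2Space M] [CompactSpace M] {φ φ' : ℝ → M → M}

/-- All points of the punctured basin of attraction of a maximum point flow to a single minimum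
point under the reversed flow. -/
theorem exists_minimum_of_basin (h : IsHeight g y k D) (hφ : IsFlow (g.gradient y) φ)
    (h' : IsHeight g y' k D) (hφ' : IsFlow (g.gradient y') φ') (hy : ∀ x, y' x = D - y x)
    (hn : 2 ≤ n) {p : M} (hp : y p = D) :
    ∃ p', y' p' = D ∧ (∃ q ≠ p, Tendsto (fun i : ℕ => φ i q) atTop (𝓝 p)) ∧
      ∀ q ≠ p, Tendsto (fun i : ℕ => φ i q) atTop (𝓝 p) →
      Tendsto (fun i : ℕ => φ' i q) atTop (𝓝 p') := by
  obtain ⟨B, -, hBt, hpB, hBp, -, hB, -⟩ := h.exists_basin_chart hφ hp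
  have hB0 : B.symm 0 = p := by rw [← hBp, B.left_inv hpB]
  have hmem : ∀ x, x ∈ B.target := fun x => hBt ▸ mem_univ x
  have himg : ∀ q, q ∈ B.symm '' {0}ᶜ ↔ q ≠ p ∧ q ∈ B.source := by
    intro q
    constructor
    · rintro ⟨x, hx, rfl⟩
      refine ⟨fun h0 => hx ?_, B.map_target (hmem x)⟩
      rw [← B.right_inv (hmem x), h0, hBp]
      rfl
    · rintro ⟨hq, hqB⟩
      refine ⟨B q, fun h0 => hq ?_, B.left_inv hqB⟩
      rw [← B.left_inv hqB, show B q = 0 from h0, hB0]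
  -- The punctured basin is the image of ℝⁿ minus the origin, which is connected because n ≥ 2.
  have hconn : IsPreconnected (B.symm '' {0}ᶜ) := by
    refine IsPreconnected.image ?_ _ (B.continuousOn_symm.mono fun x _ => hmem x)
    refine (isConnected_compl_singleton_of_one_lt_rank ?_ 0).isPreconnected
    rw [rank_eq_card_basis (EuclideanSpace.basisFun (Fin n) ℝ).toBasis, Fintype.card_fin]
    exact_mod_cast (by omega : 1 < n)
  have hlt : ∀ q ≠ p, q ∈ B.source → 0 < y' q := by
    intro q hq hqB
    rw [hy, sub_pos]
    refine (h.le q).lt_of_ne fun h0 => hq ?_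
    have h1 : Tendsto (fun _ : ℕ => q) atTop (𝓝 p) :=
      ((hB q).1 hqB).congr fun i => h.flow_fixed hφ (Or.inr h0) i
    exact tendsto_nhds_unique tendsto_const_nhds h1
  have hopen : ∀ p', y' p' = D → IsOpen {q | Tendsto (fun i : ℕ => φ' i q) atTop (𝓝 p')} := by
    intro p' hp'
    obtain ⟨B', -, -, -, -, -, hB', -⟩ := h'.exists_basin_chart hφ' hp'
    rw [← show B'.source = {q | Tendsto (fun i : ℕ => φ' i q) atTop (𝓝 p')} from ext hB']
    exact B'.open_source
  let e : EuclideanSpace ℝ (Fin n) := EuclideanSpace.single ⟨0, by omega⟩ 1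
  have he : B.symm e ∈ B.symm '' {0}ᶜ := mem_image_of_mem _ (by simp [e])
  have he' := (himg _).1 he
  obtain ⟨p', hp', hlim⟩ := h'.exists_tendsto hφ' (hlt _ he'.1 he'.2)
  refine ⟨p', hp', ⟨_, he'.1, (hB _).1 he'.2⟩, fun q hq hqp => ?_⟩
  -- The union of the basins of all other minima. It is disjoint from the basin of p', and together
  -- they cover the punctured basin of p, which therefore lies in only one of the two.
  let V : Set M := {q | ∃ z, z ≠ p' ∧ y' z = D ∧ Tendsto (fun i : ℕ => φ' i q) atTop (𝓝 z)}
  have hV : IsOpen V := by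
    rw [isOpen_iff_mem_nhds]
    rintro q ⟨z, hz, hzD, hqz⟩
    filter_upwards [(hopen z hzD).mem_nhds hqz] with q' hq' using ⟨z, hz, hzD, hq'⟩
  have hsub := hconn.subset_left_of_subset_union (hopen p' hp') hV ?_ ?_ ⟨_, he, hlim⟩
  · exact hsub ((himg q).2 ⟨hq, (hB q).2 hqp⟩)
  · rw [Set.disjoint_left]
    rintro q hq ⟨z, hz, -, hqz⟩
    exact hz (tendsto_nhds_unique hqz hq)
  · intro q hq
    obtain ⟨z, hzD, hqz⟩ := h'.exists_tendsto hφ' (hlt q ((himg q).1 hq).1 ((himg q).1 hq).2)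
    by_cases hz : z = p'
    · exact Or.inl (hz ▸ hqz)
    · exact Or.inr ⟨z, hz, hzD, hqz⟩

/-- A compact manifold with a height function is covered by two conformally flat charts onto the
model space, each of them omitting one point. -/
theorem exists_polar_charts [ConnectedSpace M] (h : IsHeight g y k D) (hn : 2 ≤ n)
    (hmax : ∃ p, y p = D) :
    ∃ p p' : M, ∃ B ∈ IsManifold.maximalAtlas (𝓡 n) ∞ M, ∃ C ∈ IsManifold.maximalAtlas (𝓡 n) ∞ M,
      y p = D ∧ y p' = 0 ∧ B.target = univ ∧ C.target = univ ∧ B.source = {p'}ᶜ ∧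
      C.source = {p}ᶜ ∧ B p = 0 ∧ C p' = 0 ∧
      (∀ x v w, g.chartForm B x v w = y (B.symm x) ^ 2 * inner ℝ v w) ∧
      ∀ x v w, g.chartForm C x v w = (D - y (C.symm x)) ^ 2 * inner ℝ v w := by
  set y' : M → ℝ := fun x => -1 * y x + D with hy'
  have h' : IsHeight g y' k D := h.compl
  have hy : ∀ x, y' x = D - y x := fun x => by rw [hy']; ring
  obtain ⟨φ, hφ⟩ := (isSmoothField_gradient g h.conc.smooth).exists_flow_of_compact
  have hφ' : IsFlow (g.gradient y') (fun t => φ (-t)) := hφ.comp_neg fun x => by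
    rw [hy', gradient_affine h.conc.smooth]
    exact neg_one_smul ℝ _
  obtain ⟨p, hp⟩ := hmax
  obtain ⟨p', hp', ⟨q₀, hq₀, hq₀p⟩, hW⟩ := h.exists_minimum_of_basin hφ h' hφ' hy hn hp
  obtain ⟨p₂, hp₂, -, hW'⟩ := h'.exists_minimum_of_basin hφ' h hφ
    (fun x => by rw [hy]; ring) hn hp'
  have hyp' : y p' = 0 := by have := hy p'; linarith
  have hne : p ≠ p' := fun h0 => h.D_pos.ne (by rw [← hyp', ← h0, hp])
  obtain ⟨B, hBm, hBt, hpB, hBp, hBpos, hB, hBf⟩ := h.exists_basin_chart hφ hp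
  obtain ⟨C, hCm, hCt, hpC, hCp, hCpos, hC, hCf⟩ := h'.exists_basin_chart hφ' hp'
  have hp'B : p' ∉ B.source := fun h0 => (hBpos _ h0).ne' hyp'
  have hpC' : p ∉ C.source := fun h0 => (hCpos _ h0).ne' (by rw [hy, hp, sub_self])
  have hq₀p' : q₀ ≠ p' := fun h0 => hp'B (h0 ▸ (hB q₀).2 hq₀p)
  -- The point q₀ flows up to p and down to p'. It thus lies in the punctured basin of p', all of
  -- which flows up to p₂, so p₂ = p.
  have hp₂p : p₂ = p := tendsto_nhds_unique (hW' q₀ hq₀p' (hW q₀ hq₀ hq₀p)) hq₀p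
  subst hp₂p
  have hBC : ∀ q, q ≠ p' → q ∈ C.source → q ∈ B.source := fun q hq hqC =>
    (hB q).2 (hW' q hq ((hC q).1 hqC))
  have hCB : ∀ q, q ≠ p₂ → q ∈ B.source → q ∈ C.source := fun q hq hqB =>
    (hC q).2 (hW q hq ((hB q).1 hqB))
  -- The union of the two basins is closed: a point outside lies in the basin of a different
  -- extremum, and that open set cannot meet the union, since limits are unique and the two
  -- punctured basins coincide.
  have hU : B.source ∪ C.source = univ := by
    refine IsClopen.eq_univ ⟨⟨?_⟩, B.open_source.union C.open_source⟩ ⟨p₂, Or.inl hpB⟩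
    rw [isOpen_iff_mem_nhds]
    intro q hq
    rcases (h.nonneg q).eq_or_lt with h0 | h0
    · have hqD : y' q = D := by rw [hy, ← h0, sub_zero]
      obtain ⟨C', -, -, hqC', -, -, hC', -⟩ := h'.exists_basin_chart hφ' hqD
      filter_upwards [C'.open_source.mem_nhds hqC'] with r hr hmem
      have h1 : r ∉ C.source := fun hrC => hq (Or.inr (by
        rw [tendsto_nhds_unique ((hC' r).1 hr) ((hC r).1 hrC)]
        exact hpC))
      rcases hmem with hrB | hrC
      · by_cases hrp : r = p₂
        · refine (show 0 < y' q from hqD ▸ h.D_pos).ne' ?_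
          have h2 : Tendsto (fun _ : ℕ => r) atTop (𝓝 q) := ((hC' r).1 hr).congr fun i =>
            h'.flow_fixed hφ' (Or.inl (by rw [hrp, hy, hp, sub_self])) i
          rw [← tendsto_nhds_unique tendsto_const_nhds h2, hrp, hy, hp, sub_self]
        · exact h1 (hCB r hrp hrB)
      · exact h1 hrC
    · obtain ⟨z, hzD, hqz⟩ := h.exists_tendsto hφ h0
      obtain ⟨B', -, -, -, -, hB'pos, hB', -⟩ := h.exists_basin_chart hφ hzD
      have hzne : z ≠ p₂ := fun h2 => hq (Or.inl ((hB q).2 (h2 ▸ hqz)))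
      filter_upwards [B'.open_source.mem_nhds ((hB' q).2 hqz)] with r hr hmem
      have h1 : r ∉ B.source := fun hrB =>
        hzne (tendsto_nhds_unique ((hB' r).1 hr) ((hB r).1 hrB))
      rcases hmem with hrB | hrC
      · exact h1 hrB
      · exact h1 (hBC r (fun h2 => (hB'pos r hr).ne' (h2 ▸ hyp')) hrC)
  have hmem : ∀ q, q ∈ B.source ∨ q ∈ C.source := fun q => by
    have : q ∈ B.source ∪ C.source := hU ▸ mem_univ q
    exact this
  refine ⟨p₂, p', B, hBm, C, hCm, hp, hyp', hBt, hCt, ?_, ?_, hBp, hCp, hBf, fun x v w => ?_⟩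
  · ext q
    refine ⟨fun hq h0 => hp'B (Set.mem_singleton_iff.1 h0 ▸ hq), fun hq => ?_⟩
    exact (hmem q).elim id (hBC q hq)
  · ext q
    refine ⟨fun hq h0 => hpC' (Set.mem_singleton_iff.1 h0 ▸ hq), fun hq => ?_⟩
    exact (hmem q).elim (hCB q hq) id
  · rw [hCf, hy]

end IsHeight
end SmoothMetric

/-! ### Flat isometries and inversions -/

section flat
set_option maxSynthPendingDepth 3
variable {E : Type*} [NormedAddCommGroup E] [InnerProductSpace ℝ E] [FiniteDimensional ℝ E]

theorem LocalMetric.gamma_const (B : E →L[ℝ] E →L[ℝ] ℝ) (y : E) :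
    LocalMetric.gamma (fun _ => B) y = 0 := by
  have h1 : LocalMetric.koszul (fun _ : E => B) y = 0 := by
    ext a b w
    rw [LocalMetric.koszul_apply, fderiv_const_apply]
    simp
  rw [LocalMetric.gamma, h1]
  simp

theorem LocalMetric.isRiemannianOn_innerSL :
    LocalMetric.IsRiemannianOn (fun _ : E => (innerSL ℝ : E →L[ℝ] E →L[ℝ] ℝ)) univ where
  isOpen := isOpen_univ
  smooth := contDiffOn_const
  symm _ _ v w := real_inner_comm w v
  pos _ _ v hv := real_inner_self_pos.2 hv

/-- A local isometry of the punctured Euclidean space which preserves the norm is linear. -/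
theorem exists_linearIsometryEquiv_eqOn_compl_zero {T : E → E} (hE : 1 < Module.rank ℝ E)
    (hT : ContDiffOn ℝ ∞ T {0}ᶜ)
    (hD : ∀ x ≠ 0, ∀ v w, inner ℝ (fderiv ℝ T x v) (fderiv ℝ T x w) = inner ℝ v w)
    (hn : ∀ x ≠ 0, ‖T x‖ = ‖x‖) : ∃ A : E ≃ₗᵢ[ℝ] E, ∀ x ≠ 0, T x = A x := by
  have ho : IsOpen ({0}ᶜ : Set E) := isOpen_compl_singleton
  have hconn : IsPreconnected ({0}ᶜ : Set E) :=
    (isConnected_compl_singleton_of_one_lt_rank hE 0).isPreconnected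
  have hTd : ∀ x ≠ 0, ContDiffAt ℝ ∞ T x := fun x hx => hT.contDiffAt (ho.mem_nhds hx)
  -- Both Christoffel forms vanish, so an isometry has zero second derivative and is affine on the
  -- connected punctured space.
  have h2 : ∀ x ≠ 0, fderiv ℝ (fderiv ℝ T) x = 0 := fun x hx => by
    ext a b : 2
    rw [LocalMetric.second_fderiv_gamma (c := 1) LocalMetric.isRiemannianOn_innerSL
      LocalMetric.isRiemannianOn_innerSL (mem_univ x) (mem_univ (T x)) (hTd x hx) one_pos ?_,
      LocalMetric.gamma_const, LocalMetric.gamma_const]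
    · simp
    · filter_upwards [ho.mem_nhds hx] with z hz v w
      rw [one_mul]
      exact hD z hz v w
  obtain ⟨e, he⟩ : ∃ e : E, e ≠ 0 := by
    haveI : Nontrivial E := rank_pos_iff_nontrivial.1 (zero_lt_one.trans hE)
    exact exists_ne 0
  have hA : ∀ x ≠ 0, fderiv ℝ T x = fderiv ℝ T e := fun x hx =>
    ho.is_const_of_fderiv_eq_zero hconn (fun z hz =>
      (((hTd z hz).fderiv_right (m := ∞) (by simp)).differentiableAt
        (by simp)).differentiableWithinAt) (fun z hz => h2 z hz) hx he
  have hb : ∀ x ≠ 0, T x - fderiv ℝ T e x = T e - fderiv ℝ T e e := fun x hx => by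
    have h3 : ∀ z ∈ ({0}ᶜ : Set E), HasFDerivAt (fun z => T z - fderiv ℝ T e z) 0 z :=
      fun z hz => by
        have h4 := ((hTd z hz).differentiableAt (by simp)).hasFDerivAt.sub
          (fderiv ℝ T e).hasFDerivAt
        rwa [hA z hz, sub_self] at h4
    exact ho.is_const_of_fderiv_eq_zero hconn (fun z hz =>
      (h3 z hz).differentiableAt.differentiableWithinAt) (fun z hz => (h3 z hz).fderiv) hx he
  have hAn : ∀ v, ‖fderiv ℝ T e v‖ = ‖v‖ := fun v => by
    have h3 := hD e he v v
    rw [real_inner_self_eq_norm_sq, real_inner_self_eq_norm_sq] at h3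
    exact (pow_left_inj₀ (norm_nonneg _) (norm_nonneg _) two_ne_zero).1 h3
  -- The translation part has norm at most ‖T x‖ + ‖x‖ = 2‖x‖ for every x ≠ 0; let x tend to 0.
  have hb0 : T e - fderiv ℝ T e e = 0 := by
    rw [← norm_le_zero_iff]
    refine le_of_forall_pos_le_add fun ε hε => ?_
    have hpos := norm_pos_iff.2 he
    have hx : (ε / 2 / ‖e‖) • e ≠ 0 := smul_ne_zero (by positivity) he
    rw [← hb _ hx]
    refine (norm_sub_le _ _).trans ?_
    rw [hn _ hx, hAn, norm_smul, Real.norm_eq_abs, abs_of_pos (by positivity),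
      div_mul_cancel₀ _ hpos.ne']
    linarith
  let A : E →ₗᵢ[ℝ] E := ⟨(fderiv ℝ T e).toLinearMap, hAn⟩
  refine ⟨A.toLinearIsometryEquiv rfl, fun x hx => ?_⟩
  have := hb x hx
  rw [hb0, sub_eq_zero] at this
  exact this

theorem inversion_zero_eq (R : ℝ) (x : E) :
    EuclideanGeometry.inversion (0 : E) R x = (R / ‖x‖) ^ 2 • x := by
  simp [EuclideanGeometry.inversion]

theorem norm_inversion_zero (R : ℝ) (x : E) :
    ‖EuclideanGeometry.inversion (0 : E) R x‖ = R ^ 2 / ‖x‖ := by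
  simpa using EuclideanGeometry.dist_inversion_center (0 : E) x R

theorem inner_fderiv_inversion_zero (R : ℝ) {x : E} (hx : x ≠ 0) (v w : E) :
    inner ℝ (fderiv ℝ (EuclideanGeometry.inversion (0 : E) R) x v)
      (fderiv ℝ (EuclideanGeometry.inversion (0 : E) R) x w)
      = ((R / ‖x‖) ^ 2) ^ 2 * inner ℝ v w := by
  rw [(EuclideanGeometry.hasFDerivAt_inversion hx).fderiv]
  have h1 : ∀ v : E, ((R / dist x 0) ^ 2 • ((Submodule.span ℝ {x - 0})ᗮ.reflection : E →L[ℝ] E)) v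
      = (R / ‖x‖) ^ 2 • (Submodule.span ℝ {x - 0})ᗮ.reflection v := fun v => by
    rw [dist_zero_right]
    rfl
  rw [h1, h1, real_inner_smul_left, real_inner_smul_right, LinearIsometryEquiv.inner_map_map]
  ring

end flat

/-! ### Explicit form of the metric and the transition map -/

namespace SmoothMetric
set_option maxSynthPendingDepth 3
variable {n : ℕ} {M : Type*} [TopologicalSpace M]
  [ChartedSpace (EuclideanSpace ℝ (Fin n)) M] [IsManifold (𝓡 n) ∞ M]
  {g : SmoothMetric n M} {y : M → ℝ} {k D : ℝ}

/-- In a conformally flat chart centered at a maximum point, the inverse of a height function is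
quadratic. -/
theorem IsHeight.inv_chart (h : IsHeight g y k D)
    {B : OpenPartialHomeomorph M (EuclideanSpace ℝ (Fin n))}
    (hB : B ∈ IsManifold.maximalAtlas (𝓡 n) ∞ M) (hBt : B.target = univ)
    (hpos : ∀ x, 0 < y (B.symm x)) (h0 : y (B.symm 0) = D)
    (hf : ∀ x v w, g.chartForm B x v w = y (B.symm x) ^ 2 * inner ℝ v w)
    (x : EuclideanSpace ℝ (Fin n)) : (y (B.symm x))⁻¹ = 1 / D + k * D / 2 * ‖x‖ ^ 2 := by
  set Y : EuclideanSpace ℝ (Fin n) → ℝ := y ∘ B.symm with hY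
  have hmem : ∀ x, x ∈ B.target := fun x => hBt ▸ mem_univ x
  have hYs : ContDiff ℝ ∞ Y := by
    have := contDiffOn_comp_symm' hB h.conc.smooth
    rwa [hBt, contDiffOn_univ] at this
  have hYpos : ∀ x, 0 < Y x := hpos
  have hYd : ∀ x, HasFDerivAt Y (fderiv ℝ Y x) x := fun x =>
    (hYs.differentiable (by simp) x).hasFDerivAt
  have hY2 : ∀ x, HasFDerivAt (fderiv ℝ Y) (fderiv ℝ (fderiv ℝ Y) x) x := fun x =>
    ((hYs.fderiv_right (m := ∞) (by simp)).differentiable (by simp) x).hasFDerivAt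
  let I : EuclideanSpace ℝ (Fin n) →L[ℝ] EuclideanSpace ℝ (Fin n) →L[ℝ] ℝ := innerSL ℝ
  have hform : g.chartForm B = fun x => Y x ^ 2 • I := by
    funext x
    ext v w
    exact hf x v w
  have hDform : ∀ x a v w, fderiv ℝ (g.chartForm B) x a v w
      = 2 * Y x * fderiv ℝ Y x a * inner ℝ v w := fun x a v w => by
    rw [hform, (((hYd x).pow 2).smul_const I).fderiv]
    have h1 : I v w = inner ℝ v w := rfl
    simp only [ContinuousLinearMap.smulRight_apply, ContinuousLinearMap.smul_apply, smul_eq_mul, h1]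
    simp
  have hinv : ∀ x, HasFDerivAt (fun x => (Y x)⁻¹) (-(Y x ^ 2)⁻¹ • fderiv ℝ Y x) x := fun x =>
    (hasDerivAt_inv (hYpos x).ne').comp_hasFDerivAt x (hYd x)
  have hinv' : fderiv ℝ (fun x => (Y x)⁻¹) = fun x => -(Y x ^ 2)⁻¹ • fderiv ℝ Y x :=
    funext fun x => (hinv x).fderiv
  have hcoef : ∀ x, HasFDerivAt (fun x => -(Y x ^ 2)⁻¹) ((2 * (Y x ^ 3)⁻¹) • fderiv ℝ Y x) x :=
    fun x => by
      have h1 : HasDerivAt (fun t : ℝ => -(t ^ 2)⁻¹) (2 * (Y x ^ 3)⁻¹) (Y x) := by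
        refine (((hasDerivAt_id (Y x)).pow 2).inv (pow_pos (hYpos x) 2).ne').neg.congr_deriv ?_
        have := (hYpos x).ne'
        simp only [id_eq]
        field_simp
        simp only [Nat.add_one_sub_one, pow_one, Nat.cast_ofNat, Pi.pow_apply, id_eq]
        ring
      exact h1.comp_hasFDerivAt x (hYd x)
  -- In the metric y² dx² the equation for ∇²y, with |∇y|² = 2ky(D - y), reads D²y = (2/y) dy⊗dy -
  -- kDy² δ. Equivalently D²(1/y) = kD δ.
  have hsecond : ∀ x v w, fderiv ℝ (fderiv ℝ (fun x => (Y x)⁻¹)) x v w = k * D * inner ℝ v w := by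
    intro x v w
    have h5 : fderiv ℝ (fun x => -(Y x ^ 2)⁻¹ • fderiv ℝ Y x) x = _ :=
      ((hcoef x).smul (hY2 x)).fderiv
    rw [hinv', h5]
    simp only [ContinuousLinearMap.add_apply, ContinuousLinearMap.smul_apply,
      ContinuousLinearMap.smulRight_apply, smul_eq_mul]
    have h1 := h.conc.hess B hB x (hmem x) v w
    set F := push B (g.gradient y) x
    have hF : ∀ v, Y x ^ 2 * inner ℝ F v = fderiv ℝ Y x v := fun v => by
      have h2 := chartForm_push_gradient (g := g) hB h.conc.smooth (hmem x)
      rw [← hY] at h2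
      rw [← h2, hf]
      rfl
    have hFF : fderiv ℝ Y x F = 2 * k * Y x * (D - Y x) := by
      have h2 := h.normSq_eq (B.symm x)
      rw [hY, fderiv_comp_symm hB h.conc.smooth (hmem x), frame_push hB (hmem x), du_gradient, h2]
      rfl
    rw [LocalMetric.koszul_apply, hDform, hDform, hDform, hf, hFF, real_inner_comm F w,
      real_inner_comm F v] at h1
    change fderiv ℝ (fderiv ℝ Y) x v w - _ = (k * D - 2 * k * Y x) * (Y x ^ 2 * _) at h1
    have hv := hF v
    have hw := hF w
    have h3 := (hYpos x).ne'
    rw [← hv, ← hw] at h1 ⊢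
    have h4 : fderiv ℝ (fderiv ℝ Y) x v w = (k * D - 2 * k * Y x) * (Y x ^ 2 * inner ℝ v w)
      + 1 / 2 * (2 * Y x * (Y x ^ 2 * inner ℝ F v) * inner ℝ F w
        + 2 * Y x * (Y x ^ 2 * inner ℝ F w) * inner ℝ F v
        - 2 * Y x * (2 * k * Y x * (D - Y x)) * inner ℝ v w) := by linarith
    rw [h4]
    field_simp
    ring
  have hinvs : ContDiff ℝ ∞ (fun x => (Y x)⁻¹) := hYs.inv fun x => (hYpos x).ne'
  have h1 := eq_quadratic_of_fderiv_fderiv hinvs hsecond x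
  have h2 : fderiv ℝ Y 0 = 0 := by
    ext v
    rw [hY, fderiv_comp_symm hB h.conc.smooth (hmem 0),
      SmoothMetric.gradient_eq_zero_iff.1 (h.gradient_eq_zero_iff.2 (Or.inr h0))]
    rfl
  rw [hinv'] at h1
  simp only [h2, smul_zero, ContinuousLinearMap.zero_apply, add_zero] at h1
  have h3 : Y 0 = D := h0
  rw [h3] at h1
  change (Y x)⁻¹ = _
  rw [h1, one_div]

/-- The change of coordinates between conformally flat charts. -/
theorem chartForm_transition (g : SmoothMetric n M)
    {B C : OpenPartialHomeomorph M (EuclideanSpace ℝ (Fin n))}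
    (hB : B ∈ IsManifold.maximalAtlas (𝓡 n) ∞ M) (hC : C ∈ IsManifold.maximalAtlas (𝓡 n) ∞ M)
    {x : EuclideanSpace ℝ (Fin n)} (hx : x ∈ C.target) (hxB : C.symm x ∈ B.source)
    (v w : EuclideanSpace ℝ (Fin n)) :
    g.chartForm B (B (C.symm x)) (fderiv ℝ (fun x => B (C.symm x)) x v)
      (fderiv ℝ (fun x => B (C.symm x)) x w) = g.chartForm C x v w := by
  have h1 := scaledForm_map (T := fun q : M => q) contMDiff_id g (fun _ => 1) hC hB hx hxB v w
  have h2 : ∀ q v, tder (n := n) (fun q : M => q) q v = v := fun q v =>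
    congrArg (fun A : EuclideanSpace ℝ (Fin n) →L[ℝ] EuclideanSpace ℝ (Fin n) => A v)
      (hasMFDerivAt_id (I := 𝓡 n) q).mfderiv
  rw [scaledForm_one, h2, h2, one_mul] at h1
  exact h1

/-- A compact manifold with a height function is covered by two charts onto the model space, the
first of which is conformally flat, whose transition map is an inversion. -/
theorem IsHeight.exists_inversion_charts [T2Space M] [CompactSpace M] [ConnectedSpace M]
    (h : IsHeight g y k D) (hn : 2 ≤ n) (hmax : ∃ p, y p = D) :
    ∃ (p' : M) (R : ℝ), 0 < R ∧ ∃ B ∈ IsManifold.maximalAtlas (𝓡 n) ∞ M,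
      ∃ C ∈ IsManifold.maximalAtlas (𝓡 n) ∞ M, B.target = univ ∧ C.target = univ ∧
      B.source = {p'}ᶜ ∧ C.symm 0 = p' ∧
      (∀ x ≠ 0, C.symm x = B.symm (EuclideanGeometry.inversion 0 R x)) ∧
      (∀ x, (y (B.symm x))⁻¹ = 1 / D + k * D / 2 * ‖x‖ ^ 2) ∧
      ∀ x v w, g.chartForm B x v w = y (B.symm x) ^ 2 * inner ℝ v w := by
  obtain ⟨p, p', B, hB, C, hC, hp, hp', hBt, hCt, hBs, hCs, hBp, hCp, hBf, hCf⟩ :=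
    h.exists_polar_charts hn hmax
  have hk := h.k_pos
  have hD := h.D_pos
  have hne : p ≠ p' := fun h0 => hD.ne (by rw [← hp', ← h0, hp])
  have hmB : ∀ x, x ∈ B.target := fun x => hBt ▸ mem_univ x
  have hmC : ∀ x, x ∈ C.target := fun x => hCt ▸ mem_univ x
  have hB0 : B.symm 0 = p := by
    rw [← hBp, B.left_inv]
    rw [hBs]
    exact hne
  have hC0 : C.symm 0 = p' := by
    rw [← hCp, C.left_inv]
    rw [hCs]
    exact hne.symm
  have hpB : ∀ x, 0 < y (B.symm x) := fun x => by
    refine (h.nonneg _).lt_of_ne' fun h0 => ?_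
    have h1 := (isRiemannianOn_chartForm hB g).pos x (hmB x)
      (EuclideanSpace.single ⟨0, by omega⟩ 1) (by simp)
    rw [hBf, h0] at h1
    simp at h1
  have hpC : ∀ x, 0 < D - y (C.symm x) := fun x => by
    refine (sub_nonneg.2 (h.le _)).lt_of_ne' fun h0 => ?_
    have h1 := (isRiemannianOn_chartForm hC g).pos x (hmC x)
      (EuclideanSpace.single ⟨0, by omega⟩ 1) (by simp)
    rw [hCf, h0] at h1
    simp at h1
  have hyB := h.inv_chart hB hBt hpB (by rw [hB0, hp]) hBf
  have hc : ∀ x, -1 * y x + D = D - y x := fun x => by ring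
  have hyC : ∀ x, (D - y (C.symm x))⁻¹ = 1 / D + k * D / 2 * ‖x‖ ^ 2 := fun x => by
    have h1 := h.compl.inv_chart hC hCt (fun x => by rw [hc]; exact hpC x)
      (by rw [hC0, hp']; ring) (fun x v w => by rw [hc]; exact hCf x v w) x
    rwa [hc] at h1
  -- R is the coordinate radius of the equator y = D/2, the same in both charts.
  set R : ℝ := √(2 / (k * D ^ 2)) with hRdef
  have hR : 0 < R := Real.sqrt_pos.2 (by positivity)
  have hR2 : R ^ 2 = 2 / (k * D ^ 2) := Real.sq_sqrt (by positivity)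
  have hCB : ∀ x ≠ 0, C.symm x ∈ B.source := fun x hx => by
    rw [hBs]
    intro h0
    refine hx ?_
    rw [← C.right_inv (hmC x), show C.symm x = p' from h0, hCp]
  have hz0 : ∀ x ≠ 0, B (C.symm x) ≠ 0 := fun x hx h0 => by
    have h1 : C.symm x = p := by rw [← B.left_inv (hCB x hx), h0, hB0]
    have h2 := C.map_target (hmC x)
    rw [hCs, h1] at h2
    exact h2 rfl
  have hyz : ∀ x ≠ 0, (y (C.symm x))⁻¹ = 1 / D + k * D / 2 * ‖B (C.symm x)‖ ^ 2 := fun x hx => by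
    rw [← hyB, B.left_inv (hCB x hx)]
  have hyCpos : ∀ x ≠ 0, 0 < y (C.symm x) := fun x hx => by
    have := hpB (B (C.symm x))
    rwa [B.left_inv (hCB x hx)] at this
  -- This is D/y - 1 = |B|²/R². With the analogous identity in the chart C it gives the product of
  -- radii in `hprod`.
  have hratio : ∀ x ≠ 0, D - y (C.symm x) = ‖B (C.symm x)‖ ^ 2 / R ^ 2 * y (C.symm x) :=
    fun x hx => by
      have h1 := hyz x hx
      have h2 := (hyCpos x hx).ne'
      rw [hR2]
      field_simp at h1 ⊢
      linarith
  have hprod : ∀ x ≠ 0, ‖B (C.symm x)‖ * ‖x‖ = R ^ 2 := fun x hx => by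
    have h1 := hyC x
    have h2 := hratio x hx
    have h3 := (hyCpos x hx).ne'
    have h4 := (hpC x).ne'
    have h5 : (‖B (C.symm x)‖ * ‖x‖) ^ 2 = (R ^ 2) ^ 2 := by
      have h6 := hyz x hx
      have h7 : k * D ^ 2 * R ^ 2 = 2 := by rw [hR2]; field_simp
      have h8 : k * D ^ 2 * ‖B (C.symm x)‖ ^ 2 * y (C.symm x) = 2 * (D - y (C.symm x)) := by
        field_simp at h6
        linarith
      have h9 : k * D ^ 2 * ‖x‖ ^ 2 * (D - y (C.symm x)) = 2 * y (C.symm x) := by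
        field_simp at h1
        linarith
      have h10 : (k * D ^ 2) ^ 2 * (‖B (C.symm x)‖ * ‖x‖) ^ 2 = (k * D ^ 2) ^ 2 * (R ^ 2) ^ 2 := by
        refine mul_right_cancel₀ (mul_ne_zero h3 h4) ?_
        linear_combination k * D ^ 2 * ‖x‖ ^ 2 * (D - y (C.symm x)) * h8
          + 2 * (D - y (C.symm x)) * h9
          - (y (C.symm x) * (D - y (C.symm x))) * (k * D ^ 2 * R ^ 2 + 2) * h7
      exact mul_left_cancel₀ (by positivity) h10
    exact (pow_left_inj₀ (by positivity) (by positivity) two_ne_zero).1 h5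
  set κ : EuclideanSpace ℝ (Fin n) → EuclideanSpace ℝ (Fin n) := fun x => B (C.symm x) with hκ
  have hκs : ContDiffOn ℝ ∞ κ {0}ᶜ := by
    have h1 := contDiffOn_chart_comp (T := fun q : M => q) contMDiff_id hC hB
    exact h1.mono fun x hx => ⟨hmC x, hCB x hx⟩
  have ho : IsOpen ({0}ᶜ : Set (EuclideanSpace ℝ (Fin n))) := isOpen_compl_singleton
  have hκd : ∀ x ≠ 0, ContDiffAt ℝ ∞ κ x := fun x hx => hκs.contDiffAt (ho.mem_nhds hx)
  -- Both charts are conformally flat, so the transition is conformal, with factor the ratio (D -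
  -- y)/y. The inversion of radius R has the reciprocal factor, hence inversion after transition is
  -- a norm-preserving local isometry.
  have hconf : ∀ x ≠ 0, ∀ v w, inner ℝ (fderiv ℝ κ x v) (fderiv ℝ κ x w)
      = (‖κ x‖ ^ 2 / R ^ 2) ^ 2 * inner ℝ v w := fun x hx v w => by
    have h1 := g.chartForm_transition hB hC (hmC x) (hCB x hx) v w
    rw [hBf, hCf, B.left_inv (hCB x hx), hratio x hx] at h1
    refine mul_left_cancel₀ (pow_ne_zero 2 (hyCpos x hx).ne') (h1.trans ?_)
    ring
  obtain ⟨A, hA⟩ := exists_linearIsometryEquiv_eqOn_compl_zero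
    (T := fun x => EuclideanGeometry.inversion 0 R (κ x)) (by
      rw [rank_eq_card_basis (EuclideanSpace.basisFun (Fin n) ℝ).toBasis, Fintype.card_fin]
      exact_mod_cast (by omega : 1 < n))
    (fun x hx => (ContDiffAt.inversion contDiffAt_const contDiffAt_const (hκd x hx)
      (hz0 x hx)).contDiffWithinAt)
    (fun x hx v w => by
      have h1 := fderiv_comp x (EuclideanGeometry.hasFDerivAt_inversion (c := 0) (R := R)
        (hz0 x hx)).differentiableAt ((hκd x hx).differentiableAt (by simp))
      change inner ℝ (fderiv ℝ (EuclideanGeometry.inversion 0 R ∘ κ) x v)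
        (fderiv ℝ (EuclideanGeometry.inversion 0 R ∘ κ) x w) = _
      rw [h1, ContinuousLinearMap.comp_apply, ContinuousLinearMap.comp_apply,
        inner_fderiv_inversion_zero R (hz0 x hx), hconf x hx]
      have h2 : ‖κ x‖ ≠ 0 := norm_ne_zero_iff.2 (hz0 x hx)
      change ((R / ‖κ x‖) ^ 2) ^ 2 * _ = _
      field_simp)
    (fun x hx => by
      rw [norm_inversion_zero, ← hprod x hx]
      exact mul_div_cancel_left₀ _ (norm_ne_zero_iff.2 (hz0 x hx)))
  -- The orthogonal map A is absorbed into the second chart, making the transition a pure inversion.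
  -- C need no longer satisfy the normalization of its metric.
  let e : OpenPartialHomeomorph (EuclideanSpace ℝ (Fin n)) (EuclideanSpace ℝ (Fin n)) :=
    A.toHomeomorph.toOpenPartialHomeomorph
  refine ⟨p', R, hR, B, hB, C.trans e, trans_mem_maximalAtlas hC A.contDiff.contDiffOn
    A.symm.contDiff.contDiffOn, hBt, ?_, hBs, ?_, fun x hx => ?_, hyB, hBf⟩
  · ext x
    simp [e, hCt]
  · change C.symm (A.symm 0) = p'
    rw [map_zero, hC0]
  · change C.symm (A.symm x) = _
    have hx' : A.symm x ≠ 0 := by simpa using hx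
    have h1 := hA _ hx'
    rw [A.apply_symm_apply] at h1
    rw [← congrArg (EuclideanGeometry.inversion 0 R) h1,
      EuclideanGeometry.inversion_inversion _ hR.ne']
    exact (B.left_inv (hCB _ hx')).symm

end SmoothMetric

/-! ### The flat weighted Einstein equation -/

namespace LocalCoord
set_option maxSynthPendingDepth 3
variable {n : ℕ}

theorem isMetricOn_one :
    IsMetricOn (fun _ : EuclideanSpace ℝ (Fin n) => (1 : Matrix (Fin n) (Fin n) ℝ)) univ where
  isOpen := isOpen_univ
  smooth _ _ := contDiffOn_const
  symm _ _ i j := by rw [Matrix.one_apply, Matrix.one_apply]; simp [eq_comm]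
  unit _ _ := by simp

theorem christoffel_one (k i j : Fin n) :
    christoffel (fun _ : EuclideanSpace ℝ (Fin n) => (1 : Matrix (Fin n) (Fin n) ℝ)) k i j = 0 := by
  funext y
  simp [christoffel, pd_const]

theorem hessian_one (f : EuclideanSpace ℝ (Fin n) → ℝ) (i j : Fin n) :
    hessian (fun _ => 1) f i j = pd i (pd j f) := by
  funext y
  simp [hessian, christoffel_one]

theorem ricci_one (i j : Fin n) :
    ricci (fun _ : EuclideanSpace ℝ (Fin n) => (1 : Matrix (Fin n) (Fin n) ℝ)) i j = 0 := by
  funext y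
  have h : ∀ k, pd k (0 : EuclideanSpace ℝ (Fin n) → ℝ) y = 0 := fun k => pd_const k 0 y
  simp [ricci, christoffel_one, h]

theorem trace_one (T : Fin n → Fin n → EuclideanSpace ℝ (Fin n) → ℝ)
    (y : EuclideanSpace ℝ (Fin n)) : trace (fun _ => 1) T y = ∑ i, T i i y := by
  simp [trace, Matrix.one_apply]

theorem gradSq_one (f : EuclideanSpace ℝ (Fin n) → ℝ) (y : EuclideanSpace ℝ (Fin n)) :
    gradSq (fun _ => 1) f y = ∑ i, pd i f y ^ 2 := by
  simp [gradSq, trace_one, sq]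

theorem fderiv_eq_zero_of_pd {f : EuclideanSpace ℝ (Fin n) → ℝ} {y : EuclideanSpace ℝ (Fin n)}
    (h : ∀ i, pd i f y = 0) : fderiv ℝ f y = 0 := by
  ext v
  conv_lhs => rw [← EuclideanSpace.sum_smul_single v]
  simp only [map_sum, map_smul, smul_eq_mul, ContinuousLinearMap.zero_apply]
  exact Finset.sum_eq_zero fun i _ => mul_eq_zero_of_right _ (h i)

/-- Solutions of the flat weighted Einstein-type equation with constant zero. -/
theorem weightedEinstein_one {φ : EuclideanSpace ℝ (Fin n) → ℝ} (hφ : ContDiff ℝ ∞ φ) {m : ℝ}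
    (hm : 0 < m) (hn : 0 < n) {y : EuclideanSpace ℝ (Fin n)}
    (h : ∀ i j, weightedEinstein (fun _ => 1) φ m i j y = 0) :
    ∃ H : ℝ, (∀ i j, pd i (pd j fun z => Real.exp (-1 / m * φ z)) y = if i = j then H else 0) ∧
      (m - 1) * (2 * H * Real.exp (-1 / m * φ y)
        - ∑ i, pd i (fun z => Real.exp (-1 / m * φ z)) y ^ 2) = 0 := by
  have hN : m + n - 1 ≠ 0 := by
    have : (1 : ℝ) ≤ n := by exact_mod_cast hn
    linarith
  set w : EuclideanSpace ℝ (Fin n) → ℝ := fun z => -1 / m * φ z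
  have hw : ContDiffOn ℝ ∞ w univ := (contDiff_const.mul hφ).contDiffOn
  have hd : ∀ z, DifferentiableAt ℝ φ z := hφ.differentiable (by simp)
  have hw1 : ∀ i, pd i w = fun z => -1 / m * pd i φ z := fun i =>
    funext fun z => pd_const_mul i _ (hd z)
  have hw2 : ∀ i j, pd i (pd j w) y = -1 / m * pd i (pd j φ) y := fun i j => by
    rw [hw1, pd_const_mul]
    exact IsMetricOn.diffAt isOpen_univ (contDiffOn_pd isOpen_univ hφ.contDiffOn j) (mem_univ y)
  set Rw := weightedScalarCurvature (fun _ : EuclideanSpace ℝ (Fin n) => (1 : Matrix (Fin n) (Fin n) ℝ)) φ m y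
    with hRw
  have hB : ∀ i j, pd i (pd j φ) y - 1 / m * (pd i φ y * pd j φ y)
      = Rw / (2 * (m + n - 1)) * (1 : Matrix (Fin n) (Fin n) ℝ) i j := fun i j => by
    have h1 := h i j
    rw [weightedEinstein, bakryEmeryRicci, ricci_one, hessian_one, ← hRw] at h1
    simp only [Pi.zero_apply] at h1
    linarith
  -- For v = e^{-φ/m} one has ∇²v = -(v/m)(∇²φ - dφ⊗dφ/m), and the equation makes the bracket
  -- R_φ^m/(2(m+n-1)) times the identity.
  refine ⟨-(Real.exp (w y) / m * (Rw / (2 * (m + n - 1)))), fun i j => ?_, ?_⟩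
  · rw [← hessian_one, hessian_exp isOpen_univ hw (mem_univ y), hessian_one, hw2, hw1, hw1]
    have h1 : -1 / m * pd i (pd j φ) y + -1 / m * pd i φ y * (-1 / m * pd j φ y)
        = -1 / m * (pd i (pd j φ) y - 1 / m * (pd i φ y * pd j φ y)) := by ring
    rw [h1, hB, Matrix.one_apply]
    split_ifs
    · ring
    · ring
  · have h1 : Rw = 2 * ∑ i, pd i (pd i φ) y - (m + 1) / m * ∑ i, pd i φ y ^ 2 := by
      rw [hRw, weightedScalarCurvature, scalarCurvature, laplacian, trace_one, trace_one, gradSq_one]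
      simp [ricci_one, hessian_one]
    have h2 : ∑ i, pd i (pd i φ) y - 1 / m * ∑ i, pd i φ y ^ 2 = n * (Rw / (2 * (m + n - 1))) := by
      rw [Finset.mul_sum, ← Finset.sum_sub_distrib]
      have h3 : ∀ i, pd i (pd i φ) y - 1 / m * pd i φ y ^ 2 = Rw / (2 * (m + n - 1)) := fun i => by
        have := hB i i
        rw [Matrix.one_apply_eq, mul_one] at this
        rw [← this, sq]
      rw [Finset.sum_congr rfl fun i _ => h3 i]
      simp
    have h3 : ∑ i, pd i (fun z => Real.exp (w z)) y ^ 2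
        = Real.exp (w y) ^ 2 * (1 / m ^ 2 * ∑ i, pd i φ y ^ 2) := by
      rw [Finset.mul_sum, Finset.mul_sum]
      refine Finset.sum_congr rfl fun i _ => ?_
      rw [pd_exp isOpen_univ hw (mem_univ y), hw1]
      ring
    rw [h3]
    set q := ∑ i, pd i φ y ^ 2
    set L := ∑ i, pd i (pd i φ) y
    have h4 : L = n * (Rw / (2 * (m + n - 1))) + 1 / m * q := by linarith
    rw [h4] at h1
    have hm' := hm.ne'
    -- The traced equation and the definition of the weighted scalar curvature are two linear
    -- relations between Δφ, |∇φ|² and R_φ^m; eliminating Δφ leaves one condition carrying the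
    -- factor m - 1.
    have h5 : (m - 1) * (Rw / (m + n - 1) + q / m) = 0 := by
      field_simp at h1 ⊢
      linear_combination h1
    have h6 : (m - 1) * (2 * -(Real.exp (w y) / m * (Rw / (2 * (m + n - 1)))) * Real.exp (w y)
        - Real.exp (w y) ^ 2 * (1 / m ^ 2 * q))
        = -(Real.exp (w y) ^ 2 / m) * ((m - 1) * (Rw / (m + n - 1) + q / m)) := by
      field_simp
      ring
    rw [h6, h5, mul_zero]

/-- A function on `ℝⁿ`, `n ≥ 2`, with pointwise isotropic Hessian has constant Hessian. -/
theorem exists_isotropic_const {f : EuclideanSpace ℝ (Fin n) → ℝ} (hf : ContDiff ℝ ∞ f)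
    (hn : 2 ≤ n) {H : EuclideanSpace ℝ (Fin n) → ℝ}
    (h : ∀ y i j, pd i (pd j f) y = if i = j then H y else 0) :
    (∀ y, H y = H 0) ∧ ∀ y v w, fderiv ℝ (fderiv ℝ f) y v w = H 0 * inner ℝ v w := by
  have hd : ∀ y, DifferentiableAt ℝ (fderiv ℝ f) y :=
    (hf.fderiv_right (m := ∞) (by simp)).differentiable (by simp)
  have hpd : ∀ i, ContDiffOn ℝ ∞ (pd i f) univ := fun i =>
    contDiffOn_pd isOpen_univ hf.contDiffOn i
  have hH : ∀ i, H = pd i (pd i f) := fun i => funext fun y => by rw [h, if_pos rfl]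
  have i₀ : Fin n := ⟨0, by omega⟩
  have hHd : ∀ y, DifferentiableAt ℝ H y := fun y => by
    rw [hH i₀]
    exact IsMetricOn.diffAt isOpen_univ (contDiffOn_pd isOpen_univ (hpd i₀) i₀) (mem_univ y)
  -- Given k, choose i ≠ k, possible as n ≥ 2: then ∂ₖH = ∂ₖ∂ᵢ∂ᵢf = ∂ᵢ(∂ₖ∂ᵢf) = 0.
  have hH0 : ∀ y, fderiv ℝ H y = 0 := fun y => fderiv_eq_zero_of_pd fun k => by
    haveI : Nontrivial (Fin n) := Fin.nontrivial_iff_two_le.2 hn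
    obtain ⟨i, hi⟩ := exists_ne k
    rw [hH i, pd_comm isOpen_univ (hpd i) (mem_univ y)]
    have h1 : pd k (pd i f) = fun _ => 0 := funext fun z => by rw [h, if_neg hi.symm]
    rw [h1, pd_const]
  have hconst : ∀ y, H y = H 0 := fun y => is_const_of_fderiv_eq_zero (𝕜 := ℝ) hHd hH0 y 0
  refine ⟨hconst, fun y v w => ?_⟩
  rw [SmoothMetric.bilin_eq_sum (fderiv ℝ (fderiv ℝ f) y)]
  have h1 : ∀ i j, fderiv ℝ (fderiv ℝ f) y (EuclideanSpace.single i 1) (EuclideanSpace.single j 1)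
      = if i = j then H 0 else 0 := fun i j => by rw [← pd_pd (hd y), h, hconst y]
  simp only [h1, mul_ite, mul_zero, Finset.sum_ite_eq, Finset.mem_univ, if_true]
  rw [PiLp.inner_apply, Finset.mul_sum]
  refine Finset.sum_congr rfl fun i _ => ?_
  simp
  ring

theorem pd_quadratic (a b : ℝ) (i : Fin n) :
    pd i (fun y : EuclideanSpace ℝ (Fin n) => b + a / 2 * ‖y‖ ^ 2) = fun y => a * y i := by
  funext y
  have h1 := ((hasStrictFDerivAt_norm_sq y).hasFDerivAt.const_mul (a / 2)).const_add b
  have h2 : innerSL ℝ y (EuclideanSpace.single i (1 : ℝ)) = y i := by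
    have : innerSL ℝ y (EuclideanSpace.single i (1 : ℝ))
      = inner ℝ y (EuclideanSpace.single i (1 : ℝ)) := rfl
    rw [this, EuclideanSpace.inner_single_right]
    simp
  rw [pd, h1.fderiv]
  simp only [ContinuousLinearMap.smul_apply, smul_eq_mul, h2, nsmul_eq_mul, Nat.cast_ofNat]
  ring

theorem pd_pd_quadratic (a b : ℝ) (i j : Fin n) (y : EuclideanSpace ℝ (Fin n)) :
    pd i (pd j fun y : EuclideanSpace ℝ (Fin n) => b + a / 2 * ‖y‖ ^ 2) y
      = if i = j then a else 0 := by
  rw [pd_quadratic]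
  have h1 : HasFDerivAt (fun y : EuclideanSpace ℝ (Fin n) => a * y j)
      (a • (EuclideanSpace.proj j : EuclideanSpace ℝ (Fin n) →L[ℝ] ℝ)) y :=
    (EuclideanSpace.proj j : EuclideanSpace ℝ (Fin n) →L[ℝ] ℝ).hasFDerivAt.const_mul a
  rw [pd, h1.fderiv]
  simp [Pi.single_apply, eq_comm]

end LocalCoord

theorem exists_complete_square {E : Type*} [NormedAddCommGroup E] [InnerProductSpace ℝ E]
    [FiniteDimensional ℝ E] {f : E → ℝ} (hf : ContDiff ℝ ∞ f) {α : ℝ} (hα : 0 < α)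
    (h : ∀ y v w, fderiv ℝ (fderiv ℝ f) y v w = 2 * α * inner ℝ v w) :
    ∃ x₀ : E, ∀ y, f y = α * ‖y - x₀‖ ^ 2 + f x₀ := by
  have h1 := eq_quadratic_of_fderiv_fderiv hf h
  set b := (InnerProductSpace.toDual ℝ E).symm (fderiv ℝ f 0)
  have hb : ∀ y, fderiv ℝ f 0 y = inner ℝ y b := fun y => by
    rw [real_inner_comm, InnerProductSpace.toDual_symm_apply]
  refine ⟨-(1 / (2 * α)) • b, fun y => ?_⟩
  rw [h1 y, h1 (-(1 / (2 * α)) • b), hb, hb, norm_sub_sq_real, real_inner_smul_left,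
    real_inner_smul_right, norm_smul, mul_pow, real_inner_self_eq_norm_sq, Real.norm_eq_abs, sq_abs]
  field_simp
  ring

/-! ### Determination of the weight -/

namespace SmoothMetricMeasureSpace
set_option maxSynthPendingDepth 3
open SmoothMetric LocalCoord
variable {n : ℕ} {M : Type*} [TopologicalSpace M]
  [ChartedSpace (EuclideanSpace ℝ (Fin n)) M] [IsManifold (𝓡 n) ∞ M]
  {S : SmoothMetricMeasureSpace n M}
  {B : OpenPartialHomeomorph M (EuclideanSpace ℝ (Fin n))}

/-- In a global chart in which `g` is the round metric with constant `2 (m + n - 1) k`, removing the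
conformal factor makes the weighted Einstein-type equation flat. -/
theorem SatisfiesEinsteinType.flat_chart {lam k D : ℝ} (hn : 0 < n) (hmn : 2 < S.m + n)
    (hS : S.SatisfiesEinsteinType lam) (hlam : lam = 2 * (S.m + n - 1) * k) (hD : 0 < D)
    (hk : 0 < k)
    (hB : B ∈ IsManifold.maximalAtlas (𝓡 n) ∞ M) (hBt : B.target = univ)
    (hf : ∀ x v w, S.g.chartForm B x v w
      = ((1 / D + k * D / 2 * ‖x‖ ^ 2)⁻¹) ^ 2 * inner ℝ v w)
    (hm : 0 < S.m) (x : EuclideanSpace ℝ (Fin n)) (i j : Fin n) :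
    weightedEinstein (fun _ => 1)
      (fun x => S.φ (B.symm x) - S.m * Real.log (1 / D + k * D / 2 * ‖x‖ ^ 2)) S.m i j x = 0 := by
  have hpos : ∀ x : EuclideanSpace ℝ (Fin n), 0 < 1 / D + k * D / 2 * ‖x‖ ^ 2 := fun x => by positivity
  -- The metric is e^{-2w} times the Euclidean one with w = log h, and the weight is changed by -m w
  -- accordingly.
  set h : EuclideanSpace ℝ (Fin n) → ℝ := fun x => 1 / D + k * D / 2 * ‖x‖ ^ 2 with hh
  have hhs : ContDiff ℝ ∞ h := contDiff_const.add (contDiff_const.mul (contDiff_norm_sq ℝ))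
  set w : EuclideanSpace ℝ (Fin n) → ℝ := fun x => Real.log (h x) with hw
  have hws : ContDiff ℝ ∞ w := hhs.log fun x => (hpos x).ne'
  change weightedEinstein (fun _ => 1) (fun x => S.φ (B.symm x) - S.m * w x) S.m i j x = 0
  have hexp : (fun x => Real.exp (w x)) = h := funext fun x => Real.exp_log (hpos x)
  have hφ : ContDiff ℝ ∞ (S.φ ∘ B.symm) := by
    have := contDiffOn_comp_symm' hB S.contMDiff_φ
    rwa [hBt, contDiffOn_univ] at this
  have hG' : ∀ z ∈ univ, S.g.inChart B z = Real.exp (-2 * w z) • (1 : Matrix (Fin n) (Fin n) ℝ) :=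
    fun z _ => by
      ext a b
      rw [inChart_apply, hf]
      have h1 : Real.exp (-2 * w z) = ((h z)⁻¹) ^ 2 := by
        rw [← congrFun hexp z, ← Real.exp_neg, ← Real.exp_nat_mul]
        congr 1
        push_cast
        ring
      rw [h1]
      simp [Matrix.one_apply, EuclideanSpace.inner_single_left, Pi.single_apply, hh]
  have h1 := conformal_weightedEinstein (isMetricOn_one (n := n)) hws.contDiffOn hG' (m := S.m)
    (φ := fun x => S.φ (B.symm x) - S.m * w x) (φ' := S.φ ∘ B.symm)
    (hφ.sub (contDiff_const.mul hws)).contDiffOn (by linarith) (fun h => absurd h hm.ne')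
    (fun z _ => by simp) (mem_univ x) i j
  have h2 : weightedEinstein (S.g.inChart B) (S.φ ∘ B.symm) S.m i j x = _ :=
    hS B hB x (hBt ▸ mem_univ x) i j
  have h3 := hessian_exp (G := fun _ => (1 : Matrix (Fin n) (Fin n) ℝ)) isOpen_univ hws.contDiffOn
    (mem_univ x) i j
  have h4 := gradSq_exp (G := fun _ => (1 : Matrix (Fin n) (Fin n) ℝ)) isOpen_univ hws.contDiffOn
    (mem_univ x)
  rw [hexp, hessian_one, hh, pd_pd_quadratic] at h3
  rw [hexp, gradSq_one, hh] at h4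
  simp only [pd_quadratic, mul_pow, ← Finset.mul_sum] at h4
  have h5 : ∑ i, x i ^ 2 = ‖x‖ ^ 2 := by
    rw [EuclideanSpace.norm_sq_eq]
    simp
  rw [h5] at h4
  have hx := hpos x
  have hex : Real.exp (w x) = h x := congrFun hexp x
  rw [hex] at h3 h4
  rw [h1, hG' x (mem_univ x), hlam] at h2
  have h6 : Real.exp (-2 * w x) = ((h x) ^ 2)⁻¹ := by
    rw [← hex, ← Real.exp_nat_mul, ← Real.exp_neg]
    congr 1
    push_cast
    ring
  rw [h6] at h2
  have hx0 : h x ≠ 0 := hx.ne'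
  have h10 : h x * D = 1 + k * D ^ 2 / 2 * ‖x‖ ^ 2 := by
    simp only [hh]
    field_simp
  clear_value h
  have h7 : hessian (fun _ => 1) w i j x + pd i w x * pd j w x
      = (if i = j then k * D else 0) / h x := by
    rw [h3]
    field_simp
  have h8 : gradSq (fun _ => 1) w x = (k * D) ^ 2 * ‖x‖ ^ 2 / h x ^ 2 := by
    rw [eq_div_iff (pow_ne_zero 2 hx0), mul_pow, h4, mul_comm]
  rw [h7, h8] at h2
  have hN : S.m + n - 1 ≠ 0 := by linarith
  -- The conformal term of the round metric equals k h⁻² δ, because hD - kD²|x|²/2 = 1. It cancels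
  -- the right-hand side exactly for the constant 2(m+n-1)k, which is why the flat constant is zero.
  have h9 : (if i = j then k * D else 0) / h x
      - 1 / 2 * ((k * D) ^ 2 * ‖x‖ ^ 2 / h x ^ 2) * (1 : Matrix (Fin n) (Fin n) ℝ) i j
      = k * ((h x ^ 2)⁻¹ • (1 : Matrix (Fin n) (Fin n) ℝ)) i j := by
    rw [Matrix.smul_apply, Matrix.one_apply, smul_eq_mul]
    split_ifs
    · field_simp
      linear_combination 2 * h10
    · simp
  rw [h9] at h2
  have h11 : (S.m + n - 2) / (2 * (S.m + n - 1)) * (2 * (S.m + n - 1) * k)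
      = (S.m + n - 2) * k := by
    field_simp
  rw [h11] at h2
  linear_combination h2

/-- The weight of a compact Einstein-type space which is a round sphere in stereographic
coordinates `B`. -/
theorem SatisfiesEinsteinType.exists_weight [CompactSpace M] [ConnectedSpace M]
    {lam k D : ℝ} {y : M → ℝ} (hn : 2 ≤ n)
    (hmn : 2 < S.m + n) (hS : S.SatisfiesEinsteinType lam) (hlam : lam = 2 * (S.m + n - 1) * k)
    (hD : 0 < D) (hk : 0 < k) (hB : B ∈ IsManifold.maximalAtlas (𝓡 n) ∞ M) (hBt : B.target = univ)
    (hy : ∀ x, (y (B.symm x))⁻¹ = 1 / D + k * D / 2 * ‖x‖ ^ 2)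
    (hf : ∀ x v w, S.g.chartForm B x v w = y (B.symm x) ^ 2 * inner ℝ v w) :
    (0 < S.m → S.m = 1) ∧ ∃ θ : M → ℝ, ContMDiff (𝓡 n) 𝓘(ℝ) ∞ θ ∧
      (∀ x, S.φ x = -(S.m * θ x)) ∧ ∃ α > 0, ∃ β > 0, ∃ x₀ : EuclideanSpace ℝ (Fin n),
        ∀ x, Real.exp (θ (B.symm x)) = y (B.symm x) * (α * ‖x - x₀‖ ^ 2 + β) := by
  have hpos : ∀ x : EuclideanSpace ℝ (Fin n), 0 < 1 / D + k * D / 2 * ‖x‖ ^ 2 := fun x => by positivity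
  have hyp : ∀ x, y (B.symm x) = (1 / D + k * D / 2 * ‖x‖ ^ 2)⁻¹ := fun x => by rw [← hy, inv_inv]
  rcases S.m_nonneg.eq_or_lt with hm | hm
  -- For m = 0 the weight is trivial, and yh = 1 already has the required form, with the
  -- coefficients of h.
  · refine ⟨fun h => absurd hm h.ne, fun _ => 0, contMDiff_const, fun x => ?_, k * D / 2, by positivity,
      1 / D, by positivity, 0, fun x => ?_⟩
    · rw [S.φ_eq_zero hm.symm, mul_zero, neg_zero]
    · have := (hpos x).ne'
      rw [hyp, Real.exp_zero, sub_zero, add_comm (k * D / 2 * _), inv_mul_cancel₀ this]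
  have hflat := hS.flat_chart (by omega) hmn hlam hD hk hB hBt
    (fun x v w => by rw [hf, hyp]) hm
  set h : EuclideanSpace ℝ (Fin n) → ℝ := fun x => 1 / D + k * D / 2 * ‖x‖ ^ 2 with hh
  have hhs : ContDiff ℝ ∞ h := contDiff_const.add (contDiff_const.mul (contDiff_norm_sq ℝ))
  have hφ : ContDiff ℝ ∞ (S.φ ∘ B.symm) := by
    have := contDiffOn_comp_symm' hB S.contMDiff_φ
    rwa [hBt, contDiffOn_univ] at this
  set φ₀ : EuclideanSpace ℝ (Fin n) → ℝ := fun x => S.φ (B.symm x) - S.m * Real.log (h x) with hφ₀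
  have hφ₀s : ContDiff ℝ ∞ φ₀ := hφ.sub (contDiff_const.mul (hhs.log fun x => (hpos x).ne'))
  set v : EuclideanSpace ℝ (Fin n) → ℝ := fun x => Real.exp (-1 / S.m * φ₀ x) with hv
  have hvs : ContDiff ℝ ∞ v := (contDiff_const.mul hφ₀s).exp
  have hve : ∀ x, v x = Real.exp (-1 / S.m * S.φ (B.symm x)) * h x := fun x => by
    have h1 : -1 / S.m * φ₀ x = -1 / S.m * S.φ (B.symm x) + Real.log (h x) := by
      simp only [hφ₀]
      field_simp
      ring
    simp only [hv]
    rw [h1, Real.exp_add, Real.exp_log (hpos x)]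
  choose H hH hode using fun x => weightedEinstein_one hφ₀s hm (by omega : 0 < n) (hflat x)
  obtain ⟨hH0, hHess⟩ := exists_isotropic_const hvs hn hH
  have hvpos : ∀ x, 0 < v x := fun x => Real.exp_pos _
  -- Compactness of M bounds φ from above, so v = e^{-φ/m} h ≥ εh grows quadratically, which is
  -- impossible for H ≤ 0.
  have hHpos : 0 < H 0 := by
    obtain ⟨q, -, hq⟩ := isCompact_univ.exists_isMaxOn univ_nonempty
      S.contMDiff_φ.continuous.continuousOn
    set ε := Real.exp (-1 / S.m * S.φ q) with hε
    have hεp : 0 < ε := Real.exp_pos _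
    have hlow : ∀ x, ε * h x ≤ v x := fun x => by
      rw [hve]
      refine mul_le_mul_of_nonneg_right (Real.exp_le_exp.2 ?_) (hpos x).le
      have h1 := hq (mem_univ (B.symm x))
      have h2 : 0 ≤ 1 / S.m * (S.φ q - S.φ (B.symm x)) :=
        mul_nonneg (by positivity) (sub_nonneg.2 h1)
      have h3 : -1 / S.m * S.φ (B.symm x) - -1 / S.m * S.φ q
        = 1 / S.m * (S.φ q - S.φ (B.symm x)) := by ring
      linarith
    have hquad := eq_quadratic_of_fderiv_fderiv hvs hHess
    by_contra! hneg
    -- Averaging over x and -x removes the linear term of v. The vector inserted below is scaled so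
    -- that εh equals v(0) + ε/D, a contradiction.
    have h1 : ∀ x, ε * h x ≤ v 0 := fun x => by
      have h2 := hlow x
      have h3 := hlow (-x)
      rw [hquad] at h2 h3
      rw [map_neg, norm_neg] at h3
      have h4 : h (-x) = h x := by simp only [hh, norm_neg]
      rw [h4] at h3
      have h5 : H 0 / 2 * ‖x‖ ^ 2 ≤ 0 :=
        mul_nonpos_of_nonpos_of_nonneg (by linarith) (by positivity)
      linarith
    have h6 := h1 (EuclideanSpace.single ⟨0, by omega⟩ √(v 0 * 2 / (ε * (k * D))))
    have h7 : 0 ≤ v 0 * 2 / (ε * (k * D)) := div_nonneg (by linarith [hvpos 0]) (by positivity)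
    simp only [hh, EuclideanSpace.norm_single, Real.norm_eq_abs, sq_abs, Real.sq_sqrt h7] at h6
    have h8 : ε * (1 / D + k * D / 2 * (v 0 * 2 / (ε * (k * D)))) = ε / D + v 0 := by
      field_simp
    rw [h8] at h6
    have : 0 < ε / D := by positivity
    linarith
  obtain ⟨x₀, hx₀⟩ := exists_complete_square hvs (α := H 0 / 2) (by positivity) fun y v w => by
    rw [hHess]
    ring
  refine ⟨fun _ => ?_, fun x => -1 / S.m * S.φ x, contMDiff_const.mul S.contMDiff_φ, fun x => ?_,
    H 0 / 2, by positivity, v x₀, hvpos _, x₀, fun x => ?_⟩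
  -- At the minimum dv = 0, so (m - 1) · 2Hv = 0 with H and v positive.
  · have h1 : IsLocalMin v x₀ := Eventually.of_forall fun x => by
      rw [hx₀ x]
      have : 0 ≤ H 0 / 2 * ‖x - x₀‖ ^ 2 := by positivity
      linarith
    have h2 := hode x₀
    have h3 : ∀ i, pd i v x₀ = 0 := fun i => by rw [pd, h1.fderiv_eq_zero]; rfl
    simp only [hv] at h3
    simp only [h3] at h2
    rw [hH0] at h2
    have h4 := (hvpos x₀).ne'
    have h5 : 2 * H 0 * Real.exp (-1 / S.m * φ₀ x₀) ≠ 0 :=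
      mul_ne_zero (by positivity) (Real.exp_ne_zero _)
    simp only [ne_eq, OfNat.ofNat_ne_zero, not_false_eq_true, zero_pow, Finset.sum_const_zero,
      sub_zero, mul_eq_zero, h5, or_false] at h2
    linarith
  · field_simp
  · rw [← hx₀, hve, hyp]
    have := (hpos x).ne'
    simp only [hh]
    field_simp
end SmoothMetricMeasureSpace

/-! ### Möbius maps and stereographic projection -/

section moebius
set_option maxSynthPendingDepth 3
variable {E : Type*} [NormedAddCommGroup E] [InnerProductSpace ℝ E]
  [FiniteDimensional ℝ E]

open EuclideanGeometry

/-- The conjugate of a similarity by inversions extends smoothly over the origin. -/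
theorem exists_inversion_conj {R R' a : ℝ} (hR : R ≠ 0) (hR' : R' ≠ 0) (ha : a ≠ 0) (b : E) :
    ∃ (κ : E → E) (O : Set E), IsOpen O ∧ 0 ∈ O ∧ ContDiffOn ℝ ∞ κ O ∧ κ 0 = 0 ∧
      ∀ x ∈ O, x ≠ 0 → κ x ≠ 0 ∧ κ x = inversion 0 R' (a • inversion 0 R x + b) := by
  -- The conjugated point before the last inversion is num/|x|². As |num|² = |x|² den, that
  -- inversion gives R'² num/den, in which all singular powers have cancelled and den(0) = a²R⁴ ≠ 0.
  set num : E → E := fun x => (a * R ^ 2) • x + ‖x‖ ^ 2 • b with hnum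
  set den : E → ℝ := fun x => a ^ 2 * R ^ 4 + 2 * (a * R ^ 2) * inner ℝ x b + ‖x‖ ^ 2 * ‖b‖ ^ 2 with hden
  have hsq : ContDiff ℝ ∞ fun x : E => ‖x‖ ^ 2 := contDiff_norm_sq ℝ
  have hnums : ContDiff ℝ ∞ num := (contDiff_const.smul contDiff_id).add (hsq.smul contDiff_const)
  have hdens : ContDiff ℝ ∞ den :=
    (contDiff_const.add (contDiff_const.mul (contDiff_id.inner ℝ contDiff_const))).add
      (hsq.mul contDiff_const)
  have hnd : ∀ x, ‖num x‖ ^ 2 = ‖x‖ ^ 2 * den x := fun x => by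
    simp only [hnum, hden]
    rw [norm_add_sq_real, norm_smul, norm_smul, real_inner_smul_left, real_inner_smul_right,
      mul_pow, mul_pow]
    simp only [Real.norm_eq_abs, sq_abs]
    ring
  refine ⟨fun x => (R' ^ 2 * (den x)⁻¹) • num x, {x | den x ≠ 0},
    isOpen_ne_fun hdens.continuous continuous_const, ?_, ?_, ?_, fun x hx hx0 => ?_⟩
  · simp [hden, ha, hR]
  · exact (contDiffOn_const.mul (hdens.contDiffOn.inv fun x hx => hx)).smul hnums.contDiffOn
  · simp [hnum]
  · have hx' : ‖x‖ ≠ 0 := norm_ne_zero_iff.2 hx0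
    have hn0 : num x ≠ 0 := by
      intro h0
      have := hnd x
      rw [h0, norm_zero, zero_pow two_ne_zero] at this
      exact mul_ne_zero (pow_ne_zero 2 hx') hx this.symm
    refine ⟨smul_ne_zero (mul_ne_zero (pow_ne_zero 2 hR') (inv_ne_zero hx)) hn0, ?_⟩
    have h1 : a • inversion 0 R x + b = (‖x‖ ^ 2)⁻¹ • num x := by
      rw [inversion_zero_eq]
      simp only [hnum]
      rw [smul_add, smul_smul, smul_smul, smul_smul, inv_mul_cancel₀ (pow_ne_zero 2 hx'), one_smul]
      congr 2
      field_simp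
    rw [h1, inversion_zero_eq, norm_smul, smul_smul]
    congr 1
    rw [div_pow, mul_pow, hnd]
    have hx'' : den x ≠ 0 := hx
    simp only [norm_inv, norm_pow, norm_norm]
    field_simp
end moebius

section sphere
set_option maxSynthPendingDepth 3
variable {n : ℕ}

/-- The value of stereographic projection. -/
theorem exists_stereographic_symm (N : UnitSphere n)
    [Fact (Module.finrank ℝ (EuclideanSpace ℝ (Fin (n + 1))) = n + 1)] :
    ∃ ι : EuclideanSpace ℝ (Fin n) →ₗᵢ[ℝ] EuclideanSpace ℝ (Fin (n + 1)),
      (∀ x, inner ℝ (N : EuclideanSpace ℝ (Fin (n + 1))) (ι x) = 0) ∧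
      ∀ x, ((stereographic' n N).symm x : EuclideanSpace ℝ (Fin (n + 1)))
        = (‖x‖ ^ 2 + 4)⁻¹ • ((4 : ℝ) • ι x + (‖x‖ ^ 2 - 4) • N.val) := by
  let U : (ℝ ∙ (N : EuclideanSpace ℝ (Fin (n + 1))))ᗮ ≃ₗᵢ[ℝ] EuclideanSpace ℝ (Fin n) :=
    (OrthonormalBasis.fromOrthogonalSpanSingleton n (ne_zero_of_mem_unit_sphere N)).repr
  refine ⟨(Submodule.subtypeₗᵢ _).comp U.symm.toLinearIsometry, fun x => ?_, fun x => ?_⟩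
  · exact Submodule.mem_orthogonal_singleton_iff_inner_right.1 (U.symm x).2
  · rw [stereographic'_symm_apply]
    have h1 : ‖((U.symm x : (ℝ ∙ (N : EuclideanSpace ℝ (Fin (n + 1))))ᗮ) :
        EuclideanSpace ℝ (Fin (n + 1)))‖ = ‖x‖ := by
      rw [Submodule.norm_coe, U.symm.norm_map]
    change (‖((U.symm x : (ℝ ∙ (N : EuclideanSpace ℝ (Fin (n + 1))))ᗮ) :
        EuclideanSpace ℝ (Fin (n + 1)))‖ ^ 2 + 4)⁻¹ • (4 : ℝ) • _
      + _ • (‖((U.symm x : (ℝ ∙ (N : EuclideanSpace ℝ (Fin (n + 1))))ᗮ) :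
        EuclideanSpace ℝ (Fin (n + 1)))‖ ^ 2 - 4) • _ = _
    rw [h1, ← smul_add]
    rfl

/-- The stereographic projections from `N` and from `-N`, the latter followed by an isometry,
differ by an inversion. -/
theorem exists_sphere_reflection (N : UnitSphere n)
    [Fact (Module.finrank ℝ (EuclideanSpace ℝ (Fin (n + 1))) = n + 1)] :
    ∃ ρ : UnitSphere n → UnitSphere n, ContMDiff (𝓡 n) (𝓡 n) ∞ ρ ∧ (∀ z, ρ (ρ z) = z) ∧
      ρ ((stereographic' n N).symm 0) = N ∧
      ∀ x ≠ 0, ρ ((stereographic' n N).symm x)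
        = (stereographic' n N).symm (EuclideanGeometry.inversion 0 2 x) := by
  obtain ⟨ι, hι, hs⟩ := exists_stereographic_symm N
  -- The reflection exchanges N and -N. In stereographic coordinates it changes the sign of |x|² - 4
  -- relative to |x|² + 4, which is inversion in the sphere of radius 2.
  set L := (ℝ ∙ (N : EuclideanSpace ℝ (Fin (n + 1))))ᗮ.reflection
  have hL : ∀ z : UnitSphere n, L z ∈ Metric.sphere (0 : EuclideanSpace ℝ (Fin (n + 1))) 1 :=
    fun z => by simp [L]
  have hLN : L N.val = -N.val := Submodule.reflection_orthogonalComplement_singleton_eq_neg _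
  have hLι : ∀ x, L (ι x) = ι x := fun x => Submodule.reflection_mem_subspace_eq_self
    (Submodule.mem_orthogonal_singleton_iff_inner_right.2 (hι x))
  have hLs : ∀ x, L ((stereographic' n N).symm x)
      = (‖x‖ ^ 2 + 4)⁻¹ • ((4 : ℝ) • ι x - (‖x‖ ^ 2 - 4) • N.val) := fun x => by
    rw [hs, map_smul, map_add, map_smul, map_smul, hLN, hLι, smul_neg,
      ← sub_eq_add_neg]
  refine ⟨Set.codRestrict (fun z : UnitSphere n => L z) _ hL, ?_, fun z => ?_, ?_, fun x hx => ?_⟩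
  · exact ContMDiff.codRestrict_sphere (L.contDiff.contMDiff.comp contMDiff_coe_sphere) hL
  · exact Subtype.ext (Submodule.reflection_reflection _ _)
  · refine Subtype.ext ((hLs 0).trans ?_)
    simp [smul_smul]
  · refine Subtype.ext ((hLs x).trans ?_)
    have hx' : ‖x‖ ≠ 0 := norm_ne_zero_iff.2 hx
    rw [hs, norm_inversion_zero, inversion_zero_eq, map_smul]
    match_scalars
    · field_simp
      ring
    · field_simp
      ring
end sphere

/-! ### Gluing the diffeomorphism with the sphere -/

section glue
set_option maxSynthPendingDepth 3
open EuclideanGeometry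
variable {n : ℕ} {M : Type*} [TopologicalSpace M]
  [ChartedSpace (EuclideanSpace ℝ (Fin n)) M] [IsManifold (𝓡 n) ∞ M] [T2Space M]

theorem stereographic_mem_maximalAtlas
    [Fact (Module.finrank ℝ (EuclideanSpace ℝ (Fin (n + 1))) = n + 1)] (N : UnitSphere n) :
    stereographic' n N ∈ IsManifold.maximalAtlas (𝓡 n) ∞ (UnitSphere n) :=
  IsManifold.subset_maximalAtlas ⟨N, rfl⟩

/-- A manifold with two charts onto `ℝⁿ` that are related by an inversion is diffeomorphic to the
sphere. -/
theorem exists_sphere_diffeo [Fact (Module.finrank ℝ (EuclideanSpace ℝ (Fin (n + 1))) = n + 1)]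
    (N : UnitSphere n) {p' : M} {R : ℝ} (hR : R ≠ 0)
    {B C : OpenPartialHomeomorph M (EuclideanSpace ℝ (Fin n))}
    (hB : B ∈ IsManifold.maximalAtlas (𝓡 n) ∞ M) (hC : C ∈ IsManifold.maximalAtlas (𝓡 n) ∞ M)
    (hBt : B.target = univ) (hCt : C.target = univ) (hBs : B.source = {p'}ᶜ) (hC0 : C.symm 0 = p')
    (hBC : ∀ x ≠ 0, C.symm x = B.symm (inversion 0 R x)) {a : ℝ} (ha : a ≠ 0)
    (x₀ : EuclideanSpace ℝ (Fin n)) :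
    ∃ F : UnitSphere n ≃ₘ^∞⟮𝓡 n, 𝓡 n⟯ M,
      ∀ z ≠ N, F z = B.symm (a • stereographic' n N z + x₀) := by
  classical
  set s := stereographic' n N with hs
  have hsm : s ∈ IsManifold.maximalAtlas (𝓡 n) ∞ (UnitSphere n) := stereographic_mem_maximalAtlas N
  have hss : s.source = {N}ᶜ := stereographic'_source N
  have hst : s.target = univ := stereographic'_target N
  have hsymm : ∀ x, s (s.symm x) = x := fun x => s.right_inv (hst ▸ mem_univ x)
  have hsymm' : ∀ z ≠ N, s.symm (s z) = z := fun z hz => s.left_inv (hss ▸ hz)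
  have hsN : ∀ x, s.symm x ≠ N := fun x => by
    have := s.map_target (hst ▸ mem_univ x)
    rwa [hss] at this
  have hBsymm : ∀ x, B (B.symm x) = x := fun x => B.right_inv (hBt ▸ mem_univ x)
  have hBsymm' : ∀ q ≠ p', B.symm (B q) = q := fun q hq => B.left_inv (hBs ▸ hq)
  have hBp : ∀ x, B.symm x ≠ p' := fun x => by
    have := B.map_target (hBt ▸ mem_univ x)
    rwa [hBs] at this
  have hCsymm : ∀ x, C (C.symm x) = x := fun x => C.right_inv (hCt ▸ mem_univ x)
  have hCs : ∀ x, C.symm x ∈ C.source := fun x => C.map_target (hCt ▸ mem_univ x)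
  have hpC : p' ∈ C.source := hC0 ▸ hCs 0
  have hCp : C p' = 0 := by rw [← hC0, hCsymm]
  have hss' : ContMDiff (𝓡 n) (𝓡 n) ∞ s.symm := by
    have := contMDiffOn_symm_of_mem_maximalAtlas hsm
    rwa [hst, contMDiffOn_univ] at this
  have hBs' : ContMDiff (𝓡 n) (𝓡 n) ∞ B.symm := by
    have := contMDiffOn_symm_of_mem_maximalAtlas hB
    rwa [hBt, contMDiffOn_univ] at this
  have hCs' : ContMDiff (𝓡 n) (𝓡 n) ∞ C.symm := by
    have := contMDiffOn_symm_of_mem_maximalAtlas hC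
    rwa [hCt, contMDiffOn_univ] at this
  obtain ⟨ρ, hρ, hρρ, hρ0, hρs⟩ := exists_sphere_reflection N
  -- κ is the coordinate expression of the map near the missing pole, between the chart s ∘ ρ at N
  -- and the chart C at p'; κ' is that of the inverse map.
  obtain ⟨κ, O, hO, h0O, hκ, hκ0, hκi⟩ := exists_inversion_conj (two_ne_zero (α := ℝ)) hR ha x₀
  obtain ⟨κ', O', hO', h0O', hκ', hκ0', hκi'⟩ :=
    exists_inversion_conj hR (two_ne_zero (α := ℝ)) (inv_ne_zero ha) (-(a⁻¹ • x₀))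
  set T : EuclideanSpace ℝ (Fin n) → EuclideanSpace ℝ (Fin n) := fun x => a • x + x₀ with hT
  set T' : EuclideanSpace ℝ (Fin n) → EuclideanSpace ℝ (Fin n) := fun x => a⁻¹ • x + -(a⁻¹ • x₀) with hT'
  have hTs : ContDiff ℝ ∞ T := by fun_prop
  have hTs' : ContDiff ℝ ∞ T' := by fun_prop
  have hTT' : ∀ x, T (T' x) = x := fun x => by
    simp only [hT, hT', smul_add, smul_neg, smul_smul, mul_inv_cancel₀ ha, one_smul]
    abel
  have hT'T : ∀ x, T' (T x) = x := fun x => by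
    simp only [hT, hT', smul_add, smul_smul, inv_mul_cancel₀ ha, one_smul]
    abel
  set f : UnitSphere n → M := fun z => if z = N then p' else B.symm (T (s z)) with hf
  set f' : M → UnitSphere n := fun q => if q = p' then N else s.symm (T' (B q)) with hf'
  have hfN : f N = p' := if_pos rfl
  have hfn : ∀ z ≠ N, f z = B.symm (T (s z)) := fun z hz => if_neg hz
  have hfp : f' p' = N := if_pos rfl
  have hfp' : ∀ q ≠ p', f' q = s.symm (T' (B q)) := fun q hq => if_neg hq
  have hl : Function.LeftInverse f' f := fun z => by
    by_cases hz : z = N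
    · rw [hz, hfN, hfp]
    · rw [hfn z hz, hfp' _ (hBp _), hBsymm, hT'T, hsymm' z hz]
  have hr : Function.RightInverse f' f := fun q => by
    by_cases hq : q = p'
    · rw [hq, hfp, hfN]
    · rw [hfp' q hq, hfn _ (hsN _), hsymm, hTT', hBsymm' q hq]
  have hρN : ρ N = s.symm 0 := by rw [← hρ0, hρρ]
  have hfs : ContMDiff (𝓡 n) (𝓡 n) ∞ f := by
    intro z
    by_cases hz : z = N
    · have hzs : ρ z ∈ s.source := by rw [hss, hz, hρN]; exact hsN 0
      have h1 : ContMDiffAt (𝓡 n) (𝓡 n) ∞ (fun z => s (ρ z)) z :=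
        ((contMDiffOn_of_mem_maximalAtlas hsm).contMDiffAt (s.open_source.mem_nhds hzs)).comp z
          (hρ z)
      have h2 : s (ρ z) = 0 := by rw [hz, hρN, hsymm]
      have h3 : ContMDiffAt (𝓡 n) (𝓡 n) ∞ (fun z => C.symm (κ (s (ρ z)))) z :=
        (hCs' _).comp z (ContMDiffAt.comp z
          ((hκ.contDiffAt (hO.mem_nhds (h2 ▸ h0O))).contMDiffAt) h1)
      refine h3.congr_of_eventuallyEq ?_
      filter_upwards [h1.continuousAt.preimage_mem_nhds (hO.mem_nhds (h2 ▸ h0O)),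
        hρ.continuous.continuousAt.preimage_mem_nhds (s.open_source.mem_nhds hzs)] with z' hz' hzs'
      by_cases h : z' = N
      · rw [h, hfN, hρN, hsymm, hκ0, hC0]
      · have h4 : s (ρ z') ≠ 0 := fun h0 => h (by
          rw [← hρρ z', ← s.left_inv hzs', h0, hρ0])
        obtain ⟨h5, h6⟩ := hκi _ hz' h4
        rw [hfn z' h, hBC _ h5, h6, inversion_inversion _ hR]
        have h7 := hρs _ h4
        rw [s.left_inv hzs', hρρ] at h7
        conv_lhs => rw [h7, hsymm]
    · have h1 : ContMDiffAt (𝓡 n) (𝓡 n) ∞ (fun z => B.symm (T (s z))) z :=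
        (hBs' _).comp z (ContMDiffAt.comp (g := T) z (hTs.contMDiff _)
          ((contMDiffOn_of_mem_maximalAtlas hsm).contMDiffAt (s.open_source.mem_nhds (by rw [hss]; exact hz))))
      refine h1.congr_of_eventuallyEq ?_
      filter_upwards [isOpen_compl_singleton.mem_nhds hz] with z' hz' using hfn z' hz'
  have hfs' : ContMDiff (𝓡 n) (𝓡 n) ∞ f' := by
    intro q
    by_cases hq : q = p'
    · have hqC : q ∈ C.source := hq ▸ hpC
      have h1 : ContMDiffAt (𝓡 n) (𝓡 n) ∞ C q :=
        (contMDiffOn_of_mem_maximalAtlas hC).contMDiffAt (C.open_source.mem_nhds hqC)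
      have h2 : C q = 0 := by rw [hq, hCp]
      have h3 : ContMDiffAt (𝓡 n) (𝓡 n) ∞ (fun q => ρ (s.symm (κ' (C q)))) q :=
        (hρ _).comp q ((hss' _).comp q (ContMDiffAt.comp q
          ((hκ'.contDiffAt (hO'.mem_nhds (h2 ▸ h0O'))).contMDiffAt) h1))
      refine h3.congr_of_eventuallyEq ?_
      filter_upwards [h1.continuousAt.preimage_mem_nhds (hO'.mem_nhds (h2 ▸ h0O')),
        C.open_source.mem_nhds hqC] with q' hq' hqC'
      by_cases h : q' = p'
      · rw [h, hfp, hCp, hκ0', hρ0]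
      · have h4 : C q' ≠ 0 := fun h0 => h (by rw [← C.left_inv hqC', h0, hC0])
        obtain ⟨h5, h6⟩ := hκi' _ hq' h4
        rw [hfp' q' h, hρs _ h5, h6, inversion_inversion _ two_ne_zero]
        have h7 := hBC _ h4
        rw [C.left_inv hqC'] at h7
        conv_lhs => rw [h7, hBsymm]
    · have h1 : ContMDiffAt (𝓡 n) (𝓡 n) ∞ (fun q => s.symm (T' (B q))) q :=
        (hss' _).comp q (ContMDiffAt.comp (g := T') q (hTs'.contMDiff _)
          ((contMDiffOn_of_mem_maximalAtlas hB).contMDiffAt (B.open_source.mem_nhds (by rw [hBs]; exact hq))))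
      refine h1.congr_of_eventuallyEq ?_
      filter_upwards [isOpen_compl_singleton.mem_nhds hq] with q' hq' using hfp' q' hq'
  exact ⟨⟨⟨f, f', hl, hr⟩, hfs, hfs'⟩, hfn⟩
end glue

/-! ### Conformal equivalence with the round sphere -/

namespace SmoothMetric
set_option maxSynthPendingDepth 3
variable {n : ℕ} {M : Type*} [TopologicalSpace M]
  [ChartedSpace (EuclideanSpace ℝ (Fin n)) M] {P : Type*} [TopologicalSpace P]
  [ChartedSpace (EuclideanSpace ℝ (Fin n)) P]

/-- The derivative of a map, with values in the model space. -/
def mder (f : P → M) (x : P) : EuclideanSpace ℝ (Fin n) →L[ℝ] EuclideanSpace ℝ (Fin n) :=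
  mfderiv (𝓡 n) (𝓡 n) f x

variable [IsManifold (𝓡 n) ∞ M] [IsManifold (𝓡 n) ∞ P] {F : P → M}
  {c : OpenPartialHomeomorph P (EuclideanSpace ℝ (Fin n))}
  {C : OpenPartialHomeomorph M (EuclideanSpace ℝ (Fin n))} {y : EuclideanSpace ℝ (Fin n)}

theorem mder_chart (hF : ContMDiff (𝓡 n) (𝓡 n) ∞ F)
    (hc : c ∈ IsManifold.maximalAtlas (𝓡 n) ∞ P) (hC : C ∈ IsManifold.maximalAtlas (𝓡 n) ∞ M)
    (hy : y ∈ c.target) (hy' : F (c.symm y) ∈ C.source) (v : EuclideanSpace ℝ (Fin n)) :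
    fderiv ℝ (fun y => C (F (c.symm y))) y v
      = coframe C (F (c.symm y)) (mder F (c.symm y) (frame c y v)) := by
  have h := (mdifferentiableAt_chart hC hy').hasMFDerivAt.comp y
    ((hF.mdifferentiable (by simp) _).hasMFDerivAt.comp y
      (mdifferentiableAt_chart_symm hc hy).hasMFDerivAt)
  have h2 := h.mfderiv
  rw [mfderiv_eq_fderiv] at h2
  exact congrArg (fun B : EuclideanSpace ℝ (Fin n) →L[ℝ] EuclideanSpace ℝ (Fin n) => B v) h2

theorem chartForm_map (g : SmoothMetric n M) (hF : ContMDiff (𝓡 n) (𝓡 n) ∞ F)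
    (hc : c ∈ IsManifold.maximalAtlas (𝓡 n) ∞ P) (hC : C ∈ IsManifold.maximalAtlas (𝓡 n) ∞ M)
    (hy : y ∈ c.target) (hy' : F (c.symm y) ∈ C.source) (v w : EuclideanSpace ℝ (Fin n)) :
    g.chartForm C (C (F (c.symm y))) (fderiv ℝ (fun y => C (F (c.symm y))) y v)
      (fderiv ℝ (fun y => C (F (c.symm y))) y w)
      = g.form (F (c.symm y)) (mder F (c.symm y) (frame c y v))
        (mder F (c.symm y) (frame c y w)) := by
  rw [mder_chart hF hc hC hy hy', mder_chart hF hc hC hy hy']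
  change g.form (C.symm (C (F (c.symm y)))) (frame C _ _) (frame C _ _) = _
  rw [C.left_inv hy', frame_coframe hC hy', frame_coframe hC hy']

/-- A conformal map away from a point is conformal. -/
theorem form_eq_of_ne (hn : 0 < n) (g₁ : SmoothMetric n P) (g : SmoothMetric n M)
    (hF : ContMDiff (𝓡 n) (𝓡 n) ∞ F) {ψ : P → ℝ} (hψ : Continuous ψ) {z₀ : P}
    (h : ∀ z ≠ z₀, ∀ v w, g₁.form z v w = ψ z * g.form (F z) (mder F z v) (mder F z w))
    (v w : EuclideanSpace ℝ (Fin n)) :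
    g₁.form z₀ v w = ψ z₀ * g.form (F z₀) (mder F z₀ v) (mder F z₀ w) := by
  set c := chartAt (EuclideanSpace ℝ (Fin n)) z₀
  have hc : c ∈ IsManifold.maximalAtlas (𝓡 n) ∞ P := IsManifold.chart_mem_maximalAtlas _
  have hz : z₀ ∈ c.source := mem_chart_source _ _
  set C := chartAt (EuclideanSpace ℝ (Fin n)) (F z₀)
  have hC : C ∈ IsManifold.maximalAtlas (𝓡 n) ∞ M := IsManifold.chart_mem_maximalAtlas _
  have hFz : F z₀ ∈ C.source := mem_chart_source _ _
  set y₀ := c z₀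
  have hy₀ : y₀ ∈ c.target := c.map_source hz
  have hcy : c.symm y₀ = z₀ := c.left_inv hz
  set U := c.target ∩ c.symm ⁻¹' (F ⁻¹' C.source) with hU
  have hUo : IsOpen U := c.symm.isOpen_inter_preimage (C.open_source.preimage hF.continuous)
  have hyU : y₀ ∈ U := ⟨hy₀, by rw [mem_preimage, hcy]; exact hFz⟩
  set G : EuclideanSpace ℝ (Fin n) → EuclideanSpace ℝ (Fin n) := fun y => C (F (c.symm y)) with hG
  have hGs : ContDiffOn ℝ ∞ G U := by
    rw [← contMDiffOn_iff_contDiffOn]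
    exact (contMDiffOn_of_mem_maximalAtlas hC).comp
      (hF.comp_contMDiffOn ((contMDiffOn_symm_of_mem_maximalAtlas hc).mono inter_subset_left))
      fun y hy => hy.2
  have hG0 : ContinuousAt G y₀ := (hGs.contDiffAt (hUo.mem_nhds hyU)).continuousAt
  have hD : ContinuousAt (fderiv ℝ G) y₀ :=
    ((hGs.fderiv_of_isOpen (m := ∞) hUo (by simp)).contDiffAt (hUo.mem_nhds hyU)).continuousAt
  have hGC : G y₀ ∈ C.target := C.map_source hyU.2
  have hform : ContinuousAt (fun y => g.chartForm C (G y)) y₀ :=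
    ContinuousAt.comp (g := g.chartForm C)
      ((contDiffOn_chartForm hC g).contDiffAt (C.open_target.mem_nhds hGC)).continuousAt hG0
  have hψ0 : ContinuousAt (fun y => ψ (c.symm y)) y₀ :=
    hψ.continuousAt.comp (c.continuousAt_symm hy₀)
  -- Both sides are continuous in the coordinate and agree on the punctured neighbourhood, in which
  -- the centre is not isolated because n > 0.
  have hkey : ∀ a b, g₁.chartForm c y₀ a b
      = ψ (c.symm y₀) * g.chartForm C (G y₀) (fderiv ℝ G y₀ a) (fderiv ℝ G y₀ b) := fun a b => by
    have h1 : Tendsto (fun y => g₁.chartForm c y a b) (𝓝[≠] y₀) (𝓝 (g₁.chartForm c y₀ a b)) :=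
      ((((contDiffOn_chartForm hc g₁).contDiffAt (c.open_target.mem_nhds hy₀)).continuousAt.clm_apply
        continuousAt_const).clm_apply continuousAt_const).tendsto.mono_left nhdsWithin_le_nhds
    have h2 : Tendsto (fun y => ψ (c.symm y)
        * g.chartForm C (G y) (fderiv ℝ G y a) (fderiv ℝ G y b)) (𝓝[≠] y₀)
        (𝓝 (ψ (c.symm y₀) * g.chartForm C (G y₀) (fderiv ℝ G y₀ a) (fderiv ℝ G y₀ b))) :=
      (hψ0.mul ((hform.clm_apply (hD.clm_apply continuousAt_const)).clm_apply
        (hD.clm_apply continuousAt_const))).tendsto.mono_left nhdsWithin_le_nhds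
    haveI : Nonempty (Fin n) := ⟨⟨0, hn⟩⟩
    haveI : (𝓝[≠] y₀).NeBot := Module.punctured_nhds_neBot ℝ _ _
    refine tendsto_nhds_unique h1 (h2.congr' ?_)
    filter_upwards [self_mem_nhdsWithin, mem_nhdsWithin_of_mem_nhds (hUo.mem_nhds hyU)] with y hy hyU'
    rw [chartForm_map g hF hc hC hyU'.1 hyU'.2, ← h _ fun h0 => hy ?_]
    · rfl
    · rw [mem_singleton_iff, ← c.right_inv hyU'.1, h0]
  have h3 := hkey (coframe c z₀ v) (coframe c z₀ w)
  rw [chartForm_map g hF hc hC hyU.1 hyU.2] at h3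
  change g₁.form (c.symm y₀) (frame c y₀ _) (frame c y₀ _) = _ at h3
  rwa [frame_coframe hc hz, frame_coframe hc hz, hcy] at h3

end SmoothMetric

section sphere
set_option maxSynthPendingDepth 3
open SmoothMetric
variable {n : ℕ}

/-- The derivative of inverse stereographic projection has a component along ι v and one along 8N -
4ι x. As ι is isometric with image orthogonal to N, the remaining inner products collapse to the
conformal factor 4/(|x|² + 4). -/
theorem stereographic_conformal
    [Fact (Module.finrank ℝ (EuclideanSpace ℝ (Fin (n + 1))) = n + 1)] (N : UnitSphere n)
    {r : ℝ} (hr : 0 < r) (x v w : EuclideanSpace ℝ (Fin n)) :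
    (roundMetric n r hr).chartForm (stereographic' n N) x v w
      = r ^ 2 * ((4 * (‖x‖ ^ 2 + 4)⁻¹) ^ 2 * inner ℝ v w) := by
  obtain ⟨ι, hι, hs⟩ := exists_stereographic_symm N
  set s := stereographic' n N
  have hsm : s ∈ IsManifold.maximalAtlas (𝓡 n) ∞ (UnitSphere n) := stereographic_mem_maximalAtlas N
  have hst : s.target = univ := stereographic'_target N
  set f : EuclideanSpace ℝ (Fin n) → EuclideanSpace ℝ (Fin (n + 1)) := fun x => (s.symm x : _) with hf
  have hd : ∀ v, sphereInclDeriv n (s.symm x) (frame s x v) = fderiv ℝ f x v := fun v => by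
    have h1 := (((contMDiff_coe_sphere (E := EuclideanSpace ℝ (Fin (n + 1))) (n := n)
      (m := ∞)).mdifferentiable (by simp)) (s.symm x)).hasMFDerivAt.comp x
      (mdifferentiableAt_chart_symm hsm (hst ▸ mem_univ x)).hasMFDerivAt
    have h2 := h1.mfderiv
    rw [mfderiv_eq_fderiv] at h2
    exact (congrArg (fun B : EuclideanSpace ℝ (Fin n) →L[ℝ] EuclideanSpace ℝ (Fin (n + 1)) => B v)
      h2).symm
  have hfx : f = fun x => (‖x‖ ^ 2 + 4)⁻¹ • ((4 : ℝ) • ι x + (‖x‖ ^ 2 - 4) • N.val) := funext hs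
  have hp : ‖x‖ ^ 2 + 4 ≠ 0 := by positivity
  have hD : ∀ v, fderiv ℝ f x v = (4 * (‖x‖ ^ 2 + 4)⁻¹) • ι v
      + (2 * inner ℝ x v * (‖x‖ ^ 2 + 4)⁻¹ ^ 2) • ((8 : ℝ) • N.val - (4 : ℝ) • ι x) := fun v => by
    have hsq : HasFDerivAt (fun x : EuclideanSpace ℝ (Fin n) => ‖x‖ ^ 2) (2 • innerSL ℝ x) x :=
      (hasStrictFDerivAt_norm_sq x).hasFDerivAt
    have h1 : HasFDerivAt (fun x : EuclideanSpace ℝ (Fin n) => (‖x‖ ^ 2 + 4)⁻¹)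
        (-((‖x‖ ^ 2 + 4) ^ 2)⁻¹ • (2 • innerSL ℝ x)) x :=
      (hasDerivAt_inv hp).comp_hasFDerivAt x (hsq.add_const 4)
    have h2 : HasFDerivAt (fun x : EuclideanSpace ℝ (Fin n) => (4 : ℝ) • ι x + (‖x‖ ^ 2 - 4) • N.val)
        ((4 : ℝ) • ι.toContinuousLinearMap + (2 • innerSL ℝ x).smulRight N.val) x :=
      (ι.toContinuousLinearMap.hasFDerivAt.const_smul (4 : ℝ)).add
        ((hsq.sub_const 4).smul_const N.val)
    have h0 : HasFDerivAt (fun x : EuclideanSpace ℝ (Fin n) =>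
        (‖x‖ ^ 2 + 4)⁻¹ • ((4 : ℝ) • ι x + (‖x‖ ^ 2 - 4) • N.val)) _ x := h1.smul h2
    rw [hfx, h0.fderiv]
    have h3 : innerSL ℝ x v = inner ℝ x v := rfl
    simp only [ContinuousLinearMap.add_apply, ContinuousLinearMap.smul_apply,
      ContinuousLinearMap.smulRight_apply, LinearIsometry.coe_toContinuousLinearMap, h3,
      nsmul_eq_mul, smul_eq_mul]
    match_scalars
    · ring
    · push_cast
      field_simp
      ring
    · push_cast
      field_simp
  change r ^ 2 * inner ℝ (sphereInclDeriv n (s.symm x) (frame s x v))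
    (sphereInclDeriv n (s.symm x) (frame s x w)) = _
  have hN : inner ℝ N.val N.val = (1 : ℝ) := by
    rw [real_inner_self_eq_norm_sq, norm_eq_of_mem_sphere, one_pow]
  have hι' : ∀ x, inner ℝ (ι x) N.val = 0 := fun x => by rw [real_inner_comm, hι]
  rw [hd, hd, hD, hD]
  simp only [inner_add_left, inner_add_right, inner_sub_left, inner_sub_right,
    real_inner_smul_left, real_inner_smul_right, ι.inner_map_map, hN, hι, hι',
    real_inner_self_eq_norm_sq]
  rw [real_inner_comm x v]
  field_simp
  ring
end sphere

namespace SmoothMetricMeasureSpace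
set_option maxSynthPendingDepth 3
open SmoothMetric
variable {n : ℕ} {M : Type*} [TopologicalSpace M]
  [ChartedSpace (EuclideanSpace ℝ (Fin n)) M] [IsManifold (𝓡 n) ∞ M]
  {S : SmoothMetricMeasureSpace n M}

/-- The choice σ = -(m+n-2)θ matches the metrics. The determinant contributes e^{-nθ} and the weight
e^{-mθ}, together the exponent required of the densities. -/
theorem conformallyEquivalent_of_form {N : Type*} [TopologicalSpace N]
    [ChartedSpace (EuclideanSpace ℝ (Fin n)) N] [IsManifold (𝓡 n) ∞ N]
    {S' : SmoothMetricMeasureSpace n N} (hmn : 2 < S.m + n) (hm : S'.m = S.m)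
    (F : N ≃ₘ^∞⟮𝓡 n, 𝓡 n⟯ M) {θ : M → ℝ} (hθ : ContMDiff (𝓡 n) 𝓘(ℝ) ∞ θ)
    (hφ : ∀ z, S'.φ z = S.φ (F z) + S.m * θ (F z))
    (hg : ∀ z v w, S'.g.form z v w
      = Real.exp (-2 * θ (F z)) * S.g.form (F z) (mder F z v) (mder F z w)) :
    S.ConformallyEquivalent S' := by
  have hN : S.m + n - 2 ≠ 0 := by linarith
  refine ⟨hm, F, fun z => -(S.m + n - 2) * θ (F z), contMDiff_const.mul (hθ.comp F.contMDiff),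
    fun z v w => ?_, fun z b => ?_⟩
  · have h1 : 2 / (S.m + n - 2) * (-(S.m + n - 2) * θ (F z)) = -2 * θ (F z) := by field_simp
    rw [h1]
    exact hg z v w
  · have h1 : (S.m + n) / (S.m + n - 2) * (-(S.m + n - 2) * θ (F z))
        = -(S.m + n) * θ (F z) := by field_simp
    have h2 : (Matrix.of fun i j => S'.g.inner z (b i) (b j))
        = Real.exp (-2 * θ (F z)) • Matrix.of fun i j => S.g.inner (F z)
          (mfderiv (𝓡 n) (𝓡 n) F z (b i)) (mfderiv (𝓡 n) (𝓡 n) F z (b j)) := by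
      ext i j
      exact hg z (b i) (b j)
    have h3 : √(Real.exp (-2 * θ (F z)) ^ n) = Real.exp (-n * θ (F z)) := by
      rw [← Real.exp_nat_mul, ← Real.sqrt_sq (Real.exp_nonneg (-n * θ (F z))), ← Real.exp_nat_mul]
      congr 2
      push_cast
      ring
    rw [density, density, h2, Matrix.det_smul, Fintype.card_fin,
      Real.sqrt_mul (pow_nonneg (Real.exp_nonneg _) n), h3, h1, hφ, ← mul_assoc, ← mul_assoc,
      ← Real.exp_add, ← Real.exp_add]
    congr 2
    ring

variable [T2Space M] [CompactSpace M] [ConnectedSpace M]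

/-- Since e^θ = y (α|x-x₀|² + β) and g = y² dx², rescaling to weight one gives e^{-2θ}g =
dx²/(α|x-x₀|² + β)², independent of y. This is a round metric in stereographic coordinates after a
similarity. -/
theorem SatisfiesEinsteinType.conformallyEquivalent_sphere {lam k D : ℝ} {y : M → ℝ} (hn : 2 ≤ n)
    (hmn : 2 < S.m + n) (hS : S.SatisfiesEinsteinType lam) (hlam : lam = 2 * (S.m + n - 1) * k)
    (h : IsHeight S.g y k D) (hmax : ∃ p, y p = D) :
    (0 < S.m → S.m = 1) ∧ ∃ (r : ℝ) (hr : 0 < r),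
      S.ConformallyEquivalent (roundSphere n r hr S.m S.m_nonneg) := by
  haveI := Fact.mk (@finrank_euclideanSpace_fin ℝ _ (n + 1))
  obtain ⟨p', R, hR, B, hB, C, hC, hBt, hCt, hBs, hC0, hBC, hy, hf⟩ :=
    h.exists_inversion_charts hn hmax
  obtain ⟨hm, θ, hθ, hφ, α, hα, β, hβ, x₀, hθB⟩ :=
    hS.exists_weight hn hmn hlam h.D_pos h.k_pos hB hBt hy hf
  refine ⟨hm, ?_⟩
  -- With 4αa² = β the substitution x = az + x₀ turns the denominator into (β/4)(|z|² + 4), the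
  -- stereographic factor for radius a/β.
  set a : ℝ := √(β / (4 * α)) with ha
  have hap : 0 < a := Real.sqrt_pos.2 (by positivity)
  have ha2 : 4 * α * a ^ 2 = β := by
    rw [ha, Real.sq_sqrt (by positivity)]
    field_simp
  let N : UnitSphere n := ⟨EuclideanSpace.single 0 1, by simp⟩
  obtain ⟨F, hF⟩ := exists_sphere_diffeo N hR.ne' hB hC hBt hCt hBs hC0 hBC hap.ne' x₀
  have hr : 0 < a / β := by positivity
  refine ⟨a / β, hr, conformallyEquivalent_of_form hmn rfl F hθ (fun z => ?_) ?_⟩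
  · rw [hφ]
    change (0 : ℝ) = _
    ring
  -- The identity is computed off the pole N, where the chart is defined, and extends to N by
  -- continuity.
  have hψ : Continuous fun z => Real.exp (-2 * θ (F z)) :=
    Real.continuous_exp.comp (continuous_const.mul (hθ.continuous.comp F.continuous))
  have hne : ∀ z ≠ N, ∀ v w, (roundMetric n (a / β) hr).form z v w
      = Real.exp (-2 * θ (F z)) * S.g.form (F z) (mder F z v) (mder F z w) := fun z hz v w => by
    set s := stereographic' n N with hs
    have hsm : s ∈ IsManifold.maximalAtlas (𝓡 n) ∞ (UnitSphere n) := stereographic_mem_maximalAtlas N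
    have hss : s.source = {N}ᶜ := stereographic'_source N
    have hst : s.target = univ := stereographic'_target N
    have hzs : z ∈ s.source := by rw [hss]; exact hz
    set x := s z with hx
    have hxt : x ∈ s.target := s.map_source hzs
    have hsx : s.symm x = z := s.left_inv hzs
    have hsN : ∀ x, s.symm x ≠ N := fun x => by
      have := s.map_target (hst ▸ mem_univ x)
      rwa [hss] at this
    have hFs : ∀ x, F (s.symm x) = B.symm (a • x + x₀) := fun x => by
      rw [hF _ (hsN x), s.right_inv (hst ▸ mem_univ x)]
    have hBF : (fun x => B (F (s.symm x))) = fun x => a • x + x₀ := funext fun x => by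
      rw [hFs, B.right_inv (hBt ▸ mem_univ _)]
    have hFB : F (s.symm x) ∈ B.source := by
      rw [hFs]
      exact B.map_target (hBt ▸ mem_univ _)
    have hD : ∀ v, fderiv ℝ (fun x : EuclideanSpace ℝ (Fin n) => a • x + x₀) x v = a • v := fun v => by
      have h1 : HasFDerivAt (fun x : EuclideanSpace ℝ (Fin n) => a • x + x₀)
          (a • ContinuousLinearMap.id ℝ (EuclideanSpace ℝ (Fin n))) x :=
        ((hasFDerivAt_id x).const_smul a).add_const x₀
      rw [h1.fderiv]
      rfl
    have hround := stereographic_conformal N hr x (coframe s z v) (coframe s z w)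
    have hmap := chartForm_map S.g F.contMDiff hsm hB hxt hFB (coframe s z v) (coframe s z w)
    change (roundMetric n (a / β) hr).form (s.symm x) (frame s x _) (frame s x _) = _ at hround
    rw [frame_coframe hsm hzs, frame_coframe hsm hzs, hsx] at hround hmap
    rw [hBF, hD, hD, congrFun hBF x |> fun h => (by rw [← hsx]; exact h : B (F z) = a • x + x₀),
      hf] at hmap
    rw [hround, ← hmap]
    have hexp : Real.exp (-2 * θ (F z))
        = ((y (B.symm (a • x + x₀)) * (α * ‖a • x‖ ^ 2 + β)) ^ 2)⁻¹ := by
      have h1 := hθB (a • x + x₀)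
      rw [add_sub_cancel_right] at h1
      rw [← h1, ← hFs, hsx, ← Real.exp_nat_mul, ← Real.exp_neg]
      congr 1
      push_cast
      ring
    have hYpos : y (B.symm (a • x + x₀)) ≠ 0 := by
      have h1 := hy (a • x + x₀)
      intro h0
      rw [h0, inv_zero] at h1
      have := h.D_pos
      have := h.k_pos
      have h2 : 0 < 1 / D + k * D / 2 * ‖a • x + x₀‖ ^ 2 := by positivity
      linarith
    rw [hexp, norm_smul, Real.norm_of_nonneg hap.le, real_inner_smul_left, real_inner_smul_right]
    have h2 : α * (a * ‖x‖) ^ 2 + β = β / 4 * (‖x‖ ^ 2 + 4) := by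
      rw [← ha2]
      ring
    rw [h2]
    have hx4 : ‖x‖ ^ 2 + 4 ≠ 0 := by positivity
    field_simp
  intro z v w
  by_cases hz : z = N
  · rw [hz]
    exact form_eq_of_ne (by omega) _ S.g F.contMDiff hψ hne v w
  · exact hne z hz v w

end SmoothMetricMeasureSpace

/-! ### The height function obtained from the conformal factor -/

namespace SmoothMetric
set_option maxSynthPendingDepth 3
variable {n : ℕ} {M : Type*} [TopologicalSpace M]
  [ChartedSpace (EuclideanSpace ℝ (Fin n)) M] [IsManifold (𝓡 n) ∞ M] [ConnectedSpace M]
  {g : SmoothMetric n M} {u : M → ℝ}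

theorem exists_eq_const_of_normSq (hu : ContMDiff (𝓡 n) 𝓘(ℝ) ∞ u) (h : ∀ x, g.normSq u x = 0) :
    ∃ a, ∀ x, u x = a := by
  refine exists_eq_const (n := n) fun c hc y hy => ?_
  have h1 : DifferentiableAt ℝ (u ∘ c.symm) y :=
    ((contDiffOn_comp_symm' hc hu).contDiffAt (c.open_target.mem_nhds hy)).differentiableAt (by simp)
  have h2 : fderiv ℝ (u ∘ c.symm) y = 0 := by
    ext v
    rw [fderiv_comp_symm hc hu hy, gradient_eq_zero_iff.1 (normSq_eq_zero_iff.1 (h _))]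
    rfl
  rw [← h2]
  exact h1.hasFDerivAt

/-- On a compact manifold, the conformal factor between two Einstein-type spaces is a height
function up to an additive constant. -/
theorem exists_isHeight [CompactSpace M] {a b s : ℝ} (hu : ¬∃ a, ∀ x, u x = a)
    (hq : ∀ x, g.normSq u x = -2 * a - 2 * b * u x ^ 2 + 2 * s * u x)
    (hc : IsConcircular g u fun x => s - 2 * b * u x) :
    ∃ (y : M → ℝ) (D : ℝ), IsHeight g y b D ∧ ∃ p, y p = D := by
  obtain ⟨p, -, hp⟩ := isCompact_univ.exists_isMaxOn univ_nonempty hc.smooth.continuous.continuousOn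
  obtain ⟨q, -, hq'⟩ := isCompact_univ.exists_isMinOn univ_nonempty hc.smooth.continuous.continuousOn
  have hle : ∀ x, u x ≤ u p := fun x => hp (mem_univ x)
  have hge : ∀ x, u q ≤ u x := fun x => hq' (mem_univ x)
  have hlt : u q < u p := by
    by_contra! h
    exact hu ⟨u p, fun x => le_antisymm (hle x) (h.trans (hge x))⟩
  have h1 := hq p
  have h2 := hq q
  rw [normSq_eq_zero_iff.2 (g.gradient_eq_zero_of_isLocalExtr hc.smooth
    (Or.inr (Eventually.of_forall hle)))] at h1
  rw [normSq_eq_zero_iff.2 (g.gradient_eq_zero_of_isLocalExtr hc.smooth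
    (Or.inl (Eventually.of_forall hge)))] at h2
  -- The gradient vanishes at the maximum and the minimum, so both extreme values are roots of -2a -
  -- 2bt² + 2st; the coefficients follow as in Vieta's formulas.
  have hs : s = b * (u p + u q) := by
    have h3 : u p - u q ≠ 0 := (sub_pos.2 hlt).ne'
    refine mul_left_cancel₀ h3 ?_
    linear_combination (h2 - h1) / 2
  have ha : a = b * (u p * u q) := by
    rw [hs] at h1
    linear_combination h1 / 2
  have hq2 : ∀ x, g.normSq u x = 2 * b * ((u x - u q) * (u p - u x)) := fun x => by
    rw [hq, hs, ha]
    ring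
  -- Otherwise 2b(u - min)(max - u) ≤ 0 would force the gradient to vanish identically.
  have hb : 0 < b := by
    by_contra! hb
    refine hu (exists_eq_const_of_normSq hc.smooth fun x => le_antisymm ?_ (g.normSq_nonneg u x))
    rw [hq2]
    exact mul_nonpos_of_nonpos_of_nonneg (by linarith)
      (mul_nonneg (sub_nonneg.2 (hge x)) (sub_nonneg.2 (hle x)))
  refine ⟨fun x => 1 * u x + -u q, u p - u q, ⟨hb, sub_pos.2 hlt, ?_, fun x => ?_, fun x => ?_,
    fun x => ?_⟩, p, by ring⟩
  · have h3 := hc.affine 1 (-u q)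
    rwa [show (fun x => 1 * (s - 2 * b * u x))
      = fun x => b * (u p - u q) - 2 * b * (1 * u x + -u q) from
        funext fun x => by rw [hs]; ring] at h3
  · rw [normSq_affine hc.smooth, hq2]
    ring
  · linarith [hge x]
  · linarith [hle x]
end SmoothMetric

end

theorem proposition9p4 (n : ℕ) (hn : 2 ≤ n)
    {M : Type*} [TopologicalSpace M] [ChartedSpace (EuclideanSpace ℝ (Fin n)) M]
    [IsManifold (𝓡 n) ∞ M] [T2Space M] [SecondCountableTopology M] [ConnectedSpace M]
    (S S' : SmoothMetricMeasureSpace n M) (hmn : 2 < S.m + n)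
    (hconf : S.PointwiseConformal S')
    (lam lam' : ℝ) (hS : S.SatisfiesEinsteinType lam) (hS' : S'.SatisfiesEinsteinType lam')
    (u : M → ℝ) (hu_pos : ∀ x, 0 < u x)
    (hu : ∀ (x : M) (v w : TangentSpace (𝓡 n) x),
      S'.g.inner x v w = (u x ^ 2)⁻¹ * S.g.inner x v w)
    (hu_nonconst : ¬ ∃ a : ℝ, ∀ x, u x = a) :
    (CompactSpace M →
      (0 < S.m → S.m = 1) ∧
      ∃ (r : ℝ) (hr : 0 < r),
        S.ConformallyEquivalent (roundSphere n r hr S.m S.m_nonneg)) ∧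
    (S.g.IsComplete → lam = 0 → 0 < lam' →
      ∃ Ψ : EuclideanSpace ℝ (Fin n) ≃ₘ^∞⟮𝓡 n, 𝓡 n⟯ M,
        (∀ (x : EuclideanSpace ℝ (Fin n)) (v w : EuclideanSpace ℝ (Fin n)),
          S.g.inner (Ψ x) (mfderiv (𝓡 n) (𝓡 n) Ψ x v) (mfderiv (𝓡 n) (𝓡 n) Ψ x w)
            = inner ℝ v w) ∧
        ∃ (x₀ : EuclideanSpace ℝ (Fin n)) (c : ℝ), 0 < c ∧
          ∀ x, u (Ψ x) = c / (2 * (S.m + n - 1)) * ‖x - x₀‖ ^ 2 + lam' / (2 * c)) := by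
  have hn0 : 0 < n := by omega
  have hN : 0 < S.m + n - 1 := by linarith
  obtain ⟨s, hq, hc⟩ := (SmoothMetricMeasureSpace.isConcircular_of_conformal hn0 hmn hconf hS hS'
    hu_pos hu).exists_first_integral hu_pos
  refine ⟨fun _ => ?_, fun hg hlam hlam' => ?_⟩
  · obtain ⟨y, D, hy, hmax⟩ := SmoothMetric.exists_isHeight hu_nonconst hq hc
    exact hS.conformallyEquivalent_sphere hn hmn (by field_simp) hy hmax
  · rw [hlam, zero_div] at hq hc
    set a := lam' / (2 * (S.m + n - 1)) with ha
    have ha0 : 0 < a := div_pos hlam' (by linarith)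
    -- With b = 0 the first integral gives su ≥ a > 0.
    have hs : 0 < s := by
      obtain ⟨x⟩ := (inferInstance : Nonempty M)
      have h1 := hq x
      have h2 := S.g.normSq_nonneg u x
      have h3 : 0 < s * u x := by linarith
      exact pos_of_mul_pos_left h3 (hu_pos x).le
    simp only [mul_zero, zero_mul, sub_zero] at hq hc
    obtain ⟨Ψ, hΨ, huΨ⟩ := hg.exists_flat_diffeo hs hc (a := a) fun x => by rw [hq]; ring
    -- The chart is centred at the critical point, whence x₀ = 0; c = s(m+n-1) turns s/2 and a/s
    -- into the stated coefficients.
    refine ⟨Ψ, hΨ, 0, s * (S.m + n - 1), mul_pos hs hN, fun x => ?_⟩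
    rw [huΨ, sub_zero, ha]
    field_simp
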